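/- **Theorem 1.** Let $M$ be a smooth 4-manifold, let $E\to M$ be a smooth oriented Euclidean vector bundle of rank 3 (the $\mathbb R^3$-bundle associated with an $\mathrm{SO}(3)$-bundle), and let $A$ be a smooth $\mathrm{SO}(3)$ (that is, metric) connection on $E$. In a local gauge (a smooth oriented orthonormal local frame) write $A^i$, $i=1,2,3$, for the connection 1-forms, $F^i=dA^i+\tfrac12\epsilon^{ijk}A^j\wedge A^k$ for the curvature 2-forms, $y^i$ for the fibre coordinates, $y^2=\sum_i (y^i)^2$, and $d_Ay^i=dy^i+\epsilon^{ijk}A^jy^k$. Fix a nowhere vanishing 4-form $v$ on $M$ (it need not be continuous), and define the symmetric matrix $X$ by $F^i\wedge F^j=-2X^{ij}v$. Suppose that $A$ is definite, i.e. at every point all eigenvalues of $X$ are nonzero and have the same sign, and that $$d_A\big[(\det X)^{1/3}X^{-1}F\big]=0,$$ where $(d_AB)^i=dB^i+\epsilon^{ijk}A^j\wedge B^k$ and the cube root is the real one (this condition does not depend on $v$). Then $A$ has a sign: there is a locally constant function $\sigma:M\to\{+1,-1\}$ such that, at each point, $\sigma\,\epsilon^{ijk}\,i_\xi F^i\wedge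 i_\xi F^j\wedge F^k$ is a positive 4-form for every tangent vector $\xi\neq0$, in the orientation of the tangent space for which $X$ is positive definite. On the open subset $D=\{1+\sigma y^2>0\}$ of the total space of $E$ the expression $$\Omega=\tfrac16(1+\sigma y^2)^{-3/4}\,\epsilon^{ijk}\,d_Ay^i\wedge d_Ay^j\wedge d_Ay^k+2\sigma(1+\sigma y^2)^{1/4}\,d_Ay^i\wedge F^i$$ does not depend on the gauge and defines a smooth 3-form with the following properties. 1. $\Omega$ is stable: at every point its $\mathrm{GL}(7)$-orbit is open in the space of 3-forms. 2. $\Omega$ defines a smooth Riemannian metric $g$ on $D$, with metric volume form $\mu$, by $i_\xi\Omega\wedge i_\eta\Omega\wedge\Omega=6\,g(\xi,\eta)\,\mu$. 3. $\Omega$ is closed, $d\Omega=0$, and co-closed, $d{*}\Omega=0$, where ${*}$ is the Hodge star of $(g,\mu)$. 4. $g$ has $G_2$ holonomy, in the sense that $\Omega$ is parallel for the Levi-Civita connection of $g$ (so that the holonomy group is contained in $G_2$). 5. $g$ is complete in the fibre direction for $\sigma=+1$: if $\sigma(x)=+1$, then the Riemannian metric induced by $g$ on the fibre $E_x$ is complete.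 -/

import Mathlib

open Bundle Set Filter MeasureTheory
open scoped Manifold ContDiff Topology ENNReal BigOperators

noncomputable section

/-! ## Exterior algebra on a real topological vector space

Exterior forms are continuous alternating maps. The wedge product is normalised so that
`(α ∧ β) (u, v) = α u * β v - α v * β u` for one-forms. -/

section Algebra

variable {V : Type*} [AddCommGroup V] [Module ℝ V] [TopologicalSpace V]

/-- The multilinear map `(v₁, …, v_{p+q}) ↦ α (v₁, …, v_p) * β (v_{p+1}, …, v_{p+q})`. -/
def formProd {p q : ℕ} (α : V [⋀^Fin p]→L[ℝ] ℝ) (β : V [⋀^Fin q]→L[ℝ] ℝ) :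
    ContinuousMultilinearMap ℝ (fun _ : Fin (p + q) => V) ℝ where
  toMultilinearMap :=
    (LinearMap.mul' ℝ ℝ).compMultilinearMap
      (((α.toAlternatingMap.toMultilinearMap).domCoprod
        (β.toAlternatingMap.toMultilinearMap)).domDomCongr finSumFinEquiv)
  cont := by
    have h : Continuous (fun w : Fin (p + q) → V =>
        α (fun i => w (Fin.castAdd q i)) * β (fun i => w (Fin.natAdd p i))) :=
      (α.cont.comp (by fun_prop)).mul (β.cont.comp (by fun_prop))
    exact h

/-- The wedge product of a `p`-form and a `q`-form: the signed sum of `α ⊗ β` over all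
permutations of the arguments, divided by `p! q!`. -/
def wedge {p q : ℕ} (α : V [⋀^Fin p]→L[ℝ] ℝ) (β : V [⋀^Fin q]→L[ℝ] ℝ) :
    V [⋀^Fin (p + q)]→L[ℝ] ℝ :=
  (((p.factorial : ℝ) * (q.factorial : ℝ))⁻¹) •
    ContinuousMultilinearMap.alternatization (formProd α β)

/-- A linear functional, seen as a one-form. -/
def oneForm (a : V →L[ℝ] ℝ) : V [⋀^Fin 1]→L[ℝ] ℝ :=
  ContinuousAlternatingMap.ofSubsingleton ℝ V ℝ (0 : Fin 1) a

/-- Insertion of a vector in the first slot of a form (interior product). -/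
def insertVec {n : ℕ} (ξ : V) (η : V [⋀^Fin (n + 1)]→L[ℝ] ℝ) : V [⋀^Fin n]→L[ℝ] ℝ where
  toAlternatingMap := η.toAlternatingMap.curryLeft ξ
  cont := by
    have h : Continuous (fun w : Fin n → V => η (Fin.cons ξ w)) :=
      η.cont.comp (by fun_prop)
    exact h

/-- The Levi-Civita symbol `ε^{ijk}` on three indices (with `ε^{012} = 1`). -/
def eps (i j k : Fin 3) : ℝ :=
  ((j : ℕ) - (i : ℕ) : ℝ) * ((k : ℕ) - (i : ℕ) : ℝ) * ((k : ℕ) - (j : ℕ) : ℝ) / 2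

/-- The real cube root of an arbitrary real number: `t ↦ sign t * |t| ^ (1/3)`. -/
def cubeRoot (t : ℝ) : ℝ := SignType.sign t * |t| ^ (1 / 3 : ℝ)

/-- `X` is the matrix of the triple `F` of two-forms with respect to the four-form `v`:
`F^i ∧ F^j = -2 X^{ij} v`. -/
def IsWedgeMatrix (v : V [⋀^Fin 4]→L[ℝ] ℝ) (F : Fin 3 → V [⋀^Fin 2]→L[ℝ] ℝ)
    (X : Matrix (Fin 3) (Fin 3) ℝ) : Prop :=
  ∀ i j, (wedge (F i) (F j) : V [⋀^Fin 4]→L[ℝ] ℝ) = (-2 * X i j) • v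

/-- A symmetric matrix is definite if all its eigenvalues are nonzero and of the same sign. -/
def IsDefiniteMatrix (X : Matrix (Fin 3) (Fin 3) ℝ) : Prop := X.PosDef ∨ (-X).PosDef

/-- The four-form `ε^{ijk} i_ξ F^i ∧ i_η F^j ∧ F^k`. -/
def urbantke (F : Fin 3 → V [⋀^Fin 2]→L[ℝ] ℝ) (ξ η : V) : V [⋀^Fin 4]→L[ℝ] ℝ :=
  ∑ i, ∑ j, ∑ k, eps i j k •
    (wedge (wedge (insertVec ξ (F i)) (insertVec η (F j))) (F k) : V [⋀^Fin 4]→L[ℝ] ℝ)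

/-- `s = ±1` is the sign of a definite triple `F` of two-forms on a four-dimensional space:
in the orientation `v` for which the matrix of `F` is positive definite, the quadratic form
`(s / v) ε^{ijk} i_ξ F^i ∧ i_ξ F^j ∧ F^k` is positive definite. -/
def IsSignOfTriple (s : ℝ) (F : Fin 3 → V [⋀^Fin 2]→L[ℝ] ℝ) : Prop :=
  (s = 1 ∨ s = -1) ∧
  ∃ (v : V [⋀^Fin 4]→L[ℝ] ℝ) (X : Matrix (Fin 3) (Fin 3) ℝ),
    v ≠ 0 ∧ IsWedgeMatrix v F X ∧ X.PosDef ∧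
    ∀ ξ : V, ξ ≠ 0 → ∃ c : ℝ, 0 < c ∧ s • urbantke F ξ ξ = c • v

/-- A three-form is stable if its orbit under the general linear group is open in the space of
three-forms. -/
def IsStableForm (φ : V [⋀^Fin 3]→L[ℝ] ℝ) : Prop :=
  IsOpen {η : V [⋀^Fin 3]→L[ℝ] ℝ |
    ∃ A : V ≃L[ℝ] V, η = φ.compContinuousLinearMap (A : V →L[ℝ] V)}

/-- The family `e` is orthonormal for the bilinear form `g`. -/
def IsOrthonormalFor {n : ℕ} (g : V →L[ℝ] V →L[ℝ] ℝ) (e : Fin n → V) : Prop :=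
  ∀ i j, g (e i) (e j) = if i = j then 1 else 0

/-- `g` is the Riemannian metric (symmetric and positive definite), and `μ` its metric volume
form, defined by a three-form `φ` on a seven-dimensional space:
`i_ξ φ ∧ i_η φ ∧ φ = 6 g(ξ, η) μ`. -/
structure IsMetricOfForm (φ : V [⋀^Fin 3]→L[ℝ] ℝ) (g : V →L[ℝ] V →L[ℝ] ℝ)
    (μ : V [⋀^Fin 7]→L[ℝ] ℝ) : Prop where
  symm : ∀ ξ η, g ξ η = g η ξ
  pos : ∀ ξ, ξ ≠ 0 → 0 < g ξ ξ
  volume : ∀ e : Fin 7 → V, IsOrthonormalFor g e → |μ e| = 1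
  eq : ∀ ξ η, (wedge (wedge (insertVec ξ φ) (insertVec η φ)) φ : V [⋀^Fin 7]→L[ℝ] ℝ) =
    (6 * g ξ η) • μ

/-- `ψ` is the Hodge dual of the three-form `φ` for the metric `g` and the metric volume form `μ`
on a seven-dimensional space:
`ψ(w) = (1/3!) ∑ φ(e_a, e_b, e_c) μ(e_a, e_b, e_c, w)` in every orthonormal basis `e`. -/
def IsHodgeDual (g : V →L[ℝ] V →L[ℝ] ℝ) (μ : V [⋀^Fin 7]→L[ℝ] ℝ)
    (φ : V [⋀^Fin 3]→L[ℝ] ℝ) (ψ : V [⋀^Fin 4]→L[ℝ] ℝ) : Prop :=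
  ∀ e : Fin 7 → V, IsOrthonormalFor g e → ∀ w : Fin 4 → V,
    ψ w = (1 / 6) * ∑ a, ∑ b, ∑ c,
      φ ![e a, e b, e c] * μ (Fin.append ![e a, e b, e c] w)

end Algebra

/-! ## Differential forms and metrics on a manifold without boundary -/

section Manifold

variable {V : Type*} [NormedAddCommGroup V] [NormedSpace ℝ V]
  {H : Type*} [TopologicalSpace H] (I : ModelWithCorners ℝ V H)
  {N : Type*} [TopologicalSpace N] [ChartedSpace H N]

/-- The derivative at the point `u` of the inverse of the preferred chart at `p`. -/
def chartInvDeriv (p : N) (u : V) : V →L[ℝ] TangentSpace I ((extChartAt I p).symm u) :=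
  mfderiv 𝓘(ℝ, V) I (extChartAt I p).symm u

/-- The expression of a differential form in the preferred chart at `p`. -/
def formInChart {k : ℕ} (η : ∀ q : N, TangentSpace I q [⋀^Fin k]→L[ℝ] ℝ) (p : N) (u : V) :
    V [⋀^Fin k]→L[ℝ] ℝ :=
  (η ((extChartAt I p).symm u)).compContinuousLinearMap (chartInvDeriv I p u)

/-- The exterior derivative of a differential form, computed at `p` in the preferred chart
at `p`. -/
def extDer {k : ℕ} (η : ∀ q : N, TangentSpace I q [⋀^Fin k]→L[ℝ] ℝ) (p : N) :
    TangentSpace I p [⋀^Fin (k + 1)]→L[ℝ] ℝ :=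
  (extDeriv (formInChart I η p) (extChartAt I p p)).compContinuousLinearMap
    (mfderiv I 𝓘(ℝ, V) (extChartAt I p) p)

/-- Smoothness of a differential form on an open set. -/
def IsSmoothFormOn {k : ℕ} (η : ∀ q : N, TangentSpace I q [⋀^Fin k]→L[ℝ] ℝ) (D : Set N) :
    Prop :=
  ∀ p ∈ D, ContDiffAt ℝ ∞ (formInChart I η p) (extChartAt I p p)

/-- A smooth differential form with vanishing exterior derivative on an open set. -/
def IsClosedFormOn {k : ℕ} (η : ∀ q : N, TangentSpace I q [⋀^Fin k]→L[ℝ] ℝ) (D : Set N) :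
    Prop :=
  IsSmoothFormOn I η D ∧ ∀ p ∈ D, extDer I η p = 0

/-- The expression of a bilinear form on the tangent bundle in the preferred chart at `p`. -/
def metricInChart (g : ∀ q : N, TangentSpace I q →L[ℝ] TangentSpace I q →L[ℝ] ℝ) (p : N)
    (u : V) : V →L[ℝ] V →L[ℝ] ℝ :=
  ContinuousLinearMap.bilinearComp (E := V) (F := V) (G := ℝ) (g ((extChartAt I p).symm u))
    (chartInvDeriv I p u) (chartInvDeriv I p u)

/-- Smoothness of a bilinear form on the tangent bundle on an open set. -/
def IsSmoothMetricOn (g : ∀ q : N, TangentSpace I q →L[ℝ] TangentSpace I q →L[ℝ] ℝ)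
    (D : Set N) : Prop :=
  ∀ p ∈ D, ContDiffAt ℝ ∞ (metricInChart I g p) (extChartAt I p p)

/-- The three-form `φ` is parallel at `p` for the Levi-Civita connection of the metric `g`.
In the preferred chart at `p`, `Γ` are the Christoffel symbols, determined by
`2 g(Γ(a, b), c) = ∂_a g(b, c) + ∂_b g(a, c) - ∂_c g(a, b)`, and the condition is
`∂_a φ(w₀, w₁, w₂) = φ(Γ(a, w₀), w₁, w₂) + φ(w₀, Γ(a, w₁), w₂) + φ(w₀, w₁, Γ(a, w₂))`. -/
def IsParallelAt (g : ∀ q : N, TangentSpace I q →L[ℝ] TangentSpace I q →L[ℝ] ℝ)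
    (φ : ∀ q : N, TangentSpace I q [⋀^Fin 3]→L[ℝ] ℝ) (p : N) : Prop :=
  let u : V := extChartAt I p p
  let G : V → V →L[ℝ] V →L[ℝ] ℝ := metricInChart I g p
  let Φ : V → V [⋀^Fin 3]→L[ℝ] ℝ := formInChart I φ p
  ∃ Γ : V → V → V,
    (∀ a b c : V, 2 * G u (Γ a b) c =
      fderiv ℝ G u a b c + fderiv ℝ G u b a c - fderiv ℝ G u c a b) ∧
    ∀ (a : V) (w : Fin 3 → V),
      fderiv ℝ Φ u a w = ∑ i, Φ u (Function.update w i (Γ a (w i)))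

/-- The length of a curve `c : [0, 1] → N` for the metric `g`. -/
def curveLength (g : ∀ q : N, TangentSpace I q →L[ℝ] TangentSpace I q →L[ℝ] ℝ)
    (c : ℝ → N) : ℝ≥0∞ :=
  ∫⁻ t in Icc (0 : ℝ) 1, ENNReal.ofReal
    (Real.sqrt (g (c t) (mfderiv 𝓘(ℝ, ℝ) I c t (1 : ℝ)) (mfderiv 𝓘(ℝ, ℝ) I c t (1 : ℝ))))

end Manifold

/-! ## Metric connections on oriented Euclidean bundles of rank three -/

/-- Euclidean three-space, the model fiber. -/
abbrev R3 : Type := EuclideanSpace ℝ (Fin 3)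

/-- Euclidean four-space, the model of the base. -/
abbrev R4 : Type := EuclideanSpace ℝ (Fin 4)

section Connection

variable {M : Type*} [TopologicalSpace M] [ChartedSpace R4 M]
  {E : M → Type*} [TopologicalSpace (TotalSpace R3 E)]
  [∀ x, NormedAddCommGroup (E x)] [∀ x, InnerProductSpace ℝ (E x)] [FiberBundle R3 E]

/-- A local gauge: a smooth local frame on an open set `U` which is orthonormal and positively
oriented for the orientation `o` of the fibers. (The values of `frame` outside `U` are
irrelevant.) Two local gauges differ by a smooth `SO(3)`-valued function. -/
structure LocalGauge (o : ∀ x, Orientation ℝ (E x) (Fin 3)) where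
  U : Set M
  isOpen : IsOpen U
  frame : ∀ x, OrthonormalBasis (Fin 3) ℝ (E x)
  smooth : ∀ i, ContMDiffOn 𝓘(ℝ, R4) (𝓘(ℝ, R4).prod 𝓘(ℝ, R3)) ∞
    (fun x => TotalSpace.mk' R3 x (frame x i)) U
  oriented : ∀ x ∈ U, (frame x).toBasis.orientation = o x

/-- The fiberwise orientation `o` is continuous: there is a local gauge around every point. In
other words, `o` reduces the structure group of the Euclidean bundle `E` to `SO(3)`. -/
def IsContinuousOrientation (o : ∀ x, Orientation ℝ (E x) (Fin 3)) : Prop :=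
  ∀ x : M, ∃ G : LocalGauge o, x ∈ G.U

variable {o : ∀ x, Orientation ℝ (E x) (Fin 3)}

/-- The connection one-forms `A^j` in a local gauge `(s_i)`, determined (for a metric connection)
by `∇ s_k = ε^{ijk} A^j s_i`; thus `A^j = ⟨s_{j+2}, ∇ s_{j+1}⟩`, with indices modulo three. -/
def gaugePotential (cov : CovariantDerivative 𝓘(ℝ, R4) R3 E) (G : LocalGauge o) (j : Fin 3)
    (x : M) : TangentSpace 𝓘(ℝ, R4) x →L[ℝ] ℝ :=
  (innerSL ℝ (G.frame x (j + 2))).comp (cov (fun z => G.frame z (j + 1)) x)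

/-- The curvature two-forms `F^i = dA^i + (1/2) ε^{ijk} A^j ∧ A^k` in a local gauge. -/
def gaugeCurvature (cov : CovariantDerivative 𝓘(ℝ, R4) R3 E) (G : LocalGauge o) (i : Fin 3)
    (x : M) : TangentSpace 𝓘(ℝ, R4) x [⋀^Fin 2]→L[ℝ] ℝ :=
  extDer 𝓘(ℝ, R4) (fun z => oneForm (gaugePotential cov G i z)) x +
    (1 / 2 : ℝ) • ∑ j, ∑ k, eps i j k •
      (wedge (oneForm (gaugePotential cov G j x)) (oneForm (gaugePotential cov G k x)) :
        TangentSpace 𝓘(ℝ, R4) x [⋀^Fin 2]→L[ℝ] ℝ)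

/-- The exterior covariant derivative `(d_A B)^i = dB^i + ε^{ijk} A^j ∧ B^k` of a triple of
two-forms in a local gauge. -/
def gaugeExtDer (cov : CovariantDerivative 𝓘(ℝ, R4) R3 E) (G : LocalGauge o)
    (B : Fin 3 → ∀ x : M, TangentSpace 𝓘(ℝ, R4) x [⋀^Fin 2]→L[ℝ] ℝ) (i : Fin 3) (x : M) :
    TangentSpace 𝓘(ℝ, R4) x [⋀^Fin 3]→L[ℝ] ℝ :=
  extDer 𝓘(ℝ, R4) (B i) x +
    ∑ j, ∑ k, eps i j k •
      (wedge (oneForm (gaugePotential cov G j x)) (B k x) :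
        TangentSpace 𝓘(ℝ, R4) x [⋀^Fin 3]→L[ℝ] ℝ)

/-- The triple of two-forms `(det X)^{1/3} X^{-1} F` in a local gauge, for a matrix-valued
function `X`. -/
def fieldTriple (cov : CovariantDerivative 𝓘(ℝ, R4) R3 E) (G : LocalGauge o)
    (X : M → Matrix (Fin 3) (Fin 3) ℝ) (i : Fin 3) (x : M) :
    TangentSpace 𝓘(ℝ, R4) x [⋀^Fin 2]→L[ℝ] ℝ :=
  cubeRoot (X x).det • ∑ j, (X x)⁻¹ i j • gaugeCurvature cov G j x

/-! ### The total space -/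

/-- The model with corners of the seven-dimensional total space of the bundle. -/
abbrev totalModel : ModelWithCorners ℝ (R4 × R3) (ModelProd R4 R3) :=
  𝓘(ℝ, R4).prod 𝓘(ℝ, R3)

/-- The fiber coordinate `y^i` of a point of the total space, in a local gauge. -/
def fiberCoord (G : LocalGauge o) (i : Fin 3) (p : TotalSpace R3 E) : ℝ :=
  inner ℝ (G.frame p.proj i) p.snd

/-- The derivative at `p` of the projection of the total space to the base. -/
def projDeriv (p : TotalSpace R3 E) :
    TangentSpace totalModel p →L[ℝ] TangentSpace 𝓘(ℝ, R4) p.proj :=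
  mfderiv totalModel 𝓘(ℝ, R4) (TotalSpace.proj : TotalSpace R3 E → M) p

/-- The one-forms `d_A y^i = dy^i + ε^{ijk} A^j y^k` on the total space, in a local gauge. -/
def covDerFiberCoord (cov : CovariantDerivative 𝓘(ℝ, R4) R3 E) (G : LocalGauge o)
    (i : Fin 3) (p : TotalSpace R3 E) : TangentSpace totalModel p →L[ℝ] ℝ :=
  mvfderiv totalModel (fiberCoord G i) p +
    ∑ j, ∑ k, (eps i j k * fiberCoord G k p) •
      (gaugePotential cov G j p.proj).comp (projDeriv p)

/-- The three-form
`(1/6) (1 + s y²)^{-3/4} ε^{ijk} d_A y^i ∧ d_A y^j ∧ d_A y^k + 2 s (1 + s y²)^{1/4} d_A y^i ∧ F^i`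
at a point `p` of the total space over the domain of a local gauge; `s = ±1`. -/
def calibratingForm (cov : CovariantDerivative 𝓘(ℝ, R4) R3 E) (G : LocalGauge o)
    (s : ℝ) (p : TotalSpace R3 E) : TangentSpace totalModel p [⋀^Fin 3]→L[ℝ] ℝ :=
  ((1 / 6) * (1 + s * ∑ i, fiberCoord G i p ^ 2) ^ (-(3 / 4) : ℝ)) •
      ∑ i, ∑ j, ∑ k, eps i j k •
        (wedge (wedge (oneForm (covDerFiberCoord cov G i p))
          (oneForm (covDerFiberCoord cov G j p))) (oneForm (covDerFiberCoord cov G k p)) :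
            TangentSpace totalModel p [⋀^Fin 3]→L[ℝ] ℝ) +
    (2 * s * (1 + s * ∑ i, fiberCoord G i p ^ 2) ^ (1 / 4 : ℝ)) •
      ∑ i, (wedge (oneForm (covDerFiberCoord cov G i p))
        ((gaugeCurvature cov G i p.proj).compContinuousLinearMap (projDeriv p)) :
          TangentSpace totalModel p [⋀^Fin 3]→L[ℝ] ℝ)

/-- The distance of two points of the fiber over `x` for the Riemannian metric induced on that
fiber by the metric `g` of the total space: the infimum of the lengths of the `C^1` curves in the
fiber that join them. -/
def fiberDist
    (g : ∀ p : TotalSpace R3 E, TangentSpace totalModel p →L[ℝ] TangentSpace totalModel p →L[ℝ] ℝ)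
    (x : M) (a b : E x) : ℝ≥0∞ :=
  ⨅ (γ : ℝ → E x) (_ : ContDiff ℝ 1 γ ∧ γ 0 = a ∧ γ 1 = b),
    curveLength totalModel g (fun t => TotalSpace.mk' R3 x (γ t))

/-- The Riemannian metric induced on the fiber over `x` is complete: every Cauchy sequence for its
distance converges. -/
def IsFiberComplete
    (g : ∀ p : TotalSpace R3 E, TangentSpace totalModel p →L[ℝ] TangentSpace totalModel p →L[ℝ] ℝ)
    (x : M) : Prop :=
  ∀ u : ℕ → E x,
    (∀ δ : ℝ≥0∞, 0 < δ → ∃ n₀, ∀ m ≥ n₀, ∀ n ≥ n₀, fiberDist g x (u m) (u n) < δ) →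
    ∃ a : E x, Tendsto (fun n => fiberDist g x (u n) a) atTop (𝓝 0)

end Connection

end

/-! The proof is pointwise linear algebra followed by a first-order computation in a gauge.

Linear algebra. Write `X = C Cᵀ` with `det C > 0`, in the orientation for which `X` is positive
definite. The triple `C⁻¹ F` has wedge matrix `1`, and such a triple is, up to a sign `σ`, the
standard anti-self-dual triple `Σ^j` of a coframe `h`; hence `F^i = σ C^i_j Σ^j`
(`exists_normal_form`). In this form `ε i_ξF ∧ i_ξF ∧ F = 6 σ det C |ξ|² h⁰¹²³`, so `σ` is the sign
of the connection (`urbantke_normal_form`). It is unchanged by rotations of the gauge, and it is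
locally constant because a continuous function without zeros keeps its sign.

Put `θ^i = d_A y^i`, `p⁴ = 1 + σ y²`, `t³ = det C`. In the coframe made of `C^i_j θ^i / (p t)` and
`√(2 p² t) h^m` the form `Ω` is the standard `G₂`-form of `ℝ⁷` (`exists_isAdapted`). Stability, the
metric and the volume form are then inherited from the model. The dual form becomes `*Ω = σ ε_{ijk}
θ^i ∧ θ^j ∧ B^k + (2/3)(1 + σ y²) B^i ∧ F^i`, where `B = (det X)^{1/3} X⁻¹ F`
(`stdFourForm_adapted`).

Calculus. The structure equations are `d(y²) = 2 y·θ`, `d_A θ = F × y`, `d_A F = 0`. They give `dΩ =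
0`: with the exponents `-3/4` and `1/4` the two remaining terms cancel. For `*Ω` the equation `d_A B
= 0` plays the part of the Bianchi identity, and `B^k ∧ F^l = δ^{kl} w` makes the derivative of the
first term cancel that of the coefficient `1 + σ y²`; the four-form `B^i ∧ F^i` comes from the
four-dimensional base and is closed.

Parallelism. A closed and co-closed `G₂`-form is parallel (Fernández and Gray). The covariant
derivative of an adapted coframe takes values in `so(7) = g₂ ⊕ ℝ⁷`; its `ℝ⁷`-part, the intrinsic
torsion, is recovered linearly from `dφ` and `d*φ`, and when it vanishes so does the derivative of
`φ`. Both facts about the structure constants are finite identities between integers, checked by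
evaluation (`combo_antisymm`, `threeAct_antisymm`). Smooth adapted coframes exist by the inverse
function theorem, from an explicit right inverse of the infinitesimal `GL(7)`-action
(`exists_smooth_coframe`).

Completeness. For `σ = 1` the metric of a fibre is comparable with `(1 + |y|²)^{-1/2} |dy|²`. The
functions `(1 + |y|²)^{1/4}` and `(1 + |y|²)^{-1/4} y` are Lipschitz for it, and their product is
`y`; a Cauchy sequence therefore converges. -/

noncomputable section

/-! ### Wedge products: bilinearity, naturality, explicit formulas in low degree -/

section WedgeAlgebra

variable {V W : Type*} [AddCommGroup V] [Module ℝ V] [TopologicalSpace V]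
  [AddCommGroup W] [Module ℝ W] [TopologicalSpace W]

theorem formProd_apply {p q : ℕ} (α : V [⋀^Fin p]→L[ℝ] ℝ) (β : V [⋀^Fin q]→L[ℝ] ℝ)
    (v : Fin (p + q) → V) :
    formProd α β v = α (fun i => v (Fin.castAdd q i)) * β (fun i => v (Fin.natAdd p i)) := rfl

theorem wedge_apply {p q : ℕ} (α : V [⋀^Fin p]→L[ℝ] ℝ) (β : V [⋀^Fin q]→L[ℝ] ℝ)
    (v : Fin (p + q) → V) :
    wedge α β v = ((p.factorial : ℝ) * (q.factorial : ℝ))⁻¹ *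
      ∑ σ : Equiv.Perm (Fin (p + q)), ((Equiv.Perm.sign σ : ℤ) : ℝ) *
        (α (fun i => v (σ (Fin.castAdd q i))) * β (fun i => v (σ (Fin.natAdd p i)))) := by
  simp only [wedge, ContinuousAlternatingMap.smul_apply, smul_eq_mul,
    ContinuousMultilinearMap.alternatization_apply_apply, formProd_apply, Function.comp,
    Units.smul_def, zsmul_eq_mul]

theorem wedge_add_left {p q : ℕ} (α α' : V [⋀^Fin p]→L[ℝ] ℝ) (β : V [⋀^Fin q]→L[ℝ] ℝ) :
    wedge (α + α') β = wedge α β + wedge α' β := by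
  ext v
  simp only [wedge_apply, ContinuousAlternatingMap.add_apply, add_mul, mul_add,
    Finset.sum_add_distrib]

theorem wedge_add_right {p q : ℕ} (α : V [⋀^Fin p]→L[ℝ] ℝ) (β β' : V [⋀^Fin q]→L[ℝ] ℝ) :
    wedge α (β + β') = wedge α β + wedge α β' := by
  ext v
  simp only [wedge_apply, ContinuousAlternatingMap.add_apply, mul_add,
    Finset.sum_add_distrib]

theorem wedge_smul_left {p q : ℕ} (c : ℝ) (α : V [⋀^Fin p]→L[ℝ] ℝ) (β : V [⋀^Fin q]→L[ℝ] ℝ) :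
    wedge (c • α) β = c • wedge α β := by
  ext v
  simp only [wedge_apply, ContinuousAlternatingMap.smul_apply, smul_eq_mul, Finset.mul_sum]
  refine Finset.sum_congr rfl fun _ _ => by ring

theorem wedge_smul_right {p q : ℕ} (c : ℝ) (α : V [⋀^Fin p]→L[ℝ] ℝ) (β : V [⋀^Fin q]→L[ℝ] ℝ) :
    wedge α (c • β) = c • wedge α β := by
  ext v
  simp only [wedge_apply, ContinuousAlternatingMap.smul_apply, smul_eq_mul, Finset.mul_sum]
  refine Finset.sum_congr rfl fun _ _ => by ring

/-- The wedge product as a bilinear map. -/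
def wedgeBilin (V : Type*) [AddCommGroup V] [Module ℝ V] [TopologicalSpace V] (p q : ℕ) :
    (V [⋀^Fin p]→L[ℝ] ℝ) →ₗ[ℝ] (V [⋀^Fin q]→L[ℝ] ℝ) →ₗ[ℝ] (V [⋀^Fin (p + q)]→L[ℝ] ℝ) :=
  LinearMap.mk₂ ℝ wedge wedge_add_left wedge_smul_left wedge_add_right
    (fun c α β => wedge_smul_right c α β)

theorem wedgeBilin_apply {p q : ℕ} (α : V [⋀^Fin p]→L[ℝ] ℝ) (β : V [⋀^Fin q]→L[ℝ] ℝ) :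
    wedgeBilin V p q α β = wedge α β := rfl

theorem wedge_sum_left {ι : Type*} {p q : ℕ} (s : Finset ι) (α : ι → V [⋀^Fin p]→L[ℝ] ℝ)
    (β : V [⋀^Fin q]→L[ℝ] ℝ) : wedge (∑ i ∈ s, α i) β = ∑ i ∈ s, wedge (α i) β := by
  simp only [← wedgeBilin_apply, map_sum, LinearMap.sum_apply]

theorem wedge_sum_right {ι : Type*} {p q : ℕ} (s : Finset ι) (α : V [⋀^Fin p]→L[ℝ] ℝ)
    (β : ι → V [⋀^Fin q]→L[ℝ] ℝ) : wedge α (∑ i ∈ s, β i) = ∑ i ∈ s, wedge α (β i) := by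
  simp only [← wedgeBilin_apply, map_sum]

theorem wedge_compContinuousLinearMap {p q : ℕ} (α : W [⋀^Fin p]→L[ℝ] ℝ)
    (β : W [⋀^Fin q]→L[ℝ] ℝ) (L : V →L[ℝ] W) :
    (wedge α β).compContinuousLinearMap L =
      wedge (α.compContinuousLinearMap L) (β.compContinuousLinearMap L) := by
  ext v
  simp only [wedge_apply, ContinuousAlternatingMap.compContinuousLinearMap_apply, Function.comp_def]

theorem oneForm_apply (a : V →L[ℝ] ℝ) (v : Fin 1 → V) : oneForm a v = a (v 0) := rfl

theorem oneForm_compContinuousLinearMap (a : W →L[ℝ] ℝ) (L : V →L[ℝ] W) :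
    (oneForm a).compContinuousLinearMap L = oneForm (a.comp L) := rfl

theorem insertVec_apply {n : ℕ} (ξ : V) (η : V [⋀^Fin (n + 1)]→L[ℝ] ℝ) (w : Fin n → V) :
    insertVec ξ η w = η (Fin.cons ξ w) := rfl

theorem insertVec_add_left {n : ℕ} (ξ ξ' : V) (η : V [⋀^Fin (n + 1)]→L[ℝ] ℝ) :
    insertVec (ξ + ξ') η = insertVec ξ η + insertVec ξ' η := by
  ext w
  exact congrArg (fun f => f w) (η.toAlternatingMap.curryLeft.map_add ξ ξ')

theorem insertVec_smul_left {n : ℕ} (c : ℝ) (ξ : V) (η : V [⋀^Fin (n + 1)]→L[ℝ] ℝ) :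
    insertVec (c • ξ) η = c • insertVec ξ η := by
  ext w
  exact congrArg (fun f => f w) (η.toAlternatingMap.curryLeft.map_smul c ξ)

theorem insertVec_sum_left {ι : Type*} {n : ℕ} (s : Finset ι) (ξ : ι → V)
    (η : V [⋀^Fin (n + 1)]→L[ℝ] ℝ) :
    insertVec (∑ i ∈ s, ξ i) η = ∑ i ∈ s, insertVec (ξ i) η := by
  classical
  induction s using Finset.induction_on with
  | empty =>
    ext w
    exact congrArg (fun f => f w) (η.toAlternatingMap.curryLeft.map_zero)
  | insert a s ha ih => rw [Finset.sum_insert ha, Finset.sum_insert ha, insertVec_add_left, ih]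

theorem insertVec_sum {ι : Type*} {n : ℕ} (s : Finset ι) (ξ : V)
    (η : ι → V [⋀^Fin (n + 1)]→L[ℝ] ℝ) :
    insertVec ξ (∑ i ∈ s, η i) = ∑ i ∈ s, insertVec ξ (η i) := by
  ext w
  simp only [insertVec_apply, ContinuousAlternatingMap.sum_apply]

theorem insertVec_compContinuousLinearMap {n : ℕ} (ξ : V) (η : W [⋀^Fin (n + 1)]→L[ℝ] ℝ)
    (L : V →L[ℝ] W) :
    insertVec ξ (η.compContinuousLinearMap L) =
      (insertVec (L ξ) η).compContinuousLinearMap L := by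
  ext w
  simp only [insertVec_apply, ContinuousAlternatingMap.compContinuousLinearMap_apply,
    Fin.comp_cons]

/-- Lets the sum run over the permutations of `Fin n` with a literal `n`, in place of `Fin (p + q)`,
so that the explicit expansions below can be used. -/
theorem wedge_apply_cast {p q n : ℕ} (h : p + q = n) (α : V [⋀^Fin p]→L[ℝ] ℝ)
    (β : V [⋀^Fin q]→L[ℝ] ℝ) (v : Fin n → V) :
    wedge α β (fun i => v (Fin.cast h i)) = ((p.factorial : ℝ) * (q.factorial : ℝ))⁻¹ *
      ∑ σ : Equiv.Perm (Fin n), ((Equiv.Perm.sign σ : ℤ) : ℝ) *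
        (α (fun i => v (σ (Fin.cast h (Fin.castAdd q i)))) *
          β (fun i => v (σ (Fin.cast h (Fin.natAdd p i))))) := by
  subst h
  exact wedge_apply α β v

/-- A permutation of `n + 1` letters is the image `p` of `0` together with a permutation of the
other letters; the transposition of `0` and `p` accounts for the sign and is trivial exactly when `p
= 0`. -/
theorem sum_perm_succ {n : ℕ} (f : Equiv.Perm (Fin (n + 1)) → ℝ) :
    ∑ σ, ((Equiv.Perm.sign σ : ℤ) : ℝ) * f σ =
      ∑ p : Fin (n + 1), (if p = 0 then (1 : ℝ) else -1) *
        ∑ e : Equiv.Perm (Fin n), ((Equiv.Perm.sign e : ℤ) : ℝ) *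
          f (Equiv.Perm.decomposeFin.symm (p, e)) := by
  rw [← Equiv.sum_comp Equiv.Perm.decomposeFin.symm, Fintype.sum_prod_type]
  refine Finset.sum_congr rfl fun p _ => ?_
  rw [Finset.mul_sum]
  refine Finset.sum_congr rfl fun e _ => ?_
  rw [Equiv.Perm.decomposeFin.symm_sign]
  split_ifs <;> simp

theorem sum_perm_two (g : Fin 2 → Fin 2 → ℝ) :
    ∑ σ : Equiv.Perm (Fin 2), ((Equiv.Perm.sign σ : ℤ) : ℝ) * g (σ 0) (σ 1) =
      g 0 1 - g 1 0 := by
  rw [sum_perm_succ]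
  simp [Fin.sum_univ_succ, Equiv.Perm.decomposeFin_symm_apply_one]
  ring

theorem sum_perm_three (g : Fin 3 → Fin 3 → Fin 3 → ℝ) :
    ∑ σ : Equiv.Perm (Fin 3), ((Equiv.Perm.sign σ : ℤ) : ℝ) * g (σ 0) (σ 1) (σ 2) =
      (g 0 1 2 - g 0 2 1) + (g 1 2 0 - g 1 0 2) + (g 2 0 1 - g 2 1 0) := by
  have h : ∀ p : Fin 3, ∑ e : Equiv.Perm (Fin 2), ((Equiv.Perm.sign e : ℤ) : ℝ) *
      g (Equiv.Perm.decomposeFin.symm (p, e) 0) (Equiv.Perm.decomposeFin.symm (p, e) 1)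
        (Equiv.Perm.decomposeFin.symm (p, e) 2) = _ := fun p => by
    refine Eq.trans (Finset.sum_congr rfl fun e _ => ?_) (sum_perm_two fun i j =>
      g p (Equiv.swap 0 p i.succ) (Equiv.swap 0 p j.succ))
    rw [Equiv.Perm.decomposeFin_symm_apply_zero, ← Equiv.Perm.decomposeFin_symm_apply_succ,
      ← Equiv.Perm.decomposeFin_symm_apply_succ]
    rfl
  refine (sum_perm_succ _).trans (Eq.trans (Finset.sum_congr rfl fun p _ =>
    congrArg _ (h p)) ?_)
  rw [Fin.sum_univ_three]
  simp only [Equiv.swap_apply_def]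
  simp [Fin.ext_iff]

theorem sum_perm_four (g : Fin 4 → Fin 4 → Fin 4 → Fin 4 → ℝ) :
    ∑ σ : Equiv.Perm (Fin 4), ((Equiv.Perm.sign σ : ℤ) : ℝ) * g (σ 0) (σ 1) (σ 2) (σ 3) =
      ((g 0 1 2 3 - g 0 1 3 2) + (g 0 2 3 1 - g 0 2 1 3) + (g 0 3 1 2 - g 0 3 2 1))
      - ((g 1 0 2 3 - g 1 0 3 2) + (g 1 2 3 0 - g 1 2 0 3) + (g 1 3 0 2 - g 1 3 2 0))
      - ((g 2 1 0 3 - g 2 1 3 0) + (g 2 0 3 1 - g 2 0 1 3) + (g 2 3 1 0 - g 2 3 0 1))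
      - ((g 3 1 2 0 - g 3 1 0 2) + (g 3 2 0 1 - g 3 2 1 0) + (g 3 0 1 2 - g 3 0 2 1)) := by
  have h : ∀ p : Fin 4, ∑ e : Equiv.Perm (Fin 3), ((Equiv.Perm.sign e : ℤ) : ℝ) *
      g (Equiv.Perm.decomposeFin.symm (p, e) 0) (Equiv.Perm.decomposeFin.symm (p, e) 1)
        (Equiv.Perm.decomposeFin.symm (p, e) 2) (Equiv.Perm.decomposeFin.symm (p, e) 3) =
      _ := fun p => by
    refine Eq.trans (Finset.sum_congr rfl fun e _ => ?_) (sum_perm_three fun i j k =>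
      g p (Equiv.swap 0 p i.succ) (Equiv.swap 0 p j.succ) (Equiv.swap 0 p k.succ))
    rw [Equiv.Perm.decomposeFin_symm_apply_zero, ← Equiv.Perm.decomposeFin_symm_apply_succ,
      ← Equiv.Perm.decomposeFin_symm_apply_succ, ← Equiv.Perm.decomposeFin_symm_apply_succ]
    rfl
  refine (sum_perm_succ _).trans (Eq.trans (Finset.sum_congr rfl fun p _ =>
    congrArg _ (h p)) ?_)
  rw [Fin.sum_univ_four]
  simp only [Equiv.swap_apply_def]
  simp [Fin.ext_iff]
  ring

theorem form_one_apply (α : V [⋀^Fin 1]→L[ℝ] ℝ) (w : Fin 1 → V) : α w = α ![w 0] := by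
  congr 1; ext i; fin_cases i; rfl

theorem form_two_apply (β : V [⋀^Fin 2]→L[ℝ] ℝ) (w : Fin 2 → V) : β w = β ![w 0, w 1] := by
  congr 1; ext i; fin_cases i <;> rfl

theorem form_three_apply (β : V [⋀^Fin 3]→L[ℝ] ℝ) (w : Fin 3 → V) :
    β w = β ![w 0, w 1, w 2] := by
  congr 1; ext i; fin_cases i <;> rfl

theorem form_two_swap (β : V [⋀^Fin 2]→L[ℝ] ℝ) (x y : V) : β ![x, y] = - β ![y, x] := by
  refine Eq.trans ?_ (β.toAlternatingMap.map_swap ![y, x] (i := 0) (j := 1) (by decide))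
  exact congrArg β (by ext i; fin_cases i <;> rfl)

theorem form_two_self (β : V [⋀^Fin 2]→L[ℝ] ℝ) (x : V) : β ![x, x] = 0 := by
  have := form_two_swap β x x
  linarith

theorem form_three_swap_left (β : V [⋀^Fin 3]→L[ℝ] ℝ) (x y z : V) :
    β ![x, y, z] = - β ![y, x, z] := by
  refine Eq.trans ?_ (β.toAlternatingMap.map_swap ![y, x, z] (i := 0) (j := 1) (by decide))
  exact congrArg β (by ext i; fin_cases i <;> rfl)

theorem form_three_swap_right (β : V [⋀^Fin 3]→L[ℝ] ℝ) (x y z : V) :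
    β ![x, y, z] = - β ![x, z, y] := by
  refine Eq.trans ?_ (β.toAlternatingMap.map_swap ![x, z, y] (i := 1) (j := 2) (by decide))
  exact congrArg β (by ext i; fin_cases i <;> rfl)

theorem wedge_one_one_apply (a b : V →L[ℝ] ℝ) (v : Fin 2 → V) :
    (wedge (oneForm a) (oneForm b) : V [⋀^Fin 2]→L[ℝ] ℝ) v =
      a (v 0) * b (v 1) - a (v 1) * b (v 0) := by
  refine (wedge_apply_cast (n := 2) rfl _ _ v).trans ?_
  refine (congrArg _ (sum_perm_two fun i j => a (v i) * b (v j))).trans ?_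
  simp [Nat.factorial]

theorem wedge_one_two_apply (a : V →L[ℝ] ℝ) (β : V [⋀^Fin 2]→L[ℝ] ℝ) (v : Fin 3 → V) :
    (wedge (oneForm a) β : V [⋀^Fin 3]→L[ℝ] ℝ) v =
      a (v 0) * β ![v 1, v 2] - a (v 1) * β ![v 0, v 2] + a (v 2) * β ![v 0, v 1] := by
  refine (wedge_apply_cast (n := 3) rfl _ _ v).trans ?_
  refine (congrArg _ ((Finset.sum_congr rfl fun σ _ =>
    congrArg _ (congrArg _ (form_two_apply β _))).trans
    (sum_perm_three fun i j k => a (v i) * β ![v j, v k]))).trans ?_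
  rw [form_two_swap β (v 2) (v 1), form_two_swap β (v 2) (v 0), form_two_swap β (v 1) (v 0)]
  simp [Nat.factorial]
  ring

theorem wedge_two_one_apply (β : V [⋀^Fin 2]→L[ℝ] ℝ) (a : V →L[ℝ] ℝ) (v : Fin 3 → V) :
    (wedge β (oneForm a) : V [⋀^Fin 3]→L[ℝ] ℝ) v =
      a (v 0) * β ![v 1, v 2] - a (v 1) * β ![v 0, v 2] + a (v 2) * β ![v 0, v 1] := by
  refine (wedge_apply_cast (n := 3) rfl _ _ v).trans ?_
  refine (congrArg _ ((Finset.sum_congr rfl fun σ _ =>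
    congrArg _ (congrArg (fun t => t * _) (form_two_apply β _))).trans
    (sum_perm_three fun i j k => β ![v i, v j] * a (v k)))).trans ?_
  rw [form_two_swap β (v 2) (v 1), form_two_swap β (v 2) (v 0), form_two_swap β (v 1) (v 0)]
  simp [Nat.factorial]
  ring

theorem wedge_two_two_apply (α β : V [⋀^Fin 2]→L[ℝ] ℝ) (v : Fin 4 → V) :
    (wedge α β : V [⋀^Fin 4]→L[ℝ] ℝ) v =
      α ![v 0, v 1] * β ![v 2, v 3] - α ![v 0, v 2] * β ![v 1, v 3]
      + α ![v 0, v 3] * β ![v 1, v 2] + α ![v 1, v 2] * β ![v 0, v 3]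
      - α ![v 1, v 3] * β ![v 0, v 2] + α ![v 2, v 3] * β ![v 0, v 1] := by
  refine (wedge_apply_cast (n := 4) rfl _ _ v).trans ?_
  refine (congrArg _ ((Finset.sum_congr rfl fun σ _ =>
    congrArg _ (congrArg₂ (fun s t => s * t) (form_two_apply α _) (form_two_apply β _))).trans
    (sum_perm_four fun i j k l => α ![v i, v j] * β ![v k, v l]))).trans ?_
  simp only [form_two_swap _ (v 3) (v 0), form_two_swap _ (v 3) (v 1),
    form_two_swap _ (v 3) (v 2), form_two_swap _ (v 2) (v 0), form_two_swap _ (v 2) (v 1),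
    form_two_swap _ (v 1) (v 0)]
  simp [Nat.factorial]
  ring

theorem wedge_one_three_apply (a : V →L[ℝ] ℝ) (β : V [⋀^Fin 3]→L[ℝ] ℝ) (v : Fin 4 → V) :
    (wedge (oneForm a) β : V [⋀^Fin 4]→L[ℝ] ℝ) v =
      a (v 0) * β ![v 1, v 2, v 3] - a (v 1) * β ![v 0, v 2, v 3]
      + a (v 2) * β ![v 0, v 1, v 3] - a (v 3) * β ![v 0, v 1, v 2] := by
  refine (wedge_apply_cast (n := 4) rfl _ _ v).trans ?_
  refine (congrArg _ ((Finset.sum_congr rfl fun σ _ =>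
    congrArg _ (congrArg _ (form_three_apply β _))).trans
    (sum_perm_four fun i j k l => a (v i) * β ![v j, v k, v l]))).trans ?_
  have c : ∀ i j k : Fin 4, β ![v i, v j, v k] = β ![v j, v k, v i] := fun i j k => by
    rw [form_three_swap_left, form_three_swap_right, neg_neg]
  have s : ∀ i j k : Fin 4, β ![v i, v j, v k] = - β ![v i, v k, v j] := fun i j k =>
    form_three_swap_right _ _ _ _
  have p : ∀ i j k : Fin 4, β ![v j, v k, v i] = β ![v i, v j, v k] ∧
      β ![v k, v i, v j] = β ![v i, v j, v k] ∧ β ![v i, v k, v j] = - β ![v i, v j, v k] ∧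
      β ![v j, v i, v k] = - β ![v i, v j, v k] ∧ β ![v k, v j, v i] = - β ![v i, v j, v k] :=
    fun i j k => ⟨(c i j k).symm, c k i j, s i k j, by rw [s j i k, ← c i j k],
      by rw [s k j i, c k i j]⟩
  simp only [(p 1 2 3).1, (p 1 2 3).2.1, (p 1 2 3).2.2.1, (p 1 2 3).2.2.2.1, (p 1 2 3).2.2.2.2,
    (p 0 2 3).1, (p 0 2 3).2.1, (p 0 2 3).2.2.1, (p 0 2 3).2.2.2.1, (p 0 2 3).2.2.2.2,
    (p 0 1 3).1, (p 0 1 3).2.1, (p 0 1 3).2.2.1, (p 0 1 3).2.2.2.1, (p 0 1 3).2.2.2.2,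
    (p 0 1 2).1, (p 0 1 2).2.1, (p 0 1 2).2.2.1, (p 0 1 2).2.2.2.1, (p 0 1 2).2.2.2.2]
  simp [Nat.factorial]
  ring

end WedgeAlgebra

/-! ### Decomposable forms and signs of index tuples -/

section DetForm

variable {V W : Type*} [AddCommGroup V] [Module ℝ V] [TopologicalSpace V]
  [AddCommGroup W] [Module ℝ W] [TopologicalSpace W]

/-- The exterior product of a tuple of linear functionals. -/
def detForm {n : ℕ} (a : Fin n → V →L[ℝ] ℝ) : V [⋀^Fin n]→L[ℝ] ℝ :=
  ContinuousMultilinearMap.alternatization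
    ((ContinuousMultilinearMap.mkPiAlgebra ℝ (Fin n) ℝ).compContinuousLinearMap a)

theorem detForm_apply_eq_sum {n : ℕ} (a : Fin n → V →L[ℝ] ℝ) (v : Fin n → V) :
    detForm a v = ∑ σ : Equiv.Perm (Fin n), ((Equiv.Perm.sign σ : ℤ) : ℝ) * ∏ i, a i (v (σ i)) := by
  simp only [detForm, ContinuousMultilinearMap.alternatization_apply_apply, Units.smul_def,
    zsmul_eq_mul]
  rfl

theorem detForm_apply {n : ℕ} (a : Fin n → V →L[ℝ] ℝ) (v : Fin n → V) :
    detForm a v = (Matrix.of fun i j => a i (v j)).det := by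
  rw [detForm_apply_eq_sum, ← Matrix.det_transpose, Matrix.det_apply']
  rfl

/-- The permutations that expand the two factors form a block permutation, which right
multiplication absorbs into the permutation of all arguments. Each of the `p! q!` pairs thus
contributes the same alternating sum, and their number cancels the normalisation of `wedge`. -/
theorem wedge_detForm {p q : ℕ} (a : Fin p → V →L[ℝ] ℝ) (b : Fin q → V →L[ℝ] ℝ) :
    wedge (detForm a) (detForm b) = detForm (Fin.append a b) := by
  ext v
  rw [wedge_apply, detForm_apply_eq_sum (Fin.append a b)]
  have key : ∀ (τ : Equiv.Perm (Fin p)) (τ' : Equiv.Perm (Fin q)),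
      ∑ σ : Equiv.Perm (Fin (p + q)), ((Equiv.Perm.sign σ : ℤ) : ℝ) *
        (((Equiv.Perm.sign τ : ℤ) : ℝ) * ((Equiv.Perm.sign τ' : ℤ) : ℝ) *
        ((∏ i, a i (v (σ (Fin.castAdd q (τ i))))) * ∏ i, b i (v (σ (Fin.natAdd p (τ' i)))))) =
      ∑ σ : Equiv.Perm (Fin (p + q)), ((Equiv.Perm.sign σ : ℤ) : ℝ) *
        ∏ i, Fin.append a b i (v (σ i)) := by
    intro τ τ'
    set ρ : Equiv.Perm (Fin (p + q)) :=
      finSumFinEquiv.permCongr (Equiv.Perm.sumCongr τ τ') with hρ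
    have hs : ((Equiv.Perm.sign ρ : ℤ) : ℝ) =
        ((Equiv.Perm.sign τ : ℤ) : ℝ) * ((Equiv.Perm.sign τ' : ℤ) : ℝ) := by
      rw [hρ, Equiv.Perm.sign_permCongr, Equiv.Perm.sign_sumCongr]
      push_cast
      rfl
    rw [← Equiv.sum_comp (Equiv.mulRight ρ) (fun σ : Equiv.Perm (Fin (p + q)) =>
      ((Equiv.Perm.sign σ : ℤ) : ℝ) * ∏ i, Fin.append a b i (v (σ i)))]
    refine Finset.sum_congr rfl fun σ _ => ?_
    simp only [Equiv.coe_mulRight, Equiv.Perm.sign_mul, Units.val_mul, Int.cast_mul, hs,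
      Equiv.Perm.mul_apply, mul_assoc]
    congr 3
    rw [Fin.prod_univ_add]
    simp [hρ, Equiv.permCongr_apply]
  have h2 : ∀ σ : Equiv.Perm (Fin (p + q)), ((Equiv.Perm.sign σ : ℤ) : ℝ) *
      (detForm a (fun i => v (σ (Fin.castAdd q i))) *
        detForm b (fun i => v (σ (Fin.natAdd p i)))) =
      ∑ τ : Equiv.Perm (Fin p), ∑ τ' : Equiv.Perm (Fin q), ((Equiv.Perm.sign σ : ℤ) : ℝ) *
        (((Equiv.Perm.sign τ : ℤ) : ℝ) * ((Equiv.Perm.sign τ' : ℤ) : ℝ) *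
        ((∏ i, a i (v (σ (Fin.castAdd q (τ i))))) *
          ∏ i, b i (v (σ (Fin.natAdd p (τ' i)))))) := by
    intro σ
    rw [detForm_apply_eq_sum, detForm_apply_eq_sum, Finset.sum_mul_sum, Finset.mul_sum]
    refine Finset.sum_congr rfl fun τ _ => ?_
    rw [Finset.mul_sum]
    exact Finset.sum_congr rfl fun τ' _ => by ring
  simp only [h2]
  rw [Finset.sum_comm]
  have h3 : ∀ τ : Equiv.Perm (Fin p), ∑ σ : Equiv.Perm (Fin (p + q)), ∑ τ' : Equiv.Perm (Fin q),
      ((Equiv.Perm.sign σ : ℤ) : ℝ) *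
        (((Equiv.Perm.sign τ : ℤ) : ℝ) * ((Equiv.Perm.sign τ' : ℤ) : ℝ) *
        ((∏ i, a i (v (σ (Fin.castAdd q (τ i))))) *
          ∏ i, b i (v (σ (Fin.natAdd p (τ' i)))))) = (q.factorial : ℝ) *
      ∑ σ : Equiv.Perm (Fin (p + q)), ((Equiv.Perm.sign σ : ℤ) : ℝ) *
        ∏ i, Fin.append a b i (v (σ i)) := fun τ => by
    rw [Finset.sum_comm, Finset.sum_congr rfl fun τ' _ => key τ τ']
    simp [Finset.card_univ, Fintype.card_perm]
  rw [Finset.sum_congr rfl fun τ _ => h3 τ]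
  have hp : (p.factorial : ℝ) ≠ 0 := by positivity
  have hq : (q.factorial : ℝ) ≠ 0 := by positivity
  simp [Finset.card_univ, Fintype.card_perm]
  field_simp

theorem detForm_compContinuousLinearMap {n : ℕ} (a : Fin n → W →L[ℝ] ℝ) (L : V →L[ℝ] W) :
    (detForm a).compContinuousLinearMap L = detForm fun i => (a i).comp L := by
  ext v
  rw [ContinuousAlternatingMap.compContinuousLinearMap_apply, detForm_apply, detForm_apply]
  rfl

theorem detForm_two_apply (a b : V →L[ℝ] ℝ) (v : Fin 2 → V) :
    detForm ![a, b] v = a (v 0) * b (v 1) - a (v 1) * b (v 0) := by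
  rw [detForm_apply, Matrix.det_fin_two]; rfl

theorem detForm_three_apply (a b c : V →L[ℝ] ℝ) (v : Fin 3 → V) :
    detForm ![a, b, c] v = a (v 0) * (b (v 1) * c (v 2) - b (v 2) * c (v 1))
      - a (v 1) * (b (v 0) * c (v 2) - b (v 2) * c (v 0))
      + a (v 2) * (b (v 0) * c (v 1) - b (v 1) * c (v 0)) := by
  rw [detForm_apply, Matrix.det_fin_three]
  simp
  ring

theorem insertVec_detForm_three (ξ : V) (a b c : V →L[ℝ] ℝ) :
    insertVec ξ (detForm ![a, b, c]) =
      a ξ • detForm ![b, c] + b ξ • detForm ![c, a] + c ξ • detForm ![a, b] := by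
  ext v
  rw [insertVec_apply, detForm_three_apply]
  have h2 : (Fin.cons ξ v : Fin 3 → V) 2 = v 1 := rfl
  simp [detForm_two_apply, h2]
  ring

theorem detForm_cons_cons {n : ℕ} (a : V →L[ℝ] ℝ) (b : Fin n → V →L[ℝ] ℝ) (ξ : V)
    (w : Fin n → V) (h : ∀ i, b i ξ = 0) :
    detForm (Fin.cons a b : Fin (n + 1) → V →L[ℝ] ℝ) (Fin.cons ξ w) = a ξ * detForm b w := by
  rw [detForm_apply, detForm_apply, Matrix.det_succ_column_zero, Fin.sum_univ_succ]
  simp [h]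
  left
  rfl

theorem detForm_comp_perm {n : ℕ} (a : Fin n → V →L[ℝ] ℝ) (ρ : Equiv.Perm (Fin n)) :
    detForm (fun i => a (ρ i)) = ((Equiv.Perm.sign ρ : ℤ) : ℝ) • detForm a := by
  ext v
  rw [ContinuousAlternatingMap.smul_apply, detForm_apply, detForm_apply, smul_eq_mul,
    ← Matrix.det_permute]
  rfl

/-- The sign of the order of two indices. -/
def orderSign {n : ℕ} (i j : Fin n) : ℤ := if i < j then 1 else if j < i then -1 else 0

/-- The Levi-Civita symbol of a tuple of indices. -/
def leviCivita {n : ℕ} (m : Fin n → Fin n) : ℤ := ∏ j, ∏ i ∈ Finset.Iio j, orderSign (m i) (m j)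

/-- The sign is taken as a product of order comparisons, not as the sign of a permutation: this
includes tuples with repeated indices, where both sides vanish, and it leaves an integer that can be
evaluated. -/
theorem detForm_comp_eq_leviCivita {n : ℕ} (a : Fin n → V →L[ℝ] ℝ) (m : Fin n → Fin n) :
    detForm (fun i => a (m i)) = (leviCivita m : ℝ) • detForm a := by
  by_cases hm : Function.Injective m
  · have hb := Finite.injective_iff_bijective.1 hm
    have h := detForm_comp_perm a (Equiv.ofBijective m hb)
    have h2 := Equiv.Perm.prod_Iio_comp_eq_sign_mul_prod (R := ℤ)
      (Equiv.ofBijective m hb) (f := orderSign) (fun i j => by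
        unfold orderSign
        rcases lt_trichotomy i j with h | h | h
        · simp [h, h.not_gt]
        · simp [h]
        · simp [h, h.not_gt])
    have h3 : ∏ j : Fin n, ∏ i ∈ Finset.Iio j, orderSign i j = 1 :=
      Finset.prod_eq_one fun j _ => Finset.prod_eq_one fun i hi => by
        simp [orderSign, Finset.mem_Iio.1 hi]
    rw [h3, mul_one] at h2
    have h4 : leviCivita m = (Equiv.Perm.sign (Equiv.ofBijective m hb) : ℤ) := by
      rw [leviCivita]; simpa using h2
    rw [h4]
    exact h
  · have h : ∃ i j, i < j ∧ m i = m j := by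
      simp only [Function.Injective, not_forall] at hm
      obtain ⟨i, j, hij, hne⟩ := hm
      rcases lt_or_gt_of_ne hne with h | h
      · exact ⟨i, j, h, hij⟩
      · exact ⟨j, i, h, hij.symm⟩
    obtain ⟨i, j, hij, he⟩ := h
    have h0 : leviCivita m = 0 := Finset.prod_eq_zero (Finset.mem_univ j)
      (Finset.prod_eq_zero (Finset.mem_Iio.2 hij) (by simp [orderSign, he]))
    rw [h0]
    ext v
    rw [detForm_apply, Matrix.det_zero_of_row_eq hij.ne (by ext k; simp [he])]
    simp

end DetForm

/-! ### The standard three-form on ℝ⁷ and its metric -/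

section Model

/-- The model seven-dimensional space. -/
abbrev R7 : Type := Fin 7 → ℝ

/-- The coordinate functionals of the model space. -/
def coord7 (i : Fin 7) : R7 →L[ℝ] ℝ := ContinuousLinearMap.proj i

theorem coord7_apply (i : Fin 7) (x : R7) : coord7 i x = x i := rfl

/-- The standard definite three-form, with the seven cyclic lines `{i, i+1, i+3}` of the Fano
plane. -/
def stdThreeForm : R7 [⋀^Fin 3]→L[ℝ] ℝ :=
  ∑ i, detForm ![coord7 i, coord7 (i + 1), coord7 (i + 3)]

/-- The Hodge dual of the standard definite three-form. -/
def stdFourForm : R7 [⋀^Fin 4]→L[ℝ] ℝ :=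
  ∑ i, detForm ![coord7 (i + 2), coord7 (i + 4), coord7 (i + 5), coord7 (i + 6)]

/-- The volume form of the standard definite three-form. -/
def stdVolume : R7 [⋀^Fin 7]→L[ℝ] ℝ := -detForm coord7

/-- The standard inner product. -/
def stdMetric : R7 →L[ℝ] R7 →L[ℝ] ℝ := ∑ i, (coord7 i).smulRight (coord7 i)

theorem stdMetric_apply (x y : R7) : stdMetric x y = ∑ i, x i * y i := by
  simp [stdMetric, coord7]

theorem insertVec_stdThreeForm (ξ : R7) :
    insertVec ξ stdThreeForm = ∑ i, ξ i • (detForm ![coord7 (i + 1), coord7 (i + 3)] +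
      detForm ![coord7 (i + 2), coord7 (i + 6)] + detForm ![coord7 (i + 4), coord7 (i + 5)]) := by
  rw [stdThreeForm, insertVec_sum]
  simp only [insertVec_detForm_three, smul_add, Finset.sum_add_distrib, coord7_apply]
  -- The index `i` is the first point of line `i`, the second of line `i - 1` and the third of line
  -- `i - 3`; the shifts by `1` and `3` collect the three contributions to the coefficient `ξ i`.
  rw [← Equiv.sum_comp (Equiv.addRight (1 : Fin 7))
    (fun i => ξ i • detForm ![coord7 (i + 2), coord7 (i + 6)]),
    ← Equiv.sum_comp (Equiv.addRight (3 : Fin 7))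
    (fun i => ξ i • detForm ![coord7 (i + 4), coord7 (i + 5)])]
  simp only [Equiv.coe_addRight, add_assoc]
  simp only [show (1 + 2 : Fin 7) = 3 from rfl, show (1 + 6 : Fin 7) = 0 from rfl,
    show (3 + 4 : Fin 7) = 0 from rfl, show (3 + 5 : Fin 7) = 1 from rfl, add_zero]

/-- The pairs of indices in the contraction of the standard three-form with a basis vector. -/
def contractionPair (i : Fin 7) (t : Fin 3) : Fin 2 → Fin 7 :=
  match t with
  | 0 => ![i + 1, i + 3]
  | 1 => ![i + 2, i + 6]
  | 2 => ![i + 4, i + 5]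

theorem insertVec_stdThreeForm_eq_sum (ξ : R7) :
    insertVec ξ stdThreeForm =
      ∑ i, ξ i • ∑ t, detForm (fun k => coord7 (contractionPair i t k)) := by
  rw [insertVec_stdThreeForm]
  refine Finset.sum_congr rfl fun i _ => ?_
  rw [Fin.sum_univ_three]
  congr 2

/-- The indices of the wedge product of two contractions with a line. -/
def contractionTuple (i j : Fin 7) (t t' : Fin 3) (l : Fin 7) : Fin 7 → Fin 7 :=
  Fin.append (Fin.append (contractionPair i t) (contractionPair j t')) ![l, l + 1, l + 3]

theorem leviCivita_seven (m : Fin 7 → Fin 7) : leviCivita m =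
    orderSign (m 0) (m 1) * (orderSign (m 0) (m 2) * orderSign (m 1) (m 2)) *
    (orderSign (m 0) (m 3) * orderSign (m 1) (m 3) * orderSign (m 2) (m 3)) *
    (orderSign (m 0) (m 4) * orderSign (m 1) (m 4) * orderSign (m 2) (m 4) * orderSign (m 3) (m 4)) *
    (orderSign (m 0) (m 5) * orderSign (m 1) (m 5) * orderSign (m 2) (m 5) * orderSign (m 3) (m 5) *
      orderSign (m 4) (m 5)) *
    (orderSign (m 0) (m 6) * orderSign (m 1) (m 6) * orderSign (m 2) (m 6) * orderSign (m 3) (m 6) *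
      orderSign (m 4) (m 6) * orderSign (m 5) (m 6)) := by
  have h : ∀ j : Fin 7, ∏ i ∈ Finset.Iio j, orderSign (m i) (m j) =
      ∏ i, if i < j then orderSign (m i) (m j) else 1 := fun j => by
    rw [← Finset.prod_filter]
    congr 1
    ext i
    simp
  simp only [leviCivita, h, Fin.prod_univ_seven]
  simp [Fin.lt_def]

-- The identity `i_ξ φ ∧ i_η φ ∧ φ = 6 g(ξ, η) μ` of the model reduces to this count of signs. The
-- value `-6` on the diagonal is the reason why `stdVolume` is minus the coordinate determinant.
set_option maxRecDepth 100000 in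
theorem sum_leviCivita_contractionTuple (i j : Fin 7) :
    ∑ t, ∑ t', ∑ l, leviCivita (contractionTuple i j t t' l) = if i = j then -6 else 0 := by
  simp only [leviCivita_seven]
  revert i j
  decide +kernel

/-- The seven-form `α ∧ β ∧ φ` of two two-forms and a three-form. -/
def wedgeTriple {V : Type*} [AddCommGroup V] [Module ℝ V] [TopologicalSpace V]
    (α β : V [⋀^Fin 2]→L[ℝ] ℝ) (φ : V [⋀^Fin 3]→L[ℝ] ℝ) : V [⋀^Fin 7]→L[ℝ] ℝ :=
  wedge (wedge α β) φ

section

variable {V : Type*} [AddCommGroup V] [Module ℝ V] [TopologicalSpace V] {ι : Type*}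

theorem wedgeTriple_apply (α β : V [⋀^Fin 2]→L[ℝ] ℝ) (φ : V [⋀^Fin 3]→L[ℝ] ℝ)
    (v : Fin 7 → V) : wedgeTriple α β φ v = wedge (wedge α β) φ v := rfl

theorem wedgeTriple_smul_left (c : ℝ) (α β : V [⋀^Fin 2]→L[ℝ] ℝ) (φ : V [⋀^Fin 3]→L[ℝ] ℝ) :
    wedgeTriple (c • α) β φ = c • wedgeTriple α β φ := by
  ext v
  rw [wedgeTriple_apply, wedge_smul_left, wedge_smul_left]
  rfl

theorem wedgeTriple_smul_right (c : ℝ) (α β : V [⋀^Fin 2]→L[ℝ] ℝ) (φ : V [⋀^Fin 3]→L[ℝ] ℝ) :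
    wedgeTriple α (c • β) φ = c • wedgeTriple α β φ := by
  ext v
  rw [wedgeTriple_apply, wedge_smul_right, wedge_smul_left]
  rfl

theorem wedgeTriple_sum_left (s : Finset ι) (α : ι → V [⋀^Fin 2]→L[ℝ] ℝ)
    (β : V [⋀^Fin 2]→L[ℝ] ℝ) (φ : V [⋀^Fin 3]→L[ℝ] ℝ) :
    wedgeTriple (∑ i ∈ s, α i) β φ = ∑ i ∈ s, wedgeTriple (α i) β φ := by
  ext v
  rw [wedgeTriple_apply, wedge_sum_left, wedge_sum_left]
  simp only [ContinuousAlternatingMap.sum_apply]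
  rfl

theorem wedgeTriple_sum_right (s : Finset ι) (α : V [⋀^Fin 2]→L[ℝ] ℝ)
    (β : ι → V [⋀^Fin 2]→L[ℝ] ℝ) (φ : V [⋀^Fin 3]→L[ℝ] ℝ) :
    wedgeTriple α (∑ i ∈ s, β i) φ = ∑ i ∈ s, wedgeTriple α (β i) φ := by
  ext v
  rw [wedgeTriple_apply, wedge_sum_right, wedge_sum_left]
  simp only [ContinuousAlternatingMap.sum_apply]
  rfl

theorem wedgeTriple_sum_form (s : Finset ι) (α β : V [⋀^Fin 2]→L[ℝ] ℝ)
    (φ : ι → V [⋀^Fin 3]→L[ℝ] ℝ) :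
    wedgeTriple α β (∑ i ∈ s, φ i) = ∑ i ∈ s, wedgeTriple α β (φ i) := by
  ext v
  rw [wedgeTriple_apply, wedge_sum_right]
  simp only [ContinuousAlternatingMap.sum_apply]
  rfl

end

theorem wedgeTriple_coord7 (i j : Fin 7) (t t' : Fin 3) (l : Fin 7) :
    wedgeTriple (detForm (fun k => coord7 (contractionPair i t k)))
      (detForm (fun k => coord7 (contractionPair j t' k)))
      (detForm ![coord7 l, coord7 (l + 1), coord7 (l + 3)]) =
      (leviCivita (contractionTuple i j t t' l) : ℝ) • detForm coord7 := by
  rw [← detForm_comp_eq_leviCivita, wedgeTriple, wedge_detForm, wedge_detForm]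
  congr 1
  ext k : 1
  fin_cases k <;> rfl

theorem wedgeTriple_contractions (i j : Fin 7) :
    wedgeTriple (∑ t, detForm (fun k => coord7 (contractionPair i t k)))
      (∑ t, detForm (fun k => coord7 (contractionPair j t k))) stdThreeForm =
      (if i = j then -6 else 0 : ℝ) • detForm coord7 := by
  have h := congrArg (fun z : ℤ => (z : ℝ)) (sum_leviCivita_contractionTuple i j)
  beta_reduce at h
  rw [show ((if i = j then -6 else 0 : ℤ) : ℝ) = if i = j then -6 else 0 by
    split_ifs <;> simp] at h
  rw [← h, wedgeTriple_sum_left]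
  push_cast
  rw [Finset.sum_smul]
  refine Finset.sum_congr rfl fun t _ => ?_
  rw [wedgeTriple_sum_right, Finset.sum_smul]
  refine Finset.sum_congr rfl fun t' _ => ?_
  rw [stdThreeForm, wedgeTriple_sum_form, Finset.sum_smul]
  exact Finset.sum_congr rfl fun l _ => wedgeTriple_coord7 i j t t' l

theorem stdThreeForm_wedgeTriple (ξ η : R7) :
    wedgeTriple (insertVec ξ stdThreeForm) (insertVec η stdThreeForm) stdThreeForm =
      (6 * stdMetric ξ η) • stdVolume := by
  have h : ∀ i j : Fin 7, (ξ i * η j) • (if i = j then -6 else 0 : ℝ) • detForm coord7 =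
      if i = j then (6 * (ξ i * η i)) • stdVolume else 0 := by
    intro i j
    split_ifs with h
    · subst h
      rw [stdVolume, smul_neg, ← neg_smul, smul_smul]
      congr 1
      ring
    · rw [zero_smul, smul_zero]
  rw [insertVec_stdThreeForm_eq_sum, insertVec_stdThreeForm_eq_sum, wedgeTriple_sum_left,
    stdMetric_apply, Finset.mul_sum, Finset.sum_smul]
  refine Finset.sum_congr rfl fun i _ => ?_
  rw [wedgeTriple_smul_left, wedgeTriple_sum_right, Finset.smul_sum]
  have h2 : ∀ j, ξ i • wedgeTriple (∑ t, detForm (fun k => coord7 (contractionPair i t k)))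
      (η j • ∑ t, detForm (fun k => coord7 (contractionPair j t k))) stdThreeForm =
      if i = j then (6 * (ξ i * η i)) • stdVolume else 0 := fun j => by
    rw [wedgeTriple_smul_right, smul_smul, wedgeTriple_contractions, h i j]
  simp only [h2]
  rw [Finset.sum_ite_eq, if_pos (Finset.mem_univ i)]

theorem isMetricOfForm_std : IsMetricOfForm stdThreeForm stdMetric stdVolume where
  symm ξ η := by
    rw [stdMetric_apply, stdMetric_apply]
    exact Finset.sum_congr rfl fun i _ => mul_comm _ _
  pos ξ hξ := by
    rw [stdMetric_apply]
    obtain ⟨i, hi⟩ := Function.ne_iff.1 hξ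
    exact Finset.sum_pos' (fun i _ => mul_self_nonneg _)
      ⟨i, Finset.mem_univ i, mul_self_pos.2 hi⟩
  volume e he := by
    set A : Matrix (Fin 7) (Fin 7) ℝ := Matrix.of fun i j => e j i with hA
    have h1 : A.transpose * A = 1 := by
      ext i j
      rw [Matrix.mul_apply, Matrix.one_apply, ← he i j, stdMetric_apply]
      rfl
    have h2 := congrArg Matrix.det h1
    rw [Matrix.det_mul, Matrix.det_transpose, Matrix.det_one] at h2
    have h3 : stdVolume e = -A.det := by
      rw [stdVolume, ContinuousAlternatingMap.neg_apply, detForm_apply]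
      rfl
    rw [h3, abs_neg, ← abs_one]
    exact (sq_eq_sq_iff_abs_eq_abs _ _).1 (by rw [sq, h2]; norm_num)
  eq := stdThreeForm_wedgeTriple

end Model

/-! ### Structure constants and the algebra of intrinsic torsion -/

/-- The structure constants of the octonions: the components of `stdThreeForm`. -/
def fano (a b c : Fin 7) : ℤ :=
  match (b - a).val, (c - a).val with
  | 1, 3 => 1
  | 3, 1 => -1
  | 2, 6 => 1
  | 6, 2 => -1
  | 4, 5 => 1
  | 5, 4 => -1
  | _, _ => 0

/-- Translations of `ℤ/7` are symmetries of the Fano plane. Identities between structure constants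
can therefore be checked with one index equal to `0` and transported to the others. -/
theorem fano_add_right (a b c p : Fin 7) : fano (a + p) (b + p) (c + p) = fano a b c := by
  simp only [fano, add_sub_add_right_eq_sub]

/-- The components of `stdFourForm`. -/
def fanoQuad (a b c d : Fin 7) : ℤ :=
  ∑ e, fano a b e * fano e c d - (if a = c ∧ b = d then 1 else 0) +
    (if a = d ∧ b = c then 1 else 0)

theorem fanoQuad_add_right (a b c d p : Fin 7) :
    fanoQuad (a + p) (b + p) (c + p) (d + p) = fanoQuad a b c d := by
  simp only [fanoQuad, add_left_inj]
  rw [← Equiv.sum_comp (Equiv.addRight p)]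
  simp only [Equiv.coe_addRight, fano_add_right]

/-- The third point of the line through two points. -/
def fanoThird (k l : Fin 7) : Fin 7 :=
  match (l - k).val with
  | 1 => k + 3
  | 3 => k + 1
  | 2 => k + 6
  | 6 => k + 2
  | 4 => k + 5
  | 5 => k + 4
  | _ => k

theorem fano_eq_ite (m k l : Fin 7) :
    fano m k l = if m = fanoThird k l then fano (fanoThird k l) k l else 0 := by
  revert m k l; decide +kernel

/-- The coefficient of `w i j` in the action of the matrix `w` on the component `b c d` of
`stdThreeForm`. -/
def threeAct (b c d i j : Fin 7) : ℤ :=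
  (if j = b then fano i c d else 0) + (if j = c then fano b i d else 0) +
    (if j = d then fano b c i else 0)

theorem threeAct_add_right (b c d i j p : Fin 7) :
    threeAct (b + p) (c + p) (d + p) (i + p) (j + p) = threeAct b c d i j := by
  simp only [threeAct, add_left_inj, fano_add_right]

/-- The coefficient of `w i j` in the action of the matrix `w` on the component `b c d e` of
`stdFourForm`. -/
def fourAct (b c d e i j : Fin 7) : ℤ :=
  (if j = b then fanoQuad i c d e else 0) + (if j = c then fanoQuad b i d e else 0) +
    (if j = d then fanoQuad b c i e else 0) + (if j = e then fanoQuad b c d i else 0)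

/-- The coefficient of `w k i j` in the alternation of the action on `stdThreeForm`. -/
def altThree (a b c d k i j : Fin 7) : ℤ :=
  (if k = a then threeAct b c d i j else 0) - (if k = b then threeAct a c d i j else 0) +
  (if k = c then threeAct a b d i j else 0) - (if k = d then threeAct a b c i j else 0)

/-- The coefficient of `w k i j` in the alternation of the action on `stdFourForm`. -/
def altFour (a b c d e k i j : Fin 7) : ℤ :=
  (if k = a then fourAct b c d e i j else 0) - (if k = b then fourAct a c d e i j else 0) +
  (if k = c then fourAct a b d e i j else 0) - (if k = d then fourAct a b c e i j else 0) +
  (if k = e then fourAct a b c d i j else 0)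

/-- Combinations of alternations that isolate a component of the intrinsic torsion. -/
def combo (a k i j : Fin 7) : ℤ :=
  match a with
  | 0 => altThree 0 3 5 6 k i j + altThree 1 3 4 5 k i j - altThree 0 1 4 6 k i j + altThree 2 4 5 6 k i j
      - altThree 0 2 3 4 k i j - altThree 1 2 3 6 k i j + altThree 0 1 2 5 k i j
  | 1 => 2 * (- altFour 0 1 2 3 5 k i j + altThree 0 2 3 6 k i j - altFour 0 1 3 4 6 k i j - altThree 0 3 4 5 k i j)
  | 2 => 2 * (- altThree 0 1 3 6 k i j + altFour 0 1 2 5 6 k i j - altFour 0 2 3 4 6 k i j - altThree 0 4 5 6 k i j)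
  | 3 => 2 * (- altFour 0 1 2 3 4 k i j + altThree 0 1 2 6 k i j + altFour 0 1 3 5 6 k i j + altThree 0 1 4 5 k i j)
  | 4 => 2 * (altFour 0 1 4 5 6 k i j - altThree 0 1 3 5 k i j - altFour 0 2 3 4 5 k i j + altThree 0 2 5 6 k i j)
  | 5 => 2 * (- altFour 0 3 4 5 6 k i j + altThree 0 1 3 4 k i j + altFour 0 1 2 4 5 k i j - altThree 0 2 4 6 k i j)
  | 6 => 2 * (altFour 0 2 3 5 6 k i j - altThree 0 1 2 3 k i j + altFour 0 1 2 4 6 k i j + altThree 0 2 4 5 k i j)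

-- The torsion has the 49 components `∑ φ_{eij} w_{aij}`, forming `ℝ⁷ ⊗ ℝ⁷ = 1 + 7 + 14 + 27`; `dφ`
-- detects the summands `1`, `7`, `27` and `d*φ` the summands `7`, `14`. The array `combo a` is a
-- combination of components of the two derivatives whose skew part in `i, j` is supported on `k =
-- a` and is proportional to `φ_{0ij}` there.
set_option maxRecDepth 100000 in
theorem combo_antisymm : ∀ a k i j : Fin 7,
    combo a k i j - combo a k j i = if k = a then 4 * fano 0 i j else 0 := by decide +kernel

-- The map `w ↦ ∑ φ_{eij} w_{ij}` is the projection of `so(7) = g₂ ⊕ ℝ⁷` to `ℝ⁷`. The identity shows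
-- that a skew matrix acts on `φ` only through this projection, by contraction of the four-form;
-- this is why vanishing torsion makes `φ` parallel.
set_option maxRecDepth 100000 in
theorem threeAct_antisymm : ∀ c d i j : Fin 7,
  2 * (threeAct 0 c d i j - threeAct 0 c d j i) =
    -∑ e, (fano e i j - fano e j i) * fanoQuad e 0 c d := by decide +kernel

set_option maxRecDepth 100000 in
theorem fano_skew : ∀ c i j : Fin 7,  fano c j i = - fano c i j := by decide +kernel

/-- The pairing of a coefficient array with a three-index array. -/
def pairing (C : Fin 7 → Fin 7 → Fin 7 → ℤ) (w : Fin 7 → Fin 7 → Fin 7 → ℝ) : ℝ :=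
  ∑ k, ∑ i, ∑ j, (C k i j : ℝ) * w k i j

section

variable (w : Fin 7 → Fin 7 → Fin 7 → ℝ)

theorem pairing_add (C C' : Fin 7 → Fin 7 → Fin 7 → ℤ) :
    pairing (fun k i j => C k i j + C' k i j) w = pairing C w + pairing C' w := by
  simp only [pairing, Int.cast_add, add_mul, Finset.sum_add_distrib]

theorem pairing_sub (C C' : Fin 7 → Fin 7 → Fin 7 → ℤ) :
    pairing (fun k i j => C k i j - C' k i j) w = pairing C w - pairing C' w := by
  simp only [pairing, Int.cast_sub, sub_mul, Finset.sum_sub_distrib]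

theorem pairing_neg (C : Fin 7 → Fin 7 → Fin 7 → ℤ) :
    pairing (fun k i j => - C k i j) w = - pairing C w := by
  simp only [pairing, Int.cast_neg, neg_mul, Finset.sum_neg_distrib]

theorem pairing_mul (m : ℤ) (C : Fin 7 → Fin 7 → Fin 7 → ℤ) :
    pairing (fun k i j => m * C k i j) w = m * pairing C w := by
  simp only [pairing, Int.cast_mul, mul_assoc, Finset.mul_sum]

theorem pairing_ite (a : Fin 7) (c : Fin 7 → Fin 7 → ℤ) :
    pairing (fun k i j => if k = a then c i j else 0) w = ∑ i, ∑ j, (c i j : ℝ) * w a i j := by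
  rw [pairing, Finset.sum_eq_single a (fun k _ hk => by simp [hk]) (by simp)]
  simp

theorem pairing_swap (hskew : ∀ a i j, w a i j = - w a j i) (C : Fin 7 → Fin 7 → Fin 7 → ℤ) :
    pairing (fun k i j => C k j i) w = - pairing C w := by
  rw [pairing, pairing, ← Finset.sum_neg_distrib]
  refine Finset.sum_congr rfl fun k _ => ?_
  rw [Finset.sum_comm, ← Finset.sum_neg_distrib]
  refine Finset.sum_congr rfl fun i _ => ?_
  rw [← Finset.sum_neg_distrib]
  refine Finset.sum_congr rfl fun j _ => ?_
  rw [hskew k j i]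
  ring

theorem pairing_shift (p : Fin 7) (C C' : Fin 7 → Fin 7 → Fin 7 → ℤ)
    (h : ∀ k i j, C' (k + p) (i + p) (j + p) = C k i j) :
    pairing C (fun a i j => w (a + p) (i + p) (j + p)) = pairing C' w := by
  symm
  rw [pairing, pairing, ← Equiv.sum_comp (Equiv.addRight p)]
  refine Finset.sum_congr rfl fun k _ => ?_
  rw [← Equiv.sum_comp (Equiv.addRight p)]
  refine Finset.sum_congr rfl fun i _ => ?_
  rw [← Equiv.sum_comp (Equiv.addRight p)]
  refine Finset.sum_congr rfl fun j _ => ?_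
  simp only [Equiv.coe_addRight, h]

/-- Being a combination of the alternations, `combo a` pairs to zero with `w`. Since `w` is skew,
the transposed array pairs to zero as well, and the difference of the two is four times the sum in
question. -/
theorem torsion_eq_zero (hskew : ∀ a i j, w a i j = - w a j i)
    (h3 : ∀ a b c d, pairing (altThree a b c d) w = 0)
    (h4 : ∀ a b c d e, pairing (altFour a b c d e) w = 0) (a : Fin 7) :
    ∑ i, ∑ j, (fano 0 i j : ℝ) * w a i j = 0 := by
  have h : pairing (combo a) w = 0 := by
    fin_cases a <;>
    · show pairing (fun k i j => combo _ k i j) w = 0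
      simp only [combo, pairing_add, pairing_sub, pairing_neg, pairing_mul]
      simp only [h3, h4]
      simp
  have h2 := pairing_sub w (combo a) (fun k i j => combo a k j i)
  simp only [combo_antisymm] at h2
  rw [pairing_swap w hskew (combo a), h, pairing_ite w a fun i j => 4 * fano 0 i j] at h2
  push_cast at h2
  simp only [mul_assoc, ← Finset.mul_sum] at h2
  linarith

/-- If the infinitesimal rotations `w a` are such that the alternations of `w · stdThreeForm` and
`w · stdFourForm` vanish, then they annihilate `stdThreeForm`. -/
theorem threeAct_eq_zero (hskew : ∀ a i j, w a i j = - w a j i)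
    (h3 : ∀ a b c d, pairing (altThree a b c d) w = 0)
    (h4 : ∀ a b c d e, pairing (altFour a b c d e) w = 0) (a b c d : Fin 7) :
    ∑ i, ∑ j, (threeAct b c d i j : ℝ) * w a i j = 0 := by
  -- Translation of all indices by `e` carries the component with index `0` to the component with
  -- index `e`.
  have key : ∀ (a e : Fin 7), ∑ i, ∑ j, (fano e i j : ℝ) * w a i j = 0 := by
    intro a e
    have := torsion_eq_zero (fun a i j => w (a + e) (i + e) (j + e)) (fun a i j => hskew _ _ _)
      (fun a b c d => (pairing_shift w e _ (altThree (a + e) (b + e) (c + e) (d + e))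
        (by intros; simp only [altThree, threeAct, add_left_inj, fano_add_right])).trans (h3 _ _ _ _))
      (fun a b c d f => (pairing_shift w e _
        (altFour (a + e) (b + e) (c + e) (d + e) (f + e))
        (by intros; simp only [altFour, fourAct, add_left_inj, fanoQuad_add_right])).trans
          (h4 _ _ _ _ _)) (a - e)
    rw [← this]
    simp only [sub_add_cancel]
    rw [← Equiv.sum_comp (Equiv.addRight e)]
    refine Finset.sum_congr rfl fun i _ => ?_
    rw [← Equiv.sum_comp (Equiv.addRight e)]
    refine Finset.sum_congr rfl fun j _ => ?_
    simp only [Equiv.coe_addRight]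
    rw [← fano_add_right 0 i j e, zero_add]
  have hb : ∀ i j, 2 * (threeAct b c d i j - threeAct b c d j i) =
      -∑ e, (fano e i j - fano e j i) * fanoQuad e b c d := by
    intro i j
    have := threeAct_antisymm (c - b) (d - b) (i - b) (j - b)
    have h1 : ∀ i j, threeAct 0 (c - b) (d - b) (i - b) (j - b) = threeAct b c d i j := by
      intro i j
      rw [← threeAct_add_right _ _ _ _ _ b]
      simp only [zero_add, sub_add_cancel]
    rw [h1, h1, ← Equiv.sum_comp (Equiv.subRight b)] at this
    rw [this]
    congr 1
    refine Finset.sum_congr rfl fun e _ => ?_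
    simp only [Equiv.subRight_apply, sub_eq_add_neg, fano_add_right]
    rw [← fanoQuad_add_right _ 0 _ _ b]
    simp
  have h5 : ∑ i, ∑ j, ((2 * (threeAct b c d i j - threeAct b c d j i) : ℤ) : ℝ) * w a i j = 0 := by
    simp only [hb]
    push_cast
    have : ∀ i j, (-∑ e, ((fano e i j : ℝ) - fano e j i) * fanoQuad e b c d) * w a i j =
        -∑ e, (fanoQuad e b c d : ℝ) * (2 * (fano e i j * w a i j)) := by
      intro i j
      rw [neg_mul, Finset.sum_mul]
      congr 1
      refine Finset.sum_congr rfl fun e _ => ?_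
      rw [fano_skew e i j]
      push_cast
      ring
    simp only [this, Finset.sum_neg_distrib]
    have h7 : ∀ e, ∑ i, ∑ j, (fanoQuad e b c d : ℝ) * (2 * (fano e i j * w a i j)) = 0 := by
      intro e
      simp only [← Finset.mul_sum, key a e, mul_zero]
    rw [neg_eq_zero, (Finset.sum_congr rfl fun i _ => Finset.sum_comm).trans Finset.sum_comm]
    exact Finset.sum_eq_zero fun e _ => h7 e
  -- As `w` is skew, the antisymmetrised coefficients of `h5` give a nonzero multiple of the wanted
  -- sum.
  have h6 : ∑ i, ∑ j, (threeAct b c d j i : ℝ) * w a i j =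
      -∑ i, ∑ j, (threeAct b c d i j : ℝ) * w a i j := by
    rw [Finset.sum_comm, ← Finset.sum_neg_distrib]
    refine Finset.sum_congr rfl fun i _ => ?_
    rw [← Finset.sum_neg_distrib]
    refine Finset.sum_congr rfl fun j _ => ?_
    rw [hskew a j i]
    ring
  push_cast at h5
  simp only [mul_sub, sub_mul, Finset.sum_sub_distrib, mul_assoc, ← Finset.mul_sum] at h5
  linarith

end

/-! ### Surjectivity of the infinitesimal action of GL(7) on three-forms -/

section

variable (c : Fin 7 → Fin 7 → Fin 7 → ℝ)

/-- The contraction of a three-form with the standard three-form. -/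
def contractFano (i j : Fin 7) : ℝ :=
  c j (i + 1) (i + 3) + c j (i + 2) (i + 6) + c j (i + 4) (i + 5)

/-- The matrix whose infinitesimal action on the standard three-form is a given three-form. -/
def sectionMatrix (i j : Fin 7) : ℝ :=
  (1 / 3) * contractFano c i j + (1 / 6) * contractFano c j i -
    if i = j then (1 / 18) * ∑ m, contractFano c m m else 0

-- For a matrix `A`, the contraction of `A · φ` with `φ` is `2A` if `A` is symmetric and traceless,
-- `9A` if `A` is scalar, and `6A` on the seven-dimensional skew summand, while `g₂` acts by zero.
-- The inverse factors are `1/2 = 1/3 + 1/6` on the symmetric part and `1/6 = 1/3 - 1/6` on the skew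
-- part; the trace term corrects `1/2` to `1/2 - 7/18 = 1/9` on scalars. It is enough to treat
-- components with first index `0`.
set_option maxHeartbeats 4000000 in
theorem sectionMatrix_third (h1 : ∀ i j k, c j i k = - c i j k) (h2 : ∀ i j k, c i k j = - c i j k)
    (k l : Fin 7) :
    sectionMatrix c (fanoThird k l) 0 * fano (fanoThird k l) k l +
    sectionMatrix c (fanoThird l 0) k * fano (fanoThird l 0) l 0 +
    sectionMatrix c (fanoThird 0 k) l * fano (fanoThird 0 k) 0 k = c 0 k l := by
  have h0 : ∀ i k, c i i k = 0 := fun i k => by linarith [h1 i i k]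
  have h0' : ∀ i k, c i k k = 0 := fun i k => by linarith [h2 i k k]
  have h0'' : ∀ i k, c i k i = 0 := fun i k => by rw [h2, h0, neg_zero]
  -- The order conditions orient the rewriting: `simp` sorts the indices and then stops.
  have s1 : ∀ i j k, i < j → c j i k = - c i j k := fun i j k _ => h1 i j k
  have s2 : ∀ i j k, j < k → c i k j = - c i j k := fun i j k _ => h2 i j k
  have n1 : (-1 : Fin 7) = 6 := rfl
  have n2 : (-2 : Fin 7) = 5 := rfl
  have n3 : (-3 : Fin 7) = 4 := rfl
  have n4 : (-4 : Fin 7) = 3 := rfl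
  have n5 : (-5 : Fin 7) = 2 := rfl
  have n6 : (-6 : Fin 7) = 1 := rfl
  fin_cases k <;> fin_cases l <;>
  (simp [sectionMatrix, contractFano, fanoThird, fano, Fin.sum_univ_seven, n1, n2, n3, n4, n5, n6,
    h0, h0', h0'', s1, s2]) <;> (try ring)

end

section

variable (c : Fin 7 → Fin 7 → Fin 7 → ℝ)

theorem fanoThird_add_right (k l p : Fin 7) : fanoThird (k + p) (l + p) = fanoThird k l + p := by
  revert k l p; decide +kernel

theorem fano_cyclic (i j k : Fin 7) : fano i j k = fano j k i := by
  revert i j k; decide +kernel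

theorem contractFano_add_right (p i j : Fin 7) :
    contractFano (fun i j k => c (i + p) (j + p) (k + p)) i j = contractFano c (i + p) (j + p) := by
  simp only [contractFano, add_right_comm]

theorem sectionMatrix_add_right (p i j : Fin 7) :
    sectionMatrix (fun i j k => c (i + p) (j + p) (k + p)) i j =
      sectionMatrix c (i + p) (j + p) := by
  simp only [sectionMatrix, contractFano_add_right, add_left_inj]
  rw [← Equiv.sum_comp (Equiv.addRight p) (fun m => contractFano c m m)]
  rfl

theorem sum_mul_fano (f : Fin 7 → ℝ) (k l : Fin 7) :
    ∑ m, f m * fano m k l = f (fanoThird k l) * fano (fanoThird k l) k l := by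
  rw [Finset.sum_eq_single (fanoThird k l) (fun m _ hm => ?_) (by simp)]
  rw [fano_eq_ite, if_neg hm, Int.cast_zero, mul_zero]

/-- The infinitesimal action of `sectionMatrix c` on the standard three-form is `c`. -/
theorem sectionMatrix_act (h1 : ∀ i j k, c j i k = - c i j k) (h2 : ∀ i j k, c i k j = - c i j k)
    (j k l : Fin 7) :
    ∑ m, sectionMatrix c m j * fano m k l + ∑ m, sectionMatrix c m k * fano j m l +
      ∑ m, sectionMatrix c m l * fano j k m = c j k l := by
  have h3 : ∀ m, fano j m l = fano m l j := fun m => fano_cyclic _ _ _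
  have h4 : ∀ m, fano j k m = fano m j k := fun m => (fano_cyclic _ _ _).symm
  have := sectionMatrix_third (fun a b d => c (a + j) (b + j) (d + j)) (fun a b d => h1 _ _ _)
    (fun a b d => h2 _ _ _) (k - j) (l - j)
  simp only [sectionMatrix_add_right, zero_add, sub_add_cancel] at this
  rw [← fanoThird_add_right, ← fanoThird_add_right, ← fanoThird_add_right,
    ← fano_add_right _ _ _ j, ← fano_add_right (fanoThird (l - j) 0) _ _ j,
    ← fano_add_right (fanoThird 0 (k - j)) _ _ j, ← fanoThird_add_right, ← fanoThird_add_right,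
    ← fanoThird_add_right] at this
  simp only [zero_add, sub_add_cancel] at this
  simp only [h3, h4, sum_mul_fano]
  exact this

end

/-! ### Components of the standard forms in the standard basis -/

/-- The standard basis of `R7`. -/
def basis7 (i : Fin 7) : R7 := Pi.single i 1

theorem basis7_apply (i j : Fin 7) : basis7 i j = if j = i then 1 else 0 := by
  simp [basis7, Pi.single_apply]

theorem coord7_basis7 (i j : Fin 7) : coord7 i (basis7 j) = if i = j then 1 else 0 :=
  basis7_apply j i

theorem sum_smul_basis7 (x : R7) : ∑ i, x i • basis7 i = x := by
  ext j
  simp [basis7_apply]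

theorem form_ext_basis7 {n : ℕ} {η η' : R7 [⋀^Fin n]→L[ℝ] ℝ}
    (h : ∀ r : Fin n → Fin 7, η (fun i => basis7 (r i)) = η' (fun i => basis7 (r i))) : η = η' := by
  apply ContinuousAlternatingMap.toAlternatingMap_injective
  refine Module.Basis.ext_alternating (Pi.basisFun ℝ (Fin 7)) fun r _ => ?_
  simpa [basis7] using h r

theorem sum_fano_mul (T : Fin 7 → Fin 7 → Fin 7 → ℝ) :
    ∑ i, ∑ j, ∑ k, (fano i j k : ℝ) * T i j k =
      ∑ i, (T i (i + 1) (i + 3) - T i (i + 3) (i + 1) + (T i (i + 2) (i + 6) -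
        T i (i + 6) (i + 2)) + (T i (i + 4) (i + 5) - T i (i + 5) (i + 4))) := by
  refine Finset.sum_congr rfl fun i _ => ?_
  rw [← Equiv.sum_comp (Equiv.addRight i)]
  have h : ∀ s, ∑ k, (fano i (Equiv.addRight i s) k : ℝ) * T i (Equiv.addRight i s) k =
      ∑ t, (fano 0 s t : ℝ) * T i (s + i) (t + i) := by
    intro s
    rw [← Equiv.sum_comp (Equiv.addRight i)]
    refine Finset.sum_congr rfl fun t _ => ?_
    simp only [Equiv.coe_addRight]
    rw [← fano_add_right 0 s t i, zero_add]
  simp only [h]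
  simp [Fin.sum_univ_seven, fano, add_comm]
  ring

theorem stdThreeForm_eq_sum (x y z : R7) :
    stdThreeForm ![x, y, z] = ∑ i, ∑ j, ∑ k, (fano i j k : ℝ) * (x i * y j * z k) := by
  rw [sum_fano_mul]
  have := congrArg (fun η => η ![y, z]) (insertVec_stdThreeForm x)
  simp only [insertVec_apply] at this
  refine this.trans ?_
  rw [ContinuousAlternatingMap.sum_apply]
  refine Finset.sum_congr rfl fun i _ => ?_
  simp [detForm_two_apply, coord7_apply]
  ring

theorem stdThreeForm_basis7 (a b c : Fin 7) :
    stdThreeForm ![basis7 a, basis7 b, basis7 c] = fano a b c := by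
  simp [stdThreeForm_eq_sum, basis7_apply]

/-- The expansion of a determinant of order four. -/
def detFour {R : Type*} [CommRing R] (M : Fin 4 → Fin 4 → R) : R :=
  let m := fun i j k l => M 2 i * M 3 j * (M 0 k * M 1 l - M 0 l * M 1 k)
  m 2 3 0 1 - m 3 2 0 1 - m 1 3 0 2 + m 3 1 0 2 + m 1 2 0 3 - m 2 1 0 3 + m 0 3 1 2 - m 3 0 1 2
    - m 0 2 1 3 + m 2 0 1 3 + m 0 1 2 3 - m 1 0 2 3

theorem det_eq_detFour (M : Matrix (Fin 4) (Fin 4) ℝ) : M.det = detFour M := by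
  simp [Matrix.det_succ_row_zero, Fin.sum_univ_succ, Fin.succAbove, detFour]
  ring

set_option maxRecDepth 100000 in
theorem sum_detFour_zero : ∀ b c d : Fin 7,
    ∑ i, detFour (fun p q => if (![i + 2, i + 4, i + 5, i + 6] : Fin 4 → Fin 7) p =
      (![0, b, c, d] : Fin 4 → Fin 7) q then (1 : ℤ) else 0) = fanoQuad 0 b c d := by
  decide +kernel

theorem sum_detFour (a b c d : Fin 7) :
    ∑ i, detFour (fun p q => if (![i + 2, i + 4, i + 5, i + 6] : Fin 4 → Fin 7) p =
      (![a, b, c, d] : Fin 4 → Fin 7) q then (1 : ℤ) else 0) = fanoQuad a b c d := by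
  rw [← fanoQuad_add_right a b c d (-a), ← sub_eq_add_neg, ← sub_eq_add_neg, ← sub_eq_add_neg,
    ← sub_eq_add_neg, sub_self, ← sum_detFour_zero, ← Equiv.sum_comp (Equiv.addRight a)]
  refine Finset.sum_congr rfl fun i _ => ?_
  congr 1
  ext p q
  have h : (![i + a + 2, i + a + 4, i + a + 5, i + a + 6] : Fin 4 → Fin 7) p =
      (![i + 2, i + 4, i + 5, i + 6] : Fin 4 → Fin 7) p + a := by
    fin_cases p <;> simp [add_right_comm]
  have h' : (![a, b, c, d] : Fin 4 → Fin 7) q =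
      (![0, b - a, c - a, d - a] : Fin 4 → Fin 7) q + a := by
    fin_cases q <;> simp
  refine if_congr ?_ rfl rfl
  simp only [Equiv.coe_addRight]
  rw [h, h', add_left_inj]

theorem detFour_intCast (M : Fin 4 → Fin 4 → ℤ) :
    ((detFour M : ℤ) : ℝ) = detFour fun p q => (M p q : ℝ) := by
  simp only [detFour]
  push_cast
  rfl

/-- Together with the definition of `fanoQuad` this is the contraction identity `φ_{abe} φ_{ecd} =
δ_{ac} δ_{bd} - δ_{ad} δ_{bc} + ψ_{abcd}`. -/
theorem stdFourForm_basis7 (a b c d : Fin 7) :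
    stdFourForm ![basis7 a, basis7 b, basis7 c, basis7 d] = fanoQuad a b c d := by
  rw [← sum_detFour, stdFourForm, ContinuousAlternatingMap.sum_apply, Int.cast_sum]
  refine Finset.sum_congr rfl fun i _ => ?_
  rw [detForm_apply, det_eq_detFour, detFour_intCast]
  congr 1
  ext p q
  have h : (![coord7 (i + 2), coord7 (i + 4), coord7 (i + 5), coord7 (i + 6)] :
      Fin 4 → R7 →L[ℝ] ℝ) p = coord7 ((![i + 2, i + 4, i + 5, i + 6] : Fin 4 → Fin 7) p) := by
    fin_cases p <;> rfl
  have h' : (![basis7 a, basis7 b, basis7 c, basis7 d] : Fin 4 → R7) q =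
      basis7 ((![a, b, c, d] : Fin 4 → Fin 7) q) := by
    fin_cases q <;> rfl
  rw [Matrix.of_apply, h, h', coord7_basis7]
  simp

/-! ### The Hodge dual of the standard three-form -/

/-- Contraction of a seven-form with three vectors. -/
def insertThree (x y z : R7) (η : R7 [⋀^Fin 7]→L[ℝ] ℝ) : R7 [⋀^Fin 4]→L[ℝ] ℝ :=
  insertVec z (insertVec y (insertVec x η))

theorem insertThree_apply_cons (x y z : R7) (η : R7 [⋀^Fin 7]→L[ℝ] ℝ) (w : Fin 4 → R7) :
    insertThree x y z η w = η (Fin.cons x (Fin.cons y (Fin.cons z w))) := rfl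

theorem insertThree_apply (x y z : R7) (η : R7 [⋀^Fin 7]→L[ℝ] ℝ) (w : Fin 4 → R7) :
    insertThree x y z η w = η (Fin.append ![x, y, z] w) := by
  show η (Fin.cons x (Fin.cons y (Fin.cons z w))) = _
  congr 1
  ext k : 1
  fin_cases k <;> rfl

theorem insertVec_insertVec_swap {V : Type*} [AddCommGroup V] [Module ℝ V] [TopologicalSpace V]
    {n : ℕ} (x y : V) (η : V [⋀^Fin (n + 2)]→L[ℝ] ℝ) :
    insertVec x (insertVec y η) = - insertVec y (insertVec x η) := by
  ext w
  show η (Fin.cons y (Fin.cons x w)) = - η (Fin.cons x (Fin.cons y w))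
  refine Eq.trans ?_ (η.toAlternatingMap.map_swap (Fin.cons x (Fin.cons y w)) (i := 0) (j := 1)
    (by simp))
  refine congrArg η ?_
  ext k : 1
  refine Fin.cases ?_ (fun k => Fin.cases ?_ (fun k => ?_) k) k
  · simp
  · simp
  · rw [Function.comp_apply, Equiv.swap_apply_of_ne_of_ne (Fin.succ_ne_zero _)
      (by simp [Fin.ext_iff])]
    rfl

theorem insertVec_neg {V : Type*} [AddCommGroup V] [Module ℝ V] [TopologicalSpace V]
    [IsTopologicalAddGroup V] {n : ℕ} (x : V) (η : V [⋀^Fin (n + 1)]→L[ℝ] ℝ) :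
    insertVec x (-η) = - insertVec x η := rfl

theorem insertThree_swap_left (x y z : R7) (η : R7 [⋀^Fin 7]→L[ℝ] ℝ) :
    insertThree y x z η = - insertThree x y z η := by
  rw [insertThree, insertThree, insertVec_insertVec_swap x y, insertVec_neg]

theorem insertThree_swap_right (x y z : R7) (η : R7 [⋀^Fin 7]→L[ℝ] ℝ) :
    insertThree x z y η = - insertThree x y z η :=
  insertVec_insertVec_swap _ _ _

theorem insertVec_sum_smul {V : Type*} [AddCommGroup V] [Module ℝ V] [TopologicalSpace V]
    {n : ℕ} {ι : Type*} (s : Finset ι) (c : ι → ℝ) (x : ι → V) (η : V [⋀^Fin (n + 1)]→L[ℝ] ℝ) :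
    insertVec (∑ i ∈ s, c i • x i) η = ∑ i ∈ s, c i • insertVec (x i) η := by
  rw [insertVec_sum_left]
  exact Finset.sum_congr rfl fun i _ => insertVec_smul_left _ _ _

theorem leviCivita_line (l : Fin 7) :
    leviCivita ![l, l + 1, l + 3, l + 2, l + 4, l + 5, l + 6] = -1 := by
  revert l; decide +kernel

/-- Listing a line and then its complement is an odd permutation, and `stdVolume` carries a minus
sign; the two signs cancel. -/
theorem insertThree_stdVolume (l : Fin 7) :
    insertThree (basis7 l) (basis7 (l + 1)) (basis7 (l + 3)) stdVolume =
      detForm ![coord7 (l + 2), coord7 (l + 4), coord7 (l + 5), coord7 (l + 6)] := by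
  have h : stdVolume = detForm (Fin.cons (coord7 l) (Fin.cons (coord7 (l + 1))
      (Fin.cons (coord7 (l + 3))
        ![coord7 (l + 2), coord7 (l + 4), coord7 (l + 5), coord7 (l + 6)]))) := by
    have := detForm_comp_eq_leviCivita coord7 ![l, l + 1, l + 3, l + 2, l + 4, l + 5, l + 6]
    rw [leviCivita_line] at this
    rw [stdVolume, show -detForm coord7 = ((-1 : ℤ) : ℝ) • detForm coord7 by ext; simp, ← this]
    congr 1
    ext k : 1
    fin_cases k <;> rfl
  have hne : ∀ s t : Fin 7, s ≠ t → coord7 (l + s) (basis7 (l + t)) = 0 := fun s t hst => by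
    rw [coord7_basis7, if_neg fun h => hst (add_left_cancel h)]
  have hne0 : ∀ s : Fin 7, s ≠ 0 → coord7 (l + s) (basis7 l) = 0 := fun s hs => by
    simpa using hne s 0 hs
  ext w
  rw [insertThree_apply_cons, h, detForm_cons_cons, detForm_cons_cons, detForm_cons_cons]
  · simp [coord7_basis7]
  · intro k
    fin_cases k <;> exact hne _ _ (by decide)
  · intro k
    fin_cases k <;> exact hne _ _ (by decide)
  · intro k
    fin_cases k <;> exact hne0 _ (by decide)

theorem sum_fano_insertThree (w : Fin 4 → R7) :
    ∑ i, ∑ j, ∑ k, (fano i j k : ℝ) * insertThree (basis7 i) (basis7 j) (basis7 k) stdVolume w =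
      6 * stdFourForm w := by
  obtain ⟨T, hT⟩ : ∃ T : Fin 7 → Fin 7 → Fin 7 → ℝ,
      ∀ i j k, insertThree (basis7 i) (basis7 j) (basis7 k) stdVolume w = T i j k :=
    ⟨_, fun _ _ _ => rfl⟩
  have h1 : ∀ i j k, T i k j = - T i j k := fun i j k => by
    rw [← hT, insertThree_swap_right, ContinuousAlternatingMap.neg_apply, hT]
  have h2 : ∀ i j k, T j i k = - T i j k := fun i j k => by
    rw [← hT, insertThree_swap_left, ContinuousAlternatingMap.neg_apply, hT]
  simp only [hT]
  rw [sum_fano_mul]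
  -- Every line is met from each of its three points, with two orderings each. Cyclic permutation
  -- brings the first point of the line to the front; this point is `i`, `i - 1 = i + 6` or `i - 3 =
  -- i + 4`.
  have h3 : ∀ i, T i (i + 1) (i + 3) - T i (i + 3) (i + 1) + (T i (i + 2) (i + 6) -
        T i (i + 6) (i + 2)) + (T i (i + 4) (i + 5) - T i (i + 5) (i + 4)) =
      2 * T i (i + 1) (i + 3) + 2 * T (i + 6) (i + 6 + 1) (i + 6 + 3) +
        2 * T (i + 4) (i + 4 + 1) (i + 4 + 3) := by
    intro i
    simp only [add_assoc]
    simp only [show (6 + 1 : Fin 7) = 0 from rfl, show (6 + 3 : Fin 7) = 2 from rfl,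
      show (4 + 1 : Fin 7) = 5 from rfl, show (4 + 3 : Fin 7) = 0 from rfl, add_zero]
    rw [h1 i (i + 1) (i + 3), h1 i (i + 2) (i + 6), h1 i (i + 4) (i + 5),
      h2 i (i + 6) (i + 2), h1 (i + 4) i (i + 5), h2 i (i + 4) (i + 5), h1 i (i + 2) (i + 6)]
    ring
  simp only [h3, Finset.sum_add_distrib]
  have h4 := Equiv.sum_comp (Equiv.addRight (6 : Fin 7)) fun i => 2 * T i (i + 1) (i + 3)
  have h5 := Equiv.sum_comp (Equiv.addRight (4 : Fin 7)) fun i => 2 * T i (i + 1) (i + 3)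
  simp only [Equiv.coe_addRight] at h4 h5
  rw [h4, h5, ← Finset.mul_sum, stdFourForm, ContinuousAlternatingMap.sum_apply]
  have h6 : ∀ l, T l (l + 1) (l + 3) =
      detForm ![coord7 (l + 2), coord7 (l + 4), coord7 (l + 5), coord7 (l + 6)] w := fun l => by
    rw [← hT, insertThree_stdVolume]
  simp only [h6]
  ring

/-- For a square matrix, orthonormal columns imply orthonormal rows. -/
theorem sum_smul_orthonormal {e : Fin 7 → R7} (he : IsOrthonormalFor stdMetric e) (i : Fin 7) :
    ∑ a, e a i • e a = basis7 i := by
  set A : Matrix (Fin 7) (Fin 7) ℝ := Matrix.of fun i j => e j i with hA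
  have h1 : A.transpose * A = 1 := by
    ext i j
    have := he i j
    rw [stdMetric_apply] at this
    simpa [Matrix.mul_apply, hA, Matrix.one_apply] using this
  have h2 := mul_eq_one_comm.1 h1
  ext j
  have := congrFun (congrFun h2 i) j
  simp only [Matrix.mul_apply, hA, Matrix.transpose_apply, Matrix.of_apply, Matrix.one_apply] at this
  rw [Finset.sum_apply, basis7_apply]
  simp only [Pi.smul_apply, smul_eq_mul, this, eq_comm]

/-- A contraction over an orthonormal basis does not depend on the basis, so the condition need only
be known in the standard one. -/
theorem isHodgeDual_of_sum_insertThree (η : R7 [⋀^Fin 7]→L[ℝ] ℝ) (ψ : R7 [⋀^Fin 4]→L[ℝ] ℝ)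
    (h : ∀ w, ∑ i, ∑ j, ∑ k, (fano i j k : ℝ) *
      insertThree (basis7 i) (basis7 j) (basis7 k) η w = 6 * ψ w) :
    IsHodgeDual stdMetric η stdThreeForm ψ := by
  intro e he w
  have hb := sum_smul_orthonormal he
  have hz : ∀ (x y : R7) (k : Fin 7), ∑ c, e c k * insertThree x y (e c) η w =
      insertThree x y (basis7 k) η w := by
    intro x y k
    rw [← hb k, insertThree, insertVec_sum_smul, ContinuousAlternatingMap.sum_apply]
    rfl
  have hy : ∀ (x z : R7) (k : Fin 7), ∑ c, e c k * insertThree x (e c) z η w =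
      insertThree x (basis7 k) z η w := by
    intro x z k
    simp only [insertThree_swap_right x z, ContinuousAlternatingMap.neg_apply, mul_neg,
      Finset.sum_neg_distrib, hz]
  have hx : ∀ (y z : R7) (k : Fin 7), ∑ c, e c k * insertThree (e c) y z η w =
      insertThree (basis7 k) y z η w := by
    intro y z k
    simp only [insertThree_swap_left y, ContinuousAlternatingMap.neg_apply, mul_neg,
      Finset.sum_neg_distrib, hy]
  have key : ∑ a, ∑ b, ∑ c, stdThreeForm ![e a, e b, e c] *
      η (Fin.append ![e a, e b, e c] w) = 6 * ψ w := by
    rw [← h w]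
    have h1 : ∀ i j k, (fano i j k : ℝ) *
        insertThree (basis7 i) (basis7 j) (basis7 k) η w =
        ∑ a, ∑ b, ∑ c, (fano i j k : ℝ) * (e a i * e b j * e c k) *
          insertThree (e a) (e b) (e c) η w := by
      intro i j k
      rw [← hx]
      simp only [← hy]
      simp only [← hz]
      simp only [Finset.mul_sum]
      refine Finset.sum_congr rfl fun a _ => Finset.sum_congr rfl fun b _ =>
        Finset.sum_congr rfl fun c _ => ?_
      ring
    simp only [h1, stdThreeForm_eq_sum, Finset.sum_mul, ← insertThree_apply]
    have h3 : ∀ f : Fin 7 → Fin 7 → Fin 7 → ℝ, ∑ i, ∑ j, ∑ k, f i j k =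
        ∑ p : Fin 7 × Fin 7 × Fin 7, f p.1 p.2.1 p.2.2 := fun f => by
      simp only [Fintype.sum_prod_type]
    simp only [h3]
    exact Finset.sum_comm (s := (Finset.univ : Finset (Fin 7 × Fin 7 × Fin 7)))
      (t := (Finset.univ : Finset (Fin 7 × Fin 7 × Fin 7)))
      (f := fun q p => (fano p.1 p.2.1 p.2.2 : ℝ) * (e q.1 p.1 * e q.2.1 p.2.1 * e q.2.2 p.2.2) *
        insertThree (e q.1) (e q.2.1) (e q.2.2) η w)
  rw [key]
  ring

theorem isHodgeDual_std : IsHodgeDual stdMetric stdVolume stdThreeForm stdFourForm :=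
  isHodgeDual_of_sum_insertThree _ _ sum_fano_insertThree

/-! ### A right inverse of the infinitesimal action -/

/-- The components of a three-form, as continuous functionals. -/
def component (i j k : Fin 7) : (R7 [⋀^Fin 3]→L[ℝ] ℝ) →L[ℝ] ℝ :=
  ContinuousAlternatingMap.apply ℝ R7 ℝ ![basis7 i, basis7 j, basis7 k]

theorem component_apply (i j k : Fin 7) (χ : R7 [⋀^Fin 3]→L[ℝ] ℝ) :
    component i j k χ = χ ![basis7 i, basis7 j, basis7 k] := rfl

/-- A linear right inverse of the infinitesimal action of endomorphisms on `stdThreeForm`. -/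
def actionSection : (R7 [⋀^Fin 3]→L[ℝ] ℝ) →L[ℝ] R7 →L[ℝ] R7 :=
  ∑ i, ∑ j, ((1 / 3 : ℝ) • (component j (i + 1) (i + 3) + component j (i + 2) (i + 6) +
      component j (i + 4) (i + 5)) +
    (1 / 6 : ℝ) • (component i (j + 1) (j + 3) + component i (j + 2) (j + 6) +
      component i (j + 4) (j + 5)) -
    if i = j then (1 / 18 : ℝ) • ∑ m, (component m (m + 1) (m + 3) + component m (m + 2) (m + 6) +
      component m (m + 4) (m + 5)) else 0).smulRight ((coord7 j).smulRight (basis7 i))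

theorem actionSection_basis7 (χ : R7 [⋀^Fin 3]→L[ℝ] ℝ) (j m : Fin 7) :
    actionSection χ (basis7 j) m = sectionMatrix (fun i j k => component i j k χ) m j := by
  have h : actionSection χ = ∑ i, ∑ j, sectionMatrix (fun i j k => component i j k χ) i j •
      (coord7 j).smulRight (basis7 i) := by
    rw [actionSection]
    simp only [sum_apply, ContinuousLinearMap.smulRight_apply]
    refine Finset.sum_congr rfl fun i _ => Finset.sum_congr rfl fun j _ => ?_
    congr 1
    rw [sectionMatrix, contractFano, contractFano]
    split_ifs <;> simp [contractFano] <;> ring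
  rw [h]
  simp [coord7_basis7, basis7_apply]

theorem stdThreeForm_basis7_right (x : R7) (k l : Fin 7) :
    stdThreeForm ![x, basis7 k, basis7 l] = ∑ m, x m * fano m k l := by
  simp [stdThreeForm_eq_sum, basis7_apply, mul_comm]

theorem stdThreeForm_basis7_mid (x : R7) (k l : Fin 7) :
    stdThreeForm ![basis7 k, x, basis7 l] = ∑ m, x m * fano k m l := by
  simp [stdThreeForm_eq_sum, basis7_apply, mul_comm]

theorem stdThreeForm_basis7_left (x : R7) (k l : Fin 7) :
    stdThreeForm ![basis7 k, basis7 l, x] = ∑ m, x m * fano k l m := by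
  simp [stdThreeForm_eq_sum, basis7_apply, mul_comm]

theorem actionSection_act (χ : R7 [⋀^Fin 3]→L[ℝ] ℝ) (j k l : Fin 7) :
    stdThreeForm ![actionSection χ (basis7 j), basis7 k, basis7 l] +
      stdThreeForm ![basis7 j, actionSection χ (basis7 k), basis7 l] +
      stdThreeForm ![basis7 j, basis7 k, actionSection χ (basis7 l)] =
      χ ![basis7 j, basis7 k, basis7 l] := by
  have hswap1 : ∀ i j k, component j i k χ = - component i j k χ := fun i j k =>
    form_three_swap_left _ _ _ _
  have hswap2 : ∀ i j k, component i k j χ = - component i j k χ := fun i j k =>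
    form_three_swap_right _ _ _ _
  rw [stdThreeForm_basis7_right, stdThreeForm_basis7_mid, stdThreeForm_basis7_left]
  simp only [actionSection_basis7]
  rw [sectionMatrix_act _ hswap1 hswap2, component_apply]

/-! ### Smooth families of forms -/

section FormFamilies

variable {V W : Type*} [NormedAddCommGroup V] [NormedSpace ℝ V]
  [NormedAddCommGroup W] [NormedSpace ℝ W]

/-- The forms on the right are fixed and only the coefficients depend on `η`. Hence a family of
forms is smooth as soon as its values on fixed vectors are. The sum runs over all tuples, which
explains the factor `1 / n!`. -/
theorem form_eq_sum_basis {ι : Type*} [Fintype ι] [FiniteDimensional ℝ V] {n : ℕ}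
    (b : Module.Basis ι ℝ V) (η : V [⋀^Fin n]→L[ℝ] ℝ) :
    η = ∑ r : Fin n → ι, η (fun i => b (r i)) • ((n.factorial : ℝ)⁻¹ •
      detForm fun i => LinearMap.toContinuousLinearMap (b.coord (r i))) := by
  classical
  ext v
  have h1 : ∀ v : Fin n → V, η v = ∑ r : Fin n → ι,
      (∏ i, b.coord (r i) (v i)) * η fun i => b (r i) := by
    intro v
    have h2 : v = fun i => ∑ j, b.coord j (v i) • b j := by
      ext1 i
      simp [b.sum_repr]
    conv_lhs => rw [h2]
    have h3 := η.toMultilinearMap.map_sum fun i j => b.coord j (v i) • b j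
    refine h3.trans (Finset.sum_congr rfl fun r _ => ?_)
    exact η.toMultilinearMap.map_smul_univ _ _
  have h4 : ∀ ρ : Equiv.Perm (Fin n), ((Equiv.Perm.sign ρ : ℤ) : ℝ) * η (fun i => v (ρ i)) = η v := by
    intro ρ
    have := η.toAlternatingMap.map_perm v ρ
    rw [Units.smul_def, zsmul_eq_mul] at this
    refine (congrArg _ this).trans ?_
    rw [← mul_assoc]
    have h5 : ((Equiv.Perm.sign ρ : ℤ) : ℝ) * ((Equiv.Perm.sign ρ : ℤ) : ℝ) = 1 := by
      rcases Int.units_eq_one_or (Equiv.Perm.sign ρ) with h | h <;> simp [h]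
    exact (congrArg (· * _) h5).trans (one_mul _)
  have h6 : (n.factorial : ℝ) * η v = ∑ ρ : Equiv.Perm (Fin n),
      ((Equiv.Perm.sign ρ : ℤ) : ℝ) * η (fun i => v (ρ i)) := by
    simp only [h4, Finset.sum_const, Finset.card_univ, Fintype.card_perm, Fintype.card_fin,
      nsmul_eq_mul]
  have h7 : η v = (n.factorial : ℝ)⁻¹ * ∑ ρ : Equiv.Perm (Fin n),
      ((Equiv.Perm.sign ρ : ℤ) : ℝ) * η (fun i => v (ρ i)) := by
    rw [← h6, inv_mul_cancel_left₀]
    exact_mod_cast n.factorial_ne_zero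
  rw [h7, ContinuousAlternatingMap.sum_apply]
  simp only [ContinuousAlternatingMap.smul_apply, smul_eq_mul, detForm_apply_eq_sum]
  rw [Finset.mul_sum]
  have h8 : ∀ ρ : Equiv.Perm (Fin n), (n.factorial : ℝ)⁻¹ * (((Equiv.Perm.sign ρ : ℤ) : ℝ) *
      η (fun i => v (ρ i))) = ∑ r : Fin n → ι, η (fun i => b (r i)) * ((n.factorial : ℝ)⁻¹ *
        (((Equiv.Perm.sign ρ : ℤ) : ℝ) * ∏ i, b.coord (r i) (v (ρ i)))) := by
    intro ρ
    rw [h1 fun i => v (ρ i), Finset.mul_sum, Finset.mul_sum]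
    refine Finset.sum_congr rfl fun r _ => ?_
    ring
  simp only [h8]
  rw [Finset.sum_comm]
  refine Finset.sum_congr rfl fun r _ => ?_
  rw [Finset.mul_sum, Finset.mul_sum]
  rfl

theorem contDiffAt_form_iff [FiniteDimensional ℝ V] {n : ℕ} {k : WithTop ℕ∞}
    {f : W → V [⋀^Fin n]→L[ℝ] ℝ} {x : W} :
    ContDiffAt ℝ k f x ↔ ∀ v : Fin n → V, ContDiffAt ℝ k (fun y => f y v) x := by
  refine ⟨fun h v => (ContinuousAlternatingMap.apply ℝ V ℝ v).contDiff.contDiffAt.comp x h,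
    fun h => ?_⟩
  have h1 : f = fun y => ∑ r : Fin n → Fin (Module.finrank ℝ V),
      f y (fun i => Module.finBasis ℝ V (r i)) • ((n.factorial : ℝ)⁻¹ •
      detForm fun i => LinearMap.toContinuousLinearMap ((Module.finBasis ℝ V).coord (r i))) :=
    funext fun y => form_eq_sum_basis _ _
  rw [h1]
  exact ContDiffAt.sum fun r _ => (h _).smul contDiffAt_const

theorem contDiffAt_clm_iff [FiniteDimensional ℝ V] {k : WithTop ℕ∞}
    {U : Type*} [NormedAddCommGroup U] [NormedSpace ℝ U] {f : W → V →L[ℝ] U} {x : W} :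
    ContDiffAt ℝ k f x ↔ ∀ v, ContDiffAt ℝ k (fun y => f y v) x := by
  refine ⟨fun h v => h.clm_apply contDiffAt_const, fun h => ?_⟩
  have h1 : f = fun y => ∑ i, (LinearMap.toContinuousLinearMap
      ((Module.finBasis ℝ V).coord i)).smulRight (f y (Module.finBasis ℝ V i)) := by
    ext y v
    conv_lhs => rw [← (Module.finBasis ℝ V).sum_repr v, map_sum]
    simp only [map_smul, sum_apply]
    rfl
  rw [h1]
  refine ContDiffAt.sum fun i _ => ?_
  exact contDiffAt_const.smulRight (h _)

theorem ContDiffAt.form_apply {n : ℕ} {k : WithTop ℕ∞} [FiniteDimensional ℝ V]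
    {f : W → V [⋀^Fin n]→L[ℝ] ℝ} {g : Fin n → W → V} {x : W}
    (hf : ContDiffAt ℝ k f x) (hg : ∀ i, ContDiffAt ℝ k (g i) x) :
    ContDiffAt ℝ k (fun y => f y fun i => g i y) x := by
  set b := Module.finBasis ℝ V
  have h1 : (fun y => f y fun i => g i y) = fun y => ∑ r : Fin n → Fin (Module.finrank ℝ V),
      f y (fun i => b (r i)) • (((n.factorial : ℝ)⁻¹ •
      detForm fun i => LinearMap.toContinuousLinearMap (b.coord (r i))) fun i => g i y) := by
    ext y
    conv_lhs => rw [form_eq_sum_basis b (f y)]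
    simp
  rw [h1]
  refine ContDiffAt.sum fun r _ => (contDiffAt_form_iff.1 hf _).smul ?_
  simp only [ContinuousAlternatingMap.smul_apply, detForm_apply_eq_sum]
  refine ContDiffAt.const_smul _ (ContDiffAt.sum fun ρ _ => ?_)
  refine (contDiffAt_const (c := ((Equiv.Perm.sign ρ : ℤ) : ℝ))).mul ?_
  refine contDiffAt_prod fun i _ => ?_
  exact (ContinuousLinearMap.contDiff _).contDiffAt.comp x (hg _)

theorem ContDiffAt.form_pullback {U : Type*} [NormedAddCommGroup U] [NormedSpace ℝ U]
    [FiniteDimensional ℝ V] [FiniteDimensional ℝ U] {n : ℕ} {k : WithTop ℕ∞}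
    {f : W → V [⋀^Fin n]→L[ℝ] ℝ} {L : W → U →L[ℝ] V} {x : W}
    (hf : ContDiffAt ℝ k f x) (hL : ContDiffAt ℝ k L x) :
    ContDiffAt ℝ k (fun y => (f y).compContinuousLinearMap (L y)) x :=
  contDiffAt_form_iff.2 fun _ => hf.form_apply fun _ => hL.clm_apply contDiffAt_const

end FormFamilies

/-! ### Pullback of the structures defined by a three-form -/

section Pullback

variable {V W : Type*} [NormedAddCommGroup V] [NormedSpace ℝ V]
  [NormedAddCommGroup W] [NormedSpace ℝ W]

theorem wedgeTriple_compContinuousLinearMap (α β : W [⋀^Fin 2]→L[ℝ] ℝ) (φ : W [⋀^Fin 3]→L[ℝ] ℝ)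
    (L : V →L[ℝ] W) : (wedgeTriple α β φ).compContinuousLinearMap L =
      wedgeTriple (α.compContinuousLinearMap L) (β.compContinuousLinearMap L)
        (φ.compContinuousLinearMap L) := by
  refine (wedge_compContinuousLinearMap (wedge α β) φ L).trans ?_
  rw [wedge_compContinuousLinearMap]
  rfl

theorem IsMetricOfForm.pullback {φ : W [⋀^Fin 3]→L[ℝ] ℝ} {g : W →L[ℝ] W →L[ℝ] ℝ}
    {μ : W [⋀^Fin 7]→L[ℝ] ℝ} (h : IsMetricOfForm φ g μ) (L : V ≃L[ℝ] W) :
    IsMetricOfForm (φ.compContinuousLinearMap (L : V →L[ℝ] W))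
      (g.bilinearComp (L : V →L[ℝ] W) (L : V →L[ℝ] W))
      (μ.compContinuousLinearMap (L : V →L[ℝ] W)) where
  symm ξ η := h.symm _ _
  pos ξ hξ := h.pos _ (by simpa using hξ)
  volume e he := h.volume (fun i => L (e i)) he
  eq ξ η := by
    have h1 := h.eq (L ξ) (L η)
    change wedgeTriple _ _ _ = _ at h1
    change wedgeTriple _ _ _ = _
    rw [insertVec_compContinuousLinearMap, insertVec_compContinuousLinearMap,
      ← wedgeTriple_compContinuousLinearMap, ContinuousLinearEquiv.coe_coe, h1]
    rfl

theorem append_three {U : Type*} (x y z : U) (w : Fin 4 → U) :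
    (Fin.append ![x, y, z] w : Fin 7 → U) = ![x, y, z, w 0, w 1, w 2, w 3] := by
  ext1 k
  fin_cases k <;> rfl

theorem comp_append_three {U U' : Type*} (L : U → U') (x y z : U) (w : Fin 4 → U) :
    (L ∘ (Fin.append ![x, y, z] w : Fin 7 → U) : Fin 7 → U') =
      ![L x, L y, L z, L (w 0), L (w 1), L (w 2), L (w 3)] := by
  ext1 k
  fin_cases k <;> rfl

theorem IsHodgeDual.pullback {φ : W [⋀^Fin 3]→L[ℝ] ℝ} {g : W →L[ℝ] W →L[ℝ] ℝ}
    {μ : W [⋀^Fin 7]→L[ℝ] ℝ} {ψ : W [⋀^Fin 4]→L[ℝ] ℝ} (h : IsHodgeDual g μ φ ψ) (L : V ≃L[ℝ] W) :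
    IsHodgeDual (g.bilinearComp (L : V →L[ℝ] W) (L : V →L[ℝ] W))
      (μ.compContinuousLinearMap (L : V →L[ℝ] W)) (φ.compContinuousLinearMap (L : V →L[ℝ] W))
      (ψ.compContinuousLinearMap (L : V →L[ℝ] W)) := by
  intro e he w
  refine (h (fun i => L (e i)) he (fun i => L (w i))).trans ?_
  congr 1
  refine Finset.sum_congr rfl fun a _ => Finset.sum_congr rfl fun b _ =>
    Finset.sum_congr rfl fun c _ => ?_
  congr 1
  · refine congrArg φ ?_
    ext k : 1
    fin_cases k <;> rfl
  · exact (congrArg μ (append_three _ _ _ _)).trans (congrArg μ (comp_append_three L _ _ _ w)).symm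

/-- A linear isomorphism with `R7` adapted to a three-form. -/
def IsAdapted (φ : V [⋀^Fin 3]→L[ℝ] ℝ) (Θ : V ≃L[ℝ] R7) : Prop :=
  φ = stdThreeForm.compContinuousLinearMap (Θ : V →L[ℝ] R7)

open Classical in
/-- The metric of a three-form that is equivalent to the standard one. -/
def metricOf (φ : V [⋀^Fin 3]→L[ℝ] ℝ) : V →L[ℝ] V →L[ℝ] ℝ :=
  if h : ∃ Θ, IsAdapted φ Θ then
    stdMetric.bilinearComp (h.choose : V →L[ℝ] R7) (h.choose : V →L[ℝ] R7) else 0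

open Classical in
/-- The volume form of a three-form that is equivalent to the standard one. -/
def volOf (φ : V [⋀^Fin 3]→L[ℝ] ℝ) : V [⋀^Fin 7]→L[ℝ] ℝ :=
  if h : ∃ Θ, IsAdapted φ Θ then stdVolume.compContinuousLinearMap (h.choose : V →L[ℝ] R7) else 0

open Classical in
/-- The dual four-form of a three-form that is equivalent to the standard one. -/
def starOf (φ : V [⋀^Fin 3]→L[ℝ] ℝ) : V [⋀^Fin 4]→L[ℝ] ℝ :=
  if h : ∃ Θ, IsAdapted φ Θ then stdFourForm.compContinuousLinearMap (h.choose : V →L[ℝ] R7) else 0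

theorem detForm_sum_smul {U : Type*} [AddCommGroup U] [Module ℝ U] [TopologicalSpace U]
    {n : ℕ} (M : Matrix (Fin n) (Fin n) ℝ) (c : Fin n → U →L[ℝ] ℝ)
    (a : Fin n → U →L[ℝ] ℝ) (ha : ∀ i u, a i u = ∑ j, M i j * c j u) :
    detForm a = M.det • detForm c := by
  ext v
  rw [ContinuousAlternatingMap.smul_apply, detForm_apply, detForm_apply, smul_eq_mul,
    ← Matrix.det_mul]
  congr 1
  ext i j
  rw [Matrix.of_apply, ha, Matrix.mul_apply]
  rfl

theorem detForm_coord7_comp (L : R7 →L[ℝ] R7) :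
    (detForm coord7).compContinuousLinearMap L =
      (Matrix.of fun i j => L (basis7 j) i).det • detForm coord7 := by
  rw [detForm_compContinuousLinearMap]
  refine detForm_sum_smul _ _ _ fun i u => ?_
  conv_lhs => rw [← sum_smul_basis7 u]
  simp [coord7_apply, mul_comm]

/-- The three-form determines the product `g ⊗ μ`; a factor in the volume form is compensated by the
inverse factor in the metric. -/
theorem IsMetricOfForm.smul_eq {φ : V [⋀^Fin 3]→L[ℝ] ℝ} {g g' : V →L[ℝ] V →L[ℝ] ℝ}
    {μ μ' : V [⋀^Fin 7]→L[ℝ] ℝ} {d : ℝ} (h : IsMetricOfForm φ g μ) (h' : IsMetricOfForm φ g' μ')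
    {e : Fin 7 → V} (hμ' : μ' e = d * μ e) (he : μ e ≠ 0) (ξ η : V) :
    d * g' ξ η = g ξ η := by
  have h1 := (h.eq ξ η).symm.trans (h'.eq ξ η)
  have h2 : 6 * g ξ η * μ e = 6 * g' ξ η * μ' e := congrArg (fun f => f e) h1
  rw [hμ'] at h2
  have h3 : (d * g' ξ η - g ξ η) * μ e = 0 := by linarith
  rcases mul_eq_zero.1 h3 with h4 | h4
  · linarith
  · exact absurd h4 he

theorem stdVolume_eq_smul : stdVolume = (-1 : ℝ) • detForm coord7 := by
  rw [stdVolume]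
  ext
  simp

theorem compContinuousLinearMap_eq_smul {n : ℕ} {η ζ : V [⋀^Fin n]→L[ℝ] ℝ} {c d : ℝ}
    (h : η = c • ζ) {L : V →L[ℝ] V} (hL : ζ.compContinuousLinearMap L = d • ζ) :
    η.compContinuousLinearMap L = d • η := by
  rw [h, smul_comm, ← hL]
  rfl

theorem stdVolume_compContinuousLinearMap (L : R7 →L[ℝ] R7) :
    stdVolume.compContinuousLinearMap L =
      (Matrix.of fun i j => L (basis7 j) i).det • stdVolume :=
  compContinuousLinearMap_eq_smul stdVolume_eq_smul (detForm_coord7_comp L)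

theorem compContinuousLinearMap_eq_of_trans {n : ℕ} {η : W [⋀^Fin n]→L[ℝ] ℝ} {Θ Θ' : V ≃L[ℝ] W}
    (h : η.compContinuousLinearMap ((Θ.symm.trans Θ' : W ≃L[ℝ] W) : W →L[ℝ] W) = η) :
    η.compContinuousLinearMap (Θ' : V →L[ℝ] W) = η.compContinuousLinearMap (Θ : V →L[ℝ] W) := by
  conv_rhs => rw [← h]
  ext v
  simp [Function.comp_def]

theorem stdVolume_basis7 : stdVolume basis7 = -1 := by
  have h1 : (Matrix.of fun i j => coord7 i (basis7 j)) = (1 : Matrix (Fin 7) (Fin 7) ℝ) := by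
    ext i j
    simp [coord7_basis7, Matrix.one_apply]
  rw [stdVolume_eq_smul, ContinuousAlternatingMap.smul_apply, detForm_apply, h1, Matrix.det_one]
  simp

theorem IsMetricOfForm.automorphism {φ : V [⋀^Fin 3]→L[ℝ] ℝ} {g : V →L[ℝ] V →L[ℝ] ℝ}
    {μ : V [⋀^Fin 7]→L[ℝ] ℝ} {d : ℝ} (h : IsMetricOfForm φ g μ) {L : V ≃L[ℝ] V}
    (hL : φ.compContinuousLinearMap (L : V →L[ℝ] V) = φ)
    (hμ : μ.compContinuousLinearMap (L : V →L[ℝ] V) = d • μ) {e : Fin 7 → V} (he : μ e ≠ 0)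
    (ξ η : V) : d * g (L ξ) (L η) = g ξ η := by
  have h1 := h.pullback L
  rw [hL] at h1
  refine h.smul_eq h1 (e := e) ?_ he ξ η
  rw [hμ]
  rfl

/-- Taking determinants gives `d⁷ · d² = 1`, and the ninth power is injective on the reals. -/
theorem det_eq_one_of_smul_transpose_mul {A : Matrix (Fin 7) (Fin 7) ℝ}
    (h : A.det • (A.transpose * A) = 1) : A.det = 1 := by
  have h9 : A.det ^ 9 = 1 := by
    have := congrArg Matrix.det h
    rw [Matrix.det_smul, Matrix.det_mul, Matrix.det_transpose, Matrix.det_one,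
      Fintype.card_fin] at this
    linarith
  have h10 : A.det ^ 9 = 1 ^ 9 := by rw [h9, one_pow]
  exact (Odd.strictMono_pow (by decide : Odd 9)).injective h10

/-- An automorphism of the standard three-form is orthogonal. -/
theorem stdMetric_of_automorphism {L : R7 ≃L[ℝ] R7}
    (hL : stdThreeForm.compContinuousLinearMap (L : R7 →L[ℝ] R7) = stdThreeForm) :
    (∀ ξ η, stdMetric (L ξ) (L η) = stdMetric ξ η) ∧
      stdVolume.compContinuousLinearMap (L : R7 →L[ℝ] R7) = stdVolume := by
  set A : Matrix (Fin 7) (Fin 7) ℝ := Matrix.of fun i j => L (basis7 j) i with hA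
  have hvol : stdVolume.compContinuousLinearMap (L : R7 →L[ℝ] R7) = A.det • stdVolume :=
    stdVolume_compContinuousLinearMap _
  -- `L` preserves `φ`, hence `g ⊗ μ`, and it multiplies `μ` by `det A`. It remains to see that this
  -- determinant is `1`.
  have hg : ∀ ξ η, A.det * stdMetric (L ξ) (L η) = stdMetric ξ η :=
    isMetricOfForm_std.automorphism hL hvol (by rw [stdVolume_basis7]; norm_num)
  have hmat : A.det • (A.transpose * A) = 1 := by
    ext i j
    have := hg (basis7 i) (basis7 j)
    rw [stdMetric_apply, stdMetric_apply] at this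
    simp only [Matrix.smul_apply, Matrix.mul_apply, Matrix.transpose_apply, hA, Matrix.of_apply,
      smul_eq_mul, Matrix.one_apply] at this ⊢
    rw [this]
    simp [basis7_apply, eq_comm]
  have hd1 := det_eq_one_of_smul_transpose_mul hmat
  rw [hd1] at hg hvol
  exact ⟨fun ξ η => (one_mul _).symm.trans (hg ξ η), by rw [hvol, one_smul]⟩

theorem IsHodgeDual.unique {φ : V [⋀^Fin 3]→L[ℝ] ℝ} {g : V →L[ℝ] V →L[ℝ] ℝ}
    {μ : V [⋀^Fin 7]→L[ℝ] ℝ} {ψ ψ' : V [⋀^Fin 4]→L[ℝ] ℝ} (h : IsHodgeDual g μ φ ψ)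
    (h' : IsHodgeDual g μ φ ψ') {e : Fin 7 → V} (he : IsOrthonormalFor g e) : ψ = ψ' := by
  ext w
  rw [h e he w, h' e he w]

theorem isOrthonormalFor_basis7 : IsOrthonormalFor stdMetric basis7 := by
  intro i j
  rw [stdMetric_apply]
  simp [basis7_apply, eq_comm]

theorem stdFourForm_of_automorphism {L : R7 ≃L[ℝ] R7}
    (hL : stdThreeForm.compContinuousLinearMap (L : R7 →L[ℝ] R7) = stdThreeForm) :
    stdFourForm.compContinuousLinearMap (L : R7 →L[ℝ] R7) = stdFourForm := by
  have h := isHodgeDual_std.pullback L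
  have h1 : stdMetric.bilinearComp (L : R7 →L[ℝ] R7) (L : R7 →L[ℝ] R7) = stdMetric := by
    ext ξ η : 2
    exact (stdMetric_of_automorphism hL).1 ξ η
  rw [hL, (stdMetric_of_automorphism hL).2, h1] at h
  exact h.unique isHodgeDual_std isOrthonormalFor_basis7

theorem IsAdapted.automorphism {φ : V [⋀^Fin 3]→L[ℝ] ℝ} {Θ Θ' : V ≃L[ℝ] R7} (h : IsAdapted φ Θ)
    (h' : IsAdapted φ Θ') :
    stdThreeForm.compContinuousLinearMap ((Θ.symm.trans Θ' : R7 ≃L[ℝ] R7) : R7 →L[ℝ] R7) =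
      stdThreeForm := by
  have h1 := congrArg (fun f : V [⋀^Fin 3]→L[ℝ] ℝ =>
    f.compContinuousLinearMap (Θ.symm : R7 →L[ℝ] V)) (h'.symm.trans h)
  ext v
  have h2 := congrArg (fun f => f v) h1
  simpa [Function.comp_def] using h2

/-- Two adapted isomorphisms differ by an automorphism of the standard three-form, which is an
isometry; so the choice in `metricOf` is immaterial. The volume form and the dual form are treated
in the same way. -/
theorem IsAdapted.metricOf_eq {φ : V [⋀^Fin 3]→L[ℝ] ℝ} {Θ : V ≃L[ℝ] R7} (h : IsAdapted φ Θ) :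
    metricOf φ = stdMetric.bilinearComp (Θ : V →L[ℝ] R7) (Θ : V →L[ℝ] R7) := by
  have hex : ∃ Θ, IsAdapted φ Θ := ⟨Θ, h⟩
  rw [metricOf, dif_pos hex]
  ext ξ η : 2
  have := (stdMetric_of_automorphism (h.automorphism hex.choose_spec)).1 (Θ ξ) (Θ η)
  simpa using this

theorem IsAdapted.volOf_eq {φ : V [⋀^Fin 3]→L[ℝ] ℝ} {Θ : V ≃L[ℝ] R7} (h : IsAdapted φ Θ) :
    volOf φ = stdVolume.compContinuousLinearMap (Θ : V →L[ℝ] R7) := by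
  have hex : ∃ Θ, IsAdapted φ Θ := ⟨Θ, h⟩
  rw [volOf, dif_pos hex]
  exact compContinuousLinearMap_eq_of_trans
    (stdMetric_of_automorphism (h.automorphism hex.choose_spec)).2

theorem IsAdapted.starOf_eq {φ : V [⋀^Fin 3]→L[ℝ] ℝ} {Θ : V ≃L[ℝ] R7} (h : IsAdapted φ Θ) :
    starOf φ = stdFourForm.compContinuousLinearMap (Θ : V →L[ℝ] R7) := by
  have hex : ∃ Θ, IsAdapted φ Θ := ⟨Θ, h⟩
  rw [starOf, dif_pos hex]
  exact compContinuousLinearMap_eq_of_trans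
    (stdFourForm_of_automorphism (h.automorphism hex.choose_spec))

theorem IsAdapted.pullback {φ : V [⋀^Fin 3]→L[ℝ] ℝ} {Θ : V ≃L[ℝ] R7} (h : IsAdapted φ Θ)
    (L : W ≃L[ℝ] V) : IsAdapted (φ.compContinuousLinearMap (L : W →L[ℝ] V)) (L.trans Θ) := by
  rw [IsAdapted, h]
  rfl

theorem IsAdapted.metricOf_pullback {φ : V [⋀^Fin 3]→L[ℝ] ℝ} {Θ : V ≃L[ℝ] R7}
    (h : IsAdapted φ Θ) (L : W ≃L[ℝ] V) :
    metricOf (φ.compContinuousLinearMap (L : W →L[ℝ] V)) =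
      (metricOf φ).bilinearComp (L : W →L[ℝ] V) (L : W →L[ℝ] V) := by
  rw [(h.pullback L).metricOf_eq, h.metricOf_eq]
  rfl

theorem IsAdapted.starOf_pullback {φ : V [⋀^Fin 3]→L[ℝ] ℝ} {Θ : V ≃L[ℝ] R7}
    (h : IsAdapted φ Θ) (L : W ≃L[ℝ] V) :
    starOf (φ.compContinuousLinearMap (L : W →L[ℝ] V)) =
      (starOf φ).compContinuousLinearMap (L : W →L[ℝ] V) := by
  rw [(h.pullback L).starOf_eq, h.starOf_eq]
  rfl

theorem IsAdapted.isMetricOfForm {φ : V [⋀^Fin 3]→L[ℝ] ℝ} {Θ : V ≃L[ℝ] R7} (h : IsAdapted φ Θ) :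
    IsMetricOfForm φ (metricOf φ) (volOf φ) := by
  rw [h.metricOf_eq, h.volOf_eq]
  have := isMetricOfForm_std.pullback Θ
  rwa [← h] at this

theorem IsAdapted.isHodgeDual {φ : V [⋀^Fin 3]→L[ℝ] ℝ} {Θ : V ≃L[ℝ] R7} (h : IsAdapted φ Θ) :
    IsHodgeDual (metricOf φ) (volOf φ) φ (starOf φ) := by
  rw [h.metricOf_eq, h.volOf_eq, h.starOf_eq]
  have := isHodgeDual_std.pullback Θ
  rwa [← h] at this

end Pullback

/-! ### Smooth adapted coframes; closed and co-closed forms are parallel -/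

section FirstOrder

variable {V W X : Type*} [NormedAddCommGroup V] [NormedSpace ℝ V]
  [NormedAddCommGroup W] [NormedSpace ℝ W] [NormedAddCommGroup X] [NormedSpace ℝ X]

theorem fderivComp_apply_update {n : ℕ} (η : W [⋀^Fin n]→L[ℝ] ℝ) (g dg : V →L[ℝ] W)
    (v : Fin n → V) : η.fderivCompContinuousLinearMap g dg v =
      ∑ i, η (Function.update (fun j => g (v j)) i (dg (v i))) := by
  rw [ContinuousAlternatingMap.fderivCompContinuousLinearMap_apply]
  refine Finset.sum_congr rfl fun i _ => congrArg η ?_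
  ext1 j
  by_cases h : j = i
  · subst h
    simp
  · simp [Function.update_of_ne h]

theorem HasFDerivAt.pullback_const {n : ℕ} {g : X → V →L[ℝ] W} {g' : X →L[ℝ] V →L[ℝ] W} {x : X}
    (hg : HasFDerivAt g g' x) (η : W [⋀^Fin n]→L[ℝ] ℝ) :
    HasFDerivAt (fun y => η.compContinuousLinearMap (g y))
      ((η.fderivCompContinuousLinearMap (g x)).comp g') x := by
  refine ((hasFDerivAt_const η x).continuousAlternatingMapCompContinuousLinearMap hg).congr_fderiv ?_
  rw [ContinuousLinearMap.comp_zero, zero_add]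

theorem fderivComp_apply_three (η : W [⋀^Fin 3]→L[ℝ] ℝ) (g dg : V →L[ℝ] W) (x y z : V) :
    η.fderivCompContinuousLinearMap g dg ![x, y, z] =
      η ![dg x, g y, g z] + η ![g x, dg y, g z] + η ![g x, g y, dg z] := by
  rw [fderivComp_apply_update, Fin.sum_univ_three]
  congr 1
  · congr 1 <;>
    · refine congrArg η ?_
      ext1 i
      fin_cases i <;> simp
  · refine congrArg η ?_
    ext1 i
    fin_cases i <;> simp

theorem form_three_ext_basis7 {η η' : R7 [⋀^Fin 3]→L[ℝ] ℝ}
    (h : ∀ j k l, η ![basis7 j, basis7 k, basis7 l] = η' ![basis7 j, basis7 k, basis7 l]) :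
    η = η' := by
  refine form_ext_basis7 fun r => ?_
  rw [form_three_apply η, form_three_apply η']
  exact h _ _ _

/-- The three-form obtained from the standard one by the transformation `1 + actionSection χ`. -/
def transformedForm (χ : R7 [⋀^Fin 3]→L[ℝ] ℝ) : R7 [⋀^Fin 3]→L[ℝ] ℝ :=
  stdThreeForm.compContinuousLinearMap (ContinuousLinearMap.id ℝ R7 + actionSection χ)

theorem transformedForm_zero : transformedForm 0 = stdThreeForm := by
  rw [transformedForm, map_zero, add_zero]
  rfl

theorem contDiff_transformedForm : ContDiff ℝ ∞ transformedForm :=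
  contDiff_iff_contDiffAt.2 fun _ => contDiffAt_const.form_pullback
    (contDiffAt_const.add actionSection.contDiff.contDiffAt)

/-- The derivative of `(1 + S χ)^* φ` at `χ = 0` is the infinitesimal action of `S χ` on `φ`, which
is `χ` because `S` is a right inverse of that action. -/
theorem hasFDerivAt_transformedForm :
    HasFDerivAt transformedForm
      ((ContinuousLinearEquiv.refl ℝ (R7 [⋀^Fin 3]→L[ℝ] ℝ) : _ ≃L[ℝ] _) :
        (R7 [⋀^Fin 3]→L[ℝ] ℝ) →L[ℝ] (R7 [⋀^Fin 3]→L[ℝ] ℝ)) 0 := by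
  have h := ((actionSection.hasFDerivAt (x := 0)).const_add
    (ContinuousLinearMap.id ℝ R7)).pullback_const stdThreeForm
  refine h.congr_fderiv ?_
  refine ContinuousLinearMap.ext fun χ => form_three_ext_basis7 fun j k l => ?_
  rw [map_zero, add_zero, ContinuousLinearMap.comp_apply, fderivComp_apply_three]
  exact actionSection_act χ j k l

theorem form_pullback_pullback {U : Type*} [NormedAddCommGroup U] [NormedSpace ℝ U] {n : ℕ}
    (η : W [⋀^Fin n]→L[ℝ] ℝ) (L : V →L[ℝ] W) (T : U →L[ℝ] V) :
    (η.compContinuousLinearMap L).compContinuousLinearMap T =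
      η.compContinuousLinearMap (L.comp T) := rfl

/-- After transport by `Θ₀` the form at `x₀` is the standard one, and by the inverse function
theorem the nearby forms are `(1 + S χ)^* φ` with `χ` depending smoothly on the form. Openness of
the orbit and smoothness of the metric and of the dual form all follow from this. -/
theorem exists_smooth_coframe {Φ : X → V [⋀^Fin 3]→L[ℝ] ℝ} {x₀ : X}
    (hΦ : ContDiffAt ℝ ∞ Φ x₀) {Θ₀ : V ≃L[ℝ] R7} (h : IsAdapted (Φ x₀) Θ₀) :
    ∃ θ : X → V →L[ℝ] R7, ContDiffAt ℝ ∞ θ x₀ ∧ θ x₀ = (Θ₀ : V →L[ℝ] R7) ∧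
      ∀ᶠ x in 𝓝 x₀, ∃ Θ : V ≃L[ℝ] R7, (Θ : V →L[ℝ] R7) = θ x ∧ IsAdapted (Φ x) Θ := by
  have : FiniteDimensional ℝ V := Θ₀.toLinearEquiv.symm.finiteDimensional
  have hN : ContDiffAt ℝ ∞ transformedForm 0 := contDiff_transformedForm.contDiffAt
  set loc := hN.localInverse hasFDerivAt_transformedForm (by simp) with hloc
  set Φ₀ : X → R7 [⋀^Fin 3]→L[ℝ] ℝ :=
    fun x => (Φ x).compContinuousLinearMap (Θ₀.symm : R7 →L[ℝ] V) with hΦ₀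
  have hΦ₀x : Φ₀ x₀ = transformedForm 0 := by
    rw [transformedForm_zero, hΦ₀]
    beta_reduce
    rw [h]
    ext v
    simp [Function.comp_def]
  have hΦ₀c : ContDiffAt ℝ ∞ Φ₀ x₀ := hΦ.form_pullback contDiffAt_const
  have hlocc : ContDiffAt ℝ ∞ loc (transformedForm 0) := hN.to_localInverse _ _
  have hloc0 : loc (transformedForm 0) = 0 := hN.localInverse_apply_image _ _
  set θ : X → V →L[ℝ] R7 := fun x =>
    (ContinuousLinearMap.id ℝ R7 + actionSection (loc (Φ₀ x))).comp (Θ₀ : V →L[ℝ] R7) with hθ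
  have hθc : ContDiffAt ℝ ∞ θ x₀ := by
    refine ContDiffAt.clm_comp (contDiffAt_const.add ?_) contDiffAt_const
    refine actionSection.contDiff.contDiffAt.comp x₀ (ContDiffAt.comp x₀ ?_ hΦ₀c)
    rw [hΦ₀x]
    exact hlocc
  have hθ0 : θ x₀ = (Θ₀ : V →L[ℝ] R7) := by
    rw [hθ]
    beta_reduce
    rw [hΦ₀x, hloc0, map_zero, add_zero]
    rfl
  refine ⟨θ, hθc, hθ0, ?_⟩
  have h1 : ∀ᶠ x in 𝓝 x₀, transformedForm (loc (Φ₀ x)) = Φ₀ x := by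
    have h2 := (hN.hasStrictFDerivAt' hasFDerivAt_transformedForm (by simp)).eventually_right_inverse
    rw [← hΦ₀x] at h2
    exact hΦ₀c.continuousAt.eventually h2
  -- Invertible maps form an open set.
  have h3 : ∀ᶠ x in 𝓝 x₀, θ x ∈ Set.range ((↑) : (V ≃L[ℝ] R7) → V →L[ℝ] R7) := by
    refine hθc.continuousAt.eventually ?_
    rw [hθ0]
    have := FiniteDimensional.complete ℝ V
    exact ContinuousLinearEquiv.nhds Θ₀
  filter_upwards [h1, h3] with x hx hx'
  obtain ⟨Θ, hΘ⟩ := hx'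
  refine ⟨Θ, hΘ, ?_⟩
  rw [IsAdapted, hΘ]
  have h4 : Φ x = (Φ₀ x).compContinuousLinearMap (Θ₀ : V →L[ℝ] R7) := by
    ext v
    simp [hΦ₀, Function.comp_def]
  rw [h4, ← hx, transformedForm, form_pullback_pullback]

/-- Three-forms that are equivalent to the standard one are stable. -/
theorem IsAdapted.isStableForm {φ : V [⋀^Fin 3]→L[ℝ] ℝ} {Θ : V ≃L[ℝ] R7} (h : IsAdapted φ Θ) :
    IsStableForm φ := by
  rw [IsStableForm, isOpen_iff_mem_nhds]
  rintro η ⟨A, rfl⟩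
  -- For the tautological family, parametrised by the three-forms themselves, adapted isomorphisms
  -- at all nearby parameters mean that the orbit is open.
  obtain ⟨θ, -, -, hev⟩ := exists_smooth_coframe (Φ := fun η : V [⋀^Fin 3]→L[ℝ] ℝ => η)
    (x₀ := φ.compContinuousLinearMap (A : V →L[ℝ] V)) contDiffAt_id (h.pullback A)
  filter_upwards [hev] with η hη
  obtain ⟨Θ', -, hΘ'⟩ := hη
  refine ⟨Θ'.trans Θ.symm, ?_⟩
  rw [hΘ', h]
  ext v
  simp [Function.comp_def]

theorem ContDiffAt.metric_pullback {θ : X → V →L[ℝ] R7} {x : X} (hθ : ContDiffAt ℝ ∞ θ x) :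
    ContDiffAt ℝ ∞ (fun y => stdMetric.bilinearComp (θ y) (θ y)) x := by
  have h : (fun y => stdMetric.bilinearComp (θ y) (θ y)) = fun y =>
      ∑ i, ((coord7 i).comp (θ y)).smulRight ((coord7 i).comp (θ y)) := by
    ext y ξ η
    simp [stdMetric_apply, coord7_apply]
  rw [h]
  exact ContDiffAt.sum fun i _ =>
    (contDiffAt_const.clm_comp hθ).smulRight (contDiffAt_const.clm_comp hθ)

theorem ContDiffAt.metricOf {Φ : X → V [⋀^Fin 3]→L[ℝ] ℝ} {x₀ : X} (hΦ : ContDiffAt ℝ ∞ Φ x₀)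
    {Θ₀ : V ≃L[ℝ] R7} (h : IsAdapted (Φ x₀) Θ₀) : ContDiffAt ℝ ∞ (fun x => metricOf (Φ x)) x₀ := by
  obtain ⟨θ, hθ, -, hev⟩ := exists_smooth_coframe hΦ h
  refine hθ.metric_pullback.congr_of_eventuallyEq ?_
  filter_upwards [hev] with x hx
  obtain ⟨Θ, hΘ, hx⟩ := hx
  rw [hx.metricOf_eq, hΘ]

theorem ContDiffAt.starOf {Φ : X → V [⋀^Fin 3]→L[ℝ] ℝ} {x₀ : X} (hΦ : ContDiffAt ℝ ∞ Φ x₀)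
    {Θ₀ : V ≃L[ℝ] R7} (h : IsAdapted (Φ x₀) Θ₀) : ContDiffAt ℝ ∞ (fun x => starOf (Φ x)) x₀ := by
  have : FiniteDimensional ℝ V := Θ₀.toLinearEquiv.symm.finiteDimensional
  obtain ⟨θ, hθ, -, hev⟩ := exists_smooth_coframe hΦ h
  refine ContDiffAt.congr_of_eventuallyEq
    ((contDiffAt_const (c := stdFourForm)).form_pullback hθ) ?_
  filter_upwards [hev] with x hx
  obtain ⟨Θ, hΘ, hx⟩ := hx
  rw [hx.starOf_eq, hΘ]

theorem fderiv_bilinear_apply {G : X → V →L[ℝ] V →L[ℝ] ℝ} {x : X} (hG : DifferentiableAt ℝ G x)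
    (a : X) (b c : V) : fderiv ℝ (fun y => G y b c) x a = fderiv ℝ G x a b c := by
  have h := (hG.hasFDerivAt.clm_apply (hasFDerivAt_const b x)).clm_apply (hasFDerivAt_const c x)
  rw [h.fderiv]
  simp

/-- The terms of a covariant derivative that contain a symmetric connection do not contribute to
the exterior derivative. -/
theorem alternatize_fderivComp_of_symm [FiniteDimensional ℝ V] {n : ℕ} (η : V [⋀^Fin n]→L[ℝ] ℝ)
    (Γ : V →L[ℝ] V →L[ℝ] V) (hΓ : ∀ a b, Γ a b = Γ b a) :
    ContinuousAlternatingMap.alternatizeUncurryFin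
      ((η.fderivCompContinuousLinearMap (ContinuousLinearMap.id ℝ V)).comp Γ) = 0 := by
  -- As `Γ` is symmetric, the derivative of `q` at `x` is `1 + Γ x`. The pullback of the constant
  -- form `η` by `q` is closed, and its exterior derivative at `0` is the alternation in the
  -- statement.
  set q : V → V := fun x => x + (1 / 2 : ℝ) • Γ x x with hq
  have hq' : ∀ x, HasFDerivAt q (ContinuousLinearMap.id ℝ V + Γ x) x := by
    intro x
    have h := (hasFDerivAt_id x).add ((Γ.hasFDerivAt.clm_apply (hasFDerivAt_id x)).const_smul
      (1 / 2 : ℝ))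
    refine h.congr_fderiv ?_
    ext v
    simp only [add_apply, smul_apply,
      ContinuousLinearMap.comp_apply, ContinuousLinearMap.id_apply, ContinuousLinearMap.flip_apply,
      id_eq]
    rw [hΓ v x, ← two_smul ℝ (Γ x v), smul_smul]
    norm_num
  have hqf : fderiv ℝ q = fun x => ContinuousLinearMap.id ℝ V + Γ x := funext fun x => (hq' x).fderiv
  have hqc : ContDiff ℝ 2 q :=
    contDiff_id.add ((Γ.contDiff.clm_apply contDiff_id).const_smul _)
  have h1 := extDeriv_pullback (f := q) (x := 0) (r := 2)
    (show DifferentiableAt ℝ (fun _ : V => η) (q 0) from differentiableAt_const η) hqc.contDiffAt (by simp)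
  have h2 : extDeriv (fun _ : V => η) (q 0) = 0 := by
    ext v
    simp [extDeriv, ContinuousAlternatingMap.alternatizeUncurryFin_apply]
  rw [h2, hqf] at h1
  have h3 := (((Γ.hasFDerivAt (x := 0)).const_add
    (ContinuousLinearMap.id ℝ V)).pullback_const η).fderiv
  have h4 : extDeriv (fun x => η.compContinuousLinearMap (ContinuousLinearMap.id ℝ V + Γ x)) 0 =
      0 := h1.trans (by ext; simp)
  rw [extDeriv] at h4
  refine Eq.trans (congrArg _ ?_) h4
  refine Eq.trans ?_ h3.symm
  rw [map_zero, add_zero]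

/-- The vector of the Koszul formula, for a metric with adapted coframe `Θ` and derivative `G'`. -/
def koszulVector (Θ : V ≃L[ℝ] R7) (G' : V → V → V → ℝ) (a b : V) : V :=
  Θ.symm fun i => (1 / 2 : ℝ) * (G' a b (Θ.symm (basis7 i)) + G' b a (Θ.symm (basis7 i)) -
    G' (Θ.symm (basis7 i)) a b)

/-- The right-hand side is linear in `c`, so it is represented by a vector, found from its values on
the orthonormal basis `Θ⁻¹ e_i`. Linearity of `G'` in each argument makes this vector bilinear in
`a` and `b`. -/
theorem exists_koszul [FiniteDimensional ℝ V] (Θ : V ≃L[ℝ] R7) (G' : V → V → V → ℝ)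
    (h1 : ∀ b c, IsLinearMap ℝ fun a => G' a b c) (h2 : ∀ a c, IsLinearMap ℝ fun b => G' a b c)
    (h3 : ∀ a b, IsLinearMap ℝ fun c => G' a b c) :
    ∃ Γ : V →L[ℝ] V →L[ℝ] V, ∀ a b c, 2 * stdMetric (Θ (Γ a b)) (Θ c) =
      G' a b c + G' b a c - G' c a b := by
  have a1 : ∀ a a' b c, G' (a + a') b c = G' a b c + G' a' b c := fun a a' b c =>
    (h1 b c).map_add a a'
  have a2 : ∀ a b b' c, G' a (b + b') c = G' a b c + G' a b' c := fun a b b' c =>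
    (h2 a c).map_add b b'
  have a3 : ∀ a b c c', G' a b (c + c') = G' a b c + G' a b c' := fun a b c c' =>
    (h3 a b).map_add c c'
  have s1 : ∀ (r : ℝ) a b c, G' (r • a) b c = r * G' a b c := fun r a b c => (h1 b c).map_smul r a
  have s2 : ∀ (r : ℝ) a b c, G' a (r • b) c = r * G' a b c := fun r a b c => (h2 a c).map_smul r b
  have s3 : ∀ (r : ℝ) a b c, G' a b (r • c) = r * G' a b c := fun r a b c => (h3 a b).map_smul r c
  set Γ₀ : V →ₗ[ℝ] V →ₗ[ℝ] V := LinearMap.mk₂ ℝ (koszulVector Θ G')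
    (fun a a' b => by
      rw [koszulVector, koszulVector, koszulVector, ← map_add]
      congr 1
      ext i
      simp only [a1, a2, Pi.add_apply]
      ring)
    (fun c a b => by
      rw [koszulVector, koszulVector, ← map_smul]
      congr 1
      ext i
      simp only [s1, s2, Pi.smul_apply, smul_eq_mul]
      ring)
    (fun a b b' => by
      rw [koszulVector, koszulVector, koszulVector, ← map_add]
      congr 1
      ext i
      simp only [a1, a2, a3, Pi.add_apply]
      ring)
    (fun c a b => by
      rw [koszulVector, koszulVector, ← map_smul]
      congr 1
      ext i
      simp only [s1, s2, s3, Pi.smul_apply, smul_eq_mul]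
      ring) with hΓ₀
  refine ⟨LinearMap.toContinuousLinearMap
    ((LinearMap.toContinuousLinearMap : (V →ₗ[ℝ] V) ≃ₗ[ℝ] (V →L[ℝ] V)).toLinearMap ∘ₗ Γ₀),
    fun a b c => ?_⟩
  have h4 : Θ (koszulVector Θ G' a b) = fun i => (1 / 2 : ℝ) * (G' a b (Θ.symm (basis7 i)) +
      G' b a (Θ.symm (basis7 i)) - G' (Θ.symm (basis7 i)) a b) := by
    simp [koszulVector]
  have h5 : ∀ f : V → ℝ, IsLinearMap ℝ f → ∑ i, f (Θ.symm (basis7 i)) * Θ c i = f c := by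
    intro f hf
    have h6 : c = ∑ i, Θ c i • Θ.symm (basis7 i) := by
      conv_lhs => rw [← Θ.symm_apply_apply c, ← sum_smul_basis7 (Θ c), map_sum]
      simp
    have h7 := congrArg hf.mk' h6
    rw [map_sum] at h7
    refine Eq.trans (Finset.sum_congr rfl fun i _ => ?_) h7.symm
    rw [map_smul, smul_eq_mul, mul_comm]
    rfl
  change 2 * stdMetric (Θ (koszulVector Θ G' a b)) (Θ c) = _
  rw [h4, stdMetric_apply]
  simp only [mul_assoc, ← Finset.mul_sum, add_mul, sub_mul, Finset.sum_add_distrib,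
    Finset.sum_sub_distrib]
  rw [h5 _ (h3 a b), h5 _ (h3 b a), h5 (fun c => G' c a b) (h1 a b)]
  ring

/-- The action of an endomorphism on the components of a form. -/
theorem fderivComp_basis {n : ℕ} (η : R7 [⋀^Fin n]→L[ℝ] ℝ) (Θ : V ≃L[ℝ] R7) (D : V →L[ℝ] R7)
    (r : Fin n → Fin 7) :
    η.fderivCompContinuousLinearMap (Θ : V →L[ℝ] R7) D (fun i => Θ.symm (basis7 (r i))) =
      ∑ i, ∑ m, D (Θ.symm (basis7 (r i))) m * η fun j => basis7 (Function.update r i m j) := by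
  rw [fderivComp_apply_update]
  refine Finset.sum_congr rfl fun i _ => ?_
  simp only [ContinuousLinearEquiv.coe_coe, ContinuousLinearEquiv.apply_symm_apply]
  conv_lhs => rw [← sum_smul_basis7 (D (Θ.symm (basis7 (r i))))]
  have h1 := map_sum (η.toContinuousLinearMap (fun j => basis7 (r j)) i)
    (fun m => D (Θ.symm (basis7 (r i))) m • basis7 m) Finset.univ
  refine h1.trans (Finset.sum_congr rfl fun m _ => ?_)
  rw [map_smul, smul_eq_mul]
  congr 1
  refine congrArg η ?_
  ext1 j
  by_cases h : j = i
  · subst h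
    simp
  · simp [Function.update_of_ne h]

theorem ext_on_coframe (Θ : V ≃L[ℝ] R7) {n : ℕ} {N : V →L[ℝ] V [⋀^Fin n]→L[ℝ] ℝ}
    (h : ∀ (p : Fin 7) (r : Fin n → Fin 7),
      N (Θ.symm (basis7 p)) (fun i => Θ.symm (basis7 (r i))) = 0) (a : V) : N a = 0 := by
  have h1 : ∀ p, N (Θ.symm (basis7 p)) = 0 := by
    intro p
    have h2 : (N (Θ.symm (basis7 p))).compContinuousLinearMap (Θ.symm : R7 →L[ℝ] V) = 0 :=
      form_ext_basis7 fun r => h p r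
    ext v
    have h3 := congrArg (fun f => f fun i => Θ (v i)) h2
    simpa [Function.comp_def] using h3
  have h6 : a = ∑ i, Θ a i • Θ.symm (basis7 i) := by
    conv_lhs => rw [← Θ.symm_apply_apply a, ← sum_smul_basis7 (Θ a), map_sum]
    simp
  rw [h6, map_sum]
  exact Finset.sum_eq_zero fun i _ => by rw [map_smul, h1, smul_zero]

theorem fderivComp_ext_on_coframe (Θ : V ≃L[ℝ] R7) {n : ℕ} (η : R7 [⋀^Fin n]→L[ℝ] ℝ)
    (D : V →L[ℝ] V →L[ℝ] R7)
    (h : ∀ (p : Fin 7) (r : Fin n → Fin 7), η.fderivCompContinuousLinearMap (Θ : V →L[ℝ] R7)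
      (D (Θ.symm (basis7 p))) (fun i => Θ.symm (basis7 (r i))) = 0) (a : V) :
    η.fderivCompContinuousLinearMap (Θ : V →L[ℝ] R7) (D a) = 0 :=
  ext_on_coframe Θ (N := (η.fderivCompContinuousLinearMap (Θ : V →L[ℝ] R7)).comp D) h a

theorem alternatize_eq_zero_three {f : V →L[ℝ] V [⋀^Fin 3]→L[ℝ] ℝ}
    (h : ContinuousAlternatingMap.alternatizeUncurryFin f = 0) {ι : Type*} (x : ι → V)
    (a b c d : ι) : f (x a) (fun i => x ((![b, c, d] : Fin 3 → ι) i)) -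
      f (x b) (fun i => x ((![a, c, d] : Fin 3 → ι) i)) +
      f (x c) (fun i => x ((![a, b, d] : Fin 3 → ι) i)) -
      f (x d) (fun i => x ((![a, b, c] : Fin 3 → ι) i)) = 0 := by
  have h5 := congrArg (fun f => f fun i => x ((![a, b, c, d] : Fin 4 → ι) i)) h
  simp only [ContinuousAlternatingMap.alternatizeUncurryFin_apply] at h5
  rw [Fin.sum_univ_four] at h5
  refine Eq.trans ?_ h5
  have e : ∀ (k : Fin 4) (r : Fin 3 → ι), (∀ i, (![a, b, c, d] : Fin 4 → ι) (k.succAbove i) = r i) →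
      (k.removeNth fun i => x ((![a, b, c, d] : Fin 4 → ι) i)) = fun i => x (r i) :=
    fun k r hr => funext fun i => congrArg x (hr i)
  rw [e 0 ![b, c, d] (by intro i; fin_cases i <;> rfl),
    e 1 ![a, c, d] (by intro i; fin_cases i <;> rfl),
    e 2 ![a, b, d] (by intro i; fin_cases i <;> rfl),
    e 3 ![a, b, c] (by intro i; fin_cases i <;> rfl)]
  simp
  ring

theorem alternatize_eq_zero_four {f : V →L[ℝ] V [⋀^Fin 4]→L[ℝ] ℝ}
    (h : ContinuousAlternatingMap.alternatizeUncurryFin f = 0) {ι : Type*} (x : ι → V)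
    (a b c d e : ι) : f (x a) (fun i => x ((![b, c, d, e] : Fin 4 → ι) i)) -
      f (x b) (fun i => x ((![a, c, d, e] : Fin 4 → ι) i)) +
      f (x c) (fun i => x ((![a, b, d, e] : Fin 4 → ι) i)) -
      f (x d) (fun i => x ((![a, b, c, e] : Fin 4 → ι) i)) +
      f (x e) (fun i => x ((![a, b, c, d] : Fin 4 → ι) i)) = 0 := by
  have h5 := congrArg (fun f => f fun i => x ((![a, b, c, d, e] : Fin 5 → ι) i)) h
  simp only [ContinuousAlternatingMap.alternatizeUncurryFin_apply] at h5
  rw [Fin.sum_univ_five] at h5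
  refine Eq.trans ?_ h5
  have e' : ∀ (k : Fin 5) (r : Fin 4 → ι),
      (∀ i, (![a, b, c, d, e] : Fin 5 → ι) (k.succAbove i) = r i) →
      (k.removeNth fun i => x ((![a, b, c, d, e] : Fin 5 → ι) i)) = fun i => x (r i) :=
    fun k r hr => funext fun i => congrArg x (hr i)
  rw [e' 0 ![b, c, d, e] (by intro i; fin_cases i <;> rfl),
    e' 1 ![a, c, d, e] (by intro i; fin_cases i <;> rfl),
    e' 2 ![a, b, d, e] (by intro i; fin_cases i <;> rfl),
    e' 3 ![a, b, c, e] (by intro i; fin_cases i <;> rfl),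
    e' 4 ![a, b, c, d] (by intro i; fin_cases i <;> rfl)]
  simp [pow_succ]
  ring

/-- Infinitesimal rotations of an adapted coframe preserve the three-form if they do not
contribute to the exterior derivatives of the three-form and the four-form. -/
theorem fderivComp_eq_zero_of_skew (Θ : V ≃L[ℝ] R7) (D : V →L[ℝ] V →L[ℝ] R7)
    (hD : ∀ a b c, stdMetric (D a b) (Θ c) + stdMetric (Θ b) (D a c) = 0)
    (h3 : ContinuousAlternatingMap.alternatizeUncurryFin
      ((stdThreeForm.fderivCompContinuousLinearMap (Θ : V →L[ℝ] R7)).comp D) = 0)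
    (h4 : ContinuousAlternatingMap.alternatizeUncurryFin
      ((stdFourForm.fderivCompContinuousLinearMap (Θ : V →L[ℝ] R7)).comp D) = 0) (a : V) :
    stdThreeForm.fderivCompContinuousLinearMap (Θ : V →L[ℝ] R7) (D a) = 0 := by
  -- In the adapted basis `w p` is the matrix of the rotation `D e_p`; the two alternation
  -- hypotheses become the vanishing of the pairings with `altThree` and `altFour`.
  set w : Fin 7 → Fin 7 → Fin 7 → ℝ := fun p i j => D (Θ.symm (basis7 p)) (Θ.symm (basis7 j)) i
    with hw
  have hskew : ∀ p i j, w p i j = - w p j i := by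
    intro p i j
    have h5 := hD (Θ.symm (basis7 p)) (Θ.symm (basis7 j)) (Θ.symm (basis7 i))
    simp only [stdMetric_apply, ContinuousLinearEquiv.apply_symm_apply, basis7_apply, mul_ite,
      mul_one, mul_zero, ite_mul, one_mul, zero_mul, Finset.sum_ite_eq', Finset.mem_univ,
      if_true] at h5
    simp only [hw]
    linarith
  have hN3 : ∀ p b c d, stdThreeForm.fderivCompContinuousLinearMap (Θ : V →L[ℝ] R7)
      (D (Θ.symm (basis7 p))) (fun i => Θ.symm (basis7 ((![b, c, d] : Fin 3 → Fin 7) i))) =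
      ∑ i, ∑ j, (threeAct b c d i j : ℝ) * w p i j := by
    intro p b c d
    rw [fderivComp_basis, Fin.sum_univ_three]
    have e0 : ∀ m, (stdThreeForm fun j => basis7 (Function.update ![b, c, d] 0 m j)) =
        fano m c d := fun m => by
      rw [← stdThreeForm_basis7]
      refine congrArg stdThreeForm ?_
      ext1 i
      fin_cases i <;> simp
    have e1 : ∀ m, (stdThreeForm fun j => basis7 (Function.update ![b, c, d] 1 m j)) =
        fano b m d := fun m => by
      rw [← stdThreeForm_basis7]
      refine congrArg stdThreeForm ?_
      ext1 i
      fin_cases i <;> simp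
    have e2 : ∀ m, (stdThreeForm fun j => basis7 (Function.update ![b, c, d] 2 m j)) =
        fano b c m := fun m => by
      rw [← stdThreeForm_basis7]
      refine congrArg stdThreeForm ?_
      ext1 i
      fin_cases i <;> simp
    simp only [e0, e1, e2]
    simp only [threeAct, Int.cast_add, add_mul, Finset.sum_add_distrib, Int.cast_ite, Int.cast_zero,
      ite_mul, zero_mul, Finset.sum_ite_eq', Finset.mem_univ, if_true, hw]
    simp [mul_comm]
  have hN4 : ∀ p b c d e, stdFourForm.fderivCompContinuousLinearMap (Θ : V →L[ℝ] R7)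
      (D (Θ.symm (basis7 p))) (fun i => Θ.symm (basis7 ((![b, c, d, e] : Fin 4 → Fin 7) i))) =
      ∑ i, ∑ j, (fourAct b c d e i j : ℝ) * w p i j := by
    intro p b c d e
    rw [fderivComp_basis, Fin.sum_univ_four]
    have e0 : ∀ m, (stdFourForm fun j => basis7 (Function.update ![b, c, d, e] 0 m j)) =
        fanoQuad m c d e := fun m => by
      rw [← stdFourForm_basis7]
      refine congrArg stdFourForm ?_
      ext1 i
      fin_cases i <;> simp
    have e1 : ∀ m, (stdFourForm fun j => basis7 (Function.update ![b, c, d, e] 1 m j)) =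
        fanoQuad b m d e := fun m => by
      rw [← stdFourForm_basis7]
      refine congrArg stdFourForm ?_
      ext1 i
      fin_cases i <;> simp
    have e2 : ∀ m, (stdFourForm fun j => basis7 (Function.update ![b, c, d, e] 2 m j)) =
        fanoQuad b c m e := fun m => by
      rw [← stdFourForm_basis7]
      refine congrArg stdFourForm ?_
      ext1 i
      fin_cases i <;> simp
    have e3 : ∀ m, (stdFourForm fun j => basis7 (Function.update ![b, c, d, e] 3 m j)) =
        fanoQuad b c d m := fun m => by
      rw [← stdFourForm_basis7]
      refine congrArg stdFourForm ?_
      ext1 i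
      fin_cases i <;> simp
    simp only [e0, e1, e2, e3]
    simp only [fourAct, Int.cast_add, add_mul, Finset.sum_add_distrib, Int.cast_ite, Int.cast_zero,
      ite_mul, zero_mul, Finset.sum_ite_eq', Finset.mem_univ, if_true, hw]
    simp [mul_comm]
  have hA3 : ∀ a b c d, pairing (altThree a b c d) w = 0 := by
    intro a b c d
    have h5 := alternatize_eq_zero_three h3 (fun i => Θ.symm (basis7 i)) a b c d
    simp only [ContinuousLinearMap.comp_apply, hN3] at h5
    rw [← h5, ← pairing_ite, ← pairing_ite, ← pairing_ite, ← pairing_ite, ← pairing_sub,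
      ← pairing_add, ← pairing_sub]
    rfl
  have hA4 : ∀ a b c d e, pairing (altFour a b c d e) w = 0 := by
    intro a b c d e
    have h5 := alternatize_eq_zero_four h4 (fun i => Θ.symm (basis7 i)) a b c d e
    simp only [ContinuousLinearMap.comp_apply, hN4] at h5
    rw [← h5, ← pairing_ite, ← pairing_ite, ← pairing_ite, ← pairing_ite, ← pairing_ite,
      ← pairing_sub, ← pairing_add, ← pairing_sub, ← pairing_add]
    rfl
  have hzero : ∀ (p : Fin 7) (r : Fin 3 → Fin 7),
      stdThreeForm.fderivCompContinuousLinearMap (Θ : V →L[ℝ] R7) (D (Θ.symm (basis7 p)))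
        (fun i => Θ.symm (basis7 (r i))) = 0 := by
    intro p r
    have h8 : r = ![r 0, r 1, r 2] := by
      ext1 i
      fin_cases i <;> rfl
    rw [h8, hN3]
    exact threeAct_eq_zero w hskew hA3 hA4 _ _ _ _
  exact fderivComp_ext_on_coframe Θ _ D hzero a

theorem fderiv_eq_of_eventually_adapted {n : ℕ} {Ψ : V → V [⋀^Fin n]→L[ℝ] ℝ} {u : V}
    {θ : V → V →L[ℝ] R7} (hθ : DifferentiableAt ℝ θ u) (η : R7 [⋀^Fin n]→L[ℝ] ℝ)
    (h : ∀ᶠ x in 𝓝 u, Ψ x = η.compContinuousLinearMap (θ x)) :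
    fderiv ℝ Ψ u = (η.fderivCompContinuousLinearMap (θ u)).comp (fderiv ℝ θ u) := by
  rw [Filter.EventuallyEq.fderiv_eq h]
  exact (hθ.hasFDerivAt.pullback_const η).fderiv

/-- Splitting of the derivative of a form in a covariant derivative and connection terms. -/
theorem alternatize_covariant [FiniteDimensional ℝ V] {n : ℕ} (η : W [⋀^Fin n]→L[ℝ] ℝ)
    (T : V →L[ℝ] W) (θ' : V →L[ℝ] V →L[ℝ] W) (Γ : V →L[ℝ] V →L[ℝ] V)
    (hΓ : ∀ a b, Γ a b = Γ b a) (D : V →L[ℝ] V →L[ℝ] W) (hD : ∀ a, D a = θ' a - T.comp (Γ a))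
    (h : ContinuousAlternatingMap.alternatizeUncurryFin
      ((η.fderivCompContinuousLinearMap T).comp θ') = 0) :
    ContinuousAlternatingMap.alternatizeUncurryFin
      ((η.fderivCompContinuousLinearMap T).comp D) = 0 := by
  -- Since `θ' = D + T Γ`, the derivative is a covariant part plus the action of `Γ` on the
  -- pulled-back form, and the latter alternates to zero by symmetry of `Γ`.
  have h0 : (η.fderivCompContinuousLinearMap T).comp θ' =
      (η.fderivCompContinuousLinearMap T).comp D +
        ((η.compContinuousLinearMap T).fderivCompContinuousLinearMap
          (ContinuousLinearMap.id ℝ V)).comp Γ := by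
    refine ContinuousLinearMap.ext fun a => ?_
    have h2 : (η.compContinuousLinearMap T).fderivCompContinuousLinearMap
        (ContinuousLinearMap.id ℝ V) (Γ a) =
        η.fderivCompContinuousLinearMap T (T.comp (Γ a)) := by
      ext v
      rw [fderivComp_apply_update, fderivComp_apply_update]
      refine Finset.sum_congr rfl fun i _ => ?_
      rw [ContinuousAlternatingMap.compContinuousLinearMap_apply]
      refine congrArg η ?_
      ext1 j
      by_cases hj : j = i
      · subst hj
        simp
      · simp [Function.update_of_ne hj]
    rw [add_apply, ContinuousLinearMap.comp_apply, ContinuousLinearMap.comp_apply,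
      ContinuousLinearMap.comp_apply, h2, hD, ← map_add, sub_add_cancel]
  rw [h0, ContinuousAlternatingMap.alternatizeUncurryFin_add,
    alternatize_fderivComp_of_symm _ Γ hΓ, add_zero] at h
  exact h

/-- A closed and co-closed three-form that is equivalent to the standard one is parallel for the
Levi-Civita connection of its metric. -/
theorem exists_christoffel_parallel {Φ : V → V [⋀^Fin 3]→L[ℝ] ℝ} {u : V}
    (hΦ : ContDiffAt ℝ ∞ Φ u) {Θ : V ≃L[ℝ] R7} (hΘ : IsAdapted (Φ u) Θ) (hd : extDeriv Φ u = 0)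
    (hs : extDeriv (fun x => starOf (Φ x)) u = 0) :
    ∃ Γ : V → V → V,
      (∀ a b c : V, 2 * metricOf (Φ u) (Γ a b) c =
        fderiv ℝ (fun x => metricOf (Φ x)) u a b c + fderiv ℝ (fun x => metricOf (Φ x)) u b a c -
          fderiv ℝ (fun x => metricOf (Φ x)) u c a b) ∧
      ∀ (a : V) (w : Fin 3 → V),
        fderiv ℝ Φ u a w = ∑ i, Φ u (Function.update w i (Γ a (w i))) := by
  have : FiniteDimensional ℝ V := Θ.toLinearEquiv.symm.finiteDimensional
  obtain ⟨θ, hθ, hθ0, hev⟩ := exists_smooth_coframe hΦ hΘ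
  have hθd : DifferentiableAt ℝ θ u := hθ.differentiableAt (by simp)
  have hG : DifferentiableAt ℝ (fun x => metricOf (Φ x)) u :=
    (hΦ.metricOf hΘ).differentiableAt (by simp)
  set G' : V → V → V → ℝ := fun a b c => fderiv ℝ (fun x => metricOf (Φ x)) u a b c with hG'
  -- The metric is the pullback of a constant metric by the smooth coframe `θ`; this is its
  -- derivative by the product rule.
  have hG'θ : ∀ a b c, G' a b c = stdMetric (fderiv ℝ θ u a b) (Θ c) +
      stdMetric (Θ b) (fderiv ℝ θ u a c) := by
    intro a b c
    simp only [hG']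
    rw [← fderiv_bilinear_apply hG]
    have h1 : (fun x => metricOf (Φ x) b c) =ᶠ[𝓝 u] fun x => stdMetric (θ x b) (θ x c) := by
      filter_upwards [hev] with x hx
      obtain ⟨Θ', hΘ', hx⟩ := hx
      rw [hx.metricOf_eq, hΘ']
      rfl
    have hb := hθd.hasFDerivAt.clm_apply (hasFDerivAt_const b u)
    have hc := hθd.hasFDerivAt.clm_apply (hasFDerivAt_const c u)
    have h2 : HasFDerivAt (fun x => stdMetric (θ x b) (θ x c)) _ u :=
      (stdMetric.hasFDerivAt.comp u hb).clm_apply hc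
    rw [h1.fderiv_eq, h2.fderiv]
    simp [add_comm, hθ0]
  obtain ⟨Γ, hΓ⟩ := exists_koszul Θ G'
    (fun b c => ⟨fun a a' => by
        simp only [hG'θ, map_add, add_apply]
        ring,
      fun r a => by
        simp only [hG'θ, map_smul, smul_apply, smul_eq_mul]
        ring⟩)
    (fun a c => ⟨fun b b' => by
        simp only [hG'θ, map_add, add_apply]
        ring,
      fun r b => by
        simp only [hG'θ, map_smul, smul_apply, smul_eq_mul]
        ring⟩)
    (fun a b => ⟨fun c c' => by
        simp only [hG'θ, map_add]
        ring,
      fun r c => by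
        simp only [hG'θ, map_smul, smul_eq_mul]
        ring⟩)
  have hG's : ∀ a b c, G' a b c = G' a c b := by
    intro a b c
    rw [hG'θ, hG'θ, isMetricOfForm_std.symm, isMetricOfForm_std.symm (Θ b), add_comm]
  have hsymm : ∀ a b, Γ a b = Γ b a := by
    intro a b
    have h1 : ∀ x, stdMetric (Θ (Γ a b - Γ b a)) (Θ x) = 0 := by
      intro x
      have h2 := hΓ a b x
      have h3 := hΓ b a x
      rw [hG's x a b] at h2
      rw [map_sub, map_sub, sub_apply]
      linarith
    by_contra hne
    have h4 := isMetricOfForm_std.pos (Θ (Γ a b - Γ b a))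
      (fun h => hne (sub_eq_zero.1 ((Θ.map_eq_zero_iff).1 h)))
    rw [h1] at h4
    exact lt_irrefl _ h4
  -- `D` is the Levi-Civita covariant derivative of the coframe. Metric compatibility makes it skew,
  -- while `fderiv θ` and `D` have the same effect on exterior derivatives.
  obtain ⟨D, hD⟩ : ∃ D : V →L[ℝ] V →L[ℝ] R7,
      ∀ a, D a = fderiv ℝ θ u a - (Θ : V →L[ℝ] R7).comp (Γ a) :=
    ⟨fderiv ℝ θ u - ((ContinuousLinearMap.compL ℝ V V R7) (Θ : V →L[ℝ] R7)).comp Γ, fun a => rfl⟩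
  have hskew : ∀ a b c, stdMetric (D a b) (Θ c) + stdMetric (Θ b) (D a c) = 0 := by
    intro a b c
    have h1 := hΓ a b c
    have h2 := hΓ a c b
    have h3 := hG'θ a b c
    have h4 := hG's a b c
    have h5 := hG's b a c
    have h6 := hG's c a b
    rw [hD]
    simp only [sub_apply, ContinuousLinearMap.comp_apply, ContinuousLinearEquiv.coe_coe, map_sub]
    rw [isMetricOfForm_std.symm (Θ b) (Θ (Γ a c))]
    linarith
  have hΦ' : fderiv ℝ Φ u =
      (stdThreeForm.fderivCompContinuousLinearMap (Θ : V →L[ℝ] R7)).comp (fderiv ℝ θ u) := by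
    rw [← hθ0]
    refine fderiv_eq_of_eventually_adapted hθd _ ?_
    filter_upwards [hev] with x hx
    obtain ⟨Θ', hΘ', hx⟩ := hx
    rw [← hΘ', ← hx]
  have hΨ' : fderiv ℝ (fun x => starOf (Φ x)) u =
      (stdFourForm.fderivCompContinuousLinearMap (Θ : V →L[ℝ] R7)).comp (fderiv ℝ θ u) := by
    rw [← hθ0]
    refine fderiv_eq_of_eventually_adapted hθd _ ?_
    filter_upwards [hev] with x hx
    obtain ⟨Θ', hΘ', hx⟩ := hx
    rw [← hΘ', hx.starOf_eq]
  rw [extDeriv, hΦ'] at hd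
  rw [extDeriv, hΨ'] at hs
  have hzero := fderivComp_eq_zero_of_skew Θ D hskew
    (alternatize_covariant _ _ _ Γ hsymm D hD hd) (alternatize_covariant _ _ _ Γ hsymm D hD hs)
  refine ⟨fun a b => Γ a b, fun a b c => ?_, fun a v => ?_⟩
  · rw [hΘ.metricOf_eq]
    exact hΓ a b c
  · have h1 : fderiv ℝ θ u a = D a + (Θ : V →L[ℝ] R7).comp (Γ a) := by
      rw [hD, sub_add_cancel]
    rw [hΦ', ContinuousLinearMap.comp_apply, h1, map_add, hzero, zero_add,
      fderivComp_apply_update]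
    refine Finset.sum_congr rfl fun i _ => ?_
    rw [hΘ]
    rw [ContinuousAlternatingMap.compContinuousLinearMap_apply]
    refine congrArg stdThreeForm ?_
    ext1 j
    by_cases hj : j = i
    · subst hj
      simp
    · simp [Function.update_of_ne hj]

end FirstOrder

/-! ### Normal form of a definite triple of two-forms in dimension four -/

section NormalForm

variable {W : Type*} [NormedAddCommGroup W] [NormedSpace ℝ W]

/-- The standard triple of anti-self-dual two-forms of a coframe `h` in dimension four. -/
def sdTwo (h : Fin 4 → W →L[ℝ] ℝ) : Fin 3 → W [⋀^Fin 2]→L[ℝ] ℝ :=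
  ![detForm ![h 0, h 1] - detForm ![h 2, h 3], detForm ![h 0, h 2] - detForm ![h 3, h 1],
    detForm ![h 0, h 3] - detForm ![h 1, h 2]]

theorem sdTwo_zero_apply (h : Fin 4 → W →L[ℝ] ℝ) (x y : W) :
    sdTwo h 0 ![x, y] = h 0 x * h 1 y - h 0 y * h 1 x - (h 2 x * h 3 y - h 2 y * h 3 x) := by
  simp [sdTwo, detForm_two_apply]

theorem sdTwo_one_apply (h : Fin 4 → W →L[ℝ] ℝ) (x y : W) :
    sdTwo h 1 ![x, y] = h 0 x * h 2 y - h 0 y * h 2 x - (h 3 x * h 1 y - h 3 y * h 1 x) := by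
  simp [sdTwo, detForm_two_apply]

theorem sdTwo_two_apply (h : Fin 4 → W →L[ℝ] ℝ) (x y : W) :
    sdTwo h 2 ![x, y] = h 0 x * h 3 y - h 0 y * h 3 x - (h 1 x * h 2 y - h 1 y * h 2 x) := by
  simp [sdTwo, detForm_two_apply]

theorem detForm_four_apply (h : Fin 4 → W →L[ℝ] ℝ) (v : Fin 4 → W) :
    detForm h v = detFour fun i j => h i (v j) := by
  rw [detForm_apply, det_eq_detFour]
  rfl

/-- With the convention `F^i ∧ F^j = -2 X^{ij} v` the standard triple has matrix `1` in the
orientation of its own coframe; this fixes the choice of the anti-self-dual triple. -/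
theorem wedge_sdTwo (h : Fin 4 → W →L[ℝ] ℝ) (i j : Fin 3) :
    (wedge (sdTwo h i) (sdTwo h j) : W [⋀^Fin 4]→L[ℝ] ℝ) =
      (if i = j then -2 else 0 : ℝ) • detForm h := by
  refine ContinuousAlternatingMap.ext fun v => ?_
  have h1 : ((if i = j then -2 else 0 : ℝ) • detForm h) v =
      (if i = j then -2 else 0 : ℝ) * detFour fun i j => h i (v j) := by
    rw [← detForm_four_apply]
    rfl
  rw [wedge_two_two_apply]
  refine Eq.trans ?_ h1.symm
  rw [detFour]
  fin_cases i <;> fin_cases j <;>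
    simp [sdTwo_zero_apply, sdTwo_one_apply, sdTwo_two_apply] <;> ring

-- A positive matrix is `Bᵀ B`. In odd dimension `B` and `-B` have determinants of opposite sign, so
-- the sign can be chosen.
open scoped MatrixOrder Matrix.Norms.L2Operator in
theorem exists_mul_transpose_of_posDef {X : Matrix (Fin 3) (Fin 3) ℝ} (hX : X.PosDef) :
    ∃ C : Matrix (Fin 3) (Fin 3) ℝ, 0 < C.det ∧ X = C * C.transpose := by
  obtain ⟨B, hB⟩ : ∃ B : Matrix (Fin 3) (Fin 3) ℝ, X = B.conjTranspose * B :=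
    CStarAlgebra.nonneg_iff_eq_star_mul_self.1 hX.posSemidef.nonneg
  rw [Matrix.conjTranspose_eq_transpose_of_trivial] at hB
  have hdet : B.det ≠ 0 := by
    intro h
    have h1 := hX.det_pos
    rw [hB, Matrix.det_mul, h, mul_zero] at h1
    exact lt_irrefl _ h1
  rcases lt_or_gt_of_ne hdet with h | h
  · refine ⟨-B.transpose, ?_, ?_⟩
    · rw [Matrix.det_neg, Matrix.det_transpose]
      norm_num [h]
    · rw [hB, Matrix.transpose_neg, Matrix.transpose_transpose, neg_mul_neg]
  · exact ⟨B.transpose, by rwa [Matrix.det_transpose], by rw [hB, Matrix.transpose_transpose]⟩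

theorem form_two_add_left (β : W [⋀^Fin 2]→L[ℝ] ℝ) (x x' y : W) :
    β ![x + x', y] = β ![x, y] + β ![x', y] :=
  congrArg (fun f : W [⋀^Fin 1]→L[ℝ] ℝ => f ![y]) (insertVec_add_left x x' β)

theorem form_two_smul_left (β : W [⋀^Fin 2]→L[ℝ] ℝ) (c : ℝ) (x y : W) :
    β ![c • x, y] = c * β ![x, y] :=
  congrArg (fun f : W [⋀^Fin 1]→L[ℝ] ℝ => f ![y]) (insertVec_smul_left c x β)

theorem form_two_add_right (β : W [⋀^Fin 2]→L[ℝ] ℝ) (x y y' : W) :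
    β ![x, y + y'] = β ![x, y] + β ![x, y'] := by
  rw [form_two_swap, form_two_add_left, form_two_swap β x, form_two_swap β x]
  ring

theorem form_two_smul_right (β : W [⋀^Fin 2]→L[ℝ] ℝ) (c : ℝ) (x y : W) :
    β ![x, c • y] = c * β ![x, y] := by
  rw [form_two_swap, form_two_smul_left, form_two_swap β x]
  ring

theorem form_two_sum_right {ι : Type*} (s : Finset ι) (β : W [⋀^Fin 2]→L[ℝ] ℝ) (x : W)
    (y : ι → W) : β ![x, ∑ i ∈ s, y i] = ∑ i ∈ s, β ![x, y i] := by
  classical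
  induction s using Finset.induction_on with
  | empty => simpa using form_two_smul_right β 0 x 0
  | insert a s ha ih => rw [Finset.sum_insert ha, Finset.sum_insert ha, form_two_add_right, ih]

theorem form_two_smul_self (β : W [⋀^Fin 2]→L[ℝ] ℝ) (c : ℝ) (x : W) : β ![x, c • x] = 0 := by
  rw [form_two_smul_right, form_two_self, mul_zero]

theorem linearIndependent_of_pairing {T : Fin 3 → W [⋀^Fin 2]→L[ℝ] ℝ} {c : ℝ} (hc : c ≠ 0) {ξ : W}
    {e : Fin 3 → W} (h : ∀ i j, T i ![ξ, e j] = if i = j then c else 0) :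
    LinearIndependent ℝ (Fin.cons ξ e : Fin 4 → W) := by
  rw [Fintype.linearIndependent_iff]
  intro g hg
  rw [Fin.sum_univ_succ] at hg
  simp only [Fin.cons_zero, Fin.cons_succ] at hg
  have h1 : ∀ i : Fin 3, g i.succ = 0 := by
    intro i
    have h2 : T i ![ξ, g 0 • ξ + ∑ j : Fin 3, g j.succ • e j] = 0 := by
      rw [hg]
      simpa using form_two_smul_right (T i) 0 ξ 0
    rw [form_two_add_right, form_two_smul_self, form_two_sum_right] at h2
    simp only [form_two_smul_right, h] at h2
    simpa [hc] using h2
  have h3 : g 0 = 0 := by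
    have h4 : T 0 ![g 0 • ξ, e 0] = 0 := by
      have : g 0 • ξ = 0 := by simpa [h1] using hg
      rw [this]
      simpa using form_two_smul_left (T 0) 0 0 (e 0)
    rw [form_two_smul_left, h] at h4
    simpa [hc] using h4
  exact Fin.cases h3 h1

/-- Two-forms with pairwise wedge products `-2 δ v` take the standard values on a suitable
frame. -/
theorem exists_frame_of_wedge (hW : Module.finrank ℝ W = 4)
    {T : Fin 3 → W [⋀^Fin 2]→L[ℝ] ℝ} {v : W [⋀^Fin 4]→L[ℝ] ℝ} (hv : v ≠ 0)
    (hT : ∀ i j, (wedge (T i) (T j) : W [⋀^Fin 4]→L[ℝ] ℝ) = (if i = j then -2 else 0 : ℝ) • v) :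
    ∃ (σ : ℝ) (ξ : W) (f : Fin 3 → W), (σ = 1 ∨ σ = -1) ∧
      (∀ i j, T i ![ξ, f j] = if i = j then σ else 0) ∧
      ∀ i, T i ![f 1, f 2] = (if i = 0 then -σ else 0) ∧
        T i ![f 2, f 0] = (if i = 1 then -σ else 0) ∧
        T i ![f 0, f 1] = (if i = 2 then -σ else 0) := by
  have hfin : FiniteDimensional ℝ W := FiniteDimensional.of_finrank_pos (by omega)
  let b : Module.Basis (Fin 4) ℝ W := Module.finBasisOfFinrankEq ℝ W hW
  have hvb : v b ≠ 0 := by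
    intro h
    refine hv (ContinuousAlternatingMap.toAlternatingMap_injective ?_)
    exact (AlternatingMap.map_basis_eq_zero_iff b v.toAlternatingMap).1 h
  have hTw : ∀ i j (w : Fin 4 → W), T i ![w 0, w 1] * T j ![w 2, w 3]
      - T i ![w 0, w 2] * T j ![w 1, w 3] + T i ![w 0, w 3] * T j ![w 1, w 2]
      + T i ![w 1, w 2] * T j ![w 0, w 3] - T i ![w 1, w 3] * T j ![w 0, w 2]
      + T i ![w 2, w 3] * T j ![w 0, w 1] = (if i = j then -2 else 0 : ℝ) * v w := by
    intro i j w
    rw [← wedge_two_two_apply, hT]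
    rfl
  set H : Matrix (Fin 3) (Fin 3) ℝ := Matrix.of fun i j => T i ![b 0, b j.succ] with hH
  -- If `t H = 0`, the two-form `∑ t_i T_i` annihilates `b 0`, so its square vanishes; but this
  -- square is `-2 |t|² v`.
  have hHdet : H.det ≠ 0 := by
    intro h
    obtain ⟨t, ht, htH⟩ := Matrix.exists_vecMul_eq_zero_iff.2 h
    have h1 : ∀ j : Fin 3, t 0 * T 0 ![b 0, b j.succ] + t 1 * T 1 ![b 0, b j.succ] +
        t 2 * T 2 ![b 0, b j.succ] = 0 := by
      intro j
      have := congrFun htH j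
      rw [Matrix.vecMul, dotProduct, Fin.sum_univ_three] at this
      exact this
    have h2 := fun i j => hTw i j b
    have a1 := h1 0
    have a2 := h1 1
    have a3 := h1 2
    simp only [Fin.succ_zero_eq_one, Fin.succ_one_eq_two, show Fin.succ (2 : Fin 3) = 3 from rfl]
      at a1 a2 a3
    have h3 : (t 0 ^ 2 + t 1 ^ 2 + t 2 ^ 2) * (-2 * v b) = 0 := by
      have c00 := h2 0 0
      have c01 := h2 0 1
      have c02 := h2 0 2
      have c11 := h2 1 1
      have c12 := h2 1 2
      have c22 := h2 2 2
      simp at c00 c01 c02 c11 c12 c22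
      linear_combination (-t 0 ^ 2) * c00 - t 1 ^ 2 * c11 - t 2 ^ 2 * c22 - 2 * t 0 * t 1 * c01
        - 2 * t 0 * t 2 * c02 - 2 * t 1 * t 2 * c12
        + 2 * (t 0 * T 0 ![b 2, b 3] + t 1 * T 1 ![b 2, b 3] + t 2 * T 2 ![b 2, b 3]) * a1
        - 2 * (t 0 * T 0 ![b 1, b 3] + t 1 * T 1 ![b 1, b 3] + t 2 * T 2 ![b 1, b 3]) * a2
        + 2 * (t 0 * T 0 ![b 1, b 2] + t 1 * T 1 ![b 1, b 2] + t 2 * T 2 ![b 1, b 2]) * a3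
    have h4 : t 0 ^ 2 + t 1 ^ 2 + t 2 ^ 2 = 0 := by
      rcases mul_eq_zero.1 h3 with h | h
      · exact h
      · exact absurd (by linarith) hvb
    apply ht
    ext i
    fin_cases i <;> simp <;> nlinarith [sq_nonneg (t 0), sq_nonneg (t 1), sq_nonneg (t 2)]
  set e : Fin 3 → W := fun j => ∑ k : Fin 3, (H⁻¹) k j • b k.succ with he
  have hTe : ∀ i j, T i ![b 0, e j] = if i = j then 1 else 0 := by
    intro i j
    have h1 := congrFun (congrFun (Matrix.mul_nonsing_inv H (isUnit_iff_ne_zero.2 hHdet)) i) j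
    rw [Matrix.mul_apply, Matrix.one_apply] at h1
    rw [he, form_two_sum_right, ← h1]
    refine Finset.sum_congr rfl fun k _ => ?_
    rw [form_two_smul_right, mul_comm]
    rfl
  set l : ℝ := v ![b 0, e 0, e 1, e 2] with hl
  -- As the pairings with `b 0` are normalised, the wedge relations fix the symmetric part of the
  -- matrix of values on the planes of the `e j` and leave its skew part free.
  have hn : ∀ i j, T j (![![e 1, e 2], ![e 2, e 0], ![e 0, e 1]] i) +
      T i (![![e 1, e 2], ![e 2, e 0], ![e 0, e 1]] j) = if i = j then -2 * l else 0 := by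
    intro i j
    have h1 := hTw i j ![b 0, e 0, e 1, e 2]
    rw [show ![b 0, e 0, e 1, e 2] 0 = b 0 from rfl, show ![b 0, e 0, e 1, e 2] 1 = e 0 from rfl,
      show ![b 0, e 0, e 1, e 2] 2 = e 1 from rfl, show ![b 0, e 0, e 1, e 2] 3 = e 2 from rfl] at h1
    simp only [hTe, form_two_swap _ (e 0) (e 2)] at h1
    fin_cases i <;> fin_cases j <;> simp at h1 ⊢ <;> linarith
  have hl0 : l ≠ 0 := by
    intro h
    let b' := basisOfLinearIndependentOfCardEqFinrank
      (linearIndependent_of_pairing one_ne_zero hTe) (by simp [hW])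
    have hb' : (b' : Fin 4 → W) = ![b 0, e 0, e 1, e 2] := by
      rw [coe_basisOfLinearIndependentOfCardEqFinrank]
      ext i
      fin_cases i <;> rfl
    refine hv (ContinuousAlternatingMap.toAlternatingMap_injective ?_)
    refine (AlternatingMap.map_basis_eq_zero_iff b' v.toAlternatingMap).1 ?_
    rw [hb']
    exact h
  -- Scaling the `e j` by `q` multiplies `l` by `q²` in the symmetric part, so its absolute value
  -- can be made `1`, but not its sign; here `σ` arises.
  obtain ⟨σ, q, hσ, hql, hq, hq0⟩ : ∃ σ q : ℝ, (σ = 1 ∨ σ = -1) ∧ q ^ 2 * l = σ ∧ 0 < q ∧ q ≠ 0 := by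
    rcases lt_or_gt_of_ne hl0 with h | h
    · refine ⟨-1, (Real.sqrt (-l))⁻¹, Or.inr rfl, ?_, ?_, ?_⟩
      · rw [inv_pow, Real.sq_sqrt (by linarith)]
        field_simp
      · exact inv_pos.2 (Real.sqrt_pos.2 (by linarith))
      · exact (inv_pos.2 (Real.sqrt_pos.2 (by linarith))).ne'
    · refine ⟨1, (Real.sqrt l)⁻¹, Or.inl rfl, ?_, ?_, ?_⟩
      · rw [inv_pow, Real.sq_sqrt h.le]
        field_simp
      · exact inv_pos.2 (Real.sqrt_pos.2 h)
      · exact (inv_pos.2 (Real.sqrt_pos.2 h)).ne'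
  have n00 := hn 0 0
  have n11 := hn 1 1
  have n22 := hn 2 2
  have n01 := hn 0 1
  have n02 := hn 0 2
  have n12 := hn 1 2
  simp at n00 n11 n22 n01 n02 n12
  have hexp : ∀ i j k (c d : ℝ), T i ![q • (e j + c • b 0), q • (e k + d • b 0)] =
      q ^ 2 * (T i ![e j, e k] + c * (if i = k then 1 else 0) - d * (if i = j then 1 else 0)) := by
    intro i j k c d
    rw [form_two_smul_left, form_two_smul_right, form_two_add_left, form_two_add_right,
      form_two_smul_left, form_two_add_right, form_two_smul_right, form_two_smul_self,
      form_two_swap _ (e j) (b 0), hTe, hTe]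
    ring
  -- Adding multiples of `b 0` to the `e j` preserves the pairings with `b 0` and changes the values
  -- on the planes of the `e j` by a skew matrix; the three coefficients are those that remove the
  -- undetermined skew part.
  refine ⟨σ, (σ / q) • b 0, fun j => q • (e j + (![T 2 ![e 2, e 0], -T 2 ![e 1, e 2],
    T 1 ![e 1, e 2]] : Fin 3 → ℝ) j • b 0), hσ, fun i j => ?_, fun i => ⟨?_, ?_, ?_⟩⟩
  · rw [form_two_smul_left, form_two_smul_right, form_two_add_right, form_two_smul_self, hTe]
    split_ifs
    · field_simp
      ring
    · ring
  · rw [hexp]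
    fin_cases i <;> simp
    linear_combination (q ^ 2 / 2) * n00 - hql
  · rw [hexp]
    fin_cases i <;> simp [hq0]
    · linarith
    · linear_combination (q ^ 2 / 2) * n11 - hql
  · rw [hexp]
    fin_cases i <;> simp [hq0]
    · linarith
    · linarith
    · linear_combination (q ^ 2 / 2) * n22 - hql

/-- Two-forms with pairwise wedge products `-2 δ v` are the standard ones in a suitable coframe. -/
theorem exists_sdTwo_of_wedge (hW : Module.finrank ℝ W = 4)
    {T : Fin 3 → W [⋀^Fin 2]→L[ℝ] ℝ} {v : W [⋀^Fin 4]→L[ℝ] ℝ} (hv : v ≠ 0)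
    (hT : ∀ i j, (wedge (T i) (T j) : W [⋀^Fin 4]→L[ℝ] ℝ) = (if i = j then -2 else 0 : ℝ) • v) :
    ∃ (σ : ℝ) (h : W ≃L[ℝ] (Fin 4 → ℝ)), (σ = 1 ∨ σ = -1) ∧
      ∀ j, T j = σ • sdTwo (fun m => (ContinuousLinearMap.proj m).comp (h : W →L[ℝ] Fin 4 → ℝ)) j := by
  obtain ⟨σ, ξ, f, hσ, h1, h2⟩ := exists_frame_of_wedge hW hv hT
  have hfin : FiniteDimensional ℝ W := FiniteDimensional.of_finrank_pos (by omega)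
  have hσ0 : σ ≠ 0 := by rcases hσ with h | h <;> rw [h] <;> norm_num
  let b := basisOfLinearIndependentOfCardEqFinrank
      (linearIndependent_of_pairing hσ0 h1) (by simp [hW])
  have hb : ∀ i, b i = ![ξ, f 0, f 1, f 2] i := by
    intro i
    rw [coe_basisOfLinearIndependentOfCardEqFinrank]
    fin_cases i <;> rfl
  refine ⟨σ, b.equivFun.toContinuousLinearEquiv, hσ, fun j => ?_⟩
  have hh : ∀ m i, ((ContinuousLinearMap.proj m).comp
      (b.equivFun.toContinuousLinearEquiv : W →L[ℝ] Fin 4 → ℝ)) (b i) =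
      if i = m then 1 else 0 := by
    intro m i
    simp [Finsupp.single_apply]
  refine ContinuousAlternatingMap.toAlternatingMap_injective
    (Module.Basis.ext_alternating b fun r _ => ?_)
  change T j (fun i => b (r i)) = σ • sdTwo _ j (fun i => b (r i))
  rw [form_two_apply (T j), form_two_apply (sdTwo _ j)]
  generalize r 0 = p
  generalize r 1 = p'
  have hs : ∀ j k, T j ![f k, ξ] = - if j = k then σ else 0 := fun j k => by
    rw [form_two_swap, h1]
  have h3 : ∀ j, T j ![f 2, f 1] = - if j = 0 then -σ else 0 := fun j => by
    rw [form_two_swap, (h2 j).1]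
  have h4 : ∀ j, T j ![f 0, f 2] = - if j = 1 then -σ else 0 := fun j => by
    rw [form_two_swap, (h2 j).2.1]
  have h5 : ∀ j, T j ![f 1, f 0] = - if j = 2 then -σ else 0 := fun j => by
    rw [form_two_swap, (h2 j).2.2]
  have h6 := fun j => (h2 j).1
  have h7 := fun j => (h2 j).2.1
  have h8 := fun j => (h2 j).2.2
  fin_cases j
  · refine Eq.trans ?_ (congrArg (σ • ·) (sdTwo_zero_apply _ _ _).symm)
    simp only [hh]
    rw [hb, hb]
    fin_cases p <;> fin_cases p' <;>
      simp [h1, hs, h3, h4, h5, h6, h7, h8, form_two_self]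
  · refine Eq.trans ?_ (congrArg (σ • ·) (sdTwo_one_apply _ _ _).symm)
    simp only [hh]
    rw [hb, hb]
    fin_cases p <;> fin_cases p' <;>
      simp [h1, hs, h3, h4, h5, h6, h7, h8, form_two_self]
  · refine Eq.trans ?_ (congrArg (σ • ·) (sdTwo_two_apply _ _ _).symm)
    simp only [hh]
    rw [hb, hb]
    fin_cases p <;> fin_cases p' <;>
      simp [h1, hs, h3, h4, h5, h6, h7, h8, form_two_self]

/-- The normal form of a definite triple of two-forms in dimension four. -/
theorem exists_normal_form (hW : Module.finrank ℝ W = 4)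
    {F : Fin 3 → W [⋀^Fin 2]→L[ℝ] ℝ} {v : W [⋀^Fin 4]→L[ℝ] ℝ} (hv : v ≠ 0)
    {X : Matrix (Fin 3) (Fin 3) ℝ} (hX : IsWedgeMatrix v F X) (hpos : X.PosDef) :
    ∃ (σ : ℝ) (C : Matrix (Fin 3) (Fin 3) ℝ) (h : W ≃L[ℝ] (Fin 4 → ℝ)), (σ = 1 ∨ σ = -1) ∧
      0 < C.det ∧ ∀ i, F i = ∑ j, (σ * C i j) •
        sdTwo (fun m => (ContinuousLinearMap.proj m).comp (h : W →L[ℝ] Fin 4 → ℝ)) j := by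
  obtain ⟨C, hC, hXC⟩ := exists_mul_transpose_of_posDef hpos
  have hu : IsUnit C.det := isUnit_iff_ne_zero.2 hC.ne'
  -- The triple `C⁻¹ F` has wedge matrix `C⁻¹ X C⁻ᵀ = 1`.
  have hT : ∀ i j, (wedge (∑ k, C⁻¹ i k • F k) (∑ k, C⁻¹ j k • F k) : W [⋀^Fin 4]→L[ℝ] ℝ) =
      (if i = j then -2 else 0 : ℝ) • v := by
    intro i j
    have h1 : C⁻¹ * X * C⁻¹.transpose = 1 := by
      rw [hXC, ← mul_assoc, Matrix.nonsing_inv_mul _ hu, one_mul, ← Matrix.transpose_mul,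
        Matrix.nonsing_inv_mul _ hu, Matrix.transpose_one]
    have h2 := congrFun (congrFun h1 i) j
    rw [Matrix.mul_apply, Matrix.one_apply] at h2
    simp only [Matrix.mul_apply, Matrix.transpose_apply, Finset.sum_mul] at h2
    rw [wedge_sum_left]
    simp only [wedge_sum_right, wedge_smul_left, wedge_smul_right]
    have h3 : ∀ k l, (wedge (F k) (F l) : W [⋀^Fin 4]→L[ℝ] ℝ) = (-2 * X k l) • v := hX
    refine (Finset.sum_congr rfl fun k _ => Finset.sum_congr rfl fun l _ =>
      congrArg (fun t => C⁻¹ j l • C⁻¹ i k • t) (h3 k l)).trans ?_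
    simp only [smul_smul, ← Finset.sum_smul]
    congr 1
    rw [Finset.sum_comm] at h2
    rw [show (if i = j then -2 else 0 : ℝ) = -2 * if i = j then 1 else 0 by split_ifs <;> simp,
      ← h2, Finset.mul_sum]
    refine Finset.sum_congr rfl fun k _ => ?_
    rw [Finset.mul_sum]
    refine Finset.sum_congr rfl fun l _ => ?_
    ring
  obtain ⟨σ, h, hσ, hT'⟩ := exists_sdTwo_of_wedge hW hv hT
  refine ⟨σ, C, h, hσ, hC, fun i => ?_⟩
  have h4 : F i = ∑ j, C i j • ∑ k, C⁻¹ j k • F k := by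
    simp only [Finset.smul_sum, smul_smul]
    rw [Finset.sum_comm]
    simp only [← Finset.sum_smul]
    have h5 := Matrix.mul_nonsing_inv _ hu
    have h6 : ∀ k, ∑ j, C i j * C⁻¹ j k = if i = k then 1 else 0 := fun k => by
      rw [← Matrix.mul_apply, h5, Matrix.one_apply]
    simp [h6]
  rw [h4]
  refine Finset.sum_congr rfl fun j _ => ?_
  rw [hT', smul_smul, mul_comm]

end NormalForm

/-! ### The calibrating form and its dual in an adapted coframe -/

section AdaptedCoframe

variable {V W : Type*} [NormedAddCommGroup V] [NormedSpace ℝ V] [NormedAddCommGroup W]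
  [NormedSpace ℝ W]

theorem wedge_oneForm_oneForm (a b : V →L[ℝ] ℝ) :
    (wedge (oneForm a) (oneForm b) : V [⋀^Fin 2]→L[ℝ] ℝ) = detForm ![a, b] := by
  refine ContinuousAlternatingMap.ext fun v => ?_
  rw [wedge_one_one_apply, detForm_two_apply]

theorem wedge_wedge_oneForm (a b : V →L[ℝ] ℝ) (β : V [⋀^Fin 2]→L[ℝ] ℝ) :
    (wedge (wedge (oneForm a) (oneForm b)) β : V [⋀^Fin 4]→L[ℝ] ℝ) = wedge (detForm ![a, b]) β :=
  congrArg (fun w : V [⋀^Fin 2]→L[ℝ] ℝ => (wedge w β : V [⋀^Fin 4]→L[ℝ] ℝ))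
    (wedge_oneForm_oneForm a b)

theorem eps_eq (i j k : Fin 3) : eps i j k = (((j : ℤ) - i) * (k - i) * (k - j) / 2 : ℤ) := by
  fin_cases i <;> fin_cases j <;> fin_cases k <;> norm_num [eps]

theorem sum_eps_smul {E : Type*} [AddCommGroup E] [Module ℝ E] (g : Fin 3 → Fin 3 → Fin 3 → E) :
    ∑ i, ∑ j, ∑ k, eps i j k • g i j k =
      g 0 1 2 - g 0 2 1 + g 1 2 0 - g 1 0 2 + g 2 0 1 - g 2 1 0 := by
  simp only [Fin.sum_univ_three, eps_eq]
  simp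
  abel

theorem wedge_three_oneForm (a b c : V →L[ℝ] ℝ) :
    (wedge (wedge (oneForm a) (oneForm b)) (oneForm c) : V [⋀^Fin 3]→L[ℝ] ℝ) =
      detForm ![a, b, c] := by
  refine ContinuousAlternatingMap.ext fun v => ?_
  refine (wedge_two_one_apply (wedge (oneForm a) (oneForm b)) c v).trans ?_
  have h := fun x y : V => wedge_one_one_apply a b ![x, y]
  refine (congrArg₂ (· + ·) (congrArg₂ (· - ·) (congrArg (c (v 0) * ·) (h _ _))
    (congrArg (c (v 1) * ·) (h _ _))) (congrArg (c (v 2) * ·) (h _ _))).trans ?_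
  rw [detForm_three_apply]
  simp
  ring

theorem sum_eps_wedge (θ : Fin 3 → V →L[ℝ] ℝ) :
    ∑ i, ∑ j, ∑ k, eps i j k •
      (wedge (wedge (oneForm (θ i)) (oneForm (θ j))) (oneForm (θ k)) : V [⋀^Fin 3]→L[ℝ] ℝ) =
      (6 : ℝ) • detForm ![θ 0, θ 1, θ 2] := by
  refine (Finset.sum_congr rfl fun i _ => Finset.sum_congr rfl fun j _ => Finset.sum_congr rfl
    fun k _ => congrArg (eps i j k • ·) (wedge_three_oneForm (θ i) (θ j) (θ k))).trans ?_
  refine (sum_eps_smul fun i j k => detForm ![θ i, θ j, θ k]).trans ?_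
  refine ContinuousAlternatingMap.ext fun v => ?_
  simp only [ContinuousAlternatingMap.sub_apply, ContinuousAlternatingMap.add_apply,
    ContinuousAlternatingMap.smul_apply, detForm_three_apply, smul_eq_mul]
  ring

/-- The seven functionals of a coframe adapted to a splitting `3 + 4`. -/
def splitCoframe (e : Fin 3 → V →L[ℝ] ℝ) (h : Fin 4 → V →L[ℝ] ℝ) : Fin 7 → V →L[ℝ] ℝ :=
  ![e 0, e 1, h 1, e 2, h 3, h 2, -h 0]

/-- The line `{0, 1, 3}` carries the three functionals `e`; each of the six other lines contains one
`e` and two `h`. The labels of the `h m` and the sign of `h 0` are chosen so that these six terms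
form the standard triple. -/
theorem stdThreeForm_splitCoframe (e : Fin 3 → V →L[ℝ] ℝ) (h : Fin 4 → V →L[ℝ] ℝ) :
    stdThreeForm.compContinuousLinearMap (ContinuousLinearMap.pi (splitCoframe e h)) =
      detForm ![e 0, e 1, e 2] +
        ∑ j, (wedge (oneForm (e j)) (sdTwo h j) : V [⋀^Fin 3]→L[ℝ] ℝ) := by
  refine ContinuousAlternatingMap.ext fun v => ?_
  rw [ContinuousAlternatingMap.compContinuousLinearMap_apply, stdThreeForm,
    ContinuousAlternatingMap.add_apply, ContinuousAlternatingMap.sum_apply, ContinuousAlternatingMap.sum_apply]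
  simp only [Fin.sum_univ_seven, Fin.sum_univ_three, wedge_one_two_apply, sdTwo_zero_apply,
    sdTwo_one_apply, sdTwo_two_apply, detForm_three_apply, coord7_apply, Function.comp_apply,
    ContinuousLinearMap.pi_apply]
  simp [splitCoframe]
  ring

theorem stdFourForm_comp_pi (f : Fin 7 → V →L[ℝ] ℝ) :
    stdFourForm.compContinuousLinearMap (ContinuousLinearMap.pi f) =
      ∑ i, detForm ![f (i + 2), f (i + 4), f (i + 5), f (i + 6)] := by
  have h : ∀ a b c d : Fin 7,
      (detForm ![coord7 a, coord7 b, coord7 c, coord7 d]).compContinuousLinearMap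
        (ContinuousLinearMap.pi f) = detForm ![f a, f b, f c, f d] := by
    intro a b c d
    rw [detForm_compContinuousLinearMap]
    congr 1
    ext i v
    fin_cases i <;> rfl
  simp only [← h]
  refine ContinuousAlternatingMap.ext fun v => ?_
  rw [ContinuousAlternatingMap.compContinuousLinearMap_apply, stdFourForm,
    ContinuousAlternatingMap.sum_apply, ContinuousAlternatingMap.sum_apply]
  rfl

set_option maxRecDepth 20000 in
theorem stdFourForm_splitCoframe (e : Fin 3 → V →L[ℝ] ℝ) (h : Fin 4 → V →L[ℝ] ℝ) :
    stdFourForm.compContinuousLinearMap (ContinuousLinearMap.pi (splitCoframe e h)) =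
      (wedge (wedge (oneForm (e 1)) (oneForm (e 2))) (sdTwo h 0) : V [⋀^Fin 4]→L[ℝ] ℝ) +
      (wedge (wedge (oneForm (e 2)) (oneForm (e 0))) (sdTwo h 1) : V [⋀^Fin 4]→L[ℝ] ℝ) +
      (wedge (wedge (oneForm (e 0)) (oneForm (e 1))) (sdTwo h 2) : V [⋀^Fin 4]→L[ℝ] ℝ) -
      detForm h := by
  have hf : ∀ f : Fin 7 → V →L[ℝ] ℝ,
      ∑ i : Fin 7, detForm ![f (i + 2), f (i + 4), f (i + 5), f (i + 6)] =
      detForm ![f 2, f 4, f 5, f 6] + detForm ![f 3, f 5, f 6, f 0] +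
      detForm ![f 4, f 6, f 0, f 1] + detForm ![f 5, f 0, f 1, f 2] +
      detForm ![f 6, f 1, f 2, f 3] + detForm ![f 0, f 2, f 3, f 4] +
      detForm ![f 1, f 3, f 4, f 5] := fun f => Fin.sum_univ_seven _
  rw [stdFourForm_comp_pi, hf]
  rw [show splitCoframe e h 0 = e 0 from rfl, show splitCoframe e h 1 = e 1 from rfl,
    show splitCoframe e h 2 = h 1 from rfl, show splitCoframe e h 3 = e 2 from rfl,
    show splitCoframe e h 4 = h 3 from rfl, show splitCoframe e h 5 = h 2 from rfl,
    show splitCoframe e h 6 = -h 0 from rfl]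
  refine ContinuousAlternatingMap.ext fun (v : Fin 4 → V) => ?_
  rw [ContinuousAlternatingMap.sub_apply, ContinuousAlternatingMap.add_apply,
    ContinuousAlternatingMap.add_apply]
  simp only [ContinuousAlternatingMap.add_apply, wedge_two_two_apply, sdTwo_zero_apply,
    sdTwo_one_apply, sdTwo_two_apply, wedge_oneForm_oneForm, detForm_four_apply, detForm_two_apply,
    detFour]
  rw [show detForm h v = _ from detForm_four_apply h v, detFour]
  simp only [Matrix.cons_val, neg_apply]
  generalize v 0 = v0
  generalize v 1 = v1
  generalize v 2 = v2
  generalize v 3 = v3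
  ring

theorem sdTwo_smul (c : ℝ) (h : Fin 4 → V →L[ℝ] ℝ) (j : Fin 3) :
    sdTwo (fun m => c • h m) j = (c * c) • sdTwo h j := by
  refine ContinuousAlternatingMap.ext fun v => ?_
  rw [ContinuousAlternatingMap.smul_apply, form_two_apply (sdTwo _ j), form_two_apply (sdTwo h j)]
  fin_cases j
  · refine (sdTwo_zero_apply _ _ _).trans ((congrArg ((c * c) • ·) (sdTwo_zero_apply _ _ _)).trans ?_).symm
    simp
    ring
  · refine (sdTwo_one_apply _ _ _).trans ((congrArg ((c * c) • ·) (sdTwo_one_apply _ _ _)).trans ?_).symm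
    simp
    ring
  · refine (sdTwo_two_apply _ _ _).trans ((congrArg ((c * c) • ·) (sdTwo_two_apply _ _ _)).trans ?_).symm
    simp
    ring

theorem sdTwo_comp (h : Fin 4 → W →L[ℝ] ℝ) (L : V →L[ℝ] W) (j : Fin 3) :
    (sdTwo h j).compContinuousLinearMap L = sdTwo (fun m => (h m).comp L) j := by
  refine ContinuousAlternatingMap.ext fun v => ?_
  rw [ContinuousAlternatingMap.compContinuousLinearMap_apply, form_two_apply (sdTwo _ j),
    form_two_apply (sdTwo _ j)]
  fin_cases j
  · exact (sdTwo_zero_apply _ _ _).trans (sdTwo_zero_apply _ _ _).symm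
  · exact (sdTwo_one_apply _ _ _).trans (sdTwo_one_apply _ _ _).symm
  · exact (sdTwo_two_apply _ _ _).trans (sdTwo_two_apply _ _ _).symm

theorem form_eq_sum_apply {n : ℕ} {ι : Type*} (s : Finset ι) (c : ι → ℝ)
    (f : ι → V [⋀^Fin n]→L[ℝ] ℝ) (v : Fin n → V) :
    (∑ i ∈ s, c i • f i) v = ∑ i ∈ s, c i * f i v := by
  rw [ContinuousAlternatingMap.sum_apply]
  rfl

/-- The three-form of a triple of one-forms and a triple of two-forms in normal form is the
standard three-form in an adapted coframe. -/
theorem stdThreeForm_adapted (θ : Fin 3 → V →L[ℝ] ℝ) (h : Fin 4 → V →L[ℝ] ℝ)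
    (C : Matrix (Fin 3) (Fin 3) ℝ) {p t σ c : ℝ} (hp : p ≠ 0) (ht : t ≠ 0) (hσ : σ * σ = 1)
    (hd : C.det = t ^ 3) (hc : c * c = 2 * p ^ 2 * t) {F : Fin 3 → V [⋀^Fin 2]→L[ℝ] ℝ}
    (hF : ∀ i, F i = ∑ j, (σ * C i j) • sdTwo h j) :
    stdThreeForm.compContinuousLinearMap (ContinuousLinearMap.pi
      (splitCoframe (fun j => ∑ i, (C i j / (p * t)) • θ i) fun m => c • h m)) =
      (p ^ 3)⁻¹ • detForm ![θ 0, θ 1, θ 2] +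
        (2 * σ * p) • ∑ i, (wedge (oneForm (θ i)) (F i) : V [⋀^Fin 3]→L[ℝ] ℝ) := by
  rw [stdThreeForm_splitCoframe]
  refine ContinuousAlternatingMap.ext fun v => ?_
  have hFv : ∀ i x y, F i ![x, y] = σ * ∑ j, C i j * sdTwo h j ![x, y] := by
    intro i x y
    rw [hF, form_eq_sum_apply, Finset.mul_sum]
    exact Finset.sum_congr rfl fun j _ => by ring
  -- Two-forms scale with `c² = 2 p² t`, and `C / (p t) · 2 p² t = 2 p C` is the coefficient
  -- required in the mixed term. The purely vertical term has the factor `det C / (p t)³ = p⁻³`.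
  have hS : ∀ j x y, sdTwo (fun m => c • h m) j ![x, y] = (2 * p ^ 2 * t) * sdTwo h j ![x, y] := by
    intro j x y
    rw [sdTwo_smul, hc]
    rfl
  rw [ContinuousAlternatingMap.add_apply, ContinuousAlternatingMap.add_apply,
    ContinuousAlternatingMap.smul_apply, ContinuousAlternatingMap.smul_apply,
    ContinuousAlternatingMap.sum_apply, ContinuousAlternatingMap.sum_apply]
  have hdet : detForm ![∑ i, (C i 0 / (p * t)) • θ i, ∑ i, (C i 1 / (p * t)) • θ i,
      ∑ i, (C i 2 / (p * t)) • θ i] v = (p ^ 3)⁻¹ * detForm ![θ 0, θ 1, θ 2] v := by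
    have h1 := detForm_sum_smul ((p * t)⁻¹ • C.transpose) ![θ 0, θ 1, θ 2]
      ![∑ i, (C i 0 / (p * t)) • θ i, ∑ i, (C i 1 / (p * t)) • θ i,
      ∑ i, (C i 2 / (p * t)) • θ i] (fun i u => by
        fin_cases i <;> simp [Fin.sum_univ_three] <;> ring)
    rw [h1, Matrix.det_smul, Matrix.det_transpose, hd, ContinuousAlternatingMap.smul_apply]
    simp only [Fintype.card_fin, smul_eq_mul]
    field_simp
  rw [hdet]
  simp only [smul_eq_mul]
  congr 1
  simp only [wedge_one_two_apply, hS, hFv, Fin.sum_univ_three, add_apply,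
    smul_apply, smul_eq_mul]
  field_simp
  rw [show σ ^ 2 = 1 by rw [sq, hσ]]
  ring

/-- Products of two linear combinations have minors of `C` as coefficients. So the dual four-form
involves the adjugate, that is, the inverse matrix of `C` up to its determinant. -/
theorem adjugate_mul_detForm (θ : Fin 3 → V →L[ℝ] ℝ) (C : Matrix (Fin 3) (Fin 3) ℝ) (q : ℝ)
    (l : Fin 3) :
    detForm ![∑ i, (C i (l + 1) / q) • θ i, ∑ i, (C i (l + 2) / q) • θ i] =
      ∑ m, (C.adjugate l m / (q * q)) • detForm ![θ (m + 1), θ (m + 2)] := by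
  refine ContinuousAlternatingMap.ext fun v => ?_
  rw [form_eq_sum_apply, detForm_two_apply, Matrix.adjugate_fin_three]
  simp only [Fin.sum_univ_three, add_apply, smul_apply, smul_eq_mul, detForm_two_apply]
  fin_cases l <;> simp <;> ring

theorem wedge_sum_smul_left {p q : ℕ} {ι : Type*} (s : Finset ι) (c : ι → ℝ)
    (α : ι → V [⋀^Fin p]→L[ℝ] ℝ) (β : V [⋀^Fin q]→L[ℝ] ℝ) :
    wedge (∑ i ∈ s, c i • α i) β = ∑ i ∈ s, c i • wedge (α i) β := by
  rw [wedge_sum_left]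
  exact Finset.sum_congr rfl fun i _ => wedge_smul_left _ _ _

theorem wedge_sum_smul_right {p q : ℕ} {ι : Type*} (s : Finset ι) (c : ι → ℝ)
    (α : V [⋀^Fin p]→L[ℝ] ℝ) (β : ι → V [⋀^Fin q]→L[ℝ] ℝ) :
    wedge α (∑ i ∈ s, c i • β i) = ∑ i ∈ s, c i • wedge α (β i) := by
  rw [wedge_sum_right]
  exact Finset.sum_congr rfl fun i _ => wedge_smul_right _ _ _

/-- Here `B` is the triple `(det X)^{1/3} X⁻¹ F` in normal form (`detField_normal_form`): the minors
in the vertical factors turn `F` into `B`. The horizontal term `-c⁴ h⁰¹²³ = -4 p⁴ t² h⁰¹²³` is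
rewritten through `∑ B ∧ F = -6 t² h⁰¹²³`. In this form the field equation for `B` governs
co-closedness. -/
theorem stdFourForm_adapted (θ : Fin 3 → V →L[ℝ] ℝ) (h : Fin 4 → V →L[ℝ] ℝ)
    (C : Matrix (Fin 3) (Fin 3) ℝ) {p t σ c : ℝ} (hp : p ≠ 0) (ht : t ≠ 0) (hσ : σ * σ = 1)
    (hd : C.det = t ^ 3) (hc : c * c = 2 * p ^ 2 * t) {F B : Fin 3 → V [⋀^Fin 2]→L[ℝ] ℝ}
    (hF : ∀ i, F i = ∑ j, (σ * C i j) • sdTwo h j)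
    (hB : ∀ m, B m = ∑ l, (σ * C.adjugate l m / t) • sdTwo h l) :
    stdFourForm.compContinuousLinearMap (ContinuousLinearMap.pi
      (splitCoframe (fun j => ∑ i, (C i j / (p * t)) • θ i) fun m => c • h m)) =
      (2 * σ) • ∑ m, (wedge (detForm ![θ (m + 1), θ (m + 2)]) (B m) : V [⋀^Fin 4]→L[ℝ] ℝ) +
        (2 / 3 * p ^ 4) • ∑ m, (wedge (B m) (F m) : V [⋀^Fin 4]→L[ℝ] ℝ) := by
  rw [stdFourForm_splitCoframe]
  refine ContinuousAlternatingMap.ext fun v => ?_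
  set K : Fin 3 → Fin 3 → ℝ := fun m l =>
    (wedge (detForm ![θ (m + 1), θ (m + 2)]) (sdTwo h l) : V [⋀^Fin 4]→L[ℝ] ℝ) v with hK
  have h1 : ∀ l : Fin 3, (wedge (wedge (oneForm (∑ i, (C i (l + 1) / (p * t)) • θ i))
      (oneForm (∑ i, (C i (l + 2) / (p * t)) • θ i))) (sdTwo (fun m => c • h m) l) :
      V [⋀^Fin 4]→L[ℝ] ℝ) v = (2 / t) * ∑ m, C.adjugate l m * K m l := by
    intro l
    refine (congrArg (fun f : V [⋀^Fin 4]→L[ℝ] ℝ => f v) (wedge_wedge_oneForm _ _ _)).trans ?_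
    rw [adjugate_mul_detForm, sdTwo_smul, wedge_smul_right, wedge_sum_smul_left, hc,
      ContinuousAlternatingMap.smul_apply, form_eq_sum_apply, smul_eq_mul, Finset.mul_sum,
      Finset.mul_sum]
    refine Finset.sum_congr rfl fun m _ => ?_
    simp only [hK]
    field_simp
  have h3 : ∀ m, (wedge (detForm ![θ (m + 1), θ (m + 2)]) (B m) : V [⋀^Fin 4]→L[ℝ] ℝ) v =
      (σ / t) * ∑ l, C.adjugate l m * K m l := by
    intro m
    rw [hB, wedge_sum_smul_right, form_eq_sum_apply, Finset.mul_sum]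
    refine Finset.sum_congr rfl fun l _ => ?_
    simp only [hK]
    ring
  have h4 : ∀ m, (wedge (B m) (F m) : V [⋀^Fin 4]→L[ℝ] ℝ) v =
      (-2 / t) * (∑ l, C.adjugate l m * C m l) * detForm h v := by
    intro m
    rw [hB, hF, wedge_sum_smul_left, form_eq_sum_apply, Finset.mul_sum, Finset.sum_mul]
    refine Finset.sum_congr rfl fun l _ => ?_
    rw [wedge_sum_smul_right, form_eq_sum_apply]
    have h5 : ∀ j, (wedge (sdTwo h l) (sdTwo h j) : V [⋀^Fin 4]→L[ℝ] ℝ) v =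
        (if l = j then -2 else 0) * detForm h v := fun j => by
      rw [wedge_sdTwo]
      rfl
    refine (congrArg _ (Finset.sum_congr rfl fun j _ => congrArg _ (h5 j))).trans ?_
    simp only [ite_mul, zero_mul, mul_ite, mul_zero, Finset.sum_ite_eq, Finset.mem_univ, if_true]
    linear_combination (C.adjugate l m / t * C m l * (-2) * detForm h v) * hσ
  have h6 : ∑ m, ∑ l, C.adjugate l m * C m l = 3 * t ^ 3 := by
    have h7 := Matrix.adjugate_mul C
    have h8 : ∀ l, ∑ m, C.adjugate l m * C m l = t ^ 3 := fun l => by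
      rw [← Matrix.mul_apply, h7, hd]
      simp
    rw [Finset.sum_comm]
    simp [h8]
  have h9 : detForm (fun m => c • h m) v = (2 * p ^ 2 * t) ^ 2 * detForm h v := by
    rw [← hc]
    simp only [detForm_four_apply, detFour, smul_apply, smul_eq_mul]
    ring
  rw [ContinuousAlternatingMap.sub_apply, ContinuousAlternatingMap.add_apply,
    ContinuousAlternatingMap.add_apply, ContinuousAlternatingMap.add_apply,
    ContinuousAlternatingMap.smul_apply, ContinuousAlternatingMap.smul_apply,
    ContinuousAlternatingMap.sum_apply, ContinuousAlternatingMap.sum_apply, h9]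
  have e0 := h1 0
  have e1 := h1 1
  have e2 := h1 2
  simp only [zero_add, show (1 : Fin 3) + 1 = 2 from rfl, show (1 : Fin 3) + 2 = 0 from rfl,
    show (2 : Fin 3) + 1 = 0 from rfl, show (2 : Fin 3) + 2 = 1 from rfl] at e0 e1 e2
  refine (congrArg (· - (2 * p ^ 2 * t) ^ 2 * detForm h v)
    (congrArg₂ (· + ·) (congrArg₂ (· + ·) e0 e1) e2)).trans ?_
  have h10 : ∑ m, (wedge (B m) (F m) : V [⋀^Fin 4]→L[ℝ] ℝ) v = -6 * t ^ 2 * detForm h v := by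
    refine (Finset.sum_congr rfl fun m _ => h4 m).trans ?_
    rw [← Finset.sum_mul, ← Finset.mul_sum, h6]
    field_simp
    ring
  have h11 : ∑ m, (wedge (detForm ![θ (m + 1), θ (m + 2)]) (B m) : V [⋀^Fin 4]→L[ℝ] ℝ) v =
      (σ / t) * ∑ l, ∑ m, C.adjugate l m * K m l := by
    refine (Finset.sum_congr rfl fun m _ => h3 m).trans ?_
    rw [← Finset.mul_sum, Finset.sum_comm]
  refine Eq.trans ?_ (congrArg₂ (fun x y => (2 * σ) • x + (2 / 3 * p ^ 4) • y) h11 h10).symm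
  simp only [smul_eq_mul]
  rw [Fin.sum_univ_three (fun l => ∑ m, C.adjugate l m * K m l)]
  linear_combination (-2 / t * (∑ m, C.adjugate 0 m * K m 0 + ∑ m, C.adjugate 1 m * K m 1 +
    ∑ m, C.adjugate 2 m * K m 2)) * hσ

end AdaptedCoframe

/-! ### The real cube root and scale invariance -/

section CubeRoot

theorem cubeRoot_mul_cube (κ d : ℝ) : cubeRoot (κ ^ 3 * d) = κ * cubeRoot d := by
  have h3 : (3 : ℕ) ≠ 0 := by norm_num
  have h : |κ ^ 3 * d| ^ (1 / 3 : ℝ) = |κ| * |d| ^ (1 / 3 : ℝ) := by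
    rw [abs_mul, abs_pow, Real.mul_rpow (by positivity) (by positivity), ← Real.rpow_natCast,
      ← Real.rpow_mul (abs_nonneg _)]
    norm_num
  rw [cubeRoot, cubeRoot, h, sign_mul, sign_pow]
  rcases lt_trichotomy κ 0 with hκ | hκ | hκ
  · simp [sign_neg hκ, abs_of_neg hκ]
    ring
  · simp [hκ]
  · simp [sign_pos hκ, abs_of_pos hκ]
    ring

theorem cubeRoot_cube (κ : ℝ) : cubeRoot (κ ^ 3) = κ := by
  have h := cubeRoot_mul_cube κ 1
  rw [mul_one] at h
  rw [h]
  simp [cubeRoot]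

/-- The matrix `(det Y)^{1/3} Y⁻¹` does not change when `Y` is multiplied by a scalar. -/
theorem cubeRoot_det_smul_inv (Y : Matrix (Fin 3) (Fin 3) ℝ) {κ : ℝ} (hκ : κ ≠ 0) :
    cubeRoot (κ • Y).det • (κ • Y)⁻¹ = cubeRoot Y.det • Y⁻¹ := by
  rw [Matrix.det_smul, Fintype.card_fin, cubeRoot_mul_cube]
  by_cases hY : IsUnit Y.det
  · have h1 : (κ • Y)⁻¹ = κ⁻¹ • Y⁻¹ := Matrix.inv_smul' (A := Y) (Units.mk0 κ hκ) hY
    rw [h1, smul_smul]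
    congr 1
    field_simp
  · have h1 : Y.det = 0 := by
      by_contra h
      exact hY (isUnit_iff_ne_zero.2 h)
    simp [h1, cubeRoot]

theorem contDiffAt_cubeRoot {t : ℝ} (ht : t ≠ 0) : ContDiffAt ℝ ∞ cubeRoot t := by
  rcases lt_or_gt_of_ne ht with h | h
  · have h1 : ContDiffAt ℝ ∞ (fun x : ℝ => -(-x) ^ (1 / 3 : ℝ)) t :=
      ((contDiffAt_id.neg).rpow_const_of_ne (by simpa using ht)).neg
    refine h1.congr_of_eventuallyEq ?_
    filter_upwards [gt_mem_nhds h] with x hx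
    simp [cubeRoot, sign_neg hx, abs_of_neg hx]
  · have h1 : ContDiffAt ℝ ∞ (fun x : ℝ => x ^ (1 / 3 : ℝ)) t :=
      contDiffAt_id.rpow_const_of_ne ht
    refine h1.congr_of_eventuallyEq ?_
    filter_upwards [lt_mem_nhds h] with x hx
    simp [cubeRoot, sign_pos hx, abs_of_pos hx]

end CubeRoot

/-! ### The sign of a triple, the triple `(det X)^{1/3} X⁻¹ F`, and adapted isomorphisms -/

section Urbantke

variable {V W : Type*} [NormedAddCommGroup V] [NormedSpace ℝ V] [NormedAddCommGroup W]
  [NormedSpace ℝ W]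

theorem insertVec_two_eq (ξ : W) (β : W [⋀^Fin 2]→L[ℝ] ℝ) :
    ∃ a : W →L[ℝ] ℝ, insertVec ξ β = oneForm a ∧ ∀ x, a x = β ![ξ, x] := by
  refine ⟨(ContinuousAlternatingMap.ofSubsingleton ℝ W ℝ (0 : Fin 1)).symm (insertVec ξ β),
    by simp [oneForm], fun x => ?_⟩
  change insertVec ξ β (fun _ => x) = _
  rw [insertVec_apply]
  refine congrArg β ?_
  ext i
  fin_cases i <;> rfl

theorem wedge_insertVec_apply (α β γ : W [⋀^Fin 2]→L[ℝ] ℝ) (ξ : W) (w : Fin 4 → W) :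
    (wedge (wedge (insertVec ξ α) (insertVec ξ β)) γ : W [⋀^Fin 4]→L[ℝ] ℝ) w =
      (α ![ξ, w 0] * β ![ξ, w 1] - α ![ξ, w 1] * β ![ξ, w 0]) * γ ![w 2, w 3]
      - (α ![ξ, w 0] * β ![ξ, w 2] - α ![ξ, w 2] * β ![ξ, w 0]) * γ ![w 1, w 3]
      + (α ![ξ, w 0] * β ![ξ, w 3] - α ![ξ, w 3] * β ![ξ, w 0]) * γ ![w 1, w 2]
      + (α ![ξ, w 1] * β ![ξ, w 2] - α ![ξ, w 2] * β ![ξ, w 1]) * γ ![w 0, w 3]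
      - (α ![ξ, w 1] * β ![ξ, w 3] - α ![ξ, w 3] * β ![ξ, w 1]) * γ ![w 0, w 2]
      + (α ![ξ, w 2] * β ![ξ, w 3] - α ![ξ, w 3] * β ![ξ, w 2]) * γ ![w 0, w 1] := by
  obtain ⟨a, ha, ha'⟩ := insertVec_two_eq ξ α
  obtain ⟨b, hb, hb'⟩ := insertVec_two_eq ξ β
  rw [ha, hb]
  refine (congrArg (fun f : W [⋀^Fin 4]→L[ℝ] ℝ => f w) (wedge_wedge_oneForm _ _ _)).trans ?_
  rw [wedge_two_two_apply]
  simp only [detForm_two_apply, ← ha', ← hb']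
  rfl

theorem urbantke_apply (F : Fin 3 → W [⋀^Fin 2]→L[ℝ] ℝ) (ξ : W) (w : Fin 4 → W) :
    urbantke F ξ ξ w = ∑ i, ∑ j, ∑ k, eps i j k •
      (wedge (wedge (insertVec ξ (F i)) (insertVec ξ (F j))) (F k) : W [⋀^Fin 4]→L[ℝ] ℝ) w := by
  simp only [urbantke, ContinuousAlternatingMap.sum_apply]
  rfl

theorem form_four_eq_of_basis {ι : Type*} [Finite ι] (b : Module.Basis ι ℝ W)
    {α β : W [⋀^ι]→L[ℝ] ℝ} (h : α b = β b) : α = β := by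
  refine ContinuousAlternatingMap.toAlternatingMap_injective (sub_eq_zero.1 ?_)
  exact (AlternatingMap.map_basis_eq_zero_iff b (α.toAlternatingMap - β.toAlternatingMap)).1
    (sub_eq_zero.2 h)

/-- The coframe of a linear isomorphism with `ℝ⁴`. -/
def coframe (h : W ≃L[ℝ] (Fin 4 → ℝ)) (m : Fin 4) : W →L[ℝ] ℝ :=
  (ContinuousLinearMap.proj m).comp (h : W →L[ℝ] Fin 4 → ℝ)

/-- The basis dual to `coframe h`. -/
def frameBasis (h : W ≃L[ℝ] (Fin 4 → ℝ)) : Module.Basis (Fin 4) ℝ W :=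
  Module.Basis.ofEquivFun h.toLinearEquiv

theorem coframe_frameBasis (h : W ≃L[ℝ] (Fin 4 → ℝ)) (m i : Fin 4) :
    coframe h m (frameBasis h i) = if m = i then 1 else 0 := by
  simp [coframe, frameBasis, Pi.single_apply]

theorem detForm_coframe_frameBasis (h : W ≃L[ℝ] (Fin 4 → ℝ)) :
    detForm (coframe h) (frameBasis h) = 1 := by
  rw [detForm_apply]
  have h1 : (Matrix.of fun i j => coframe h i (frameBasis h j)) = (1 : Matrix (Fin 4) (Fin 4) ℝ) := by
    ext i j
    rw [Matrix.of_apply, coframe_frameBasis, Matrix.one_apply]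
  rw [h1, Matrix.det_one]

/-- The expression is cubic and alternating in `F`, so `C` enters through its determinant and the
sign through `σ³ = σ`; the standard triple contributes `6 |ξ|² h⁰¹²³`. -/
theorem urbantke_normal_form {F : Fin 3 → W [⋀^Fin 2]→L[ℝ] ℝ} {σ : ℝ}
    {C : Matrix (Fin 3) (Fin 3) ℝ} {h : W ≃L[ℝ] (Fin 4 → ℝ)} (hσ : σ * σ = 1)
    (hF : ∀ i, F i = ∑ j, (σ * C i j) • sdTwo (coframe h) j) (ξ : W) :
    urbantke F ξ ξ = (6 * σ * C.det * ∑ m, h ξ m ^ 2) • detForm (coframe h) := by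
  refine form_four_eq_of_basis (frameBasis h) ?_
  rw [ContinuousAlternatingMap.smul_apply, detForm_coframe_frameBasis, urbantke_apply, sum_eps_smul]
  simp only [wedge_insertVec_apply]
  have hFv : ∀ i x y, F i ![x, y] = σ * (C i 0 * sdTwo (coframe h) 0 ![x, y] +
      C i 1 * sdTwo (coframe h) 1 ![x, y] + C i 2 * sdTwo (coframe h) 2 ![x, y]) := by
    intro i x y
    rw [hF, form_eq_sum_apply, Fin.sum_univ_three]
    ring
  have hξ : ∀ m, coframe h m ξ = h ξ m := fun m => rfl
  simp only [hFv, sdTwo_zero_apply, sdTwo_one_apply, sdTwo_two_apply, coframe_frameBasis, hξ,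
    Matrix.det_fin_three, Fin.sum_univ_four]
  simp
  have hσ3 : σ ^ 3 = σ := by rw [pow_succ, sq, hσ, one_mul]
  ring_nf
  rw [hσ3]

theorem wedge_normal_form {F : Fin 3 → W [⋀^Fin 2]→L[ℝ] ℝ} {σ : ℝ}
    {C : Matrix (Fin 3) (Fin 3) ℝ} {h : Fin 4 → W →L[ℝ] ℝ} (hσ : σ * σ = 1)
    (hF : ∀ i, F i = ∑ j, (σ * C i j) • sdTwo h j) :
    IsWedgeMatrix (detForm h) F (C * C.transpose) := by
  intro i j
  rw [hF, hF, wedge_sum_smul_left]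
  simp only [wedge_sum_smul_right]
  refine (Finset.sum_congr rfl fun k _ => congrArg ((σ * C i k) • ·) (Finset.sum_congr rfl
    fun l _ => congrArg ((σ * C j l) • ·) (wedge_sdTwo h k l))).trans ?_
  refine ContinuousAlternatingMap.ext fun w => ?_
  simp only [form_eq_sum_apply, ContinuousAlternatingMap.smul_apply, smul_eq_mul,
    Matrix.mul_apply, Matrix.transpose_apply, ite_mul, zero_mul, mul_ite, mul_zero,
    Finset.sum_ite_eq, Finset.mem_univ, if_true, Finset.mul_sum, Finset.sum_mul]
  refine Finset.sum_congr rfl fun k _ => ?_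
  linear_combination (C i k * C j k * (-2) * detForm h w) * hσ

theorem posDef_mul_transpose {C : Matrix (Fin 3) (Fin 3) ℝ} (hC : C.det ≠ 0) :
    (C * C.transpose).PosDef := by
  have h := Matrix.PosDef.mul_conjTranspose_self C
    (Matrix.vecMul_injective_of_isUnit ((Matrix.isUnit_iff_isUnit_det C).2 hC.isUnit))
  rwa [Matrix.conjTranspose_eq_transpose_of_trivial] at h

theorem isSignOfTriple_normal_form {F : Fin 3 → W [⋀^Fin 2]→L[ℝ] ℝ} {σ : ℝ}
    {C : Matrix (Fin 3) (Fin 3) ℝ} {h : W ≃L[ℝ] (Fin 4 → ℝ)} (hσ : σ = 1 ∨ σ = -1)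
    (hC : 0 < C.det) (hF : ∀ i, F i = ∑ j, (σ * C i j) • sdTwo (coframe h) j) :
    IsSignOfTriple σ F := by
  have hσσ : σ * σ = 1 := by rcases hσ with h | h <;> rw [h] <;> norm_num
  refine ⟨hσ, detForm (coframe h), C * C.transpose, fun h0 => ?_, wedge_normal_form hσσ hF,
    posDef_mul_transpose hC.ne', fun ξ hξ => ⟨6 * C.det * ∑ m, h ξ m ^ 2, ?_, ?_⟩⟩
  · have h1 := detForm_coframe_frameBasis h
    rw [h0] at h1
    exact zero_ne_one h1
  · have h1 : ∃ m, h ξ m ≠ 0 := by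
      by_contra! h2
      exact hξ (h.map_eq_zero_iff.1 (funext h2))
    obtain ⟨m, hm⟩ := h1
    have h3 : 0 < ∑ m, h ξ m ^ 2 :=
      Finset.sum_pos' (fun i _ => sq_nonneg _) ⟨m, Finset.mem_univ _, by positivity⟩
    positivity
  · rw [urbantke_normal_form hσσ hF, smul_smul]
    congr 1
    linear_combination (6 * C.det * ∑ m, h ξ m ^ 2) * hσσ

/-- The sign of a triple of two-forms is detected by the values of its forms on a basis. -/
theorem sign_mul_lt_zero {F : Fin 3 → W [⋀^Fin 2]→L[ℝ] ℝ} {σ : ℝ}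
    {C : Matrix (Fin 3) (Fin 3) ℝ} {h : W ≃L[ℝ] (Fin 4 → ℝ)} (hσ : σ = 1 ∨ σ = -1)
    (hC : 0 < C.det) (hF : ∀ i, F i = ∑ j, (σ * C i j) • sdTwo (coframe h) j)
    (b : Module.Basis (Fin 4) ℝ W) {ξ : W} (hξ : ξ ≠ 0) :
    σ * (urbantke F ξ ξ b * (wedge (F 0) (F 0) : W [⋀^Fin 4]→L[ℝ] ℝ) b) < 0 := by
  have hσσ : σ * σ = 1 := by rcases hσ with h | h <;> rw [h] <;> norm_num
  have h1 : ∃ m, h ξ m ≠ 0 := by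
    by_contra! h2
    exact hξ (h.map_eq_zero_iff.1 (funext h2))
  obtain ⟨m, hm⟩ := h1
  have h3 : 0 < ∑ m, h ξ m ^ 2 :=
    Finset.sum_pos' (fun i _ => sq_nonneg _) ⟨m, Finset.mem_univ _, by positivity⟩
  have h4 : detForm (coframe h) b ≠ 0 := by
    intro h5
    have h6 := form_four_eq_of_basis b (α := detForm (coframe h)) (β := 0) h5
    have h7 := detForm_coframe_frameBasis h
    rw [h6] at h7
    exact zero_ne_one h7
  have h8 := (posDef_mul_transpose hC.ne').diag_pos (i := 0)
  have h9 : (wedge (F 0) (F 0) : W [⋀^Fin 4]→L[ℝ] ℝ) b =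
      (-2 * (C * C.transpose) 0 0) * detForm (coframe h) b := by
    refine (congrArg (fun f : W [⋀^Fin 4]→L[ℝ] ℝ => f b) (wedge_normal_form hσσ hF 0 0)).trans ?_
    rfl
  rw [urbantke_normal_form hσσ hF, h9, ContinuousAlternatingMap.smul_apply, smul_eq_mul]
  -- The two four-forms are evaluated on the same basis, so the orientation of `b` enters as a
  -- square: the sign is read off without an orientation.
  have h10 : 0 < C.det * (∑ m, h ξ m ^ 2) * (C * C.transpose) 0 0 * detForm (coframe h) b ^ 2 := by
    positivity
  calc _ = (σ * σ) * (-12 * (C.det * (∑ m, h ξ m ^ 2) * (C * C.transpose) 0 0 *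
        detForm (coframe h) b ^ 2)) := by ring
    _ < 0 := by rw [hσσ]; linarith

/-- The triple of two-forms `(det X)^{1/3} X^{-1} F`. -/
def detField (X : Matrix (Fin 3) (Fin 3) ℝ) (F : Fin 3 → W [⋀^Fin 2]→L[ℝ] ℝ) (i : Fin 3) :
    W [⋀^Fin 2]→L[ℝ] ℝ :=
  cubeRoot X.det • ∑ j, X⁻¹ i j • F j

theorem detField_smul (X : Matrix (Fin 3) (Fin 3) ℝ) {κ : ℝ} (hκ : κ ≠ 0)
    (F : Fin 3 → W [⋀^Fin 2]→L[ℝ] ℝ) (i : Fin 3) : detField (κ • X) F i = detField X F i := by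
  have h1 := fun j => congrFun (congrFun (cubeRoot_det_smul_inv X hκ) i) j
  simp only [Matrix.smul_apply, smul_eq_mul] at h1
  simp only [detField, Finset.smul_sum, smul_smul, h1]

theorem IsWedgeMatrix.eq_smul {F : Fin 3 → W [⋀^Fin 2]→L[ℝ] ℝ} {v v' : W [⋀^Fin 4]→L[ℝ] ℝ}
    {X X' : Matrix (Fin 3) (Fin 3) ℝ} (h : IsWedgeMatrix v F X) (h' : IsWedgeMatrix v' F X')
    {w : Fin 4 → W} (hv : v w ≠ 0) : X = (v' w / v w) • X' := by
  ext i j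
  have h1 := congrArg (fun f : W [⋀^Fin 4]→L[ℝ] ℝ => f w) ((h i j).symm.trans (h' i j))
  have h2 : (-2 * X i j) * v w = (-2 * X' i j) * v' w := h1
  rw [Matrix.smul_apply, smul_eq_mul]
  field_simp
  linarith

/-- The triple of two-forms `(det X)^{1/3} X^{-1} F` in normal form. -/
theorem detField_normal_form {F : Fin 3 → W [⋀^Fin 2]→L[ℝ] ℝ} {σ t : ℝ}
    {C : Matrix (Fin 3) (Fin 3) ℝ} {h : W ≃L[ℝ] (Fin 4 → ℝ)} (hσ : σ * σ = 1)
    (hC : 0 < C.det) (ht : C.det = t ^ 3)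
    (hF : ∀ i, F i = ∑ j, (σ * C i j) • sdTwo (coframe h) j) {v : W [⋀^Fin 4]→L[ℝ] ℝ} (hv : v ≠ 0)
    {X : Matrix (Fin 3) (Fin 3) ℝ} (hX : IsWedgeMatrix v F X) (m : Fin 3) :
    detField X F m = ∑ l, (σ * C.adjugate l m / t) • sdTwo (coframe h) l := by
  have hvb : v (frameBasis h) ≠ 0 := fun h0 => hv (form_four_eq_of_basis (frameBasis h) h0)
  have ht0 : t ≠ 0 := by
    rintro rfl
    rw [ht] at hC
    norm_num at hC
  -- By scale invariance `v` may be replaced by the volume of the coframe, for which `X = C Cᵀ`.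
  -- Then `(det X)^{1/3} = t²` and `X⁻¹ C = C⁻ᵀ`, the transposed adjugate over `t³`.
  rw [hX.eq_smul (wedge_normal_form hσ hF) hvb, detField_smul _ (by
    rw [detForm_coframe_frameBasis]
    exact one_div_ne_zero hvb), detField]
  have hdet : (C * C.transpose).det = (t ^ 2) ^ 3 := by
    rw [Matrix.det_mul, Matrix.det_transpose, ht]
    ring
  have hu : IsUnit C.det := hC.ne'.isUnit
  have hinv : (C * C.transpose)⁻¹ * C = (C⁻¹).transpose := by
    rw [Matrix.mul_inv_rev, mul_assoc, Matrix.nonsing_inv_mul _ hu, mul_one,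
      Matrix.transpose_nonsing_inv]
  have hinv' : ∀ i l, ∑ j, (C * C.transpose)⁻¹ i j * C j l = C.adjugate l i / t ^ 3 := by
    intro i l
    rw [← Matrix.mul_apply, hinv, Matrix.transpose_apply, Matrix.inv_def, ht]
    simp [div_eq_inv_mul]
  rw [hdet, cubeRoot_cube]
  simp only [hF, Finset.smul_sum, smul_smul]
  rw [Finset.sum_comm]
  refine Finset.sum_congr rfl fun l _ => ?_
  rw [← Finset.sum_smul]
  congr 1
  have h1 := hinv' m l
  calc _ = t ^ 2 * σ * ∑ j, (C * C.transpose)⁻¹ m j * C j l := by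
        rw [Finset.mul_sum]
        exact Finset.sum_congr rfl fun j _ => by ring
    _ = _ := by
        rw [h1]
        field_simp

/-- The calibrating three-form is equivalent to the standard one. -/
theorem exists_isAdapted [FiniteDimensional ℝ V] (hV : Module.finrank ℝ V = 7)
    {θ : Fin 3 → V →L[ℝ] ℝ} {pr : V →L[ℝ] W}
    (hinj : ∀ w, (∀ i, θ i w = 0) → pr w = 0 → w = 0)
    {F : Fin 3 → W [⋀^Fin 2]→L[ℝ] ℝ} {σ s : ℝ} (hs : 0 < s)
    {C : Matrix (Fin 3) (Fin 3) ℝ} {h : W ≃L[ℝ] (Fin 4 → ℝ)} (hσ : σ = 1 ∨ σ = -1)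
    (hC : 0 < C.det) (hF : ∀ i, F i = ∑ j, (σ * C i j) • sdTwo (coframe h) j)
    {v : W [⋀^Fin 4]→L[ℝ] ℝ} (hv : v ≠ 0)
    {X : Matrix (Fin 3) (Fin 3) ℝ} (hX : IsWedgeMatrix v F X) :
    ∃ Θ : V ≃L[ℝ] R7,
      IsAdapted ((s ^ (-(3 / 4) : ℝ)) • detForm ![θ 0, θ 1, θ 2] +
        (2 * σ * s ^ (1 / 4 : ℝ)) • ∑ i, (wedge (oneForm (θ i))
          ((F i).compContinuousLinearMap pr) : V [⋀^Fin 3]→L[ℝ] ℝ)) Θ ∧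
      stdFourForm.compContinuousLinearMap (Θ : V →L[ℝ] R7) =
        (2 * σ) • ∑ m, (wedge (detForm ![θ (m + 1), θ (m + 2)])
          ((detField X F m).compContinuousLinearMap pr) : V [⋀^Fin 4]→L[ℝ] ℝ) +
        (2 / 3 * s) • ∑ m, (wedge ((detField X F m).compContinuousLinearMap pr)
          ((F m).compContinuousLinearMap pr) : V [⋀^Fin 4]→L[ℝ] ℝ) ∧
      ∀ w, pr w = 0 → stdMetric (Θ w) (Θ w) =
        ((s ^ (1 / 4 : ℝ) * C.det ^ (1 / 3 : ℝ)) ^ 2)⁻¹ * ∑ j, (∑ i, C i j * θ i w) ^ 2 := by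
  have hσσ : σ * σ = 1 := by rcases hσ with h | h <;> rw [h] <;> norm_num
  -- In the application `s = 1 + σ y²`. With `p⁴ = s` and `t³ = det C` the fractional powers become
  -- monomials in `p` and `t`.
  set p : ℝ := s ^ (1 / 4 : ℝ) with hp
  set t : ℝ := C.det ^ (1 / 3 : ℝ) with ht
  have hp0 : 0 < p := Real.rpow_pos_of_pos hs _
  have ht0 : 0 < t := Real.rpow_pos_of_pos hC _
  have hp3 : s ^ (-(3 / 4) : ℝ) = (p ^ 3)⁻¹ := by
    rw [hp, ← Real.rpow_natCast, ← Real.rpow_mul hs.le, ← Real.rpow_neg hs.le]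
    norm_num
  have hp4 : s = p ^ 4 := by
    rw [hp, ← Real.rpow_natCast, ← Real.rpow_mul hs.le]
    norm_num
  have ht3 : C.det = t ^ 3 := by
    rw [ht, ← Real.rpow_natCast, ← Real.rpow_mul hC.le]
    norm_num
  have hc : Real.sqrt (2 * p ^ 2 * t) * Real.sqrt (2 * p ^ 2 * t) = 2 * p ^ 2 * t :=
    Real.mul_self_sqrt (by positivity)
  have hc0 : Real.sqrt (2 * p ^ 2 * t) ≠ 0 := (Real.sqrt_pos.2 (by positivity)).ne'
  have hF' : ∀ i, (F i).compContinuousLinearMap pr =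
      ∑ j, (σ * C i j) • sdTwo (fun m => (coframe h m).comp pr) j := by
    intro i
    rw [hF]
    refine ContinuousAlternatingMap.ext fun x => ?_
    rw [ContinuousAlternatingMap.compContinuousLinearMap_apply, form_eq_sum_apply,
      form_eq_sum_apply]
    refine Finset.sum_congr rfl fun j _ => ?_
    rw [← sdTwo_comp]
    rfl
  have hB' : ∀ m, (detField X F m).compContinuousLinearMap pr =
      ∑ l, (σ * C.adjugate l m / t) • sdTwo (fun m => (coframe h m).comp pr) l := by
    intro m
    rw [detField_normal_form hσσ hC ht3 hF hv hX]
    refine ContinuousAlternatingMap.ext fun x => ?_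
    rw [ContinuousAlternatingMap.compContinuousLinearMap_apply, form_eq_sum_apply,
      form_eq_sum_apply]
    refine Finset.sum_congr rfl fun j _ => ?_
    rw [← sdTwo_comp]
    rfl
  set f : Fin 7 → V →L[ℝ] ℝ := splitCoframe (fun j => ∑ i, (C i j / (p * t)) • θ i)
    (fun m => Real.sqrt (2 * p ^ 2 * t) • (coframe h m).comp pr) with hf
  have he : ∀ j w, (∑ i, (C i j / (p * t)) • θ i) w = (p * t)⁻¹ * ∑ i, C i j * θ i w := by
    intro j w
    simp only [sum_apply, smul_apply, smul_eq_mul, Finset.mul_sum]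
    exact Finset.sum_congr rfl fun i _ => by ring
  -- `C` and `h` are invertible and the `θ i` separate the kernel of `pr`, so the seven functionals
  -- have no common zero; in dimension seven they form a coframe.
  have hLinj : Function.Injective (ContinuousLinearMap.pi f) := by
    rw [injective_iff_map_eq_zero]
    intro w hw
    have h0 : ∀ k, f k w = 0 := fun k => congrFun hw k
    have hj : ∀ j, ∑ i, C i j * θ i w = 0 := by
      intro j
      have h1 : (∑ i, (C i j / (p * t)) • θ i) w = 0 := by
        fin_cases j
        · exact h0 0
        · exact h0 1
        · exact h0 3
      rw [he] at h1
      exact (mul_eq_zero.1 h1).resolve_left (by positivity)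
    refine hinj w ?_ ?_
    · have h2 := Matrix.eq_zero_of_vecMul_eq_zero hC.ne' (v := fun i => θ i w) (by
        ext j
        rw [Matrix.vecMul, dotProduct, Pi.zero_apply, ← hj j]
        exact Finset.sum_congr rfl fun i _ => mul_comm _ _)
      exact fun i => congrFun h2 i
    · refine h.map_eq_zero_iff.1 (funext fun m => ?_)
      have h3 : Real.sqrt (2 * p ^ 2 * t) * h (pr w) m = 0 := by
        fin_cases m
        · exact neg_eq_zero.1 (h0 6)
        · exact h0 2
        · exact h0 5
        · exact h0 4
      exact (mul_eq_zero.1 h3).resolve_left hc0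
  obtain ⟨Θ, hΘ⟩ : ∃ Θ : V ≃L[ℝ] R7, (Θ : V →L[ℝ] R7) = ContinuousLinearMap.pi f := by
    refine ⟨(LinearEquiv.ofInjectiveOfFinrankEq (ContinuousLinearMap.pi f : V →L[ℝ] R7).toLinearMap
      hLinj (by rw [hV]; simp)).toContinuousLinearEquiv, ?_⟩
    ext w : 1
    rfl
  refine ⟨Θ, ?_, ?_, fun w hw => ?_⟩
  · rw [IsAdapted, hΘ, hf, stdThreeForm_adapted θ _ C hp0.ne' ht0.ne' hσσ ht3 hc hF', hp3]
  · rw [hΘ, hf, stdFourForm_adapted θ _ C hp0.ne' ht0.ne' hσσ ht3 hc hF' hB', hp4]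
  · have h1 : ∀ k, Θ w k = f k w := fun k =>
      congrFun (congrArg (fun L : V →L[ℝ] R7 => L w) hΘ) k
    rw [stdMetric_apply]
    simp only [h1]
    have e0 : f 0 w = _ := he 0 w
    have e1 : f 1 w = _ := he 1 w
    have e2 : f 3 w = _ := he 2 w
    have h0 : ∀ m, coframe h m (pr w) = 0 := fun m => by rw [hw, map_zero]
    have g0 : f 6 w = 0 := neg_eq_zero.2 (mul_eq_zero_of_right _ (h0 0))
    have g1 : f 2 w = 0 := mul_eq_zero_of_right _ (h0 1)
    have g2 : f 5 w = 0 := mul_eq_zero_of_right _ (h0 2)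
    have g3 : f 4 w = 0 := mul_eq_zero_of_right _ (h0 3)
    rw [Fin.sum_univ_seven, e0, e1, e2, g0, g1, g2, g3,
      Fin.sum_univ_three (fun j => (∑ i, C i j * θ i w) ^ 2)]
    field_simp
    ring

end Urbantke

/-! ### Exterior derivatives of products in low degree -/

section Leibniz

variable {X V W : Type*} [NormedAddCommGroup X] [NormedSpace ℝ X] [NormedAddCommGroup V]
  [NormedSpace ℝ V] [NormedAddCommGroup W] [NormedSpace ℝ W]

/-- A crude bound suffices: it makes the wedge product a continuous bilinear map, to which the
product rule applies. -/
theorem norm_wedge_le {p q : ℕ} (α : V [⋀^Fin p]→L[ℝ] ℝ) (β : V [⋀^Fin q]→L[ℝ] ℝ) :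
    ‖wedge α β‖ ≤ ((p.factorial : ℝ) * (q.factorial : ℝ))⁻¹ *
      Fintype.card (Equiv.Perm (Fin (p + q))) * ‖α‖ * ‖β‖ := by
  refine ContinuousAlternatingMap.opNorm_le_bound _ (by positivity) fun w => ?_
  have h1 : ∀ σ : Equiv.Perm (Fin (p + q)), ‖((Equiv.Perm.sign σ : ℤ) : ℝ) *
      (α (fun i => w (σ (Fin.castAdd q i))) * β (fun i => w (σ (Fin.natAdd p i))))‖ ≤
      ‖α‖ * ‖β‖ * ∏ i, ‖w i‖ := by
    intro σ
    have h2 : ‖((Equiv.Perm.sign σ : ℤ) : ℝ)‖ = 1 := by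
      rcases Int.units_eq_one_or (Equiv.Perm.sign σ) with h | h <;> simp [h]
    have h3 : ∏ i, ‖w i‖ = (∏ i, ‖w (σ (Fin.castAdd q i))‖) * ∏ i, ‖w (σ (Fin.natAdd p i))‖ := by
      rw [← Equiv.prod_comp σ, Fin.prod_univ_add]
    rw [norm_mul, h2, one_mul, norm_mul, h3]
    calc _ ≤ (‖α‖ * ∏ i, ‖w (σ (Fin.castAdd q i))‖) * (‖β‖ * ∏ i, ‖w (σ (Fin.natAdd p i))‖) :=
          mul_le_mul (α.le_opNorm _) (β.le_opNorm _) (norm_nonneg _) (by positivity)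
      _ = _ := by ring
  rw [wedge_apply, norm_mul, Real.norm_of_nonneg (by positivity : (0 : ℝ) ≤
    ((p.factorial : ℝ) * (q.factorial : ℝ))⁻¹)]
  calc _ ≤ ((p.factorial : ℝ) * (q.factorial : ℝ))⁻¹ *
        ∑ σ : Equiv.Perm (Fin (p + q)), ‖α‖ * ‖β‖ * ∏ i, ‖w i‖ := by
        gcongr
        exact (norm_sum_le _ _).trans (Finset.sum_le_sum fun σ _ => h1 σ)
    _ = _ := by
        rw [Finset.sum_const, nsmul_eq_mul, Finset.card_univ]
        ring

/-- The wedge product as a continuous bilinear map. -/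
def wedgeL (V : Type*) [NormedAddCommGroup V] [NormedSpace ℝ V] (p q : ℕ) :
    (V [⋀^Fin p]→L[ℝ] ℝ) →L[ℝ] (V [⋀^Fin q]→L[ℝ] ℝ) →L[ℝ] (V [⋀^Fin (p + q)]→L[ℝ] ℝ) :=
  (wedgeBilin V p q).mkContinuous₂ (((p.factorial : ℝ) * (q.factorial : ℝ))⁻¹ *
      Fintype.card (Equiv.Perm (Fin (p + q)))) norm_wedge_le

theorem HasFDerivAt.wedge {p q : ℕ} {α : X → V [⋀^Fin p]→L[ℝ] ℝ} {β : X → V [⋀^Fin q]→L[ℝ] ℝ}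
    {z : X} (hα : DifferentiableAt ℝ α z) (hβ : DifferentiableAt ℝ β z) :
    ∃ L : X →L[ℝ] V [⋀^Fin (p + q)]→L[ℝ] ℝ, HasFDerivAt (fun x => _root_.wedge (α x) (β x)) L z ∧
      ∀ v, L v = _root_.wedge (α z) (fderiv ℝ β z v) + _root_.wedge (fderiv ℝ α z v) (β z) :=
  ⟨_, (wedgeL V p q).hasFDerivAt_of_bilinear hα.hasFDerivAt hβ.hasFDerivAt, fun _ => rfl⟩

theorem ContDiffAt.bilinear {E F G : Type*} [NormedAddCommGroup E] [NormedSpace ℝ E]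
    [NormedAddCommGroup F] [NormedSpace ℝ F] [NormedAddCommGroup G] [NormedSpace ℝ G]
    (B : E →L[ℝ] F →L[ℝ] G) {f : X → E} {g : X → F} {z : X} {n : WithTop ℕ∞}
    (hf : ContDiffAt ℝ n f z) (hg : ContDiffAt ℝ n g z) :
    ContDiffAt ℝ n (fun x => B (f x) (g x)) z :=
  (hf.continuousLinearMap_comp B).clm_apply hg

theorem ContDiffAt.wedge {p q : ℕ} {α : X → V [⋀^Fin p]→L[ℝ] ℝ} {β : X → V [⋀^Fin q]→L[ℝ] ℝ}
    {z : X} {n : WithTop ℕ∞} (hα : ContDiffAt ℝ n α z) (hβ : ContDiffAt ℝ n β z) :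
    ContDiffAt ℝ n (fun x => _root_.wedge (α x) (β x)) z :=
  ContDiffAt.bilinear (wedgeL V p q) hα hβ

/-- A linear functional as a one-form, continuously and linearly. -/
def oneFormL (V : Type*) [NormedAddCommGroup V] [NormedSpace ℝ V] :
    (V →L[ℝ] ℝ) →L[ℝ] (V [⋀^Fin 1]→L[ℝ] ℝ) :=
  ((ContinuousAlternatingMap.ofSubsingletonLIE (𝕜 := ℝ) (E := V) (F := ℝ) (0 : Fin 1)).toContinuousLinearEquiv :
    (V →L[ℝ] ℝ) →L[ℝ] (V [⋀^Fin 1]→L[ℝ] ℝ))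

theorem hasFDerivAt_oneForm {θ : X → V →L[ℝ] ℝ} {z : X} (hθ : DifferentiableAt ℝ θ z) :
    HasFDerivAt (fun u => oneForm (θ u)) ((oneFormL V).comp (fderiv ℝ θ z)) z :=
  (oneFormL V).hasFDerivAt.comp (f := θ) z hθ.hasFDerivAt

theorem fderiv_oneForm {θ : X → V →L[ℝ] ℝ} {z : X} (hθ : DifferentiableAt ℝ θ z) (v : X) :
    fderiv ℝ (fun u => oneForm (θ u)) z v = oneForm (fderiv ℝ θ z v) := by
  rw [(hasFDerivAt_oneForm hθ).fderiv]
  rfl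

theorem extDeriv_apply_two {α : V → V [⋀^Fin 1]→L[ℝ] ℝ} {z : V} (x y : V) :
    extDeriv α z ![x, y] = fderiv ℝ α z x ![y] - fderiv ℝ α z y ![x] := by
  rw [extDeriv, ContinuousAlternatingMap.alternatizeUncurryFin_apply, Fin.sum_univ_two]
  rw [form_one_apply (fderiv ℝ α z _), form_one_apply (fderiv ℝ α z (![x, y] 1))]
  simp [Fin.removeNth]
  ring

theorem extDeriv_apply_three {α : V → V [⋀^Fin 2]→L[ℝ] ℝ} {z : V} (x : Fin 3 → V) :
    extDeriv α z x = fderiv ℝ α z (x 0) ![x 1, x 2] - fderiv ℝ α z (x 1) ![x 0, x 2] +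
      fderiv ℝ α z (x 2) ![x 0, x 1] := by
  rw [extDeriv, ContinuousAlternatingMap.alternatizeUncurryFin_apply, Fin.sum_univ_three]
  rw [form_two_apply (fderiv ℝ α z _), form_two_apply (fderiv ℝ α z (x 1)),
    form_two_apply (fderiv ℝ α z (x 2))]
  simp [Fin.removeNth]
  rw [show Fin.succAbove (2 : Fin 3) (1 : Fin 2) = 1 from rfl]
  ring

theorem extDeriv_apply_four {α : V → V [⋀^Fin 3]→L[ℝ] ℝ} {z : V} (x : Fin 4 → V) :
    extDeriv α z x = fderiv ℝ α z (x 0) ![x 1, x 2, x 3] - fderiv ℝ α z (x 1) ![x 0, x 2, x 3] +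
      fderiv ℝ α z (x 2) ![x 0, x 1, x 3] - fderiv ℝ α z (x 3) ![x 0, x 1, x 2] := by
  have e : ∀ k : Fin 4, k.removeNth x = fun i => x (k.succAbove i) := fun k => rfl
  rw [extDeriv, ContinuousAlternatingMap.alternatizeUncurryFin_apply, Fin.sum_univ_four]
  rw [form_three_apply (fderiv ℝ α z _), form_three_apply (fderiv ℝ α z (x 1)),
    form_three_apply (fderiv ℝ α z (x 2)), form_three_apply (fderiv ℝ α z (x 3))]
  simp only [e]
  rw [show Fin.succAbove (0 : Fin 4) (0 : Fin 3) = 1 from rfl,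
    show Fin.succAbove (0 : Fin 4) (1 : Fin 3) = 2 from rfl,
    show Fin.succAbove (0 : Fin 4) (2 : Fin 3) = 3 from rfl,
    show Fin.succAbove (1 : Fin 4) (0 : Fin 3) = 0 from rfl,
    show Fin.succAbove (1 : Fin 4) (1 : Fin 3) = 2 from rfl,
    show Fin.succAbove (1 : Fin 4) (2 : Fin 3) = 3 from rfl,
    show Fin.succAbove (2 : Fin 4) (0 : Fin 3) = 0 from rfl,
    show Fin.succAbove (2 : Fin 4) (1 : Fin 3) = 1 from rfl,
    show Fin.succAbove (2 : Fin 4) (2 : Fin 3) = 3 from rfl,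
    show Fin.succAbove (3 : Fin 4) (0 : Fin 3) = 0 from rfl,
    show Fin.succAbove (3 : Fin 4) (1 : Fin 3) = 1 from rfl,
    show Fin.succAbove (3 : Fin 4) (2 : Fin 3) = 2 from rfl]
  simp
  ring

theorem extDeriv_apply_five {α : V → V [⋀^Fin 4]→L[ℝ] ℝ} {z : V} (x : Fin 5 → V) :
    extDeriv α z x = fderiv ℝ α z (x 0) ![x 1, x 2, x 3, x 4]
      - fderiv ℝ α z (x 1) ![x 0, x 2, x 3, x 4] + fderiv ℝ α z (x 2) ![x 0, x 1, x 3, x 4]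
      - fderiv ℝ α z (x 3) ![x 0, x 1, x 2, x 4] + fderiv ℝ α z (x 4) ![x 0, x 1, x 2, x 3] := by
  have e : ∀ (k : Fin 5) (r : Fin 4 → Fin 5), (∀ i, k.succAbove i = r i) →
      k.removeNth x = ![x (r 0), x (r 1), x (r 2), x (r 3)] := by
    intro k r h
    ext1 i
    change x (k.succAbove i) = _
    rw [h]
    fin_cases i <;> rfl
  rw [extDeriv, ContinuousAlternatingMap.alternatizeUncurryFin_apply, Fin.sum_univ_five,
    e 0 ![1, 2, 3, 4] (by intro i; fin_cases i <;> rfl),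
    e 1 ![0, 2, 3, 4] (by intro i; fin_cases i <;> rfl),
    e 2 ![0, 1, 3, 4] (by intro i; fin_cases i <;> rfl),
    e 3 ![0, 1, 2, 4] (by intro i; fin_cases i <;> rfl),
    e 4 ![0, 1, 2, 3] (by intro i; fin_cases i <;> rfl)]
  simp
  ring

/-- The Leibniz rule for the product of a one-form and a two-form. -/
theorem extDeriv_wedge_one_two_apply {θ : V → V →L[ℝ] ℝ} {β : V → V [⋀^Fin 2]→L[ℝ] ℝ} {z : V}
    (hθ : DifferentiableAt ℝ θ z) (hβ : DifferentiableAt ℝ β z) (x : Fin 4 → V) :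
    extDeriv (fun u => (wedge (oneForm (θ u)) (β u) : V [⋀^Fin 3]→L[ℝ] ℝ)) z x =
      (wedge (extDeriv (fun u => oneForm (θ u)) z) (β z) : V [⋀^Fin 4]→L[ℝ] ℝ) x -
      (wedge (oneForm (θ z)) (extDeriv β z) : V [⋀^Fin 4]→L[ℝ] ℝ) x := by
  obtain ⟨D, hD, hDv⟩ := HasFDerivAt.wedge (hasFDerivAt_oneForm hθ).differentiableAt hβ
  have h1 : ∀ v a b c, fderiv ℝ (fun u => (wedge (oneForm (θ u)) (β u) : V [⋀^Fin 3]→L[ℝ] ℝ)) z v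
      ![a, b, c] = (wedge (oneForm (θ z)) (fderiv ℝ β z v) : V [⋀^Fin 3]→L[ℝ] ℝ) ![a, b, c] +
        (wedge (oneForm (fderiv ℝ θ z v)) (β z) : V [⋀^Fin 3]→L[ℝ] ℝ) ![a, b, c] := by
    intro v a b c
    rw [← fderiv_oneForm hθ]
    refine (congrArg (fun L : V →L[ℝ] V [⋀^Fin 3]→L[ℝ] ℝ => L v ![a, b, c])
      (HasFDerivAt.fderiv (f' := D) hD)).trans ?_
    exact congrArg (fun L : V [⋀^Fin 3]→L[ℝ] ℝ => L ![a, b, c]) (hDv v)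
  rw [extDeriv_apply_four]
  simp only [h1, wedge_one_two_apply, wedge_two_two_apply, wedge_one_three_apply,
    extDeriv_apply_two, extDeriv_apply_three, fderiv_oneForm hθ, oneForm_apply]
  simp only [Matrix.cons_val]
  ring

/-- The Leibniz rule for the product of two one-forms. -/
theorem extDeriv_detForm_two_apply {θ η : V → V →L[ℝ] ℝ} {z : V}
    (hθ : DifferentiableAt ℝ θ z) (hη : DifferentiableAt ℝ η z) (x : Fin 3 → V) :
    DifferentiableAt ℝ (fun u => detForm ![θ u, η u]) z ∧
    extDeriv (fun u => detForm ![θ u, η u]) z x =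
      (wedge (oneForm (η z)) (extDeriv (fun u => oneForm (θ u)) z) : V [⋀^Fin 3]→L[ℝ] ℝ) x -
      (wedge (oneForm (θ z)) (extDeriv (fun u => oneForm (η u)) z) : V [⋀^Fin 3]→L[ℝ] ℝ) x := by
  obtain ⟨D, hD, hDv⟩ := HasFDerivAt.wedge (hasFDerivAt_oneForm hθ).differentiableAt
    (hasFDerivAt_oneForm hη).differentiableAt
  have h0 : (fun u => detForm ![θ u, η u]) =
      fun u => (wedge (oneForm (θ u)) (oneForm (η u)) : V [⋀^Fin 2]→L[ℝ] ℝ) :=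
    funext fun u => (wedge_oneForm_oneForm _ _).symm
  rw [h0]
  refine ⟨HasFDerivAt.differentiableAt (f' := D) hD, ?_⟩
  have h1 : ∀ v a b, fderiv ℝ (fun u => (wedge (oneForm (θ u)) (oneForm (η u)) :
      V [⋀^Fin 2]→L[ℝ] ℝ)) z v ![a, b] =
      (wedge (oneForm (θ z)) (oneForm (fderiv ℝ η z v)) : V [⋀^Fin 2]→L[ℝ] ℝ) ![a, b] +
        (wedge (oneForm (fderiv ℝ θ z v)) (oneForm (η z)) : V [⋀^Fin 2]→L[ℝ] ℝ) ![a, b] := by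
    intro v a b
    rw [← fderiv_oneForm hθ, ← fderiv_oneForm hη]
    refine (congrArg (fun L : V →L[ℝ] V [⋀^Fin 2]→L[ℝ] ℝ => L v ![a, b])
      (HasFDerivAt.fderiv (f' := D) hD)).trans ?_
    exact congrArg (fun L : V [⋀^Fin 2]→L[ℝ] ℝ => L ![a, b]) (hDv v)
  rw [extDeriv_apply_three]
  simp only [h1, wedge_one_two_apply, wedge_one_one_apply,
    extDeriv_apply_two, fderiv_oneForm hθ, fderiv_oneForm hη, oneForm_apply]
  simp only [Matrix.cons_val]
  ring

/-- The value of the product of a three-form and a two-form. -/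
def threeTwo (γ : V [⋀^Fin 3]→L[ℝ] ℝ) (β : V [⋀^Fin 2]→L[ℝ] ℝ) (x : Fin 5 → V) : ℝ :=
  γ ![x 0, x 1, x 2] * β ![x 3, x 4] - γ ![x 0, x 1, x 3] * β ![x 2, x 4] +
  γ ![x 0, x 1, x 4] * β ![x 2, x 3] + γ ![x 0, x 2, x 3] * β ![x 1, x 4] -
  γ ![x 0, x 2, x 4] * β ![x 1, x 3] + γ ![x 0, x 3, x 4] * β ![x 1, x 2] -
  γ ![x 1, x 2, x 3] * β ![x 0, x 4] + γ ![x 1, x 2, x 4] * β ![x 0, x 3] -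
  γ ![x 1, x 3, x 4] * β ![x 0, x 2] + γ ![x 2, x 3, x 4] * β ![x 0, x 1]

/-- The Leibniz rule for the product of two two-forms. -/
theorem extDeriv_wedge_two_two_apply {α β : V → V [⋀^Fin 2]→L[ℝ] ℝ} {z : V}
    (hα : DifferentiableAt ℝ α z) (hβ : DifferentiableAt ℝ β z) (x : Fin 5 → V) :
    extDeriv (fun u => (wedge (α u) (β u) : V [⋀^Fin 4]→L[ℝ] ℝ)) z x =
      threeTwo (extDeriv α z) (β z) x + threeTwo (extDeriv β z) (α z) x := by
  obtain ⟨D, hD, hDv⟩ := HasFDerivAt.wedge hα hβ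
  have h1 : ∀ v a b c d, fderiv ℝ (fun u => (wedge (α u) (β u) : V [⋀^Fin 4]→L[ℝ] ℝ)) z v
      ![a, b, c, d] = (wedge (α z) (fderiv ℝ β z v) : V [⋀^Fin 4]→L[ℝ] ℝ) ![a, b, c, d] +
        (wedge (fderiv ℝ α z v) (β z) : V [⋀^Fin 4]→L[ℝ] ℝ) ![a, b, c, d] := by
    intro v a b c d
    refine (congrArg (fun L : V →L[ℝ] V [⋀^Fin 4]→L[ℝ] ℝ => L v ![a, b, c, d])
      (HasFDerivAt.fderiv (f' := D) hD)).trans ?_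
    exact congrArg (fun L : V [⋀^Fin 4]→L[ℝ] ℝ => L ![a, b, c, d]) (hDv v)
  rw [extDeriv_apply_five]
  simp only [h1, wedge_two_two_apply, threeTwo, extDeriv_apply_three]
  simp only [Matrix.cons_val]
  ring

/-- The Leibniz rule for the product of a function and a three-form. -/
theorem extDeriv_smul_three_apply {g : V → ℝ} {α : V → V [⋀^Fin 3]→L[ℝ] ℝ} {z : V}
    (hg : DifferentiableAt ℝ g z) (hα : DifferentiableAt ℝ α z) (x : Fin 4 → V) :
    extDeriv (fun u => g u • α u) z x = g z * extDeriv α z x +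
      (wedge (oneForm (fderiv ℝ g z)) (α z) : V [⋀^Fin 4]→L[ℝ] ℝ) x := by
  rw [extDeriv_apply_four, extDeriv_apply_four, (show HasFDerivAt (fun u => g u • α u) _ z from hg.hasFDerivAt.smul hα.hasFDerivAt).fderiv,
    wedge_one_three_apply]
  simp
  ring

theorem extDeriv_smul_four_apply {g : V → ℝ} {α : V → V [⋀^Fin 4]→L[ℝ] ℝ} {z : V}
    (hg : DifferentiableAt ℝ g z) (hα : DifferentiableAt ℝ α z) (x : Fin 5 → V) :
    extDeriv (fun u => g u • α u) z x = g z * extDeriv α z x +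
      (fderiv ℝ g z (x 0) * α z ![x 1, x 2, x 3, x 4]
      - fderiv ℝ g z (x 1) * α z ![x 0, x 2, x 3, x 4]
      + fderiv ℝ g z (x 2) * α z ![x 0, x 1, x 3, x 4]
      - fderiv ℝ g z (x 3) * α z ![x 0, x 1, x 2, x 4]
      + fderiv ℝ g z (x 4) * α z ![x 0, x 1, x 2, x 3]) := by
  rw [extDeriv_apply_five, extDeriv_apply_five, (show HasFDerivAt (fun u => g u • α u) _ z from hg.hasFDerivAt.smul hα.hasFDerivAt).fderiv]
  simp
  ring

end Leibniz

/-! ### Closedness and co-closedness from the structure equations -/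

section LocalCalculus

variable {V : Type*} [NormedAddCommGroup V] [NormedSpace ℝ V]

/-- The first-order structure equations, at the point `z`, of the fiber coordinates `y` and their
covariant derivatives `θ`, for a connection with potential `A` and curvature `F`. -/
structure IsGaugeJet (y : Fin 3 → V → ℝ) (θ : Fin 3 → V → V →L[ℝ] ℝ) (A : Fin 3 → V →L[ℝ] ℝ)
    (F : Fin 3 → V [⋀^Fin 2]→L[ℝ] ℝ) (z : V) : Prop where
  coord : ∀ i, HasFDerivAt (y i)
    (θ i z - (y (i + 2) z • A (i + 1) - y (i + 1) z • A (i + 2))) z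
  diff : ∀ i, DifferentiableAt ℝ (θ i) z
  cov : ∀ i v w, extDeriv (fun u => oneForm (θ i u)) z ![v, w] =
    y (i + 2) z * F (i + 1) ![v, w] - y (i + 1) z * F (i + 2) ![v, w] -
      (A (i + 1) v * θ (i + 2) z w - A (i + 1) w * θ (i + 2) z v -
        (A (i + 2) v * θ (i + 1) z w - A (i + 2) w * θ (i + 1) z v))

/-- The triple of two-forms `β` is covariantly closed at the point `z`. -/
structure IsCovClosed (A : Fin 3 → V →L[ℝ] ℝ) (β : Fin 3 → V → V [⋀^Fin 2]→L[ℝ] ℝ) (z : V) :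
    Prop where
  diff : ∀ i, DifferentiableAt ℝ (β i) z
  cov : ∀ i a b c, extDeriv (β i) z ![a, b, c] =
    -(A (i + 1) a * β (i + 2) z ![b, c] - A (i + 1) b * β (i + 2) z ![a, c] +
        A (i + 1) c * β (i + 2) z ![a, b] -
      (A (i + 2) a * β (i + 1) z ![b, c] - A (i + 2) b * β (i + 1) z ![a, c] +
        A (i + 2) c * β (i + 1) z ![a, b]))

theorem detForm_three_eq_wedge (a b c : V →L[ℝ] ℝ) :
    detForm ![a, b, c] = (wedge (oneForm a) (detForm ![b, c]) : V [⋀^Fin 3]→L[ℝ] ℝ) := by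
  refine ContinuousAlternatingMap.ext fun v => ?_
  rw [wedge_one_two_apply, detForm_three_apply]
  simp only [detForm_two_apply, Matrix.cons_val]

variable {y : Fin 3 → V → ℝ} {θ : Fin 3 → V → V →L[ℝ] ℝ} {A : Fin 3 → V →L[ℝ] ℝ}
  {F B : Fin 3 → V → V [⋀^Fin 2]→L[ℝ] ℝ} {z : V}

theorem extDeriv_smul_add_smul_apply {g k : V → ℝ} {α β : V → V [⋀^Fin 3]→L[ℝ] ℝ}
    (hg : DifferentiableAt ℝ g z) (hα : DifferentiableAt ℝ α z) (hk : DifferentiableAt ℝ k z)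
    (hβ : DifferentiableAt ℝ β z) (x : Fin 4 → V) :
    extDeriv (fun u => g u • α u + k u • β u) z x = g z * extDeriv α z x +
      (wedge (oneForm (fderiv ℝ g z)) (α z) : V [⋀^Fin 4]→L[ℝ] ℝ) x + (k z * extDeriv β z x +
      (wedge (oneForm (fderiv ℝ k z)) (β z) : V [⋀^Fin 4]→L[ℝ] ℝ) x) := by
  have h1 : DifferentiableAt ℝ (fun u => g u • α u) z := hg.smul hα
  have h2 : DifferentiableAt ℝ (fun u => k u • β u) z := hk.smul hβ
  rw [extDeriv_fun_add h1 h2, ContinuousAlternatingMap.add_apply, extDeriv_smul_three_apply hg hα,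
    extDeriv_smul_three_apply hk hβ]

/-- The norm is invariant under rotations, so the connection terms cancel and `d(y²) = 2 y · d_A y`.
-/
theorem IsGaugeJet.hasFDerivAt_norm (h : IsGaugeJet y θ A (fun i => F i z) z) (σ : ℝ) :
    HasFDerivAt (fun u => 1 + σ * ∑ i, y i u ^ 2) ((2 * σ) • ∑ i, y i z • θ i z) z := by
  have h1 : HasFDerivAt (fun u => 1 + σ * ∑ i, y i u ^ 2) _ z :=
    ((HasFDerivAt.fun_sum (u := Finset.univ) fun i _ => (h.coord i).pow 2).const_mul σ).const_add 1
  refine h1.congr_fderiv ?_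
  ext v
  simp only [Fin.sum_univ_three, add_apply, smul_apply, sub_apply, smul_eq_mul, zero_add,
    show (1 : Fin 3) + 1 = 2 from rfl, show (1 : Fin 3) + 2 = 0 from rfl,
    show (2 : Fin 3) + 1 = 0 from rfl, show (2 : Fin 3) + 2 = 1 from rfl]
  simp
  ring

theorem extDeriv_detForm_three_apply {a b c : V → V →L[ℝ] ℝ}
    (ha : DifferentiableAt ℝ a z) (hb : DifferentiableAt ℝ b z) (hc : DifferentiableAt ℝ c z)
    (x : Fin 4 → V) :
    DifferentiableAt ℝ (fun u => detForm ![a u, b u, c u]) z ∧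
    extDeriv (fun u => detForm ![a u, b u, c u]) z x =
      (wedge (extDeriv (fun u => oneForm (a u)) z) (detForm ![b z, c z]) : V [⋀^Fin 4]→L[ℝ] ℝ) x -
      (wedge (oneForm (a z)) (extDeriv (fun u => detForm ![b u, c u]) z) :
        V [⋀^Fin 4]→L[ℝ] ℝ) x := by
  have h1 := extDeriv_detForm_two_apply hb hc ![x 0, x 0, x 0]
  have h0 : (fun u => detForm ![a u, b u, c u]) =
      fun u => (wedge (oneForm (a u)) (detForm ![b u, c u]) : V [⋀^Fin 3]→L[ℝ] ℝ) :=
    funext fun u => detForm_three_eq_wedge _ _ _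
  obtain ⟨D, hD, -⟩ := HasFDerivAt.wedge (hasFDerivAt_oneForm ha).differentiableAt h1.1
  rw [h0]
  exact ⟨HasFDerivAt.differentiableAt (f' := D) hD, extDeriv_wedge_one_two_apply ha h1.1 x⟩

/-- Infinitesimal rotations preserve `θ⁰ ∧ θ¹ ∧ θ²`, so the connection terms of `dθ` cancel and the
curvature terms `d_A θ = F × y` remain. -/
theorem IsGaugeJet.extDeriv_detForm_three (h : IsGaugeJet y θ A (fun i => F i z) z)
    (x : Fin 4 → V) :
    extDeriv (fun u => detForm ![θ 0 u, θ 1 u, θ 2 u]) z x =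
      ∑ i, (wedge (y (i + 2) z • F (i + 1) z - y (i + 1) z • F (i + 2) z)
        (detForm ![θ (i + 1) z, θ (i + 2) z]) : V [⋀^Fin 4]→L[ℝ] ℝ) x := by
  have c0 := h.cov 0
  have c1 := h.cov 1
  have c2 := h.cov 2
  simp only [zero_add, show (1 : Fin 3) + 1 = 2 from rfl, show (1 : Fin 3) + 2 = 0 from rfl,
    show (2 : Fin 3) + 1 = 0 from rfl, show (2 : Fin 3) + 2 = 1 from rfl] at c0 c1 c2
  have h12 := fun a b c => (extDeriv_detForm_two_apply (h.diff 1) (h.diff 2) ![a, b, c]).2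
  rw [(extDeriv_detForm_three_apply (h.diff 0) (h.diff 1) (h.diff 2) x).2, Fin.sum_univ_three]
  simp only [wedge_one_three_apply, wedge_two_two_apply, h12, wedge_one_two_apply, c0, c1, c2,
    detForm_two_apply, zero_add, show (1 : Fin 3) + 1 = 2 from rfl,
    show (1 : Fin 3) + 2 = 0 from rfl,
    show (2 : Fin 3) + 1 = 0 from rfl, show (2 : Fin 3) + 2 = 1 from rfl, Matrix.cons_val,
    ContinuousAlternatingMap.sub_apply, ContinuousAlternatingMap.smul_apply, smul_eq_mul]
  ring

theorem extDeriv_sum_apply {n : ℕ} {ι : Type*} (s : Finset ι) {α : ι → V → V [⋀^Fin n]→L[ℝ] ℝ}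
    (h : ∀ i ∈ s, DifferentiableAt ℝ (α i) z) (x : Fin (n + 1) → V) :
    extDeriv (fun u => ∑ i ∈ s, α i u) z x = ∑ i ∈ s, extDeriv (α i) z x := by
  have h1 : fderiv ℝ (fun u => ∑ i ∈ s, α i u) z = ∑ i ∈ s, fderiv ℝ (α i) z :=
    fderiv_fun_sum h
  rw [extDeriv, h1, ContinuousAlternatingMap.alternatizeUncurryFin_apply]
  simp only [extDeriv, ContinuousAlternatingMap.alternatizeUncurryFin_apply, sum_apply,
    ContinuousAlternatingMap.sum_apply, Finset.smul_sum]
  rw [Finset.sum_comm]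

/-- By covariance the derivative is `d_A θ · F - θ · d_A F`. The second term vanishes by the Bianchi
identity; the first is `(F × y) · F`, zero because two-forms commute. -/
theorem IsGaugeJet.extDeriv_wedge (h : IsGaugeJet y θ A (fun i => F i z) z)
    (hF : IsCovClosed A F z) (x : Fin 4 → V) :
    extDeriv (fun u => ∑ i, (wedge (oneForm (θ i u)) (F i u) : V [⋀^Fin 3]→L[ℝ] ℝ)) z x = 0 := by
  have hd : ∀ i, DifferentiableAt ℝ
      (fun u => (wedge (oneForm (θ i u)) (F i u) : V [⋀^Fin 3]→L[ℝ] ℝ)) z := by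
    intro i
    obtain ⟨D, hD, -⟩ := HasFDerivAt.wedge (hasFDerivAt_oneForm (h.diff i)).differentiableAt
      (hF.diff i)
    exact HasFDerivAt.differentiableAt (f' := D) hD
  rw [extDeriv_sum_apply _ fun i _ => hd i]
  simp only [extDeriv_wedge_one_two_apply (h.diff _) (hF.diff _)]
  simp only [wedge_two_two_apply, wedge_one_three_apply, h.cov, hF.cov, Fin.sum_univ_three,
    zero_add, show (1 : Fin 3) + 1 = 2 from rfl, show (1 : Fin 3) + 2 = 0 from rfl,
    show (2 : Fin 3) + 1 = 0 from rfl, show (2 : Fin 3) + 2 = 1 from rfl]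
  ring

/-- The form `β` stands for `θ · F`. Of the four terms of the product rule, `dβ` vanishes, the
derivative of the first coefficient is a combination of the `θ i` and dies against their product,
and the two others cancel by the choice of the exponents. -/
theorem IsGaugeJet.extDeriv_smul_add_smul (h : IsGaugeJet y θ A (fun i => F i z) z)
    {β : V → V [⋀^Fin 3]→L[ℝ] ℝ} (hd : DifferentiableAt ℝ β z)
    (hβ : ∀ x : Fin 4 → V, extDeriv β z x = 0)
    (hsum : ∀ a b c : V, β z ![a, b, c] =
      ∑ i, (θ i z a * F i z ![b, c] - θ i z b * F i z ![a, c] + θ i z c * F i z ![a, b]))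
    {σ : ℝ} (hσ : σ * σ = 1) (hs : 0 < 1 + σ * ∑ i, y i z ^ 2) :
    extDeriv (fun u => (1 + σ * ∑ i, y i u ^ 2) ^ (-(3 / 4) : ℝ) • detForm ![θ 0 u, θ 1 u, θ 2 u] +
      (2 * σ * (1 + σ * ∑ i, y i u ^ 2) ^ (1 / 4 : ℝ)) • β u) z = 0 := by
  refine ContinuousAlternatingMap.ext fun (x : Fin 4 → V) => ?_
  have hN := h.hasFDerivAt_norm σ
  have h1 := hN.rpow_const (p := (-(3 / 4) : ℝ)) (Or.inl hs.ne')
  -- With `d(y²) = 2 y · θ` the constants give `2σ · (1/4) · 2σ = σ² = 1`, so the derivative is `y ·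
  -- θ` times the first coefficient.
  have h2 : HasFDerivAt (fun u => 2 * σ * (1 + σ * ∑ i, y i u ^ 2) ^ (1 / 4 : ℝ))
      ((1 + σ * ∑ i, y i z ^ 2) ^ (-(3 / 4) : ℝ) • ∑ i, y i z • θ i z) z := by
    refine ((hN.rpow_const (p := (1 / 4 : ℝ)) (Or.inl hs.ne')).const_mul (2 * σ)).congr_fderiv ?_
    rw [show (1 / 4 - 1 : ℝ) = -(3 / 4) by norm_num, smul_smul, smul_smul]
    congr 1
    linear_combination ((1 + σ * ∑ i, y i z ^ 2) ^ (-(3 / 4) : ℝ)) * hσ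
  have d1 := (extDeriv_detForm_three_apply (h.diff 0) (h.diff 1) (h.diff 2) x).1
  rw [extDeriv_smul_add_smul_apply h1.differentiableAt d1 h2.differentiableAt hd,
    hβ, h.extDeriv_detForm_three, h1.fderiv, h2.fderiv]
  generalize (1 + σ * ∑ i, y i z ^ 2) ^ (-(3 / 4) : ℝ) = q
  generalize (1 + σ * ∑ i, y i z ^ 2) ^ (-(3 / 4) - 1 : ℝ) = r
  generalize (1 + σ * ∑ i, y i z ^ 2) ^ (1 / 4 : ℝ) = g
  rw [wedge_one_three_apply, wedge_one_three_apply]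
  simp only [hsum, detForm_three_apply,
    wedge_two_two_apply, Fin.sum_univ_three, smul_apply, add_apply, smul_eq_mul,
    detForm_two_apply, zero_add, show (1 : Fin 3) + 1 = 2 from rfl,
    show (1 : Fin 3) + 2 = 0 from rfl,
    show (2 : Fin 3) + 1 = 0 from rfl, show (2 : Fin 3) + 2 = 1 from rfl, Matrix.cons_val,
    ContinuousAlternatingMap.sub_apply, ContinuousAlternatingMap.smul_apply]
  change _ = (0 : ℝ)
  ring

/-- The calibrating three-form is closed. -/
theorem IsGaugeJet.extDeriv_eq_zero (h : IsGaugeJet y θ A (fun i => F i z) z)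
    (hF : IsCovClosed A F z) {σ : ℝ} (hσ : σ * σ = 1) (hs : 0 < 1 + σ * ∑ i, y i z ^ 2) :
    extDeriv (fun u => (1 + σ * ∑ i, y i u ^ 2) ^ (-(3 / 4) : ℝ) • detForm ![θ 0 u, θ 1 u, θ 2 u] +
      (2 * σ * (1 + σ * ∑ i, y i u ^ 2) ^ (1 / 4 : ℝ)) •
        ∑ i, (wedge (oneForm (θ i u)) (F i u) : V [⋀^Fin 3]→L[ℝ] ℝ)) z = 0 := by
  refine h.extDeriv_smul_add_smul (DifferentiableAt.fun_sum fun i _ => ?_) (h.extDeriv_wedge hF)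
    (fun a b c => ?_) hσ hs
  · obtain ⟨D, hD, -⟩ := HasFDerivAt.wedge (hasFDerivAt_oneForm (h.diff i)).differentiableAt
      (hF.diff i)
    exact HasFDerivAt.differentiableAt (f' := D) hD
  · refine (ContinuousAlternatingMap.sum_apply _ _).trans (Finset.sum_congr rfl fun i _ => ?_)
    rw [wedge_one_two_apply]
    rfl

/-- The value of the product of a one-form and a four-form. -/
def oneFour (a : V →L[ℝ] ℝ) (γ : V [⋀^Fin 4]→L[ℝ] ℝ) (x : Fin 5 → V) : ℝ :=
  a (x 0) * γ ![x 1, x 2, x 3, x 4] - a (x 1) * γ ![x 0, x 2, x 3, x 4]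
    + a (x 2) * γ ![x 0, x 1, x 3, x 4] - a (x 3) * γ ![x 0, x 1, x 2, x 4]
    + a (x 4) * γ ![x 0, x 1, x 2, x 3]

/-- The connection terms of `dθ` and `dB` cancel by covariance. What remains comes from `d_A θ = F ×
y` and contains `B` and `F` only through the products `B ∧ F`. -/
theorem IsGaugeJet.threeTwo_extDeriv (h : IsGaugeJet y θ A (fun i => F i z) z)
    (hB : IsCovClosed A B z) (x : Fin 5 → V) :
    ∑ m, (threeTwo (extDeriv (fun u => detForm ![θ (m + 1) u, θ (m + 2) u]) z) (B m z) x +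
      threeTwo (extDeriv (B m) z) (detForm ![θ (m + 1) z, θ (m + 2) z]) x) =
    ∑ m, (y m z * (oneFour (θ (m + 2) z) (wedge (B m z) (F (m + 2) z)) x +
        oneFour (θ (m + 1) z) (wedge (B m z) (F (m + 1) z)) x) -
      (y (m + 2) z * oneFour (θ (m + 2) z) (wedge (B m z) (F m z)) x +
        y (m + 1) z * oneFour (θ (m + 1) z) (wedge (B m z) (F m z)) x)) := by
  have h1 := fun i j a b c => (extDeriv_detForm_two_apply (h.diff i) (h.diff j) ![a, b, c]).2
  have h2 := fun i j a b c d => wedge_two_two_apply (B i z) (F j z) ![a, b, c, d]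
  simp only [Fin.sum_univ_three, zero_add, show (1 : Fin 3) + 1 = 2 from rfl,
    show (1 : Fin 3) + 2 = 0 from rfl,
    show (2 : Fin 3) + 1 = 0 from rfl, show (2 : Fin 3) + 2 = 1 from rfl, threeTwo, oneFour, h1, h2,
    hB.cov, wedge_one_two_apply, h.cov, detForm_two_apply, Matrix.cons_val]
  generalize x 0 = x0
  generalize x 1 = x1
  generalize x 2 = x2
  generalize x 3 = x3
  generalize x 4 = x4
  ring

end LocalCalculus

/-! ### Closedness of the dual four-form -/

section LocalCalculus

variable {V : Type*} [NormedAddCommGroup V] [NormedSpace ℝ V]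
variable {y : Fin 3 → V → ℝ} {θ : Fin 3 → V → V →L[ℝ] ℝ} {A : Fin 3 → V →L[ℝ] ℝ}
  {F B : Fin 3 → V → V [⋀^Fin 2]→L[ℝ] ℝ} {z : V}

theorem oneFour_zero (a : V →L[ℝ] ℝ) (x : Fin 5 → V) : oneFour a 0 x = 0 := by
  have h : ∀ u : Fin 4 → V, (0 : V [⋀^Fin 4]→L[ℝ] ℝ) u = 0 := fun u => rfl
  simp only [oneFour, h]
  ring

/-- Because `B^k ∧ F^l = δ^{kl} w`, the first sum has derivative `-2 (y · θ) ∧ w`, which the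
coefficient turns into `-4σ (y · θ) ∧ w`. In the second term `κ` is closed and equal to `3w` at the
point, so it contributes `(2/3) · 2σ · 3 = 4σ` times the same form. -/
theorem IsGaugeJet.extDeriv_add_eq_zero (h : IsGaugeJet y θ A (fun i => F i z) z)
    (hB : IsCovClosed A B z) {w : V [⋀^Fin 4]→L[ℝ] ℝ} {κ : V → V [⋀^Fin 4]→L[ℝ] ℝ}
    (hBF : ∀ k l, (wedge (B k z) (F l z) : V [⋀^Fin 4]→L[ℝ] ℝ) = if k = l then w else 0)
    (hκ : κ z = 3 • w) (hd : DifferentiableAt ℝ κ z) (hκ' : ∀ x, extDeriv κ z x = 0) (σ : ℝ) :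
    extDeriv (fun u => (2 * σ) • ∑ m, (wedge (detForm ![θ (m + 1) u, θ (m + 2) u]) (B m u) :
      V [⋀^Fin 4]→L[ℝ] ℝ) + (2 / 3 * (1 + σ * ∑ i, y i u ^ 2)) • κ u) z = 0 := by
  refine ContinuousAlternatingMap.ext fun (x : Fin 5 → V) => ?_
  have hN := (h.hasFDerivAt_norm σ).const_mul (2 / 3)
  have h1 : ∀ m : Fin 3, DifferentiableAt ℝ (fun u => detForm ![θ (m + 1) u, θ (m + 2) u]) z :=
    fun m => (extDeriv_detForm_two_apply (h.diff (m + 1)) (h.diff (m + 2)) ![x 0, x 1, x 2]).1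
  have h2 : ∀ m ∈ Finset.univ, DifferentiableAt ℝ
      (fun u => (wedge (detForm ![θ (m + 1) u, θ (m + 2) u]) (B m u) :
        V [⋀^Fin 4]→L[ℝ] ℝ)) z := by
    intro m _
    obtain ⟨D, hD, -⟩ := HasFDerivAt.wedge (h1 m) (hB.diff m)
    exact HasFDerivAt.differentiableAt (f' := D) hD
  have h3 : DifferentiableAt ℝ (fun u => ∑ m,
      (wedge (detForm ![θ (m + 1) u, θ (m + 2) u]) (B m u) : V [⋀^Fin 4]→L[ℝ] ℝ)) z :=
    DifferentiableAt.fun_sum h2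
  have h4 : DifferentiableAt ℝ (fun u => (2 * σ) • ∑ m,
      (wedge (detForm ![θ (m + 1) u, θ (m + 2) u]) (B m u) : V [⋀^Fin 4]→L[ℝ] ℝ)) z :=
    (differentiableAt_const (2 * σ)).smul h3
  have h5 : DifferentiableAt ℝ (fun u => (2 / 3 * (1 + σ * ∑ i, y i u ^ 2)) • κ u) z :=
    hN.differentiableAt.smul hd
  have e1 : ∑ m, extDeriv (fun u => (wedge (detForm ![θ (m + 1) u, θ (m + 2) u]) (B m u) :
        V [⋀^Fin 4]→L[ℝ] ℝ)) z x = -2 * ∑ m, y m z * oneFour (θ m z) w x := by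
    have e2 := h.threeTwo_extDeriv hB x
    simp only [hBF] at e2
    rw [Finset.sum_congr rfl fun m _ => extDeriv_wedge_two_two_apply (h1 m) (hB.diff m) x, e2]
    simp only [Fin.sum_univ_three, zero_add, show (1 : Fin 3) + 1 = 2 from rfl,
      show (1 : Fin 3) + 2 = 0 from rfl, show (2 : Fin 3) + 1 = 0 from rfl,
      show (2 : Fin 3) + 2 = 1 from rfl, if_true, oneFour_zero,
      show ((0 : Fin 3) = 1) = False by decide, show ((0 : Fin 3) = 2) = False by decide,
      show ((1 : Fin 3) = 0) = False by decide, show ((1 : Fin 3) = 2) = False by decide,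
      show ((2 : Fin 3) = 0) = False by decide, show ((2 : Fin 3) = 1) = False by decide, if_false]
    ring
  rw [extDeriv_fun_add h4 h5, ContinuousAlternatingMap.add_apply,
    extDeriv_smul_four_apply (differentiableAt_const (2 * σ)) h3,
    extDeriv_smul_four_apply hN.differentiableAt hd, hκ', hN.fderiv, fderiv_const_apply,
    extDeriv_sum_apply _ h2, e1, hκ]
  have h6 : ∀ u : Fin 4 → V, (3 • w) u = 3 * w u := fun u => by
    rw [ContinuousAlternatingMap.smul_apply, nsmul_eq_mul]; rfl
  simp only [h6, Fin.sum_univ_three, smul_apply, add_apply, smul_eq_mul, oneFour,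
    show ∀ v : V, (0 : V →L[ℝ] ℝ) v = 0 from fun _ => rfl]
  change _ = (0 : ℝ)
  ring

end LocalCalculus

/-! ### Structure equations and Bianchi identity from the potentials -/

section GaugeData

variable {V W : Type*} [NormedAddCommGroup V] [NormedSpace ℝ V] [NormedAddCommGroup W]
  [NormedSpace ℝ W]

theorem extDeriv_oneForm_fderiv {Y : V → ℝ} {z : V} (hY : ContDiffAt ℝ ∞ Y z) (v w : V) :
    extDeriv (fun u => oneForm (fderiv ℝ Y u)) z ![v, w] = 0 := by
  have hd : DifferentiableAt ℝ (fderiv ℝ Y) z :=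
    (hY.fderiv_right (m := 1) (WithTop.coe_le_coe.2 le_top)).differentiableAt one_ne_zero
  rw [extDeriv_apply_two, fderiv_oneForm hd, fderiv_oneForm hd]
  have h := (hY.isSymmSndFDerivAt (by
    rw [minSmoothness_of_isRCLikeNormedField]; exact WithTop.coe_le_coe.2 le_top)).eq v w
  simp only [oneForm_apply, Matrix.cons_val_zero]
  rw [h, sub_self]

theorem ContDiffAt.extDeriv {n : ℕ} {α : V → V [⋀^Fin n]→L[ℝ] ℝ} {z : V}
    (h : ContDiffAt ℝ ∞ α z) : ContDiffAt ℝ ∞ (extDeriv α) z := by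
  have h1 : ContDiffAt ℝ ∞ (fderiv ℝ α) z := h.fderiv_right (m := ∞) le_rfl
  have h2 : ContDiff ℝ ∞ (ContinuousAlternatingMap.alternatizeUncurryFinCLM (n := n) ℝ V ℝ) :=
    ContinuousLinearMap.contDiff _
  exact h2.contDiffAt.comp z h1

/-- The curvature two-forms of the potential one-forms `a`. -/
def curvatureOf (a : Fin 3 → W → W →L[ℝ] ℝ) (i : Fin 3) (x : W) : W [⋀^Fin 2]→L[ℝ] ℝ :=
  extDeriv (fun u => oneForm (a i u)) x +
    (wedge (oneForm (a (i + 1) x)) (oneForm (a (i + 2) x)) : W [⋀^Fin 2]→L[ℝ] ℝ)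

/-- Apply `d` to `θ = dY + α × Y`: the second derivatives of `Y` cancel by symmetry, and `dα`
together with the products of potentials makes up the curvature. -/
theorem isGaugeJet_of_eventuallyEq {Y : Fin 3 → V → ℝ} {α θ : Fin 3 → V → V →L[ℝ] ℝ} {z : V}
    {F : Fin 3 → V [⋀^Fin 2]→L[ℝ] ℝ} (hα : ∀ i, DifferentiableAt ℝ (α i) z)
    (hY : ∀ i, ContDiffAt ℝ ∞ (Y i) z)
    (hF : ∀ i v w, F i ![v, w] = extDeriv (fun u => oneForm (α i u)) z ![v, w] +
      (α (i + 1) z v * α (i + 2) z w - α (i + 1) z w * α (i + 2) z v))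
    (hθ : ∀ i, θ i =ᶠ[𝓝 z] fun u => fderiv ℝ (Y i) u +
      (Y (i + 2) u • α (i + 1) u - Y (i + 1) u • α (i + 2) u)) :
    IsGaugeJet Y θ (fun i => α i z) F z := by
  have hYd : ∀ i, HasFDerivAt (Y i) (fderiv ℝ (Y i) z) z := fun i =>
    ((hY i).differentiableAt (by simp)).hasFDerivAt
  have hYd2 : ∀ i, DifferentiableAt ℝ (fderiv ℝ (Y i)) z := fun i =>
    ((hY i).fderiv_right (m := 1) (WithTop.coe_le_coe.2 le_top)).differentiableAt one_ne_zero
  have hder : ∀ i, HasFDerivAt (θ i) _ z := fun i =>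
    ((hYd2 i).hasFDerivAt.add (((hYd (i + 2)).smul (hα (i + 1)).hasFDerivAt).sub
      ((hYd (i + 1)).smul (hα (i + 2)).hasFDerivAt))).congr_of_eventuallyEq (hθ i)
  have hsymm : ∀ i v w, fderiv ℝ (fderiv ℝ (Y i)) z v w = fderiv ℝ (fderiv ℝ (Y i)) z w v :=
    fun i v w => ((hY i).isSymmSndFDerivAt (by
      rw [minSmoothness_of_isRCLikeNormedField]; exact WithTop.coe_le_coe.2 le_top)).eq v w
  have hθz : ∀ i, θ i z = fderiv ℝ (Y i) z + (Y (i + 2) z • α (i + 1) z - Y (i + 1) z • α (i + 2) z) :=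
    fun i => (hθ i).eq_of_nhds
  refine ⟨fun i => (hYd i).congr_fderiv ?_, fun i => (hder i).differentiableAt, fun i v w => ?_⟩
  · rw [hθz]; abel
  · rw [hF, hF, extDeriv_apply_two, extDeriv_apply_two, extDeriv_apply_two,
      fderiv_oneForm (hder i).differentiableAt, fderiv_oneForm (hder i).differentiableAt,
      fderiv_oneForm (hα _), fderiv_oneForm (hα _), fderiv_oneForm (hα _), fderiv_oneForm (hα _),
      (hder i).fderiv, hθz, hθz]
    have h3 : i + 1 + 1 = i + 2 := by fin_cases i <;> rfl
    have h4 : i + 1 + 2 = i := by fin_cases i <;> rfl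
    have h5 : i + 2 + 1 = i := by fin_cases i <;> rfl
    have h6 : i + 2 + 2 = i + 1 := by fin_cases i <;> rfl
    simp only [oneForm_apply, Matrix.cons_val_zero, add_apply, sub_apply, smul_apply, smul_eq_mul,
      ContinuousLinearMap.smulRight_apply, h3, h4, h5, h6, hsymm i w v]
    ring

/-- The Bianchi identity. -/
theorem isCovClosed_curvatureOf {a : Fin 3 → W → W →L[ℝ] ℝ} {x : W}
    (ha : ∀ i, ContDiffAt ℝ ∞ (a i) x) :
    IsCovClosed (fun i => a i x) (fun i => curvatureOf a i) x := by
  have hda : ∀ i, DifferentiableAt ℝ (a i) x := fun i => (ha i).differentiableAt (by simp)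
  have h1 : ∀ i, ContDiffAt ℝ ∞ (fun u => oneForm (a i u)) x := fun i =>
    (oneFormL W).contDiff.contDiffAt.comp x (ha i)
  have h2 : ∀ i, DifferentiableAt ℝ (extDeriv (fun u => oneForm (a i u))) x := fun i =>
    (h1 i).extDeriv.differentiableAt (by simp)
  have h3 : ∀ i u, curvatureOf a i u = extDeriv (fun u => oneForm (a i u)) u +
      detForm ![a (i + 1) u, a (i + 2) u] := fun i u => by
    rw [← wedge_oneForm_oneForm]; rfl
  have h4 := fun i (v : Fin 3 → W) => extDeriv_detForm_two_apply (hda (i + 1)) (hda (i + 2)) v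
  have h5 : ∀ i, curvatureOf a i = fun u => extDeriv (fun u => oneForm (a i u)) u +
      detForm ![a (i + 1) u, a (i + 2) u] := fun i => funext (h3 i)
  refine ⟨fun i => ?_, fun i p q r => ?_⟩
  · exact (h5 i) ▸ (h2 i).add (h4 i ![0, 0, 0]).1
  · have h7 : extDeriv (extDeriv (fun u => oneForm (a i u))) x ![p, q, r] = 0 := by
      rw [extDeriv_extDeriv_apply (h1 i) (by
        rw [minSmoothness_of_isRCLikeNormedField]; exact WithTop.coe_le_coe.2 le_top)]
      rfl
    have h9 : extDeriv (curvatureOf a i) x ![p, q, r] =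
        extDeriv (fun u => detForm ![a (i + 1) u, a (i + 2) u]) x ![p, q, r] := by
      rw [h5, extDeriv_fun_add (h2 i) (h4 i ![0, 0, 0]).1, ContinuousAlternatingMap.add_apply, h7, zero_add]
    have e3 : i + 1 + 1 = i + 2 := by fin_cases i <;> rfl
    have e4 : i + 1 + 2 = i := by fin_cases i <;> rfl
    have e5 : i + 2 + 1 = i := by fin_cases i <;> rfl
    have e6 : i + 2 + 2 = i + 1 := by fin_cases i <;> rfl
    rw [h9, (h4 i _).2, wedge_one_two_apply, wedge_one_two_apply]
    have h8 : ∀ i p q, curvatureOf a i x ![p, q] = extDeriv (fun u => oneForm (a i u)) x ![p, q] +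
        (a (i + 1) x p * a (i + 2) x q - a (i + 1) x q * a (i + 2) x p) := fun i p q => by
      rw [h3, ContinuousAlternatingMap.add_apply]
      exact congrArg _ (detForm_two_apply _ _ ![p, q])
    simp only [h8, Matrix.cons_val, e3, e4, e5, e6]
    ring

theorem IsCovClosed.pullback {A : Fin 3 → W →L[ℝ] ℝ} {β : Fin 3 → W → W [⋀^Fin 2]→L[ℝ] ℝ}
    {L : V →L[ℝ] W} {z : V} (h : IsCovClosed A β (L z)) :
    IsCovClosed (fun i => (A i).comp L)
      (fun i u => (β i (L u)).compContinuousLinearMap L) z := by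
  have hp : ∀ i, extDeriv (fun u => (β i (L u)).compContinuousLinearMap L) z =
      (extDeriv (β i) (L z)).compContinuousLinearMap L := fun i => by
    have := extDeriv_pullback (f := L) (h.diff i) (L.contDiff (n := ∞)).contDiffAt (by
        rw [minSmoothness_of_isRCLikeNormedField]; exact WithTop.coe_le_coe.2 le_top)
    simpa only [ContinuousLinearMap.fderiv] using this
  refine ⟨fun i => ?_, fun i a b c => ?_⟩
  · have h1 : DifferentiableAt ℝ (fun u => β i (L u)) z :=
      DifferentiableAt.comp z (h.diff i) L.differentiableAt
    exact (ContinuousAlternatingMap.compContinuousLinearMapCLM L).differentiableAt.comp z h1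
  · have e : ∀ {n : ℕ} (γ : W [⋀^Fin n]→L[ℝ] ℝ) (v : Fin n → V),
        γ.compContinuousLinearMap L v = γ (fun i => L (v i)) := fun _ _ => rfl
    have e2 : ∀ a b : V, (fun i => L ((![a, b] : Fin 2 → V) i)) = ![L a, L b] := fun a b => by
      ext i; fin_cases i <;> rfl
    have e3 : (fun i => L ((![a, b, c] : Fin 3 → V) i)) = ![L a, L b, L c] := by
      ext i; fin_cases i <;> rfl
    rw [hp, e, e3, h.cov]
    simp only [e, e2]
    rfl

end GaugeData

/-! ### Forms and exterior derivatives in charts -/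

section Charts

variable {V : Type*} [NormedAddCommGroup V] [NormedSpace ℝ V]
  {H : Type*} [TopologicalSpace H] (I : ModelWithCorners ℝ V H) [I.Boundaryless]
  {N : Type*} [TopologicalSpace N] [ChartedSpace H N] [IsManifold I ∞ N]

theorem contMDiffAt_extChartAt_symm' {p : N} {u : V} (hu : u ∈ (extChartAt I p).target) :
    ContMDiffAt 𝓘(ℝ, V) I ∞ (extChartAt I p).symm u :=
  (contMDiffOn_extChartAt_symm p).contMDiffAt ((isOpen_extChartAt_target p).mem_nhds hu)

theorem mdifferentiableAt_extChartAt_symm' {p : N} {u : V} (hu : u ∈ (extChartAt I p).target) :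
    MDifferentiableAt 𝓘(ℝ, V) I (extChartAt I p).symm u :=
  (contMDiffAt_extChartAt_symm' I hu).mdifferentiableAt (by simp)

-- The tangent spaces at `f u` and `g u` are different types, but both unfold to the model space
-- `V`; the comparison is made there.
omit [I.Boundaryless] [IsManifold I ∞ N] in
theorem pullback_congr {k : ℕ} (η : ∀ q : N, TangentSpace I q [⋀^Fin k]→L[ℝ] ℝ) {f g : V → N}
    {u : V} (h : f =ᶠ[𝓝 u] g) :
    (η (f u)).compContinuousLinearMap (mfderiv 𝓘(ℝ, V) I f u) =
      (η (g u)).compContinuousLinearMap (mfderiv 𝓘(ℝ, V) I g u) := by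
  have h1 : (mfderiv 𝓘(ℝ, V) I f u : V →L[ℝ] V) = mfderiv 𝓘(ℝ, V) I g u := h.mfderiv_eq
  exact congrArg₂ (fun (q : N) (L : V →L[ℝ] V) =>
    ContinuousAlternatingMap.compContinuousLinearMap (M := TangentSpace I q) (M' := V) (η q) L) h.eq_of_nhds h1

theorem chartInvDeriv_equiv {p : N} {u : V} (hu : u ∈ (extChartAt I p).target) :
    ∃ L : V ≃L[ℝ] TangentSpace I ((extChartAt I p).symm u),
      (L : V →L[ℝ] TangentSpace I ((extChartAt I p).symm u)) = chartInvDeriv I p u := by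
  have : IsManifold I 1 N := IsManifold.of_le (n := ∞) (by simp)
  have h := isInvertible_mfderivWithin_extChartAt_symm (I := I) hu
  rw [I.range_eq_univ, mfderivWithin_univ] at h
  exact h

theorem mfderiv_extChartAt_comp_chartInvDeriv {p p' : N} {u : V}
    (hu : u ∈ (extChartAt I p).target) (hp : (extChartAt I p).symm u ∈ (extChartAt I p').source) :
    (mfderiv I 𝓘(ℝ, V) (extChartAt I p') ((extChartAt I p).symm u)).comp (chartInvDeriv I p u) =
      fderiv ℝ (extChartAt I p' ∘ (extChartAt I p).symm) u := by
  have : IsManifold I 1 N := IsManifold.of_le (n := ∞) (by simp)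
  rw [← mfderiv_eq_fderiv, chartInvDeriv, mfderiv_comp u (mdifferentiableAt_extChartAt
    (by rwa [extChartAt_source] at hp)) (mdifferentiableAt_extChartAt_symm' I hu)]
  rfl

theorem contDiffAt_extChartAt_comp_symm {p p' : N} {u : V}
    (hu : u ∈ (extChartAt I p).target) (hp : (extChartAt I p).symm u ∈ (extChartAt I p').source) :
    ContDiffAt ℝ ∞ (extChartAt I p' ∘ (extChartAt I p).symm) u :=
  ((contMDiffAt_extChartAt' (by rwa [extChartAt_source] at hp)).comp u
    (contMDiffAt_extChartAt_symm' I hu)).contDiffAt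

/-- `extDer` uses at each point the preferred chart of that point, while the local calculus takes
place in one fixed chart; the transition maps link the two. -/
theorem formInChart_eq_pullback {k : ℕ} (η : ∀ q : N, TangentSpace I q [⋀^Fin k]→L[ℝ] ℝ)
    {p p' : N} {u : V} (hu : u ∈ (extChartAt I p).target)
    (hp : (extChartAt I p).symm u ∈ (extChartAt I p').source) :
    formInChart I η p u = (formInChart I η p' ((extChartAt I p' ∘ (extChartAt I p).symm) u)).compContinuousLinearMap
      (fderiv ℝ (extChartAt I p' ∘ (extChartAt I p).symm) u) := by
  have h1 : (extChartAt I p).symm =ᶠ[𝓝 u]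
      (extChartAt I p').symm ∘ (extChartAt I p' ∘ (extChartAt I p).symm) := by
    have h2 := (contMDiffAt_extChartAt_symm' I hu).continuousAt.preimage_mem_nhds
      ((isOpen_extChartAt_source p').mem_nhds hp)
    filter_upwards [h2] with z hz
    exact ((extChartAt I p').left_inv hz).symm
  refine (pullback_congr I η h1).trans ?_
  have hd : MDifferentiableAt 𝓘(ℝ, V) 𝓘(ℝ, V) (extChartAt I p' ∘ (extChartAt I p).symm) u :=
    ((contDiffAt_extChartAt_comp_symm I hu hp).differentiableAt (by simp)).mdifferentiableAt
  rw [mfderiv_comp u (mdifferentiableAt_extChartAt_symm' I ((extChartAt I p').map_source hp)) hd,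
    mfderiv_eq_fderiv]
  rfl

/-- The exterior derivative commutes with the passage to a chart. -/
theorem formInChart_extDer {k : ℕ} (η : ∀ q : N, TangentSpace I q [⋀^Fin k]→L[ℝ] ℝ)
    {p : N} {u : V} (hu : u ∈ (extChartAt I p).target)
    (hd : DifferentiableAt ℝ (formInChart I η ((extChartAt I p).symm u))
      (extChartAt I ((extChartAt I p).symm u) ((extChartAt I p).symm u))) :
    formInChart I (extDer I η) p u = extDeriv (formInChart I η p) u := by
  set x := (extChartAt I p).symm u with hx
  have hp : (extChartAt I p).symm u ∈ (extChartAt I x).source := mem_extChartAt_source x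
  set φ := extChartAt I x ∘ (extChartAt I p).symm with hφ
  have h1 : formInChart I η p =ᶠ[𝓝 u]
      fun z => (formInChart I η x (φ z)).compContinuousLinearMap (fderiv ℝ φ z) := by
    have h2 := (contMDiffAt_extChartAt_symm' I hu).continuousAt.preimage_mem_nhds
      ((isOpen_extChartAt_source x).mem_nhds hp)
    filter_upwards [h2, (isOpen_extChartAt_target p).mem_nhds hu] with z hz hz'
    exact formInChart_eq_pullback I η hz' hz
  rw [h1.extDeriv_eq, extDeriv_pullback (f := φ) hd (contDiffAt_extChartAt_comp_symm I hu hp) (by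
        rw [minSmoothness_of_isRCLikeNormedField]; exact WithTop.coe_le_coe.2 le_top),
    ← mfderiv_extChartAt_comp_chartInvDeriv I hu hp]
  rfl

end Charts

section Charts

variable {V : Type*} [NormedAddCommGroup V] [NormedSpace ℝ V]
  {H : Type*} [TopologicalSpace H] (I : ModelWithCorners ℝ V H)
  {N : Type*} [TopologicalSpace N] [ChartedSpace H N]

theorem formInChart_add {k : ℕ} (α β : ∀ q : N, TangentSpace I q [⋀^Fin k]→L[ℝ] ℝ) (p : N)
    (u : V) : formInChart I (fun q => α q + β q) p u =
      formInChart I α p u + formInChart I β p u := by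
  rfl

theorem formInChart_wedge {k l : ℕ} (α : ∀ q : N, TangentSpace I q [⋀^Fin k]→L[ℝ] ℝ)
    (β : ∀ q : N, TangentSpace I q [⋀^Fin l]→L[ℝ] ℝ) (p : N) (u : V) :
    formInChart I (fun q => wedge (α q) (β q)) p u =
      wedge (formInChart I α p u) (formInChart I β p u) :=
  wedge_compContinuousLinearMap _ _ _

end Charts

/-! ### Potentials, fibre coordinates and curvature of a gauge in charts -/

section LocalGauge

set_option linter.unusedSectionVars false

variable {M : Type*} [TopologicalSpace M] [ChartedSpace R4 M] [IsManifold 𝓘(ℝ, R4) ∞ M]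
  {E : M → Type*} [TopologicalSpace (TotalSpace R3 E)]
  [∀ x, NormedAddCommGroup (E x)] [∀ x, InnerProductSpace ℝ (E x)]
  [FiberBundle R3 E] [VectorBundle ℝ R3 E] [ContMDiffVectorBundle ∞ R3 E 𝓘(ℝ, R4)]
  [IsContMDiffRiemannianBundle 𝓘(ℝ, R4) ∞ R3 E]
  {o : ∀ x, Orientation ℝ (E x) (Fin 3)} {cov : CovariantDerivative 𝓘(ℝ, R4) R3 E}

theorem sum_eps_smul_two {F : Type*} [AddCommGroup F] [Module ℝ F] (i : Fin 3)
    (g : Fin 3 → Fin 3 → F) :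
    ∑ j, ∑ k, eps i j k • g j k = g (i + 1) (i + 2) - g (i + 2) (i + 1) := by
  fin_cases i <;> simp [Fin.sum_univ_three, eps_eq, sub_eq_add_neg,
    show (1 : Fin 3) + 1 = 2 from rfl, show (1 : Fin 3) + 2 = 0 from rfl,
    show (2 : Fin 3) + 1 = 0 from rfl, show (2 : Fin 3) + 2 = 1 from rfl, add_comm]

/-- The connection one-forms of a local gauge, in the preferred chart at `x₀`. -/
def chartPotential (cov : CovariantDerivative 𝓘(ℝ, R4) R3 E) (G : LocalGauge o) (x₀ : M)
    (i : Fin 3) (u : R4) : R4 →L[ℝ] ℝ :=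
  (gaugePotential cov G i ((extChartAt 𝓘(ℝ, R4) x₀).symm u)).comp (chartInvDeriv 𝓘(ℝ, R4) x₀ u)

/-- The fiber coordinates of a local gauge, in the preferred chart at `p`. -/
def chartCoord (G : LocalGauge o) (p : TotalSpace R3 E) (i : Fin 3) (z : R4 × R3) : ℝ :=
  fiberCoord G i ((extChartAt totalModel p).symm z)

/-- The covariant derivatives of the fiber coordinates, in the preferred chart at `p`. -/
def chartCovDer (cov : CovariantDerivative 𝓘(ℝ, R4) R3 E) (G : LocalGauge o)
    (p : TotalSpace R3 E) (i : Fin 3) (z : R4 × R3) : R4 × R3 →L[ℝ] ℝ :=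
  (covDerFiberCoord cov G i ((extChartAt totalModel p).symm z)).comp
    (chartInvDeriv totalModel p z)

theorem formInChart_gaugePotential (G : LocalGauge o) (x₀ : M) (i : Fin 3) :
    formInChart 𝓘(ℝ, R4) (fun x => oneForm (gaugePotential cov G i x)) x₀ =
      fun u => oneForm (chartPotential cov G x₀ i u) := by
  rfl

theorem contMDiffAt_chartInvDeriv {x₀ : M} {u : R4} (hu : u ∈ (extChartAt 𝓘(ℝ, R4) x₀).target)
    (e : R4) : ContMDiffAt 𝓘(ℝ, R4) 𝓘(ℝ, R4).tangent ∞
      (fun z => TotalSpace.mk' R4 ((extChartAt 𝓘(ℝ, R4) x₀).symm z)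
        (chartInvDeriv 𝓘(ℝ, R4) x₀ z e : TangentSpace 𝓘(ℝ, R4) ((extChartAt 𝓘(ℝ, R4) x₀).symm z))) u := by
  have ht := isOpen_extChartAt_target (I := 𝓘(ℝ, R4)) x₀
  have h1 := (contMDiffOn_extChartAt_symm (I := 𝓘(ℝ, R4)) (n := ∞) x₀).contMDiffOn_tangentMapWithin
    (m := ∞) le_rfl ht.uniqueMDiffOn
  have h2 : ContMDiff 𝓘(ℝ, R4) 𝓘(ℝ, R4).tangent ∞ (fun z : R4 => (⟨z, e⟩ : TangentBundle 𝓘(ℝ, R4) R4)) := by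
    intro z
    rw [contMDiffAt_totalSpace]
    refine ⟨contMDiffAt_id, ?_⟩
    simp
    exact contMDiffAt_const
  have h3 := (h1.contMDiffAt (x := ⟨u, e⟩) ?_).comp u h2.contMDiffAt
  · refine h3.congr_of_eventuallyEq ?_
    filter_upwards [ht.mem_nhds hu] with z hz
    simp only [Function.comp, tangentMapWithin, mfderivWithin_of_isOpen ht hz]
    rfl
  · exact (ht.preimage (FiberBundle.continuous_proj R4 _)).mem_nhds hu

/-- On a fixed vector the potential is the inner product of a smooth frame section with the
covariant derivative of another, along a smooth tangent field. -/
theorem contDiffAt_chartPotential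
    (hsmooth : ∀ U : Set M, IsOpen U → ContMDiffCovariantDerivativeOn R3 ∞ cov U)
    (G : LocalGauge o) {x₀ : M} {u : R4} (hu : u ∈ (extChartAt 𝓘(ℝ, R4) x₀).target)
    (hG : (extChartAt 𝓘(ℝ, R4) x₀).symm u ∈ G.U) (i : Fin 3) :
    ContDiffAt ℝ ∞ (chartPotential cov G x₀ i) u := by
  rw [contDiffAt_clm_iff]
  intro e
  have hs := contMDiffAt_extChartAt_symm' 𝓘(ℝ, R4) hu
  have h1 := (((hsmooth G.U G.isOpen).contMDiff (σ := fun z => G.frame z (i + 1))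
    (G.smooth (i + 1))).contMDiffAt (G.isOpen.mem_nhds hG)).comp u hs
  have h2 := h1.clm_bundle_apply (contMDiffAt_chartInvDeriv hu e)
  have h3 := ((G.smooth (i + 2)).contMDiffAt (G.isOpen.mem_nhds hG)).comp u hs
  exact (h3.inner_bundle h2).contDiffAt

/-- The charts of the total space are bundle charts over charts of the base: the first coordinate
alone determines the base point, and the projection becomes `Prod.fst`. -/
theorem extChartAt_symm_proj (p : TotalSpace R3 E) {z : R4 × R3}
    (hz : z ∈ (extChartAt totalModel p).target) :
    ((extChartAt totalModel p).symm z).proj = (extChartAt 𝓘(ℝ, R4) p.proj).symm z.1 ∧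
      z.1 ∈ (extChartAt 𝓘(ℝ, R4) p.proj).target := by
  rw [FiberBundle.extChartAt_target] at hz
  refine ⟨?_, hz.1.1⟩
  rw [FiberBundle.extChartAt]
  exact (trivializationAt R3 E p.proj).proj_symm_apply' hz.1.2

theorem contDiffAt_chartCoord (G : LocalGauge o) {p : TotalSpace R3 E} {z : R4 × R3}
    (hz : z ∈ (extChartAt totalModel p).target)
    (hG : ((extChartAt totalModel p).symm z).proj ∈ G.U) (i : Fin 3) :
    ContDiffAt ℝ ∞ (chartCoord G p i) z := by
  have hs := contMDiffAt_extChartAt_symm' totalModel hz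
  have h1 := (((G.smooth i).contMDiffAt (G.isOpen.mem_nhds hG)).comp _
    (contMDiff_proj E).contMDiffAt).comp z hs
  exact (ContMDiffAt.inner_bundle (b := fun z => ((extChartAt totalModel p).symm z).proj)
    (w := fun z => ((extChartAt totalModel p).symm z).snd) h1 hs).contDiffAt

theorem projDeriv_comp_chartInvDeriv {p : TotalSpace R3 E} {z : R4 × R3}
    (hz : z ∈ (extChartAt totalModel p).target) :
    ((projDeriv ((extChartAt totalModel p).symm z)).comp (chartInvDeriv totalModel p z) :
      R4 × R3 →L[ℝ] R4) =
      ContinuousLinearMap.comp (chartInvDeriv 𝓘(ℝ, R4) p.proj z.1 : R4 →L[ℝ] R4)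
        (ContinuousLinearMap.fst ℝ R4 R3) := by
  have h1 : (TotalSpace.proj : TotalSpace R3 E → M) ∘ (extChartAt totalModel p).symm =ᶠ[𝓝 z]
      (extChartAt 𝓘(ℝ, R4) p.proj).symm ∘ (Prod.fst : R4 × R3 → R4) := by
    filter_upwards [(isOpen_extChartAt_target p).mem_nhds hz] with w hw
    exact (extChartAt_symm_proj p hw).1
  have h2 : (mfderiv 𝓘(ℝ, R4 × R3) 𝓘(ℝ, R4)
      ((TotalSpace.proj : TotalSpace R3 E → M) ∘ (extChartAt totalModel p).symm) z :
        R4 × R3 →L[ℝ] R4) = _ := h1.mfderiv_eq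
  rw [mfderiv_comp z ((contMDiff_proj (n := ∞) E).contMDiffAt.mdifferentiableAt (by simp))
    (mdifferentiableAt_extChartAt_symm' totalModel hz)] at h2
  refine Eq.trans ?_ (h2.trans ?_)
  · rfl
  · rw [mfderiv_comp z (mdifferentiableAt_extChartAt_symm' _ (extChartAt_symm_proj p hz).2)
      differentiableAt_fst.mdifferentiableAt, mfderiv_eq_fderiv, fderiv_fst]
    rfl

theorem gaugePotential_comp_projDeriv (G : LocalGauge o) {p : TotalSpace R3 E} {z : R4 × R3}
    (hz : z ∈ (extChartAt totalModel p).target) (i : Fin 3) :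
    (((gaugePotential cov G i ((extChartAt totalModel p).symm z).proj).comp
      (projDeriv ((extChartAt totalModel p).symm z))).comp (chartInvDeriv totalModel p z) :
        R4 × R3 →L[ℝ] ℝ) =
      (chartPotential cov G p.proj i z.1).comp (ContinuousLinearMap.fst ℝ R4 R3) :=
  congrArg₂ (fun (q : M) (L : R4 × R3 →L[ℝ] R4) =>
    ContinuousLinearMap.comp (gaugePotential cov G i q : R4 →L[ℝ] ℝ) L)
    (extChartAt_symm_proj p hz).1 (projDeriv_comp_chartInvDeriv hz)

theorem form_comp_projDeriv {p : TotalSpace R3 E} {z : R4 × R3}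
    (hz : z ∈ (extChartAt totalModel p).target)
    (β : ∀ x : M, TangentSpace 𝓘(ℝ, R4) x [⋀^Fin 2]→L[ℝ] ℝ) :
    ((β ((extChartAt totalModel p).symm z).proj).compContinuousLinearMap
      (projDeriv ((extChartAt totalModel p).symm z))).compContinuousLinearMap
        (chartInvDeriv totalModel p z) =
      (formInChart 𝓘(ℝ, R4) β p.proj z.1).compContinuousLinearMap
        (ContinuousLinearMap.fst ℝ R4 R3) :=
  ContinuousAlternatingMap.ext fun w => congrArg₂ (fun (q : M) (L : R4 × R3 →L[ℝ] R4) =>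
    β q (fun i => (L (w i) : TangentSpace 𝓘(ℝ, R4) q)))
    (extChartAt_symm_proj p hz).1 (projDeriv_comp_chartInvDeriv hz)

theorem chartCovDer_eq (G : LocalGauge o) {p : TotalSpace R3 E} {z : R4 × R3}
    (hz : z ∈ (extChartAt totalModel p).target)
    (hG : ((extChartAt totalModel p).symm z).proj ∈ G.U) (i : Fin 3) :
    chartCovDer cov G p i z = fderiv ℝ (chartCoord G p i) z +
      (chartCoord G p (i + 2) z •
          (chartPotential cov G p.proj (i + 1) z.1).comp (ContinuousLinearMap.fst ℝ R4 R3) -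
        chartCoord G p (i + 1) z •
          (chartPotential cov G p.proj (i + 2) z.1).comp (ContinuousLinearMap.fst ℝ R4 R3)) := by
  have hs := contMDiffAt_extChartAt_symm' totalModel hz
  have hY : MDifferentiableAt totalModel 𝓘(ℝ, ℝ) (fiberCoord G i)
      ((extChartAt totalModel p).symm z) := by
    have h1 := ((G.smooth i).contMDiffAt (G.isOpen.mem_nhds hG)).comp _
      (contMDiff_proj E).contMDiffAt
    exact (ContMDiffAt.inner_bundle (b := fun q : TotalSpace R3 E => q.proj)
      (w := fun q => q.snd) h1 contMDiffAt_id).mdifferentiableAt (by simp)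
  have h1 : (mvfderiv totalModel (fiberCoord G i) ((extChartAt totalModel p).symm z)).comp
      (chartInvDeriv totalModel p z) = fderiv ℝ (chartCoord G p i) z := by
    rw [← mfderiv_eq_fderiv]
    refine Eq.trans ?_ (mfderiv_comp z hY (mdifferentiableAt_extChartAt_symm' totalModel hz)).symm
    rfl
  rw [← h1, chartCovDer, covDerFiberCoord]
  have h2 := gaugePotential_comp_projDeriv (cov := cov) G hz
  simp only [mul_smul]
  rw [sum_eps_smul_two i fun j k => fiberCoord G k ((extChartAt totalModel p).symm z) •
    (gaugePotential cov G j ((extChartAt totalModel p).symm z).proj).comp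
      (projDeriv ((extChartAt totalModel p).symm z)), ← h2, ← h2]
  rfl

theorem gaugeCurvature_eq (G : LocalGauge o) (i : Fin 3) :
    gaugeCurvature cov G i = fun x => extDer 𝓘(ℝ, R4)
      (fun z => oneForm (gaugePotential cov G i z)) x +
        wedge (oneForm (gaugePotential cov G (i + 1) x))
          (oneForm (gaugePotential cov G (i + 2) x)) := by
  funext x
  rw [gaugeCurvature]
  congr 1
  refine (congrArg ((1 / 2 : ℝ) • ·) (sum_eps_smul_two i fun j k =>
    (wedge (oneForm (gaugePotential cov G j x)) (oneForm (gaugePotential cov G k x)) :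
      TangentSpace 𝓘(ℝ, R4) x [⋀^Fin 2]→L[ℝ] ℝ))).trans ?_
  refine ContinuousAlternatingMap.ext fun w => ?_
  refine Eq.trans (b := (1 / 2 : ℝ) * ((wedge (oneForm (gaugePotential cov G (i + 1) x))
    (oneForm (gaugePotential cov G (i + 2) x)) : TangentSpace 𝓘(ℝ, R4) x [⋀^Fin 2]→L[ℝ] ℝ) w -
    (wedge (oneForm (gaugePotential cov G (i + 2) x))
    (oneForm (gaugePotential cov G (i + 1) x)) : TangentSpace 𝓘(ℝ, R4) x [⋀^Fin 2]→L[ℝ] ℝ) w))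
    rfl ?_
  rw [wedge_one_one_apply, wedge_one_one_apply]
  ring

theorem formInChart_gaugeCurvature
    (hsmooth : ∀ U : Set M, IsOpen U → ContMDiffCovariantDerivativeOn R3 ∞ cov U)
    (G : LocalGauge o) {x₀ : M} {u : R4} (hu : u ∈ (extChartAt 𝓘(ℝ, R4) x₀).target)
    (hG : (extChartAt 𝓘(ℝ, R4) x₀).symm u ∈ G.U) (i : Fin 3) :
    formInChart 𝓘(ℝ, R4) (gaugeCurvature cov G i) x₀ u =
      curvatureOf (chartPotential cov G x₀) i u := by
  have hd : DifferentiableAt ℝ (formInChart 𝓘(ℝ, R4)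
      (fun x => oneForm (gaugePotential cov G i x)) ((extChartAt 𝓘(ℝ, R4) x₀).symm u))
        (extChartAt 𝓘(ℝ, R4) ((extChartAt 𝓘(ℝ, R4) x₀).symm u)
          ((extChartAt 𝓘(ℝ, R4) x₀).symm u)) := by
    generalize (extChartAt 𝓘(ℝ, R4) x₀).symm u = x at hG
    have h1 : (extChartAt 𝓘(ℝ, R4) x).symm (extChartAt 𝓘(ℝ, R4) x x) ∈ G.U := by
      rwa [(extChartAt 𝓘(ℝ, R4) x).left_inv (mem_extChartAt_source x)]
    rw [formInChart_gaugePotential]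
    exact (hasFDerivAt_oneForm ((contDiffAt_chartPotential hsmooth G
      (mem_extChartAt_target x) h1 i).differentiableAt (by simp))).differentiableAt
  have h2 := formInChart_extDer 𝓘(ℝ, R4) (fun x => oneForm (gaugePotential cov G i x)) hu hd
  rw [curvatureOf, ← formInChart_gaugePotential, ← h2, gaugeCurvature_eq, formInChart_add,
    formInChart_wedge]
  rfl

end LocalGauge

/-! ### Pullback of the calibrating form and of the curvature -/

section Pullback

/-- The `ε`-sum consists of six equal terms, which the factor `1/6` compensates. -/
theorem calibrating_pullback {V W : Type*} [NormedAddCommGroup V] [NormedSpace ℝ V]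
    [AddCommGroup W] [Module ℝ W] [TopologicalSpace W] [IsTopologicalAddGroup W]
    [ContinuousSMul ℝ W] (L : V →L[ℝ] W) (θ : Fin 3 → W →L[ℝ] ℝ) (F : Fin 3 → W [⋀^Fin 2]→L[ℝ] ℝ)
    (c k : ℝ) :
    (((1 / 6) * c) • ∑ i, ∑ j, ∑ k, eps i j k • (wedge (wedge (oneForm (θ i)) (oneForm (θ j)))
        (oneForm (θ k)) : W [⋀^Fin 3]→L[ℝ] ℝ) +
      k • ∑ i, (wedge (oneForm (θ i)) (F i) : W [⋀^Fin 3]→L[ℝ] ℝ)).compContinuousLinearMap L =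
    c • detForm ![(θ 0).comp L, (θ 1).comp L, (θ 2).comp L] +
      k • ∑ i, (wedge (oneForm ((θ i).comp L)) ((F i).compContinuousLinearMap L) :
        V [⋀^Fin 3]→L[ℝ] ℝ) := by
  have h1 : ∀ i j k, (wedge (wedge (oneForm (θ i)) (oneForm (θ j))) (oneForm (θ k)) :
      W [⋀^Fin 3]→L[ℝ] ℝ).compContinuousLinearMap L = (wedge (wedge (oneForm ((θ i).comp L))
        (oneForm ((θ j).comp L))) (oneForm ((θ k).comp L)) : V [⋀^Fin 3]→L[ℝ] ℝ) := fun i j k => by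
    refine (wedge_compContinuousLinearMap (wedge (oneForm (θ i)) (oneForm (θ j)))
      (oneForm (θ k)) L).trans ?_
    rw [wedge_compContinuousLinearMap]
    rfl
  have h2 : ∀ i, (wedge (oneForm (θ i)) (F i) : W [⋀^Fin 3]→L[ℝ] ℝ).compContinuousLinearMap L =
      (wedge (oneForm ((θ i).comp L)) ((F i).compContinuousLinearMap L) :
        V [⋀^Fin 3]→L[ℝ] ℝ) := fun i => wedge_compContinuousLinearMap (oneForm (θ i)) (F i) L
  have h3 := sum_eps_wedge fun i => (θ i).comp L
  simp only [← h1] at h3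
  simp only [← h2]
  have h4 : c • detForm ![(θ 0).comp L, (θ 1).comp L, (θ 2).comp L] =
      ((1 / 6) * c) • (6 : ℝ) • detForm ![(θ 0).comp L, (θ 1).comp L, (θ 2).comp L] := by
    rw [smul_smul]
    congr 1
    ring
  rw [h4, ← h3]
  refine ContinuousAlternatingMap.ext fun w => ?_
  simp only [ContinuousAlternatingMap.compContinuousLinearMap_apply,
    ContinuousAlternatingMap.add_apply, ContinuousAlternatingMap.smul_apply,
    ContinuousAlternatingMap.sum_apply]

theorem curvatureOf_pullback_apply {V W : Type*} [NormedAddCommGroup V] [NormedSpace ℝ V]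
    [NormedAddCommGroup W] [NormedSpace ℝ W] (L : V →L[ℝ] W) {a : Fin 3 → W → W →L[ℝ] ℝ} {z : V}
    {i : Fin 3} (ha : DifferentiableAt ℝ (a i) (L z)) (v w : V) :
    (curvatureOf a i (L z)).compContinuousLinearMap L ![v, w] =
      extDeriv (fun u => oneForm ((a i (L u)).comp L)) z ![v, w] +
      ((a (i + 1) (L z)).comp L v * (a (i + 2) (L z)).comp L w -
        (a (i + 1) (L z)).comp L w * (a (i + 2) (L z)).comp L v) := by
  have h2 := extDeriv_pullback (f := L) (hasFDerivAt_oneForm ha).differentiableAt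
    (L.contDiff (n := ∞)).contDiffAt (by
      rw [minSmoothness_of_isRCLikeNormedField]; exact WithTop.coe_le_coe.2 le_top)
  simp only [ContinuousLinearMap.fderiv, oneForm_compContinuousLinearMap] at h2
  have h3 := wedge_one_one_apply (a (i + 1) (L z)) (a (i + 2) (L z)) ![L v, L w]
  have h4 : (L ∘ ![v, w]) = ![L v, L w] := by ext i; fin_cases i <;> rfl
  rw [h2, ContinuousAlternatingMap.compContinuousLinearMap_apply,
    ContinuousAlternatingMap.compContinuousLinearMap_apply, h4, curvatureOf,
    ContinuousAlternatingMap.add_apply, h3]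
  rfl

theorem contDiffAt_calibrating {V : Type*} [NormedAddCommGroup V] [NormedSpace ℝ V]
    {θ : Fin 3 → V → V →L[ℝ] ℝ} {F : Fin 3 → V → V [⋀^Fin 2]→L[ℝ] ℝ} {c k : V → ℝ} {z : V}
    (hc : ContDiffAt ℝ ∞ c z) (hk : ContDiffAt ℝ ∞ k z) (hθ : ∀ i, ContDiffAt ℝ ∞ (θ i) z)
    (hF : ∀ i, ContDiffAt ℝ ∞ (F i) z) :
    ContDiffAt ℝ ∞ (fun u => c u • detForm ![θ 0 u, θ 1 u, θ 2 u] +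
      k u • ∑ i, (wedge (oneForm (θ i u)) (F i u) : V [⋀^Fin 3]→L[ℝ] ℝ)) z := by
  have h1 : ∀ i, ContDiffAt ℝ ∞ (fun u => oneForm (θ i u)) z := fun i =>
    (oneFormL V).contDiff.contDiffAt.comp z (hθ i)
  have hdet : ContDiffAt ℝ ∞ (fun u => detForm ![θ 0 u, θ 1 u, θ 2 u]) z := by
    simp only [← wedge_three_oneForm]
    exact ((h1 0).wedge (h1 1)).wedge (h1 2)
  have hsum : ContDiffAt ℝ ∞
      (fun u => ∑ i, (wedge (oneForm (θ i u)) (F i u) : V [⋀^Fin 3]→L[ℝ] ℝ)) z :=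
    ContDiffAt.sum fun i _ => (h1 i).wedge (hF i)
  exact (hc.smul hdet).add (hk.smul hsum)

theorem isGaugeJet_pullback {V W : Type*} [NormedAddCommGroup V] [NormedSpace ℝ V]
    [NormedAddCommGroup W] [NormedSpace ℝ W] (L : V →L[ℝ] W) {a : Fin 3 → W → W →L[ℝ] ℝ} {z : V}
    {Y : Fin 3 → V → ℝ} {θ : Fin 3 → V → V →L[ℝ] ℝ}
    (ha : ∀ i, DifferentiableAt ℝ (a i) (L z)) (hY : ∀ i, ContDiffAt ℝ ∞ (Y i) z)
    (hθ : ∀ i, θ i =ᶠ[𝓝 z] fun u => fderiv ℝ (Y i) u +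
      (Y (i + 2) u • (a (i + 1) (L u)).comp L - Y (i + 1) u • (a (i + 2) (L u)).comp L)) :
    IsGaugeJet Y θ (fun i => (a i (L z)).comp L)
      (fun i => (curvatureOf a i (L z)).compContinuousLinearMap L) z :=
  isGaugeJet_of_eventuallyEq (α := fun i u => (a i (L u)).comp L)
    (fun i => ((ha i).comp z L.differentiableAt).clm_comp (differentiableAt_const _)) hY
    (fun i v w => curvatureOf_pullback_apply L (ha i) v w) hθ

end Pullback

/-! ### The calibrating form in a chart of the total space: smooth and closed -/

section LocalGauge

set_option linter.unusedSectionVars false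

variable {M : Type*} [TopologicalSpace M] [ChartedSpace R4 M] [IsManifold 𝓘(ℝ, R4) ∞ M]
  {E : M → Type*} [TopologicalSpace (TotalSpace R3 E)]
  [∀ x, NormedAddCommGroup (E x)] [∀ x, InnerProductSpace ℝ (E x)]
  [FiberBundle R3 E] [VectorBundle ℝ R3 E] [ContMDiffVectorBundle ∞ R3 E 𝓘(ℝ, R4)]
  [IsContMDiffRiemannianBundle 𝓘(ℝ, R4) ∞ R3 E]
  {o : ∀ x, Orientation ℝ (E x) (Fin 3)} {cov : CovariantDerivative 𝓘(ℝ, R4) R3 E}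

/-- The curvature two-forms of a local gauge on the total space, in the preferred chart at `p`. -/
def chartCurvature (cov : CovariantDerivative 𝓘(ℝ, R4) R3 E) (G : LocalGauge o)
    (p : TotalSpace R3 E) (i : Fin 3) (z : R4 × R3) : (R4 × R3) [⋀^Fin 2]→L[ℝ] ℝ :=
  (curvatureOf (chartPotential cov G p.proj) i z.1).compContinuousLinearMap
    (ContinuousLinearMap.fst ℝ R4 R3)

/-- The chart of the total space at `p`, over the domain of a local gauge. -/
def gaugeTarget (G : LocalGauge o) (p : TotalSpace R3 E) : Set (R4 × R3) :=
  {z | z ∈ (extChartAt totalModel p).target ∧ ((extChartAt totalModel p).symm z).proj ∈ G.U}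

theorem gaugeTarget_mem_nhds {G : LocalGauge o} {p : TotalSpace R3 E} {z : R4 × R3}
    (hz : z ∈ gaugeTarget G p) : gaugeTarget G p ∈ 𝓝 z := by
  have h1 := (contMDiffAt_extChartAt_symm' totalModel hz.1).continuousAt.preimage_mem_nhds
    ((G.isOpen.preimage (FiberBundle.continuous_proj R3 E)).mem_nhds hz.2)
  exact Filter.inter_mem ((isOpen_extChartAt_target p).mem_nhds hz.1) h1

theorem mem_gaugeTarget {G : LocalGauge o} {p : TotalSpace R3 E} (hp : p.proj ∈ G.U) :
    extChartAt totalModel p p ∈ gaugeTarget G p :=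
  ⟨mem_extChartAt_target p, by
    rwa [(extChartAt totalModel p).left_inv (mem_extChartAt_source p)]⟩

theorem fst_mem_of_mem_gaugeTarget {G : LocalGauge o} {p : TotalSpace R3 E} {z : R4 × R3}
    (hz : z ∈ gaugeTarget G p) : (extChartAt 𝓘(ℝ, R4) p.proj).symm z.1 ∈ G.U := by
  rw [← (extChartAt_symm_proj p hz.1).1]
  exact hz.2

theorem formInChart_calibratingForm
    (hsmooth : ∀ U : Set M, IsOpen U → ContMDiffCovariantDerivativeOn R3 ∞ cov U)
    (G : LocalGauge o) {p : TotalSpace R3 E} {z : R4 × R3} (hz : z ∈ gaugeTarget G p) (s : ℝ) :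
    formInChart totalModel (calibratingForm cov G s) p z =
      (1 + s * ∑ i, chartCoord G p i z ^ 2) ^ (-(3 / 4) : ℝ) •
        detForm ![chartCovDer cov G p 0 z, chartCovDer cov G p 1 z, chartCovDer cov G p 2 z] +
      (2 * s * (1 + s * ∑ i, chartCoord G p i z ^ 2) ^ (1 / 4 : ℝ)) •
        ∑ i, (wedge (oneForm (chartCovDer cov G p i z)) (chartCurvature cov G p i z) :
          (R4 × R3) [⋀^Fin 3]→L[ℝ] ℝ) := by
  have h1 : ∀ i, chartCurvature cov G p i z =
      ((gaugeCurvature cov G i ((extChartAt totalModel p).symm z).proj).compContinuousLinearMap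
      (projDeriv ((extChartAt totalModel p).symm z))).compContinuousLinearMap
        (chartInvDeriv totalModel p z) := fun i => by
    rw [chartCurvature, ← formInChart_gaugeCurvature hsmooth G (extChartAt_symm_proj p hz.1).2
      (fst_mem_of_mem_gaugeTarget hz), form_comp_projDeriv hz.1]
  simp only [h1, chartCovDer, chartCoord, formInChart, calibratingForm]
  have key := calibrating_pullback (chartInvDeriv totalModel p z)
    (fun i => covDerFiberCoord cov G i ((extChartAt totalModel p).symm z))
    (fun i => (gaugeCurvature cov G i ((extChartAt totalModel p).symm z).proj).compContinuousLinearMap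
      (projDeriv ((extChartAt totalModel p).symm z)))
    ((1 + s * ∑ i, fiberCoord G i ((extChartAt totalModel p).symm z) ^ 2) ^ (-(3 / 4) : ℝ))
    (2 * s * (1 + s * ∑ i, fiberCoord G i ((extChartAt totalModel p).symm z) ^ 2) ^ (1 / 4 : ℝ))
  beta_reduce at key
  rw [key]

theorem isGaugeJet_chart
    (hsmooth : ∀ U : Set M, IsOpen U → ContMDiffCovariantDerivativeOn R3 ∞ cov U)
    (G : LocalGauge o) {p : TotalSpace R3 E} {z : R4 × R3} (hz : z ∈ gaugeTarget G p) :
    IsGaugeJet (chartCoord G p) (chartCovDer cov G p)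
      (fun i => (chartPotential cov G p.proj i z.1).comp (ContinuousLinearMap.fst ℝ R4 R3))
      (fun i => chartCurvature cov G p i z) z := by
  have h := isGaugeJet_pullback (a := chartPotential cov G p.proj) (z := z)
    (Y := chartCoord G p) (θ := chartCovDer cov G p) (ContinuousLinearMap.fst ℝ R4 R3)
    (fun i => (contDiffAt_chartPotential hsmooth G (extChartAt_symm_proj p hz.1).2
      (fst_mem_of_mem_gaugeTarget hz) i).differentiableAt (by simp))
    (fun i => contDiffAt_chartCoord G hz.1 hz.2 i) (fun i => by
      filter_upwards [gaugeTarget_mem_nhds hz] with u hu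
      exact chartCovDer_eq G hu.1 hu.2 i)
  exact h

theorem isCovClosed_chartCurvature
    (hsmooth : ∀ U : Set M, IsOpen U → ContMDiffCovariantDerivativeOn R3 ∞ cov U)
    (G : LocalGauge o) {p : TotalSpace R3 E} {z : R4 × R3} (hz : z ∈ gaugeTarget G p) :
    IsCovClosed (fun i => (chartPotential cov G p.proj i z.1).comp (ContinuousLinearMap.fst ℝ R4 R3))
      (chartCurvature cov G p) z :=
  (isCovClosed_curvatureOf fun i => contDiffAt_chartPotential hsmooth G
    (extChartAt_symm_proj p hz.1).2 (fst_mem_of_mem_gaugeTarget hz) i).pullback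
    (L := ContinuousLinearMap.fst ℝ R4 R3)

theorem contDiffAt_chartCovDer
    (hsmooth : ∀ U : Set M, IsOpen U → ContMDiffCovariantDerivativeOn R3 ∞ cov U)
    (G : LocalGauge o) {p : TotalSpace R3 E} {z : R4 × R3} (hz : z ∈ gaugeTarget G p) (i : Fin 3) :
    ContDiffAt ℝ ∞ (chartCovDer cov G p i) z := by
  have hY : ∀ i, ContDiffAt ℝ ∞ (chartCoord G p i) z := contDiffAt_chartCoord G hz.1 hz.2
  have ha : ∀ i, ContDiffAt ℝ ∞ (fun u : R4 × R3 => (chartPotential cov G p.proj i u.1).comp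
      (ContinuousLinearMap.fst ℝ R4 R3)) z := fun i => by
    have h1 : ContDiffAt ℝ ∞ (fun u : R4 × R3 => chartPotential cov G p.proj i u.1) z :=
      (contDiffAt_chartPotential hsmooth G (extChartAt_symm_proj p hz.1).2
        (fst_mem_of_mem_gaugeTarget hz) i).comp z contDiffAt_fst
    exact h1.clm_comp contDiffAt_const
  refine ContDiffAt.congr_of_eventuallyEq (((hY i).fderiv_right (m := ∞) le_rfl).add
    (((hY (i + 2)).smul (ha (i + 1))).sub ((hY (i + 1)).smul (ha (i + 2))))) ?_
  filter_upwards [gaugeTarget_mem_nhds hz] with u hu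
  exact chartCovDer_eq G hu.1 hu.2 i

theorem contDiffAt_curvatureOf {W : Type*} [NormedAddCommGroup W] [NormedSpace ℝ W]
    [FiniteDimensional ℝ W] {a : Fin 3 → W → W →L[ℝ] ℝ} {x : W}
    (ha : ∀ i, ContDiffAt ℝ ∞ (a i) x) (i : Fin 3) : ContDiffAt ℝ ∞ (curvatureOf a i) x := by
  have h1 : ∀ i, ContDiffAt ℝ ∞ (fun u => oneForm (a i u)) x := fun i =>
    (oneFormL W).contDiff.contDiffAt.comp x (ha i)
  exact (h1 i).extDeriv.add ((h1 (i + 1)).wedge (h1 (i + 2)))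

theorem contDiffAt_chartCurvature
    (hsmooth : ∀ U : Set M, IsOpen U → ContMDiffCovariantDerivativeOn R3 ∞ cov U)
    (G : LocalGauge o) {p : TotalSpace R3 E} {z : R4 × R3} (hz : z ∈ gaugeTarget G p) (i : Fin 3) :
    ContDiffAt ℝ ∞ (chartCurvature cov G p i) z := by
  have h1 : ContDiffAt ℝ ∞ (fun u : R4 × R3 => curvatureOf (chartPotential cov G p.proj) i u.1) z :=
    (contDiffAt_curvatureOf (fun i => contDiffAt_chartPotential hsmooth G
      (extChartAt_symm_proj p hz.1).2 (fst_mem_of_mem_gaugeTarget hz) i) i).comp z contDiffAt_fst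
  exact h1.form_pullback contDiffAt_const

theorem contDiffAt_calibratingForm
    (hsmooth : ∀ U : Set M, IsOpen U → ContMDiffCovariantDerivativeOn R3 ∞ cov U)
    (G : LocalGauge o) {p : TotalSpace R3 E} {z : R4 × R3} (hz : z ∈ gaugeTarget G p) {s : ℝ}
    (hs : 0 < 1 + s * ∑ i, chartCoord G p i z ^ 2) :
    ContDiffAt ℝ ∞ (formInChart totalModel (calibratingForm cov G s) p) z := by
  have hY : ∀ i, ContDiffAt ℝ ∞ (chartCoord G p i) z := contDiffAt_chartCoord G hz.1 hz.2
  have hN : ContDiffAt ℝ ∞ (fun u => 1 + s * ∑ i, chartCoord G p i u ^ 2) z :=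
    contDiffAt_const.add (contDiffAt_const.mul (ContDiffAt.sum fun i _ => (hY i).pow 2))
  refine ContDiffAt.congr_of_eventuallyEq (contDiffAt_calibrating
    (hN.rpow_const_of_ne (p := -(3 / 4)) hs.ne')
    (contDiffAt_const (c := 2 * s) |>.mul (hN.rpow_const_of_ne (p := 1 / 4) hs.ne'))
    (contDiffAt_chartCovDer hsmooth G hz) (contDiffAt_chartCurvature hsmooth G hz)) ?_
  filter_upwards [gaugeTarget_mem_nhds hz] with u hu
  exact formInChart_calibratingForm hsmooth G hu s

theorem extDeriv_calibratingForm
    (hsmooth : ∀ U : Set M, IsOpen U → ContMDiffCovariantDerivativeOn R3 ∞ cov U)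
    (G : LocalGauge o) {p : TotalSpace R3 E} {z : R4 × R3} (hz : z ∈ gaugeTarget G p) {s : ℝ}
    (hσ : s * s = 1) (hs : 0 < 1 + s * ∑ i, chartCoord G p i z ^ 2) :
    extDeriv (formInChart totalModel (calibratingForm cov G s) p) z = 0 := by
  rw [← (isGaugeJet_chart hsmooth G hz).extDeriv_eq_zero (isCovClosed_chartCurvature hsmooth G hz)
    hσ hs]
  refine Filter.EventuallyEq.extDeriv_eq ?_
  filter_upwards [gaugeTarget_mem_nhds hz] with u hu
  exact formInChart_calibratingForm hsmooth G hu s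

end LocalGauge

/-! ### Change of gauge -/

section GaugeChange

/-- The matrix `P` is a rotation: its columns are orthonormal and it agrees with its matrix of
cofactors. -/
structure IsRotation (P : Fin 3 → Fin 3 → ℝ) : Prop where
  col : ∀ i j, ∑ l, P l i * P l j = if i = j then 1 else 0
  row : ∀ i j, ∑ l, P i l * P j l = if i = j then 1 else 0
  cof : ∀ i j, P (i + 1) (j + 1) * P (i + 2) (j + 2) - P (i + 1) (j + 2) * P (i + 2) (j + 1) = P i j

/-- For determinant `1` the adjugate is the inverse, and for an orthogonal matrix the inverse is the
transpose. -/
theorem isRotation_of_det {P : Matrix (Fin 3) (Fin 3) ℝ} (h : P.transpose * P = 1)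
    (hd : P.det = 1) : IsRotation P := by
  have h' : P * P.transpose = 1 := mul_eq_one_comm.1 h
  have hadj : P.adjugate = P.transpose := by
    have h1 : P.adjugate * P = 1 := by rw [Matrix.adjugate_mul, hd, one_smul]
    calc P.adjugate = P.adjugate * (P * P.transpose) := by rw [h', mul_one]
      _ = P.transpose := by rw [← mul_assoc, h1, one_mul]
  refine ⟨fun i j => ?_, fun i j => ?_, fun i j => ?_⟩
  · simpa [Matrix.mul_apply, Matrix.one_apply] using congrFun (congrFun h i) j
  · simpa [Matrix.mul_apply, Matrix.one_apply] using congrFun (congrFun h' i) j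
  · have h2 := congrFun (congrFun hadj j) i
    rw [Matrix.transpose_apply, Matrix.adjugate_fin_three] at h2
    rw [← h2]
    fin_cases i <;> fin_cases j <;> simp [show (1 : Fin 3) + 1 = 2 from rfl,
      show (1 : Fin 3) + 2 = 0 from rfl, show (2 : Fin 3) + 1 = 0 from rfl,
      show (2 : Fin 3) + 2 = 1 from rfl] <;> ring

theorem isRotation_orthonormalBasis {F : Type*} [NormedAddCommGroup F] [InnerProductSpace ℝ F]
    {b b' : OrthonormalBasis (Fin 3) ℝ F} (h : b.toBasis.orientation = b'.toBasis.orientation) :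
    IsRotation fun i j => inner ℝ (b i) (b' j) := by
  have h1 : b.toBasis.toMatrix b' = Matrix.of fun i j => inner ℝ (b i) (b' j) := by
    ext i j
    simp [Module.Basis.toMatrix_apply, OrthonormalBasis.repr_apply_apply]
  have hd := OrthonormalBasis.det_to_matrix_orthonormalBasis_of_same_orientation b b' h
  rw [Module.Basis.det_apply, h1] at hd
  refine isRotation_of_det (P := Matrix.of fun i j => inner ℝ (b i) (b' j)) ?_ hd
  ext i j
  simp only [Matrix.mul_apply, Matrix.transpose_apply, Matrix.of_apply, Matrix.one_apply]
  have h2 := OrthonormalBasis.sum_inner_mul_inner b (b' i) (b' j)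
  rw [orthonormal_iff_ite.1 b'.orthonormal i j] at h2
  rw [← h2]
  simp only [real_inner_comm (b' i)]

variable {W : Type*} [NormedAddCommGroup W] [NormedSpace ℝ W]

theorem add_one_add_one (i : Fin 3) : i + 1 + 1 = i + 2 := by fin_cases i <;> rfl
theorem add_one_add_two (i : Fin 3) : i + 1 + 2 = i := by fin_cases i <;> rfl
theorem add_two_add_one (i : Fin 3) : i + 2 + 1 = i := by fin_cases i <;> rfl
theorem add_two_add_two (i : Fin 3) : i + 2 + 2 = i + 1 := by fin_cases i <;> rfl

theorem sum_fin_three_shift {F : Type*} [AddCommGroup F] (f : Fin 3 → F) (i : Fin 3) :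
    ∑ l, f l = f i + f (i + 1) + f (i + 2) := by
  rw [Fin.sum_univ_three]
  fin_cases i <;> simp [show (1 : Fin 3) + 1 = 2 from rfl,
      show (1 : Fin 3) + 2 = 0 from rfl, show (2 : Fin 3) + 1 = 0 from rfl,
      show (2 : Fin 3) + 2 = 1 from rfl] <;> abel

/-- The transformation law of the potentials of a connection under a change of gauge `P`. -/
def IsGaugeChange (P : Fin 3 → Fin 3 → W → ℝ) (a a' : Fin 3 → W → W →L[ℝ] ℝ) (u : W) : Prop :=
  ∀ l k, HasFDerivAt (P l k) (P (l + 1) k u • a (l + 2) u - P (l + 2) k u • a (l + 1) u +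
    (P l (k + 1) u • a' (k + 2) u - P l (k + 2) u • a' (k + 1) u)) u

/-- This is `d(dP) = 0`, with `dP` expressed by the two potentials. It yields a linear relation
between the two curvatures in which no derivative of `P` is left. -/
theorem IsGaugeChange.curvature_relation {P : Fin 3 → Fin 3 → W → ℝ} {a a' : Fin 3 → W → W →L[ℝ] ℝ}
    {x : W} (h : ∀ᶠ u in 𝓝 x, IsGaugeChange P a a' u) (hP : ∀ l k, ContDiffAt ℝ ∞ (P l k) x)
    (ha : ∀ i, DifferentiableAt ℝ (a i) x) (ha' : ∀ i, DifferentiableAt ℝ (a' i) x)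
    (l k : Fin 3) (v w : W) :
    P (l + 1) k x * curvatureOf a (l + 2) x ![v, w] - P (l + 2) k x * curvatureOf a (l + 1) x ![v, w]
      + (P l (k + 1) x * curvatureOf a' (k + 2) x ![v, w] -
        P l (k + 2) x * curvatureOf a' (k + 1) x ![v, w]) = 0 := by
  have hx := h.self_of_nhds
  have h1 := extDeriv_oneForm_fderiv (hP l k) v w
  have h2 : fderiv ℝ (P l k) =ᶠ[𝓝 x] fun u => P (l + 1) k u • a (l + 2) u - P (l + 2) k u • a (l + 1) u +
    (P l (k + 1) u • a' (k + 2) u - P l (k + 2) u • a' (k + 1) u) := by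
    filter_upwards [h] with u hu
    exact (hu l k).fderiv
  have h3 : HasFDerivAt (fderiv ℝ (P l k)) _ x :=
    ((((hx (l + 1) k).smul (ha (l + 2)).hasFDerivAt).sub
      ((hx (l + 2) k).smul (ha (l + 1)).hasFDerivAt)).add
    (((hx l (k + 1)).smul (ha' (k + 2)).hasFDerivAt).sub
      ((hx l (k + 2)).smul (ha' (k + 1)).hasFDerivAt))).congr_of_eventuallyEq h2
  rw [extDeriv_apply_two, fderiv_oneForm h3.differentiableAt, fderiv_oneForm h3.differentiableAt,
    h3.fderiv] at h1
  simp only [curvatureOf, ContinuousAlternatingMap.add_apply, extDeriv_apply_two,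
    fderiv_oneForm (ha _), fderiv_oneForm (ha' _), wedge_one_one_apply]
  simp only [oneForm_apply, Matrix.cons_val_zero, Matrix.cons_val_one, add_apply, sub_apply,
    smul_apply, smul_eq_mul,
    ContinuousLinearMap.smulRight_apply, add_one_add_one, add_one_add_two, add_two_add_one,
    add_two_add_two] at h1 ⊢
  linear_combination h1

theorem IsRotation.eq_sum_of_relation {P : Fin 3 → Fin 3 → ℝ} (hP : IsRotation P) {f f' : Fin 3 → ℝ}
    (h : ∀ l k, P (l + 1) k * f (l + 2) - P (l + 2) k * f (l + 1) +
      (P l (k + 1) * f' (k + 2) - P l (k + 2) * f' (k + 1)) = 0) (k : Fin 3) :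
    f' k = ∑ l, P l k * f l := by
  have h0 := h 0 (k + 1)
  have h1 := h 1 (k + 1)
  have h2 := h 2 (k + 1)
  have c1 := hP.col (k + 2) (k + 2)
  have c2 := hP.col (k + 2) k
  rw [if_pos rfl] at c1
  rw [if_neg (by fin_cases k <;> decide)] at c2
  have d0 := hP.cof 0 k
  have d1 := hP.cof 1 k
  have d2 := hP.cof 2 k
  simp only [Fin.sum_univ_three, zero_add, show (1 : Fin 3) + 1 = 2 from rfl,
      show (1 : Fin 3) + 2 = 0 from rfl, show (2 : Fin 3) + 1 = 0 from rfl,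
      show (2 : Fin 3) + 2 = 1 from rfl, add_one_add_one, add_one_add_two] at *
  rw [← d0, ← d1, ← d2]
  -- Pair the relations for column `k + 1` with column `k + 2`: orthonormality isolates `f' k`, and
  -- the coefficients of `f` are the cofactors of column `k`.
  linear_combination P 0 (k + 2) * h0 + P 1 (k + 2) * h1 + P 2 (k + 2) * h2 - f' k * c1 +
    f' (k + 2) * c2

/-- The derivative of `P` in `dY'` is traded for the two potentials; the terms with `a'` cancel and
`d_A y` transforms like `y`. -/
theorem IsGaugeChange.covDer {V : Type*} [NormedAddCommGroup V] [NormedSpace ℝ V]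
    {P : Fin 3 → Fin 3 → W → ℝ} {a a' : Fin 3 → W → W →L[ℝ] ℝ} {L : V →L[ℝ] W} {z : V}
    (h : IsGaugeChange P a a' (L z)) {Y Y' : Fin 3 → V → ℝ} (hY : ∀ i, DifferentiableAt ℝ (Y i) z)
    (hY' : ∀ k, Y' k =ᶠ[𝓝 z] fun u => ∑ l, P l k (L u) * Y l u) (k : Fin 3) :
    fderiv ℝ (Y' k) z + (Y' (k + 2) z • (a' (k + 1) (L z)).comp L -
      Y' (k + 1) z • (a' (k + 2) (L z)).comp L) =
    ∑ l, P l k (L z) • (fderiv ℝ (Y l) z + (Y (l + 2) z • (a (l + 1) (L z)).comp L -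
      Y (l + 1) z • (a (l + 2) (L z)).comp L)) := by
  have h1 : HasFDerivAt (Y' k) _ z := (HasFDerivAt.fun_sum (u := Finset.univ) fun l _ =>
    ((h l k).comp z L.hasFDerivAt).mul (hY l).hasFDerivAt).congr_of_eventuallyEq (hY' k)
  rw [h1.fderiv, (hY' (k + 1)).eq_of_nhds, (hY' (k + 2)).eq_of_nhds]
  refine ContinuousLinearMap.ext fun w => ?_
  simp only [Fin.sum_univ_three, add_apply, sub_apply, smul_apply, smul_eq_mul,
    ContinuousLinearMap.comp_apply, Function.comp_apply, zero_add,
    show (1 : Fin 3) + 1 = 2 from rfl,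
    show (1 : Fin 3) + 2 = 0 from rfl, show (2 : Fin 3) + 1 = 0 from rfl,
    show (2 : Fin 3) + 2 = 1 from rfl]
  ring

end GaugeChange

/-! ### The rotation between two gauges and the potentials -/

section LocalGauge

set_option linter.unusedSectionVars false

variable {M : Type*} [TopologicalSpace M] [ChartedSpace R4 M] [IsManifold 𝓘(ℝ, R4) ∞ M]
  {E : M → Type*} [TopologicalSpace (TotalSpace R3 E)]
  [∀ x, NormedAddCommGroup (E x)] [∀ x, InnerProductSpace ℝ (E x)]
  [FiberBundle R3 E] [VectorBundle ℝ R3 E] [ContMDiffVectorBundle ∞ R3 E 𝓘(ℝ, R4)]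
  [IsContMDiffRiemannianBundle 𝓘(ℝ, R4) ∞ R3 E]
  {o : ∀ x, Orientation ℝ (E x) (Fin 3)} {cov : CovariantDerivative 𝓘(ℝ, R4) R3 E}

theorem mvfderiv_inner_eq (hmetric : cov.IsMetricCompatible) {x : M} {s t : ∀ x, E x}
    (hs : MDifferentiableAt 𝓘(ℝ, R4) (𝓘(ℝ, R4).prod 𝓘(ℝ, R3)) (fun x => TotalSpace.mk' R3 x (s x)) x)
    (ht : MDifferentiableAt 𝓘(ℝ, R4) (𝓘(ℝ, R4).prod 𝓘(ℝ, R3)) (fun x => TotalSpace.mk' R3 x (t x)) x)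
    (ξ : TangentSpace 𝓘(ℝ, R4) x) :
    mvfderiv 𝓘(ℝ, R4) (fun x => (inner ℝ (s x) (t x) : ℝ)) x ξ =
      inner ℝ (cov s x ξ) (t x) + inner ℝ (s x) (cov t x ξ) := by
  classical
  have h2 := hmetric.mvfderiv_inner_eq (x := x)
    (Function.update (fun y => (0 : TangentSpace 𝓘(ℝ, R4) y)) x ξ) hs ht
  simpa only [Function.update_self] using h2

theorem LocalGauge.mdifferentiableAt_frame (G : LocalGauge o) {x : M} (hx : x ∈ G.U) (i : Fin 3) :
    MDifferentiableAt 𝓘(ℝ, R4) (𝓘(ℝ, R4).prod 𝓘(ℝ, R3))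
      (fun x => TotalSpace.mk' R3 x (G.frame x i)) x :=
  ((G.smooth i).contMDiffAt (G.isOpen.mem_nhds hx)).mdifferentiableAt (by simp)

/-- In a local gauge, the covariant derivative of the frame is given by the potentials. -/
theorem cov_frame (hmetric : cov.IsMetricCompatible) (G : LocalGauge o) {x : M} (hx : x ∈ G.U)
    (k : Fin 3) (ξ : TangentSpace 𝓘(ℝ, R4) x) :
    cov (fun z => G.frame z k) x ξ = gaugePotential cov G (k + 2) x ξ • G.frame x (k + 1) -
      gaugePotential cov G (k + 1) x ξ • G.frame x (k + 2) := by
  have h1 : ∀ i j, inner ℝ (cov (fun z => G.frame z i) x ξ) (G.frame x j) +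
      inner ℝ (G.frame x i) (cov (fun z => G.frame z j) x ξ) = 0 := fun i j => by
    rw [← mvfderiv_inner_eq hmetric (G.mdifferentiableAt_frame hx i)
      (G.mdifferentiableAt_frame hx j)]
    have h3 : (fun x => (inner ℝ (G.frame x i) (G.frame x j) : ℝ)) = fun _ => if i = j then 1 else 0 :=
      funext fun y => orthonormal_iff_ite.1 (G.frame y).orthonormal i j
    rw [h3, mvfderiv, mfderiv_const]
    rfl
  have h4 : ∀ j, gaugePotential cov G j x ξ =
      inner ℝ (G.frame x (j + 2)) (cov (fun z => G.frame z (j + 1)) x ξ) := fun j => rfl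
  have h5 := (G.frame x).sum_repr' (cov (fun z => G.frame z k) x ξ)
  rw [sum_fin_three_shift _ k] at h5
  have h6 := h1 k k
  rw [real_inner_comm, ← two_mul, mul_eq_zero] at h6
  have h7 := h6.resolve_left two_ne_zero
  have h8 := h1 (k + 2) k
  rw [real_inner_comm] at h8
  rw [← h5, h7, h4, h4, add_two_add_two, add_two_add_one, add_one_add_two, add_one_add_one,
    zero_smul, zero_add, sub_eq_add_neg, ← neg_smul]
  congr 2
  linarith

/-- The matrix of the change of gauge from `G` to `G'`. -/
def gaugeMatrix (G G' : LocalGauge o) (l k : Fin 3) (x : M) : ℝ :=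
  inner ℝ (G.frame x l) (G'.frame x k)

theorem isRotation_gaugeMatrix {G G' : LocalGauge o} {x : M} (h : x ∈ G.U) (h' : x ∈ G'.U) :
    IsRotation fun l k => gaugeMatrix G G' l k x :=
  isRotation_orthonormalBasis ((G.oriented x h).trans (G'.oriented x h').symm)

theorem fiberCoord_change (G G' : LocalGauge o) (k : Fin 3) (p : TotalSpace R3 E) :
    fiberCoord G' k p = ∑ l, gaugeMatrix G G' l k p.proj * fiberCoord G l p := by
  have h := OrthonormalBasis.sum_inner_mul_inner (G.frame p.proj) (G'.frame p.proj k) p.snd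
  simp only [fiberCoord, gaugeMatrix, ← h, real_inner_comm (G'.frame p.proj k)]

theorem sum_fiberCoord_sq (G : LocalGauge o) (p : TotalSpace R3 E) :
    ∑ i, fiberCoord G i p ^ 2 = ‖p.snd‖ ^ 2 :=
  OrthonormalBasis.sum_sq_inner_right (G.frame p.proj) p.snd

theorem contDiffAt_gaugeMatrix {G G' : LocalGauge o} {x₀ : M} {u : R4}
    (hu : u ∈ (extChartAt 𝓘(ℝ, R4) x₀).target)
    (hG : (extChartAt 𝓘(ℝ, R4) x₀).symm u ∈ G.U) (hG' : (extChartAt 𝓘(ℝ, R4) x₀).symm u ∈ G'.U)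
    (l k : Fin 3) :
    ContDiffAt ℝ ∞ (fun u => gaugeMatrix G G' l k ((extChartAt 𝓘(ℝ, R4) x₀).symm u)) u := by
  have hs := contMDiffAt_extChartAt_symm' 𝓘(ℝ, R4) hu
  have h1 := ((G.smooth l).contMDiffAt (G.isOpen.mem_nhds hG)).comp u hs
  have h2 := ((G'.smooth k).contMDiffAt (G'.isOpen.mem_nhds hG')).comp u hs
  exact (h1.inner_bundle h2).contDiffAt

theorem isGaugeChange_chartPotential (hmetric : cov.IsMetricCompatible)
    {G G' : LocalGauge o} {x₀ : M} {u : R4} (hu : u ∈ (extChartAt 𝓘(ℝ, R4) x₀).target)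
    (hG : (extChartAt 𝓘(ℝ, R4) x₀).symm u ∈ G.U) (hG' : (extChartAt 𝓘(ℝ, R4) x₀).symm u ∈ G'.U) :
    IsGaugeChange (fun l k u => gaugeMatrix G G' l k ((extChartAt 𝓘(ℝ, R4) x₀).symm u))
      (chartPotential cov G x₀) (chartPotential cov G' x₀) u := by
  intro l k
  refine ((contDiffAt_gaugeMatrix hu hG hG' l k).differentiableAt (by simp)).hasFDerivAt.congr_fderiv ?_
  have hf : MDifferentiableAt 𝓘(ℝ, R4) 𝓘(ℝ, ℝ) (gaugeMatrix G G' l k)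
      ((extChartAt 𝓘(ℝ, R4) x₀).symm u) :=
    (((G.smooth l).contMDiffAt (G.isOpen.mem_nhds hG)).inner_bundle
      ((G'.smooth k).contMDiffAt (G'.isOpen.mem_nhds hG'))).mdifferentiableAt (by simp)
  have h1 : (mvfderiv 𝓘(ℝ, R4) (gaugeMatrix G G' l k) ((extChartAt 𝓘(ℝ, R4) x₀).symm u)).comp
      (chartInvDeriv 𝓘(ℝ, R4) x₀ u) =
      fderiv ℝ (fun u => gaugeMatrix G G' l k ((extChartAt 𝓘(ℝ, R4) x₀).symm u)) u := by
    rw [← mfderiv_eq_fderiv]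
    refine Eq.trans ?_ (mfderiv_comp u hf (mdifferentiableAt_extChartAt_symm' _ hu)).symm
    rfl
  rw [← h1]
  refine ContinuousLinearMap.ext fun e => ?_
  rw [ContinuousLinearMap.comp_apply]
  refine (mvfderiv_inner_eq hmetric (G.mdifferentiableAt_frame hG l)
      (G'.mdifferentiableAt_frame hG' k) (chartInvDeriv 𝓘(ℝ, R4) x₀ u e)).trans ?_
  rw [cov_frame hmetric G hG, cov_frame hmetric G' hG', inner_sub_left, inner_sub_right,
    real_inner_smul_left, real_inner_smul_left, real_inner_smul_right, real_inner_smul_right]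
  simp only [add_apply, sub_apply, smul_apply, smul_eq_mul, chartPotential,
    ContinuousLinearMap.comp_apply, gaugeMatrix]
  ring

end LocalGauge

/-! ### Normal form up to sign, and invariance under rotations -/

section Sign

variable {V W : Type*} [NormedAddCommGroup V] [NormedSpace ℝ V] [NormedAddCommGroup W]
  [NormedSpace ℝ W]

/-- The triple `F` of two-forms is, up to the sign `s` and a matrix of positive determinant, the
standard triple of self-dual two-forms of some coframe. -/
def HasSign (s : ℝ) (F : Fin 3 → W [⋀^Fin 2]→L[ℝ] ℝ) : Prop :=
  (s = 1 ∨ s = -1) ∧ ∃ (C : Matrix (Fin 3) (Fin 3) ℝ) (h : W ≃L[ℝ] (Fin 4 → ℝ)), 0 < C.det ∧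
    ∀ i, F i = ∑ j, (s * C i j) • sdTwo (coframe h) j

/-- In the negative definite case `-v` replaces `v`: definiteness of either sign becomes positivity
in one of the two orientations. -/
theorem exists_hasSign (hW : Module.finrank ℝ W = 4)
    {F : Fin 3 → W [⋀^Fin 2]→L[ℝ] ℝ} {v : W [⋀^Fin 4]→L[ℝ] ℝ} (hv : v ≠ 0)
    {X : Matrix (Fin 3) (Fin 3) ℝ} (hX : IsWedgeMatrix v F X) (hdef : IsDefiniteMatrix X) :
    ∃ s, HasSign s F := by
  rcases hdef with h | h
  · obtain ⟨s, C, e, h1, h2, h3⟩ := exists_normal_form hW hv hX h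
    exact ⟨s, h1, C, e, h2, h3⟩
  · have hX' : IsWedgeMatrix (-v) F (-X) := fun i j => by
      rw [hX i j, Matrix.neg_apply, mul_neg, smul_neg, neg_smul, neg_neg]
    obtain ⟨s, C, e, h1, h2, h3⟩ := exists_normal_form hW (neg_ne_zero.2 hv) hX' h
    exact ⟨s, h1, C, e, h2, h3⟩

theorem HasSign.pullback {s : ℝ} {F : Fin 3 → W [⋀^Fin 2]→L[ℝ] ℝ} (h : HasSign s F)
    (L : V ≃L[ℝ] W) : HasSign s fun i => (F i).compContinuousLinearMap (L : V →L[ℝ] W) := by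
  obtain ⟨hs, C, e, hC, hF⟩ := h
  refine ⟨hs, C, L.trans e, hC, fun i => ?_⟩
  have h1 : ∀ j, sdTwo (coframe (L.trans e)) j =
      (sdTwo (coframe e) j).compContinuousLinearMap (L : V →L[ℝ] W) := fun j => by
    rw [sdTwo_comp]
    rfl
  simp only [hF, h1]
  refine ContinuousAlternatingMap.ext fun w => ?_
  simp only [ContinuousAlternatingMap.compContinuousLinearMap_apply,
    ContinuousAlternatingMap.smul_apply, ContinuousAlternatingMap.sum_apply]

theorem IsRotation.det_eq_one {P : Fin 3 → Fin 3 → ℝ} (hP : IsRotation P) :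
    (Matrix.of P).det = 1 := by
  have h0 := hP.cof 0 0
  have h1 := hP.cof 0 1
  have h2 := hP.cof 0 2
  have h3 := hP.row 0 0
  simp only [Fin.sum_univ_three, zero_add, show (1 : Fin 3) + 1 = 2 from rfl,
    show (1 : Fin 3) + 2 = 0 from rfl, show (2 : Fin 3) + 1 = 0 from rfl,
    show (2 : Fin 3) + 2 = 1 from rfl, if_true] at h0 h1 h2 h3
  rw [Matrix.det_fin_three]
  simp only [Matrix.of_apply]
  linear_combination P 0 0 * h0 + P 0 1 * h1 + P 0 2 * h2 + h3

/-- The matrix `C` becomes `Pᵀ C`, of the same positive determinant, while coframe and sign are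
unchanged. Hence the sign does not depend on the gauge. -/
theorem HasSign.rotate {s : ℝ} {F F' : Fin 3 → W [⋀^Fin 2]→L[ℝ] ℝ} (h : HasSign s F)
    {P : Fin 3 → Fin 3 → ℝ} (hP : IsRotation P) (hF' : ∀ k, F' k = ∑ l, P l k • F l) :
    HasSign s F' := by
  obtain ⟨hs, C, e, hC, hF⟩ := h
  refine ⟨hs, (Matrix.of P).transpose * C, e, ?_, fun i => ?_⟩
  · rw [Matrix.det_mul, Matrix.det_transpose, hP.det_eq_one, one_mul]
    exact hC
  · simp only [hF', hF, Finset.smul_sum, smul_smul, Matrix.mul_apply, Matrix.transpose_apply,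
      Matrix.of_apply, Finset.mul_sum, Finset.sum_smul]
    rw [Finset.sum_comm]
    refine Finset.sum_congr rfl fun j _ => Finset.sum_congr rfl fun l _ => ?_
    congr 1
    ring

theorem HasSign.isSignOfTriple {s : ℝ} {F : Fin 3 → W [⋀^Fin 2]→L[ℝ] ℝ} (h : HasSign s F) :
    IsSignOfTriple s F := by
  obtain ⟨hs, C, e, hC, hF⟩ := h
  exact isSignOfTriple_normal_form hs hC hF

theorem HasSign.mul_lt_zero {s : ℝ} {F : Fin 3 → W [⋀^Fin 2]→L[ℝ] ℝ} (h : HasSign s F)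
    (b : Module.Basis (Fin 4) ℝ W) {ξ : W} (hξ : ξ ≠ 0) :
    s * (urbantke F ξ ξ b * (wedge (F 0) (F 0) : W [⋀^Fin 4]→L[ℝ] ℝ) b) < 0 := by
  obtain ⟨hs, C, e, hC, hF⟩ := h
  exact sign_mul_lt_zero hs hC hF b hξ

theorem HasSign.eq_of_mul_pos {s t : ℝ} {F F' : Fin 3 → W [⋀^Fin 2]→L[ℝ] ℝ} (h : HasSign s F)
    (h' : HasSign t F') (b : Module.Basis (Fin 4) ℝ W) {ξ : W} (hξ : ξ ≠ 0)
    (hpos : 0 < (urbantke F ξ ξ b * (wedge (F 0) (F 0) : W [⋀^Fin 4]→L[ℝ] ℝ) b) *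
      (urbantke F' ξ ξ b * (wedge (F' 0) (F' 0) : W [⋀^Fin 4]→L[ℝ] ℝ) b)) : s = t := by
  have h1 := h.mul_lt_zero b hξ
  have h2 := h'.mul_lt_zero b hξ
  have h3 := mul_pos_of_neg_of_neg h1 h2
  rcases h.1 with hs | hs <;> rcases h'.1 with ht | ht <;> rw [hs, ht] at h3 ⊢ <;> nlinarith

theorem IsRotation.sum_mul {P : Fin 3 → Fin 3 → ℝ} (hP : IsRotation P) (f g : Fin 3 → ℝ) :
    ∑ k, (∑ l, P l k * f l) * ∑ l, P l k * g l = ∑ l, f l * g l := by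
  have h00 := hP.row 0 0
  have h01 := hP.row 0 1
  have h02 := hP.row 0 2
  have h11 := hP.row 1 1
  have h12 := hP.row 1 2
  have h22 := hP.row 2 2
  rw [if_pos rfl] at h00 h11 h22
  rw [if_neg (by decide)] at h01 h02 h12
  simp only [Fin.sum_univ_three] at *
  linear_combination f 0 * g 0 * h00 + f 1 * g 1 * h11 + f 2 * g 2 * h22 +
    (f 0 * g 1 + f 1 * g 0) * h01 + (f 0 * g 2 + f 2 * g 0) * h02 + (f 1 * g 2 + f 2 * g 1) * h12

theorem IsRotation.detForm_eq {P : Fin 3 → Fin 3 → ℝ} (hP : IsRotation P) {θ θ' : Fin 3 → V →L[ℝ] ℝ}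
    (hθ : ∀ k, θ' k = ∑ l, P l k • θ l) :
    detForm ![θ' 0, θ' 1, θ' 2] = detForm ![θ 0, θ 1, θ 2] := by
  rw [detForm_sum_smul (Matrix.of P).transpose ![θ 0, θ 1, θ 2] ![θ' 0, θ' 1, θ' 2],
    Matrix.det_transpose, hP.det_eq_one, one_smul]
  intro i u
  fin_cases i <;> simp [hθ, Fin.sum_univ_three]

theorem IsRotation.sum_wedge_eq {P : Fin 3 → Fin 3 → ℝ} (hP : IsRotation P)
    {θ θ' : Fin 3 → V →L[ℝ] ℝ} {F F' : Fin 3 → V [⋀^Fin 2]→L[ℝ] ℝ}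
    (hθ : ∀ k, θ' k = ∑ l, P l k • θ l) (hF : ∀ k, F' k = ∑ l, P l k • F l) :
    ∑ k, (wedge (oneForm (θ' k)) (F' k) : V [⋀^Fin 3]→L[ℝ] ℝ) =
      ∑ k, (wedge (oneForm (θ k)) (F k) : V [⋀^Fin 3]→L[ℝ] ℝ) := by
  refine ContinuousAlternatingMap.ext fun (x : Fin 3 → V) => ?_
  refine (ContinuousAlternatingMap.sum_apply _ _).trans
    (Eq.trans ?_ (ContinuousAlternatingMap.sum_apply _ _).symm)
  simp only [wedge_one_two_apply]
  have h1 : ∀ k v, θ' k v = ∑ l, P l k * θ l v := fun k v => by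
    simp only [hθ, sum_apply, smul_apply, smul_eq_mul]
  have h2 : ∀ k v, F' k v = ∑ l, P l k * F l v := fun k v => by
    simp only [hF, ContinuousAlternatingMap.sum_apply, ContinuousAlternatingMap.smul_apply,
      smul_eq_mul]
  simp only [h1, h2, Finset.sum_add_distrib, Finset.sum_sub_distrib]
  rw [hP.sum_mul, hP.sum_mul, hP.sum_mul]

end Sign

/-! ### Forms are determined by their chart expressions -/

section Charts

variable {V : Type*} [NormedAddCommGroup V] [NormedSpace ℝ V]
  {H : Type*} [TopologicalSpace H] (I : ModelWithCorners ℝ V H) [I.Boundaryless]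
  {N : Type*} [TopologicalSpace N] [ChartedSpace H N] [IsManifold I ∞ N]

theorem eq_of_formInChart_eq {k : ℕ} {α β : ∀ q : N, TangentSpace I q [⋀^Fin k]→L[ℝ] ℝ} {p : N}
    (h : formInChart I α p (extChartAt I p p) = formInChart I β p (extChartAt I p p)) :
    α p = β p := by
  have hq : (extChartAt I p).symm (extChartAt I p p) = p :=
    (extChartAt I p).left_inv (mem_extChartAt_source p)
  obtain ⟨L, hL⟩ := chartInvDeriv_equiv I (mem_extChartAt_target (I := I) p)
  have h1 : α ((extChartAt I p).symm (extChartAt I p p)) =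
      β ((extChartAt I p).symm (extChartAt I p p)) := by
    rw [formInChart, formInChart, ← hL] at h
    refine ContinuousAlternatingMap.ext fun w => ?_
    have h2 := DFunLike.congr_fun h fun i => L.symm (w i)
    change α _ (fun i => L (L.symm (w i))) = β _ (fun i => L (L.symm (w i))) at h2
    simpa only [ContinuousLinearEquiv.apply_symm_apply] using h2
  rwa [hq] at h1

end Charts

/-! ### Gauge independence of the calibrating form -/

section LocalGauge

set_option linter.unusedSectionVars false

variable {M : Type*} [TopologicalSpace M] [ChartedSpace R4 M] [IsManifold 𝓘(ℝ, R4) ∞ M]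
  {E : M → Type*} [TopologicalSpace (TotalSpace R3 E)]
  [∀ x, NormedAddCommGroup (E x)] [∀ x, InnerProductSpace ℝ (E x)]
  [FiberBundle R3 E] [VectorBundle ℝ R3 E] [ContMDiffVectorBundle ∞ R3 E 𝓘(ℝ, R4)]
  [IsContMDiffRiemannianBundle 𝓘(ℝ, R4) ∞ R3 E]
  {o : ∀ x, Orientation ℝ (E x) (Fin 3)} {cov : CovariantDerivative 𝓘(ℝ, R4) R3 E}

theorem curvatureOf_chartPotential_change
    (hsmooth : ∀ U : Set M, IsOpen U → ContMDiffCovariantDerivativeOn R3 ∞ cov U)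
    (hmetric : cov.IsMetricCompatible) {G G' : LocalGauge o} {x₀ : M} {u : R4}
    (hu : u ∈ (extChartAt 𝓘(ℝ, R4) x₀).target)
    (hG : (extChartAt 𝓘(ℝ, R4) x₀).symm u ∈ G.U) (hG' : (extChartAt 𝓘(ℝ, R4) x₀).symm u ∈ G'.U)
    (k : Fin 3) :
    curvatureOf (chartPotential cov G' x₀) k u =
      ∑ l, gaugeMatrix G G' l k ((extChartAt 𝓘(ℝ, R4) x₀).symm u) •
        curvatureOf (chartPotential cov G x₀) l u := by
  have hev : ∀ᶠ u in 𝓝 u, IsGaugeChange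
      (fun l k u => gaugeMatrix G G' l k ((extChartAt 𝓘(ℝ, R4) x₀).symm u))
      (chartPotential cov G x₀) (chartPotential cov G' x₀) u := by
    have h2 := (contMDiffAt_extChartAt_symm' 𝓘(ℝ, R4) hu).continuousAt.preimage_mem_nhds
      ((G.isOpen.inter G'.isOpen).mem_nhds ⟨hG, hG'⟩)
    filter_upwards [(isOpen_extChartAt_target x₀).mem_nhds hu, h2] with z hz hz'
    exact isGaugeChange_chartPotential hmetric hz hz'.1 hz'.2
  have h1 := IsGaugeChange.curvature_relation hev (contDiffAt_gaugeMatrix hu hG hG')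
    (fun i => (contDiffAt_chartPotential hsmooth G hu hG i).differentiableAt (by simp))
    (fun i => (contDiffAt_chartPotential hsmooth G' hu hG' i).differentiableAt (by simp))
  refine ContinuousAlternatingMap.ext fun (w : Fin 2 → R4) => ?_
  have hw : w = ![w 0, w 1] := by ext i; fin_cases i <;> rfl
  rw [hw, (isRotation_gaugeMatrix hG hG').eq_sum_of_relation
    (f := fun l => curvatureOf (chartPotential cov G x₀) l u ![w 0, w 1])
    (f' := fun l => curvatureOf (chartPotential cov G' x₀) l u ![w 0, w 1])
    (fun l k => h1 l k (w 0) (w 1)) k]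
  simp only [ContinuousAlternatingMap.sum_apply, ContinuousAlternatingMap.smul_apply, smul_eq_mul]

/-- The curvature forms in two local gauges differ by a rotation. -/
theorem gaugeCurvature_change
    (hsmooth : ∀ U : Set M, IsOpen U → ContMDiffCovariantDerivativeOn R3 ∞ cov U)
    (hmetric : cov.IsMetricCompatible) {G G' : LocalGauge o} {x : M} (hG : x ∈ G.U) (hG' : x ∈ G'.U)
    (k : Fin 3) :
    gaugeCurvature cov G' k x = ∑ l, gaugeMatrix G G' l k x • gaugeCurvature cov G l x := by
  refine eq_of_formInChart_eq 𝓘(ℝ, R4)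
    (β := fun x => ∑ l, gaugeMatrix G G' l k x • gaugeCurvature cov G l x) ?_
  have hu := mem_extChartAt_target (I := 𝓘(ℝ, R4)) x
  have hq : (extChartAt 𝓘(ℝ, R4) x).symm (extChartAt 𝓘(ℝ, R4) x x) = x :=
    (extChartAt 𝓘(ℝ, R4) x).left_inv (mem_extChartAt_source x)
  have h1 : (extChartAt 𝓘(ℝ, R4) x).symm (extChartAt 𝓘(ℝ, R4) x x) ∈ G.U := hq.symm ▸ hG
  have h2 : (extChartAt 𝓘(ℝ, R4) x).symm (extChartAt 𝓘(ℝ, R4) x x) ∈ G'.U := hq.symm ▸ hG'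
  rw [formInChart_gaugeCurvature hsmooth G' hu h2,
    curvatureOf_chartPotential_change hsmooth hmetric hu h1 h2]
  simp only [← formInChart_gaugeCurvature hsmooth G hu h1]
  refine ContinuousAlternatingMap.ext fun w => ?_
  simp only [ContinuousAlternatingMap.sum_apply, ContinuousAlternatingMap.smul_apply, formInChart,
    ContinuousAlternatingMap.compContinuousLinearMap_apply]

/-- The calibrating three-form does not depend on the local gauge. -/
theorem calibratingForm_change
    (hsmooth : ∀ U : Set M, IsOpen U → ContMDiffCovariantDerivativeOn R3 ∞ cov U)
    (hmetric : cov.IsMetricCompatible) {G G' : LocalGauge o} {p : TotalSpace R3 E}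
    (hG : p.proj ∈ G.U) (hG' : p.proj ∈ G'.U) (s : ℝ) :
    calibratingForm cov G' s p = calibratingForm cov G s p := by
  refine eq_of_formInChart_eq totalModel ?_
  have hz := mem_gaugeTarget hG
  have hz' := mem_gaugeTarget hG'
  rw [formInChart_calibratingForm hsmooth G hz, formInChart_calibratingForm hsmooth G' hz']
  set z := extChartAt totalModel p p
  have hP := isRotation_gaugeMatrix (fst_mem_of_mem_gaugeTarget hz) (fst_mem_of_mem_gaugeTarget hz')
  have hx := (extChartAt_symm_proj p hz.1).2
  have hY : ∑ i, chartCoord G' p i z ^ 2 = ∑ i, chartCoord G p i z ^ 2 := by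
    simp only [chartCoord, sum_fiberCoord_sq]
  have hF : ∀ k, chartCurvature cov G' p k z = ∑ l, gaugeMatrix G G' l k
      ((extChartAt 𝓘(ℝ, R4) p.proj).symm z.1) • chartCurvature cov G p l z := fun k => by
    simp only [chartCurvature]
    rw [curvatureOf_chartPotential_change hsmooth hmetric hx (fst_mem_of_mem_gaugeTarget hz)
      (fst_mem_of_mem_gaugeTarget hz')]
    refine ContinuousAlternatingMap.ext fun w => ?_
    simp only [ContinuousAlternatingMap.sum_apply, ContinuousAlternatingMap.smul_apply,
      ContinuousAlternatingMap.compContinuousLinearMap_apply]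
  have hθ : ∀ k, chartCovDer cov G' p k z = ∑ l, gaugeMatrix G G' l k
      ((extChartAt 𝓘(ℝ, R4) p.proj).symm z.1) • chartCovDer cov G p l z := fun k => by
    rw [chartCovDer_eq G' hz'.1 hz'.2]
    simp only [chartCovDer_eq G hz.1 hz.2]
    refine (isGaugeChange_chartPotential hmetric hx (fst_mem_of_mem_gaugeTarget hz)
      (fst_mem_of_mem_gaugeTarget hz')).covDer (L := ContinuousLinearMap.fst ℝ R4 R3)
      (fun i => (contDiffAt_chartCoord G hz.1 hz.2 i).differentiableAt (by simp)) (fun k => ?_) k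
    filter_upwards [(isOpen_extChartAt_target p).mem_nhds hz.1] with w hw
    have h1 := fiberCoord_change G G' k ((extChartAt totalModel p).symm w)
    rw [(extChartAt_symm_proj p hw).1] at h1
    exact h1
  rw [hY, hP.detForm_eq hθ, hP.sum_wedge_eq hθ hF]

end LocalGauge

/-! ### The triple `(det X)^{1/3} X⁻¹ F`: smoothness and products with `F` -/

section DetField

variable {X W : Type*} [NormedAddCommGroup X] [NormedSpace ℝ X] [NormedAddCommGroup W]
  [NormedSpace ℝ W]

/-- No continuity of `v` or `Y` is available. The triple is invariant under scaling of the matrix,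
so `Y` may be replaced by the proportional matrix `Z` of values of `-(1/2) F^i ∧ F^j` on a fixed
basis, which is smooth. -/
theorem contDiffAt_detField {F : Fin 3 → X → W [⋀^Fin 2]→L[ℝ] ℝ}
    (b : Module.Basis (Fin 4) ℝ W) {u₀ : X} (hF : ∀ i, ContDiffAt ℝ ∞ (F i) u₀)
    {v : X → W [⋀^Fin 4]→L[ℝ] ℝ} {Y : X → Matrix (Fin 3) (Fin 3) ℝ}
    (h : ∀ᶠ u in 𝓝 u₀, v u ≠ 0 ∧ IsWedgeMatrix (v u) (fun i => F i u) (Y u) ∧ (Y u).det ≠ 0)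
    (i : Fin 3) : ContDiffAt ℝ ∞ (fun u => detField (Y u) (fun j => F j u) i) u₀ := by
  have : FiniteDimensional ℝ W := b.finiteDimensional_of_finite
  set Z : X → Matrix (Fin 3) (Fin 3) ℝ := fun u => Matrix.of fun i j =>
    -(1 / 2) * (wedge (F i u) (F j u) : W [⋀^Fin 4]→L[ℝ] ℝ) b with hZ
  have hZc : ∀ i j, ContDiffAt ℝ ∞ (fun u => Z u i j) u₀ := fun i j => by
    have h1 : ContDiffAt ℝ ∞ (fun u => (wedge (F i u) (F j u) : W [⋀^Fin 4]→L[ℝ] ℝ)) u₀ :=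
      (hF i).wedge (hF j)
    exact contDiffAt_const.mul (contDiffAt_form_iff.1 h1 b)
  have hvb : ∀ u, v u ≠ 0 → v u b ≠ 0 := fun u hu h0 => hu (form_four_eq_of_basis b h0)
  have hZY : ∀ u, IsWedgeMatrix (v u) (fun i => F i u) (Y u) → Z u = (v u b) • Y u := fun u hu => by
    ext i j
    have h1 : (wedge (F i u) (F j u) : W [⋀^Fin 4]→L[ℝ] ℝ) b = (-2 * Y u i j) * v u b :=
      congrArg (fun f : W [⋀^Fin 4]→L[ℝ] ℝ => f b) (hu i j)
    simp only [hZ, Matrix.of_apply, h1, Matrix.smul_apply, smul_eq_mul]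
    ring
  have hdet : ContDiffAt ℝ ∞ (fun u => (Z u).det) u₀ := by
    simp only [Matrix.det_fin_three]
    have := hZc
    fun_prop
  have hadj : ∀ i j, ContDiffAt ℝ ∞ (fun u => (Z u).adjugate i j) u₀ := fun i j => by
    simp only [Matrix.adjugate_fin_three]
    have := hZc
    fin_cases i <;> fin_cases j <;> simp <;> fun_prop
  obtain ⟨h1, h2, h3⟩ := h.self_of_nhds
  have hd0 : (Z u₀).det ≠ 0 := by
    rw [hZY u₀ h2, Matrix.det_smul]
    exact mul_ne_zero (pow_ne_zero _ (hvb _ h1)) h3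
  have hc : ContDiffAt ℝ ∞ (fun u => detField (Z u) (fun j => F j u) i) u₀ := by
    simp only [detField, Matrix.inv_def, Ring.inverse_eq_inv', Matrix.smul_apply, smul_eq_mul]
    have hcr : ContDiffAt ℝ ∞ (fun u => cubeRoot (Z u).det) u₀ := ContDiffAt.comp (g := cubeRoot)
      (f := fun u => (Z u).det) u₀ (contDiffAt_cubeRoot hd0) hdet
    exact hcr.smul (ContDiffAt.sum fun j _ => ((hdet.inv hd0).mul (hadj i j)).smul (hF j))
  refine hc.congr_of_eventuallyEq ?_
  filter_upwards [h] with u hu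
  rw [hZY u hu.2.1, detField_smul _ (hvb u hu.1)]

/-- The factor `Y⁻¹` cancels the wedge matrix of `F`. This orthogonality is what co-closedness uses
besides the field equation. -/
theorem wedge_detField {F : Fin 3 → W [⋀^Fin 2]→L[ℝ] ℝ} {v : W [⋀^Fin 4]→L[ℝ] ℝ}
    {Y : Matrix (Fin 3) (Fin 3) ℝ} (h : IsWedgeMatrix v F Y) (hY : Y.det ≠ 0) (k l : Fin 3) :
    (wedge (detField Y F k) (F l) : W [⋀^Fin 4]→L[ℝ] ℝ) =
      if k = l then (-2 * cubeRoot Y.det) • v else 0 := by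
  have h1 : ∑ j, Y⁻¹ k j * Y j l = if k = l then 1 else 0 := by
    have := congrFun (congrFun (Matrix.nonsing_inv_mul Y hY.isUnit) k) l
    simpa [Matrix.mul_apply, Matrix.one_apply] using this
  rw [detField]
  refine (wedge_smul_left (p := 2) (q := 2) _ _ _).trans ?_
  refine (congrArg (cubeRoot Y.det • ·) (wedge_sum_smul_left (p := 2) (q := 2) _ _ _ _)).trans ?_
  refine (congrArg (cubeRoot Y.det • ·) (Finset.sum_congr rfl fun j _ =>
    congrArg (Y⁻¹ k j • ·) (h j l))).trans ?_
  simp only [smul_smul]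
  rw [← Finset.sum_smul, smul_smul]
  have h2 : ∑ j, Y⁻¹ k j * (-2 * Y j l) = -2 * if k = l then 1 else 0 := by
    rw [← h1, Finset.mul_sum]
    exact Finset.sum_congr rfl fun j _ => by ring
  rw [h2]
  split_ifs
  · congr 1
    ring
  · rw [mul_zero, mul_zero, zero_smul]

end DetField

/-! ### Coframe property and curvature data in charts -/

section LocalGauge

set_option linter.unusedSectionVars false

variable {M : Type*} [TopologicalSpace M] [ChartedSpace R4 M] [IsManifold 𝓘(ℝ, R4) ∞ M]
  {E : M → Type*} [TopologicalSpace (TotalSpace R3 E)]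
  [∀ x, NormedAddCommGroup (E x)] [∀ x, InnerProductSpace ℝ (E x)]
  [FiberBundle R3 E] [VectorBundle ℝ R3 E] [ContMDiffVectorBundle ∞ R3 E 𝓘(ℝ, R4)]
  [IsContMDiffRiemannianBundle 𝓘(ℝ, R4) ∞ R3 E]
  {o : ∀ x, Orientation ℝ (E x) (Fin 3)} {cov : CovariantDerivative 𝓘(ℝ, R4) R3 E}

theorem chartCoord_eq (G : LocalGauge o) {p : TotalSpace R3 E} {z : R4 × R3}
    (hz : z ∈ (extChartAt totalModel p).target) (i : Fin 3) :
    chartCoord G p i z = inner ℝ (G.frame ((extChartAt 𝓘(ℝ, R4) p.proj).symm z.1) i)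
      ((trivializationAt R3 E p.proj).symmL ℝ ((extChartAt 𝓘(ℝ, R4) p.proj).symm z.1) z.2) := by
  have hb : (extChartAt 𝓘(ℝ, R4) p.proj).symm z.1 ∈ (trivializationAt R3 E p.proj).baseSet := by
    rw [FiberBundle.extChartAt_target] at hz
    exact hz.1.2
  have h1 : (extChartAt totalModel p).symm z = TotalSpace.mk' R3
      ((extChartAt 𝓘(ℝ, R4) p.proj).symm z.1)
      ((trivializationAt R3 E p.proj).symm ((extChartAt 𝓘(ℝ, R4) p.proj).symm z.1) z.2) := by
    rw [FiberBundle.extChartAt]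
    exact ((trivializationAt R3 E p.proj).mk_symm hb z.2).symm
  rw [chartCoord, h1, Trivialization.symmL_apply _ hb]
  rfl

/-- The covariant derivatives of the fiber coordinates and the differential of the projection
form a coframe. -/
theorem eq_zero_of_chartCovDer (G : LocalGauge o) {p : TotalSpace R3 E} {z : R4 × R3}
    (hz : z ∈ gaugeTarget G p) {w : R4 × R3} (hw : ∀ i, chartCovDer cov G p i z w = 0)
    (hw' : ContinuousLinearMap.fst ℝ R4 R3 w = 0) : w = 0 := by
  have hw1 : w.1 = 0 := hw'
  have ht : ∀ t : ℝ, z + t • w ∈ (extChartAt totalModel p).target := fun t => by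
    have := hz.1
    rw [FiberBundle.extChartAt_target] at this ⊢
    refine ⟨?_, trivial⟩
    simpa [hw1] using this.1
  set x := (extChartAt 𝓘(ℝ, R4) p.proj).symm z.1 with hx
  have hb : x ∈ (trivializationAt R3 E p.proj).baseSet := by
    have := hz.1
    rw [FiberBundle.extChartAt_target] at this
    exact this.1.2
  have h1 : ∀ i, inner ℝ (G.frame x i) ((trivializationAt R3 E p.proj).symmL ℝ x w.2) = (0 : ℝ) := by
    intro i
    have h2 := (((contDiffAt_chartCoord G hz.1 hz.2 i).differentiableAt
      (by simp)).hasFDerivAt.hasLineDerivAt w)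
    have h3 : fderiv ℝ (chartCoord G p i) z w = 0 := by
      have := hw i
      rw [chartCovDer_eq G hz.1 hz.2] at this
      simpa [hw1] using this
    rw [h3] at h2
    -- A vertical line stays over one base point, where the fibre coordinates are linear in the
    -- chart; they are affine along the line and their slope is the derivative.
    have h4 : (fun t : ℝ => chartCoord G p i (z + t • w)) = fun t =>
        inner ℝ (G.frame x i) ((trivializationAt R3 E p.proj).symmL ℝ x z.2) +
        t * inner ℝ (G.frame x i) ((trivializationAt R3 E p.proj).symmL ℝ x w.2) := by
      funext t
      rw [chartCoord_eq G (ht t)]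
      have h5 : (z + t • w).1 = z.1 := by simp [hw1]
      rw [h5, ← hx, Prod.snd_add, Prod.smul_snd, map_add, map_smul, inner_add_right,
        real_inner_smul_right]
    have h6 : HasDerivAt (fun t : ℝ => chartCoord G p i (z + t • w))
        (inner ℝ (G.frame x i) ((trivializationAt R3 E p.proj).symmL ℝ x w.2)) 0 := by
      rw [h4]
      simpa using ((hasDerivAt_id (0 : ℝ)).mul_const
        (inner ℝ (G.frame x i) ((trivializationAt R3 E p.proj).symmL ℝ x w.2))).const_add
        (inner ℝ (G.frame x i) ((trivializationAt R3 E p.proj).symmL ℝ x z.2))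
    exact h6.unique h2
  have h7 : (trivializationAt R3 E p.proj).symmL ℝ x w.2 = 0 := by
    rw [← (G.frame x).sum_repr' ((trivializationAt R3 E p.proj).symmL ℝ x w.2)]
    simp [h1]
  have h8 := (trivializationAt R3 E p.proj).continuousLinearMapAt_symmL (R := ℝ) hb w.2
  rw [h7, map_zero] at h8
  exact Prod.ext hw1 h8.symm

theorem formInChart_fieldTriple
    (hsmooth : ∀ U : Set M, IsOpen U → ContMDiffCovariantDerivativeOn R3 ∞ cov U)
    (G : LocalGauge o) (X : M → Matrix (Fin 3) (Fin 3) ℝ) {x₀ : M} {u : R4}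
    (hu : u ∈ (extChartAt 𝓘(ℝ, R4) x₀).target)
    (hG : (extChartAt 𝓘(ℝ, R4) x₀).symm u ∈ G.U) (i : Fin 3) :
    formInChart 𝓘(ℝ, R4) (fieldTriple cov G X i) x₀ u =
      detField (X ((extChartAt 𝓘(ℝ, R4) x₀).symm u))
        (fun j => curvatureOf (chartPotential cov G x₀) j u) i := by
  simp only [← formInChart_gaugeCurvature hsmooth G hu hG]
  refine ContinuousAlternatingMap.ext fun w => ?_
  simp only [detField, fieldTriple, ContinuousAlternatingMap.sum_apply,
    ContinuousAlternatingMap.smul_apply, formInChart,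
    ContinuousAlternatingMap.compContinuousLinearMap_apply]

theorem IsWedgeMatrix.inChart
    (hsmooth : ∀ U : Set M, IsOpen U → ContMDiffCovariantDerivativeOn R3 ∞ cov U)
    {G : LocalGauge o} {v : ∀ x : M, TangentSpace 𝓘(ℝ, R4) x [⋀^Fin 4]→L[ℝ] ℝ}
    {X : M → Matrix (Fin 3) (Fin 3) ℝ} {x₀ : M} {u : R4}
    (hu : u ∈ (extChartAt 𝓘(ℝ, R4) x₀).target)
    (hG : (extChartAt 𝓘(ℝ, R4) x₀).symm u ∈ G.U)
    (hv : v ((extChartAt 𝓘(ℝ, R4) x₀).symm u) ≠ 0)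
    (h : IsWedgeMatrix (v ((extChartAt 𝓘(ℝ, R4) x₀).symm u))
      (fun i => gaugeCurvature cov G i ((extChartAt 𝓘(ℝ, R4) x₀).symm u))
      (X ((extChartAt 𝓘(ℝ, R4) x₀).symm u))) :
    formInChart 𝓘(ℝ, R4) v x₀ u ≠ 0 ∧ IsWedgeMatrix (formInChart 𝓘(ℝ, R4) v x₀ u)
      (fun i => curvatureOf (chartPotential cov G x₀) i u)
      (X ((extChartAt 𝓘(ℝ, R4) x₀).symm u)) := by
  constructor
  · intro h0
    obtain ⟨L, hL⟩ := chartInvDeriv_equiv 𝓘(ℝ, R4) hu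
    refine hv (ContinuousAlternatingMap.ext fun w => ?_)
    rw [formInChart, ← hL] at h0
    have h2 := DFunLike.congr_fun h0 fun i => L.symm (w i)
    change v _ (fun i => L (L.symm (w i))) = 0 at h2
    simp only [ContinuousLinearEquiv.apply_symm_apply] at h2
    exact h2
  · intro i j
    simp only [← formInChart_gaugeCurvature hsmooth G hu hG]
    have h1 := wedge_compContinuousLinearMap
      (gaugeCurvature cov G i ((extChartAt 𝓘(ℝ, R4) x₀).symm u))
      (gaugeCurvature cov G j ((extChartAt 𝓘(ℝ, R4) x₀).symm u)) (chartInvDeriv 𝓘(ℝ, R4) x₀ u)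
    refine h1.symm.trans ?_
    exact congrArg (fun f : TangentSpace 𝓘(ℝ, R4) ((extChartAt 𝓘(ℝ, R4) x₀).symm u) [⋀^Fin 4]→L[ℝ] ℝ
      => f.compContinuousLinearMap (chartInvDeriv 𝓘(ℝ, R4) x₀ u)) (h i j)

theorem IsDefiniteMatrix.det_ne_zero {X : Matrix (Fin 3) (Fin 3) ℝ} (h : IsDefiniteMatrix X) :
    X.det ≠ 0 := by
  rcases h with h | h
  · exact h.det_pos.ne'
  · have := h.det_pos.ne'
    rw [Matrix.det_neg] at this
    exact right_ne_zero_of_mul this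

end LocalGauge

/-! ### Four-forms pulled back from a four-dimensional space -/

section Pullback

variable {V W : Type*} [NormedAddCommGroup V] [NormedSpace ℝ V] [NormedAddCommGroup W]
  [NormedSpace ℝ W]

/-- The derivative is the pullback of a five-form on a four-dimensional space, where five vectors
are always dependent. -/
theorem extDeriv_four_form_pullback_eq_zero (hW : Module.finrank ℝ W = 4) (L : V →L[ℝ] W)
    {κ : W → W [⋀^Fin 4]→L[ℝ] ℝ} {z : V} (hκ : DifferentiableAt ℝ κ (L z)) :
    DifferentiableAt ℝ (fun u => (κ (L u)).compContinuousLinearMap L) z ∧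
    ∀ x, extDeriv (fun u => (κ (L u)).compContinuousLinearMap L) z x = 0 := by
  constructor
  · exact (ContinuousAlternatingMap.compContinuousLinearMapCLM L).differentiableAt.comp z
      (DifferentiableAt.comp z hκ L.differentiableAt)
  · intro x
    have := extDeriv_pullback (f := L) hκ (L.contDiff (n := ∞)).contDiffAt (by
        rw [minSmoothness_of_isRCLikeNormedField]; exact WithTop.coe_le_coe.2 le_top)
    simp only [ContinuousLinearMap.fderiv] at this
    rw [this, ContinuousAlternatingMap.compContinuousLinearMap_apply]
    refine AlternatingMap.map_linearDependent (extDeriv κ (L z)).toAlternatingMap _ fun h => ?_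
    have : FiniteDimensional ℝ W := Module.finite_of_finrank_pos (by omega)
    have h1 := h.fintype_card_le_finrank
    rw [hW, Fintype.card_fin] at h1
    omega

end Pullback

/-! ### The field equation in charts -/

section LocalGauge

set_option linter.unusedSectionVars false

variable {M : Type*} [TopologicalSpace M] [ChartedSpace R4 M] [IsManifold 𝓘(ℝ, R4) ∞ M]
  {E : M → Type*} [TopologicalSpace (TotalSpace R3 E)]
  [∀ x, NormedAddCommGroup (E x)] [∀ x, InnerProductSpace ℝ (E x)]
  [FiberBundle R3 E] [VectorBundle ℝ R3 E] [ContMDiffVectorBundle ∞ R3 E 𝓘(ℝ, R4)]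
  [IsContMDiffRiemannianBundle 𝓘(ℝ, R4) ∞ R3 E]
  {o : ∀ x, Orientation ℝ (E x) (Fin 3)} {cov : CovariantDerivative 𝓘(ℝ, R4) R3 E}

/-- The forms `(det X)^{1/3} X^{-1} F` in the preferred chart at `x₀`. -/
def chartField (cov : CovariantDerivative 𝓘(ℝ, R4) R3 E) (G : LocalGauge o)
    (X : M → Matrix (Fin 3) (Fin 3) ℝ) (x₀ : M) (i : Fin 3) (u : R4) : R4 [⋀^Fin 2]→L[ℝ] ℝ :=
  detField (X ((extChartAt 𝓘(ℝ, R4) x₀).symm u))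
    (fun j => curvatureOf (chartPotential cov G x₀) j u) i

variable {v : ∀ x : M, TangentSpace 𝓘(ℝ, R4) x [⋀^Fin 4]→L[ℝ] ℝ} {G : LocalGauge o}
  {X : M → Matrix (Fin 3) (Fin 3) ℝ}

theorem contDiffAt_chartField
    (hsmooth : ∀ U : Set M, IsOpen U → ContMDiffCovariantDerivativeOn R3 ∞ cov U)
    (hv : ∀ x, v x ≠ 0)
    (hX : ∀ x ∈ G.U, IsWedgeMatrix (v x) (fun i => gaugeCurvature cov G i x) (X x))
    (hdef : ∀ x ∈ G.U, IsDefiniteMatrix (X x)) {x₀ : M} {u : R4}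
    (hu : u ∈ (extChartAt 𝓘(ℝ, R4) x₀).target)
    (hG : (extChartAt 𝓘(ℝ, R4) x₀).symm u ∈ G.U) (i : Fin 3) :
    ContDiffAt ℝ ∞ (chartField cov G X x₀ i) u := by
  refine contDiffAt_detField (F := curvatureOf (chartPotential cov G x₀))
    (v := formInChart 𝓘(ℝ, R4) v x₀) (EuclideanSpace.basisFun (Fin 4) ℝ).toBasis
    (contDiffAt_curvatureOf (contDiffAt_chartPotential hsmooth G hu hG)) ?_ i
  have h2 := (contMDiffAt_extChartAt_symm' 𝓘(ℝ, R4) hu).continuousAt.preimage_mem_nhds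
    (G.isOpen.mem_nhds hG)
  filter_upwards [(isOpen_extChartAt_target x₀).mem_nhds hu, h2] with w hw hwG
  obtain ⟨h3, h4⟩ := IsWedgeMatrix.inChart hsmooth hw hwG (hv _) (hX _ hwG)
  exact ⟨h3, h4, (hdef _ hwG).det_ne_zero⟩

theorem isCovClosed_chartField
    (hsmooth : ∀ U : Set M, IsOpen U → ContMDiffCovariantDerivativeOn R3 ∞ cov U)
    (hv : ∀ x, v x ≠ 0)
    (hX : ∀ x ∈ G.U, IsWedgeMatrix (v x) (fun i => gaugeCurvature cov G i x) (X x))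
    (hdef : ∀ x ∈ G.U, IsDefiniteMatrix (X x))
    (hpde : ∀ x ∈ G.U, ∀ i, gaugeExtDer cov G (fieldTriple cov G X) i x = 0) {x₀ : M} {u : R4}
    (hu : u ∈ (extChartAt 𝓘(ℝ, R4) x₀).target)
    (hG : (extChartAt 𝓘(ℝ, R4) x₀).symm u ∈ G.U) :
    IsCovClosed (fun i => chartPotential cov G x₀ i u) (chartField cov G X x₀) u := by
  have hev : ∀ (y : M) {u : R4} (hu : u ∈ (extChartAt 𝓘(ℝ, R4) y).target)
      (hG : (extChartAt 𝓘(ℝ, R4) y).symm u ∈ G.U) (i : Fin 3),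
      formInChart 𝓘(ℝ, R4) (fieldTriple cov G X i) y =ᶠ[𝓝 u] chartField cov G X y i := by
    intro y u hu hG i
    have h2 := (contMDiffAt_extChartAt_symm' 𝓘(ℝ, R4) hu).continuousAt.preimage_mem_nhds
      (G.isOpen.mem_nhds hG)
    filter_upwards [(isOpen_extChartAt_target y).mem_nhds hu, h2] with w hw hwG
    exact formInChart_fieldTriple hsmooth G X hw hwG i
  have hsm : ∀ (y : M) {u : R4} (hu : u ∈ (extChartAt 𝓘(ℝ, R4) y).target)
      (hG : (extChartAt 𝓘(ℝ, R4) y).symm u ∈ G.U) (i : Fin 3),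
      DifferentiableAt ℝ (chartField cov G X y i) u := fun y u hu hG i =>
    (contDiffAt_chartField hsmooth hv hX hdef hu hG i).differentiableAt (by simp)
  refine ⟨hsm x₀ hu hG, fun i a b c => ?_⟩
  have hd : DifferentiableAt ℝ (formInChart 𝓘(ℝ, R4) (fieldTriple cov G X i)
      ((extChartAt 𝓘(ℝ, R4) x₀).symm u)) (extChartAt 𝓘(ℝ, R4) ((extChartAt 𝓘(ℝ, R4) x₀).symm u)
        ((extChartAt 𝓘(ℝ, R4) x₀).symm u)) := by
    generalize (extChartAt 𝓘(ℝ, R4) x₀).symm u = y at hG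
    have h1 : (extChartAt 𝓘(ℝ, R4) y).symm (extChartAt 𝓘(ℝ, R4) y y) ∈ G.U := by
      rwa [(extChartAt 𝓘(ℝ, R4) y).left_inv (mem_extChartAt_source y)]
    exact (hsm y (mem_extChartAt_target y) h1 i).congr_of_eventuallyEq
      (hev y (mem_extChartAt_target y) h1 i)
  have h1 := formInChart_extDer 𝓘(ℝ, R4) (fieldTriple cov G X i) hu hd
  rw [(hev x₀ hu hG i).extDeriv_eq] at h1
  rw [← h1]
  have h2 := hpde _ hG i
  rw [gaugeExtDer, sum_eps_smul_two i fun j k =>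
    (wedge (oneForm (gaugePotential cov G j ((extChartAt 𝓘(ℝ, R4) x₀).symm u)))
      (fieldTriple cov G X k ((extChartAt 𝓘(ℝ, R4) x₀).symm u)) :
        TangentSpace 𝓘(ℝ, R4) ((extChartAt 𝓘(ℝ, R4) x₀).symm u) [⋀^Fin 3]→L[ℝ] ℝ),
    add_eq_zero_iff_eq_neg] at h2
  have h3 := fun j k => wedge_one_two_apply
    (gaugePotential cov G j ((extChartAt 𝓘(ℝ, R4) x₀).symm u))
    (fieldTriple cov G X k ((extChartAt 𝓘(ℝ, R4) x₀).symm u))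
    ![chartInvDeriv 𝓘(ℝ, R4) x₀ u a, chartInvDeriv 𝓘(ℝ, R4) x₀ u b, chartInvDeriv 𝓘(ℝ, R4) x₀ u c]
  have h4 : (chartInvDeriv 𝓘(ℝ, R4) x₀ u ∘ ![a, b, c]) = ![chartInvDeriv 𝓘(ℝ, R4) x₀ u a,
      chartInvDeriv 𝓘(ℝ, R4) x₀ u b, chartInvDeriv 𝓘(ℝ, R4) x₀ u c] := by
    ext1 i; fin_cases i <;> rfl
  have h5 : ∀ j (a b : R4), chartField cov G X x₀ j u ![a, b] =
      fieldTriple cov G X j ((extChartAt 𝓘(ℝ, R4) x₀).symm u)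
        ![chartInvDeriv 𝓘(ℝ, R4) x₀ u a, chartInvDeriv 𝓘(ℝ, R4) x₀ u b] := fun j a b => by
    rw [← (hev x₀ hu hG j).eq_of_nhds, formInChart,
      ContinuousAlternatingMap.compContinuousLinearMap_apply]
    congr 1
    ext1 i; fin_cases i <;> rfl
  rw [formInChart, ContinuousAlternatingMap.compContinuousLinearMap_apply, h4, h2]
  simp only [h5]
  refine (congrArg Neg.neg (congrArg₂ (fun s t : ℝ => s - t) (h3 (i + 1) (i + 2))
    (h3 (i + 2) (i + 1)))).trans ?_
  rfl

end LocalGauge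

/-! ### Adapted isomorphisms in charts and co-closedness -/

section LocalGauge

set_option linter.unusedSectionVars false

variable {M : Type*} [TopologicalSpace M] [ChartedSpace R4 M] [IsManifold 𝓘(ℝ, R4) ∞ M]
  {E : M → Type*} [TopologicalSpace (TotalSpace R3 E)]
  [∀ x, NormedAddCommGroup (E x)] [∀ x, InnerProductSpace ℝ (E x)]
  [FiberBundle R3 E] [VectorBundle ℝ R3 E] [ContMDiffVectorBundle ∞ R3 E 𝓘(ℝ, R4)]
  [IsContMDiffRiemannianBundle 𝓘(ℝ, R4) ∞ R3 E]
  {o : ∀ x, Orientation ℝ (E x) (Fin 3)} {cov : CovariantDerivative 𝓘(ℝ, R4) R3 E}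

variable {v : ∀ x : M, TangentSpace 𝓘(ℝ, R4) x [⋀^Fin 4]→L[ℝ] ℝ} {G : LocalGauge o}
  {X : M → Matrix (Fin 3) (Fin 3) ℝ} {p : TotalSpace R3 E} {z : R4 × R3} {s : ℝ}

theorem exists_isAdapted_chart
    (hsmooth : ∀ U : Set M, IsOpen U → ContMDiffCovariantDerivativeOn R3 ∞ cov U)
    (hv : ∀ x, v x ≠ 0)
    (hX : ∀ x ∈ G.U, IsWedgeMatrix (v x) (fun i => gaugeCurvature cov G i x) (X x))
    (hz : z ∈ gaugeTarget G p)
    {C : Matrix (Fin 3) (Fin 3) ℝ} {h : R4 ≃L[ℝ] (Fin 4 → ℝ)} (hs : s = 1 ∨ s = -1)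
    (hC : 0 < C.det) (hF : ∀ i, curvatureOf (chartPotential cov G p.proj) i z.1 =
      ∑ j, (s * C i j) • sdTwo (coframe h) j)
    (hpos : 0 < 1 + s * ∑ i, chartCoord G p i z ^ 2) :
    ∃ Θ : (R4 × R3) ≃L[ℝ] R7, IsAdapted (formInChart totalModel (calibratingForm cov G s) p z) Θ ∧
      stdFourForm.compContinuousLinearMap (Θ : R4 × R3 →L[ℝ] R7) =
        (2 * s) • ∑ m, (wedge (detForm ![chartCovDer cov G p (m + 1) z,
            chartCovDer cov G p (m + 2) z])
          ((chartField cov G X p.proj m z.1).compContinuousLinearMap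
            (ContinuousLinearMap.fst ℝ R4 R3)) : (R4 × R3) [⋀^Fin 4]→L[ℝ] ℝ) +
        (2 / 3 * (1 + s * ∑ i, chartCoord G p i z ^ 2)) •
          ∑ m, (wedge ((chartField cov G X p.proj m z.1).compContinuousLinearMap
            (ContinuousLinearMap.fst ℝ R4 R3)) (chartCurvature cov G p m z) :
              (R4 × R3) [⋀^Fin 4]→L[ℝ] ℝ) ∧
      ∀ w : R4 × R3, w.1 = 0 → stdMetric (Θ w) (Θ w) =
        (((1 + s * ∑ i, chartCoord G p i z ^ 2) ^ (1 / 4 : ℝ) * C.det ^ (1 / 3 : ℝ)) ^ 2)⁻¹ *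
          ∑ j, (∑ i, C i j * chartCovDer cov G p i z w) ^ 2 := by
  obtain ⟨h3, h4⟩ := IsWedgeMatrix.inChart hsmooth (extChartAt_symm_proj p hz.1).2
    (fst_mem_of_mem_gaugeTarget hz) (hv _) (hX _ (fst_mem_of_mem_gaugeTarget hz))
  have hfin : Module.finrank ℝ (R4 × R3) = 7 := by simp
  have hinj : ∀ w : R4 × R3, (∀ i, (fun i => chartCovDer cov G p i z) i w = 0) →
      ContinuousLinearMap.fst ℝ R4 R3 w = 0 → w = 0 :=
    fun w => eq_zero_of_chartCovDer (cov := cov) G hz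
  have key := exists_isAdapted (V := R4 × R3) (W := R4) hfin
    (θ := fun i => chartCovDer cov G p i z) (pr := ContinuousLinearMap.fst ℝ R4 R3) hinj
    (F := fun i => curvatureOf (chartPotential cov G p.proj) i z.1) hpos hs hC hF h3 h4
  beta_reduce at key
  obtain ⟨Θ, h5, h6, h7⟩ := key
  refine ⟨Θ, ?_, ?_, ?_⟩
  · rw [formInChart_calibratingForm hsmooth G hz]
    exact h5
  · simp only [chartField, chartCurvature]
    rw [h6]
  · exact h7

/-- The dual four-form of the calibrating three-form is closed. -/
theorem extDeriv_starOf_calibratingForm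
    (hsmooth : ∀ U : Set M, IsOpen U → ContMDiffCovariantDerivativeOn R3 ∞ cov U)
    (hv : ∀ x, v x ≠ 0)
    (hX : ∀ x ∈ G.U, IsWedgeMatrix (v x) (fun i => gaugeCurvature cov G i x) (X x))
    (hdef : ∀ x ∈ G.U, IsDefiniteMatrix (X x))
    (hpde : ∀ x ∈ G.U, ∀ i, gaugeExtDer cov G (fieldTriple cov G X) i x = 0)
    (hz : z ∈ gaugeTarget G p)
    (hs : ∀ᶠ z in 𝓝 z, HasSign s fun i => curvatureOf (chartPotential cov G p.proj) i z.1)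
    (hpos : 0 < 1 + s * ∑ i, chartCoord G p i z ^ 2) :
    extDeriv (fun z => starOf (formInChart totalModel (calibratingForm cov G s) p z)) z = 0 := by
  have hx := (extChartAt_symm_proj p hz.1).2
  have hU := fst_mem_of_mem_gaugeTarget hz
  obtain ⟨h3, h4⟩ := IsWedgeMatrix.inChart hsmooth hx hU (hv _) (hX _ hU)
  have hdet := (hdef _ hU).det_ne_zero
  have hBc := isCovClosed_chartField hsmooth hv hX hdef hpde hx hU
  have hB : IsCovClosed
      (fun i => (chartPotential cov G p.proj i z.1).comp (ContinuousLinearMap.fst ℝ R4 R3))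
      (fun i u => (chartField cov G X p.proj i u.1).compContinuousLinearMap
        (ContinuousLinearMap.fst ℝ R4 R3)) z :=
    IsCovClosed.pullback (L := ContinuousLinearMap.fst ℝ R4 R3) hBc
  have hF : ∀ i, DifferentiableAt ℝ (curvatureOf (chartPotential cov G p.proj) i) z.1 := fun i =>
    (contDiffAt_curvatureOf (contDiffAt_chartPotential hsmooth G hx hU) i).differentiableAt (by simp)
  set w : R4 [⋀^Fin 4]→L[ℝ] ℝ :=
    (-2 * cubeRoot (X ((extChartAt 𝓘(ℝ, R4) p.proj).symm z.1)).det) •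
      formInChart 𝓘(ℝ, R4) v p.proj z.1 with hw
  have hBF := wedge_detField h4 hdet
  have hκ : DifferentiableAt ℝ (fun u => ∑ m, (wedge (chartField cov G X p.proj m u)
      (curvatureOf (chartPotential cov G p.proj) m u) : R4 [⋀^Fin 4]→L[ℝ] ℝ)) z.1 := by
    refine DifferentiableAt.fun_sum fun m _ => ?_
    obtain ⟨D, hD, -⟩ := HasFDerivAt.wedge (hBc.diff m) (hF m)
    exact HasFDerivAt.differentiableAt (f' := D) hD
  obtain ⟨hκ1, hκ2⟩ := extDeriv_four_form_pullback_eq_zero (by simp)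
    (ContinuousLinearMap.fst ℝ R4 R3) hκ
  have hwedge : ∀ (k l : Fin 3) (u : R4 × R3),
      (wedge ((chartField cov G X p.proj k u.1).compContinuousLinearMap
        (ContinuousLinearMap.fst ℝ R4 R3)) (chartCurvature cov G p l u) :
          (R4 × R3) [⋀^Fin 4]→L[ℝ] ℝ) = (wedge (chartField cov G X p.proj k u.1)
        (curvatureOf (chartPotential cov G p.proj) l u.1) :
          R4 [⋀^Fin 4]→L[ℝ] ℝ).compContinuousLinearMap (ContinuousLinearMap.fst ℝ R4 R3) :=
    fun k l u => (wedge_compContinuousLinearMap (chartField cov G X p.proj k u.1)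
      (curvatureOf (chartPotential cov G p.proj) l u.1) (ContinuousLinearMap.fst ℝ R4 R3)).symm
  have hsum : ∀ u : R4 × R3, ∑ m, (wedge ((chartField cov G X p.proj m
      u.1).compContinuousLinearMap (ContinuousLinearMap.fst ℝ R4 R3)) (chartCurvature cov G p m u) :
          (R4 × R3) [⋀^Fin 4]→L[ℝ] ℝ) = (∑ m, (wedge (chartField cov G X p.proj m (ContinuousLinearMap.fst ℝ R4 R3 u))
        (curvatureOf (chartPotential cov G p.proj) m (ContinuousLinearMap.fst ℝ R4 R3 u)) :
          R4 [⋀^Fin 4]→L[ℝ] ℝ)).compContinuousLinearMap (ContinuousLinearMap.fst ℝ R4 R3) := by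
    intro u
    refine (Finset.sum_congr rfl fun m _ => hwedge m m u).trans ?_
    exact (map_sum (ContinuousAlternatingMap.compContinuousLinearMapCLM
      (ContinuousLinearMap.fst ℝ R4 R3)) _ _).symm
  have hBF' : ∀ k l : Fin 3, (wedge ((chartField cov G X p.proj k z.1).compContinuousLinearMap
      (ContinuousLinearMap.fst ℝ R4 R3)) (chartCurvature cov G p l z) :
        (R4 × R3) [⋀^Fin 4]→L[ℝ] ℝ) =
      if k = l then w.compContinuousLinearMap (ContinuousLinearMap.fst ℝ R4 R3) else 0 := by
    intro k l
    refine (hwedge k l z).trans ?_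
    refine (congrArg (fun f : R4 [⋀^Fin 4]→L[ℝ] ℝ => f.compContinuousLinearMap
      (ContinuousLinearMap.fst ℝ R4 R3)) (hBF k l)).trans ?_
    split_ifs
    · rfl
    · rfl
  have h7 : ∑ m, (wedge (chartField cov G X p.proj m z.1)
      (curvatureOf (chartPotential cov G p.proj) m z.1) : R4 [⋀^Fin 4]→L[ℝ] ℝ) = 3 • w := by
    refine (Finset.sum_congr rfl fun m _ => (hBF m m).trans (if_pos rfl)).trans ?_
    rw [Finset.sum_const, Finset.card_univ, Fintype.card_fin]
  have hκz : (fun u : R4 × R3 => (∑ m, (wedge (chartField cov G X p.proj m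
      (ContinuousLinearMap.fst ℝ R4 R3 u)) (curvatureOf (chartPotential cov G p.proj) m
        (ContinuousLinearMap.fst ℝ R4 R3 u)) : R4 [⋀^Fin 4]→L[ℝ] ℝ)).compContinuousLinearMap
          (ContinuousLinearMap.fst ℝ R4 R3)) z =
      3 • w.compContinuousLinearMap (ContinuousLinearMap.fst ℝ R4 R3) :=
    congrArg (fun f : R4 [⋀^Fin 4]→L[ℝ] ℝ => f.compContinuousLinearMap
      (ContinuousLinearMap.fst ℝ R4 R3)) h7
  have key := (isGaugeJet_chart hsmooth G hz).extDeriv_add_eq_zero hB hBF' hκz hκ1 hκ2 s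
  refine (Filter.EventuallyEq.extDeriv_eq ?_).trans key
  -- The explicit formula for the dual form is needed on a neighbourhood, as it is to be
  -- differentiated. The adapted isomorphisms behind it may vary arbitrarily with the point, since
  -- the formula does not involve them.
  have hpos' : ∀ᶠ u in 𝓝 z, 0 < 1 + s * ∑ i, chartCoord G p i u ^ 2 := by
    have hN : ContinuousAt (fun u => 1 + s * ∑ i, chartCoord G p i u ^ 2) z :=
      (contDiffAt_const.add (contDiffAt_const.mul (ContDiffAt.sum fun i _ =>
        (contDiffAt_chartCoord G hz.1 hz.2 i).pow 2))).continuousAt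
    exact hN.eventually (lt_mem_nhds hpos)
  filter_upwards [gaugeTarget_mem_nhds hz, hs, hpos'] with u hu hsu hpu
  obtain ⟨hs1, C, h, hC, hCF⟩ := hsu
  obtain ⟨Θ, h5, h6, -⟩ := exists_isAdapted_chart hsmooth hv hX hu hs1 hC hCF hpu
  rw [h5.starOf_eq, h6, hsum]

end LocalGauge

/-! ### From charts to the manifold -/

section AdaptedField

set_option linter.unusedSectionVars false

variable {V : Type*} [NormedAddCommGroup V] [NormedSpace ℝ V]
  {H : Type*} [TopologicalSpace H] (I : ModelWithCorners ℝ V H) [I.Boundaryless]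
  {N : Type*} [TopologicalSpace N] [ChartedSpace H N] [IsManifold I ∞ N]
  {Ω : ∀ q : N, TangentSpace I q [⋀^Fin 3]→L[ℝ] ℝ} {p : N} {u : V}

theorem exists_isAdapted_of_inChart (hu : u ∈ (extChartAt I p).target) {Θ : V ≃L[ℝ] R7}
    (h : IsAdapted (formInChart I Ω p u) Θ) :
    ∃ L : V ≃L[ℝ] V, (L : V →L[ℝ] V) = chartInvDeriv I p u ∧
      IsAdapted (V := V) (Ω ((extChartAt I p).symm u)) (L.symm.trans Θ) := by
  obtain ⟨L, hL⟩ := chartInvDeriv_equiv I hu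
  refine ⟨L, hL, ?_⟩
  have h1 : (Ω ((extChartAt I p).symm u)).compContinuousLinearMap
      (L : V →L[ℝ] TangentSpace I ((extChartAt I p).symm u)) =
        stdThreeForm.compContinuousLinearMap (Θ : V →L[ℝ] R7) := by
    rw [hL]
    exact h
  refine ContinuousAlternatingMap.ext fun (x : Fin 3 → V) => ?_
  have h2 := congrArg (fun f : V [⋀^Fin 3]→L[ℝ] ℝ => f fun i => L.symm (x i)) h1
  refine Eq.trans (congrArg (Ω ((extChartAt I p).symm u)) (funext fun i => ?_)) h2
  exact (L.apply_symm_apply (x i)).symm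

theorem formInChart_starOf (hu : u ∈ (extChartAt I p).target) {Θ : V ≃L[ℝ] R7}
    (h : IsAdapted (formInChart I Ω p u) Θ) :
    formInChart I (fun q => starOf (V := V) (Ω q)) p u = starOf (formInChart I Ω p u) := by
  obtain ⟨L, hL, h1⟩ := exists_isAdapted_of_inChart I hu h
  have h2 := h1.starOf_pullback L
  rw [hL] at h2
  exact h2.symm

theorem metricInChart_metricOf (hu : u ∈ (extChartAt I p).target) {Θ : V ≃L[ℝ] R7}
    (h : IsAdapted (formInChart I Ω p u) Θ) :
    metricInChart I (fun q => metricOf (V := V) (Ω q)) p u = metricOf (formInChart I Ω p u) := by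
  obtain ⟨L, hL, h1⟩ := exists_isAdapted_of_inChart I hu h
  have h2 := h1.metricOf_pullback L
  rw [hL] at h2
  exact h2.symm

theorem exists_isAdapted_of_inChart_self {Θ : V ≃L[ℝ] R7}
    (h : IsAdapted (formInChart I Ω p (extChartAt I p p)) Θ) :
    ∃ Θ', IsAdapted (V := V) (Ω p) Θ' := by
  obtain ⟨L, -, h1⟩ := exists_isAdapted_of_inChart I (mem_extChartAt_target p) h
  rw [extChartAt_to_inv] at h1
  exact ⟨_, h1⟩

/-- A three-form that is adapted and closed in charts, with closed dual, defines a torsion-free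
`G₂`-structure. -/
theorem torsionFree_of_inChart {D : Set N}
    (hD : ∀ p ∈ D, ContDiffAt ℝ ∞ (formInChart I Ω p) (extChartAt I p p) ∧
      (∀ᶠ u in 𝓝 (extChartAt I p p), ∃ Θ, IsAdapted (formInChart I Ω p u) Θ) ∧
      extDeriv (formInChart I Ω p) (extChartAt I p p) = 0 ∧
      extDeriv (fun u => starOf (formInChart I Ω p u)) (extChartAt I p p) = 0) :
    (∀ p ∈ D, IsStableForm (Ω p)) ∧
    (∀ p ∈ D, IsMetricOfForm (Ω p) (metricOf (V := V) (Ω p)) (volOf (V := V) (Ω p))) ∧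
    IsSmoothMetricOn I (fun q => metricOf (V := V) (Ω q)) D ∧
    IsClosedFormOn I Ω D ∧
    (∀ p ∈ D, IsHodgeDual (metricOf (V := V) (Ω p)) (volOf (V := V) (Ω p)) (Ω p)
      (starOf (V := V) (Ω p))) ∧
    IsClosedFormOn I (fun q => starOf (V := V) (Ω q)) D ∧
    ∀ p ∈ D, IsParallelAt I (fun q => metricOf (V := V) (Ω q)) Ω p := by
  have hself : ∀ p ∈ D, ∃ Θ', IsAdapted (V := V) (Ω p) Θ' := fun p hp => by
    obtain ⟨Θ, hΘ⟩ := (hD p hp).2.1.self_of_nhds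
    exact exists_isAdapted_of_inChart_self I hΘ
  have htar : ∀ p : N, ∀ᶠ u in 𝓝 (extChartAt I p p), u ∈ (extChartAt I p).target :=
    fun p => extChartAt_target_mem_nhds p
  have hg : ∀ p ∈ D, metricInChart I (fun q => metricOf (V := V) (Ω q)) p =ᶠ[𝓝 (extChartAt I p p)]
      fun u => metricOf (formInChart I Ω p u) := fun p hp => by
    filter_upwards [htar p, (hD p hp).2.1] with u hu hΘ
    obtain ⟨Θ, hΘ⟩ := hΘ
    exact metricInChart_metricOf I hu hΘ
  have hΨ : ∀ p ∈ D, formInChart I (fun q => starOf (V := V) (Ω q)) p =ᶠ[𝓝 (extChartAt I p p)]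
      fun u => starOf (formInChart I Ω p u) := fun p hp => by
    filter_upwards [htar p, (hD p hp).2.1] with u hu hΘ
    obtain ⟨Θ, hΘ⟩ := hΘ
    exact formInChart_starOf I hu hΘ
  refine ⟨fun p hp => ?_, fun p hp => ?_, fun p hp => ?_, ⟨fun p hp => (hD p hp).1, fun p hp => ?_⟩,
    fun p hp => ?_, ⟨fun p hp => ?_, fun p hp => ?_⟩, fun p hp => ?_⟩
  · obtain ⟨Θ, hΘ⟩ := hself p hp
    exact hΘ.isStableForm
  · obtain ⟨Θ, hΘ⟩ := hself p hp
    exact hΘ.isMetricOfForm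
  · obtain ⟨Θ, hΘ⟩ := (hD p hp).2.1.self_of_nhds
    exact ((hD p hp).1.metricOf hΘ).congr_of_eventuallyEq (hg p hp)
  · exact (congrArg (fun f : V [⋀^Fin 4]→L[ℝ] ℝ => f.compContinuousLinearMap
      (mfderiv I 𝓘(ℝ, V) (extChartAt I p) p)) (hD p hp).2.2.1).trans rfl
  · obtain ⟨Θ, hΘ⟩ := hself p hp
    exact hΘ.isHodgeDual
  · obtain ⟨Θ, hΘ⟩ := (hD p hp).2.1.self_of_nhds
    exact ((hD p hp).1.starOf hΘ).congr_of_eventuallyEq (hΨ p hp)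
  · exact (congrArg (fun f : V [⋀^Fin 5]→L[ℝ] ℝ => f.compContinuousLinearMap
      (mfderiv I 𝓘(ℝ, V) (extChartAt I p) p))
        ((hΨ p hp).extDeriv_eq.trans (hD p hp).2.2.2)).trans rfl
  · obtain ⟨Θ, hΘ⟩ := (hD p hp).2.1.self_of_nhds
    obtain ⟨Γ, h1, h2⟩ := exists_christoffel_parallel (hD p hp).1 hΘ (hD p hp).2.2.1
      (hD p hp).2.2.2
    refine ⟨Γ, ?_, h2⟩
    rw [(hg p hp).fderiv_eq, (hg p hp).self_of_nhds]
    exact h1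

end AdaptedField

/-! ### Local constancy of the sign of a continuous triple -/

section Sign

variable {W : Type*} [NormedAddCommGroup W] [NormedSpace ℝ W]

theorem wedge_one_one_form_apply (α β : W [⋀^Fin 1]→L[ℝ] ℝ) (v : Fin 2 → W) :
    (wedge α β : W [⋀^Fin 2]→L[ℝ] ℝ) v = α ![v 0] * β ![v 1] - α ![v 1] * β ![v 0] := by
  have h : ∀ γ : W [⋀^Fin 1]→L[ℝ] ℝ, ∃ c, γ = oneForm c ∧ ∀ x, c x = γ ![x] := fun γ =>
    ⟨(ContinuousAlternatingMap.ofSubsingleton ℝ W ℝ (0 : Fin 1)).symm γ,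
      (Equiv.apply_symm_apply _ _).symm, fun x => congrArg γ (funext fun i => by fin_cases i; rfl)⟩
  obtain ⟨a, ha, ha'⟩ := h α
  obtain ⟨b, hb, hb'⟩ := h β
  rw [← ha', ← ha', ← hb', ← hb', ha, hb, wedge_one_one_apply]

theorem _root_.ContinuousAt.eventually_mul_pos {X : Type*} [TopologicalSpace X] {f : X → ℝ} {x : X}
    (h : ContinuousAt f x) (h0 : f x ≠ 0) : ∀ᶠ y in 𝓝 x, 0 < f y * f x :=
  (h.mul continuousAt_const).eventually (lt_mem_nhds (mul_self_pos.2 h0))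

theorem continuousAt_urbantke_mul {X : Type*} [TopologicalSpace X] {F : Fin 3 → X → W [⋀^Fin 2]→L[ℝ] ℝ}
    {x : X} (hF : ∀ i, ContinuousAt (F i) x) (ξ : W) (b : Fin 4 → W) :
    ContinuousAt (fun y => urbantke (fun i => F i y) ξ ξ b *
      (wedge (F 0 y) (F 0 y) : W [⋀^Fin 4]→L[ℝ] ℝ) b) x := by
  have h1 : ∀ i (w : Fin 2 → W), ContinuousAt (fun y => F i y w) x := fun i w => by
    have h := ((ContinuousAlternatingMap.apply ℝ W ℝ w).continuous.continuousAt
      (x := F i x)).comp (hF i)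
    exact h
  have h2 : ∀ i j (w : Fin 2 → W), ContinuousAt
      (fun y => (wedge (insertVec ξ (F i y)) (insertVec ξ (F j y)) : W [⋀^Fin 2]→L[ℝ] ℝ) w) x := by
    intro i j w
    simp only [wedge_one_one_form_apply, insertVec_apply]
    fun_prop
  simp only [urbantke_apply]
  refine ContinuousAt.mul (tendsto_finsetSum _ fun i _ => tendsto_finsetSum _ fun j _ =>
    tendsto_finsetSum _ fun k _ => ?_) ?_
  · have h3 : ContinuousAt (fun y => (wedge (wedge (insertVec ξ (F i y)) (insertVec ξ (F j y)))
        (F k y) : W [⋀^Fin 4]→L[ℝ] ℝ) b) x := by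
      simp only [wedge_two_two_apply]
      fun_prop
    exact h3.const_smul (eps i j k)
  · simp only [wedge_two_two_apply]
    fun_prop

/-- The function `urbantke F ξ ξ b * (F 0 ∧ F 0) b` is continuous and nonzero at `x`, so it keeps
its sign nearby, and its sign is opposite to that of the triple. -/
theorem HasSign.eventually_eq {X : Type*} [TopologicalSpace X] {F : Fin 3 → X → W [⋀^Fin 2]→L[ℝ] ℝ}
    {x : X} (hF : ∀ i, ContinuousAt (F i) x) {s : ℝ} (h : HasSign s fun i => F i x)
    (b : Module.Basis (Fin 4) ℝ W) : ∀ᶠ y in 𝓝 x, ∀ t, HasSign t (fun i => F i y) → t = s := by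
  have hb : b 0 ≠ 0 := b.ne_zero 0
  filter_upwards [(continuousAt_urbantke_mul hF (b 0) b).eventually_mul_pos
    (right_ne_zero_of_mul (h.mul_lt_zero b hb).ne)] with y hy t ht
  exact ht.eq_of_mul_pos h b hb hy

end Sign

/-! ### The sign of the connection -/

section LocalGauge

set_option linter.unusedSectionVars false

variable {M : Type*} [TopologicalSpace M] [ChartedSpace R4 M] [IsManifold 𝓘(ℝ, R4) ∞ M]
  {E : M → Type*} [TopologicalSpace (TotalSpace R3 E)]
  [∀ x, NormedAddCommGroup (E x)] [∀ x, InnerProductSpace ℝ (E x)]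
  [FiberBundle R3 E] [VectorBundle ℝ R3 E] [ContMDiffVectorBundle ∞ R3 E 𝓘(ℝ, R4)]
  [IsContMDiffRiemannianBundle 𝓘(ℝ, R4) ∞ R3 E]
  {o : ∀ x, Orientation ℝ (E x) (Fin 3)} {cov : CovariantDerivative 𝓘(ℝ, R4) R3 E}

variable {v : ∀ x : M, TangentSpace 𝓘(ℝ, R4) x [⋀^Fin 4]→L[ℝ] ℝ}
  {X : LocalGauge o → M → Matrix (Fin 3) (Fin 3) ℝ} {σ : M → ℝ}

/-- The function `σ` is the sign of the curvature in every local gauge. -/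
def IsSign (cov : CovariantDerivative 𝓘(ℝ, R4) R3 E) (o : ∀ x, Orientation ℝ (E x) (Fin 3))
    (σ : M → ℝ) : Prop :=
  ∀ (G : LocalGauge o), ∀ x ∈ G.U, HasSign (W := R4) (σ x) fun i => gaugeCurvature cov G i x

theorem exists_isSign (ho : IsContinuousOrientation o)
    (hsmooth : ∀ U : Set M, IsOpen U → ContMDiffCovariantDerivativeOn R3 ∞ cov U)
    (hmetric : cov.IsMetricCompatible) (hv : ∀ x, v x ≠ 0)
    (hX : ∀ (G : LocalGauge o), ∀ x ∈ G.U,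
      IsWedgeMatrix (v x) (fun i => gaugeCurvature cov G i x) (X G x))
    (hdef : ∀ (G : LocalGauge o), ∀ x ∈ G.U, IsDefiniteMatrix (X G x)) :
    ∃ σ : M → ℝ, IsSign cov o σ := by
  have h : ∀ x : M, ∃ s : ℝ, ∀ G : LocalGauge o, x ∈ G.U →
      HasSign (W := R4) s fun i => gaugeCurvature cov G i x := fun x => by
    obtain ⟨G, hG⟩ := ho x
    obtain ⟨s, hs⟩ := exists_hasSign (W := R4) (by simp) (hv x) (hX G x hG) (hdef G x hG)
    refine ⟨s, fun G' hG' => ?_⟩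
    exact HasSign.rotate (W := R4) hs (isRotation_gaugeMatrix hG hG') fun k =>
      gaugeCurvature_change hsmooth hmetric hG hG' k
  choose σ hσ using h
  exact ⟨σ, fun G x hx => hσ x G hx⟩

theorem IsSign.inChart (h : IsSign cov o σ)
    (hsmooth : ∀ U : Set M, IsOpen U → ContMDiffCovariantDerivativeOn R3 ∞ cov U)
    {G : LocalGauge o} {x₀ : M} {u : R4} (hu : u ∈ (extChartAt 𝓘(ℝ, R4) x₀).target)
    (hG : (extChartAt 𝓘(ℝ, R4) x₀).symm u ∈ G.U) :
    HasSign (σ ((extChartAt 𝓘(ℝ, R4) x₀).symm u))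
      fun i => curvatureOf (chartPotential cov G x₀) i u := by
  obtain ⟨L, hL⟩ := chartInvDeriv_equiv 𝓘(ℝ, R4) hu
  have h1 := HasSign.pullback (V := R4) (W := R4) (h G _ hG) L
  have h2 : ∀ i, curvatureOf (chartPotential cov G x₀) i u =
      (gaugeCurvature cov G i ((extChartAt 𝓘(ℝ, R4) x₀).symm u)).compContinuousLinearMap
        (L : R4 →L[ℝ] TangentSpace 𝓘(ℝ, R4) ((extChartAt 𝓘(ℝ, R4) x₀).symm u)) := fun i => by
    rw [hL, ← formInChart_gaugeCurvature hsmooth G hu hG]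
    rfl
  simp only [h2]
  exact h1

theorem IsSign.isLocallyConstant (h : IsSign cov o σ) (ho : IsContinuousOrientation o)
    (hsmooth : ∀ U : Set M, IsOpen U → ContMDiffCovariantDerivativeOn R3 ∞ cov U) :
    IsLocallyConstant σ := by
  rw [IsLocallyConstant.iff_eventually_eq]
  intro x
  obtain ⟨G, hG⟩ := ho x
  have hu := mem_extChartAt_target (I := 𝓘(ℝ, R4)) x
  have hq : (extChartAt 𝓘(ℝ, R4) x).symm (extChartAt 𝓘(ℝ, R4) x x) = x :=
    (extChartAt 𝓘(ℝ, R4) x).left_inv (mem_extChartAt_source x)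
  have h0 := h.inChart hsmooth hu (hq.symm ▸ hG)
  rw [hq] at h0
  have hev := (continuousAt_extChartAt (I := 𝓘(ℝ, R4)) x).eventually (HasSign.eventually_eq
    (F := curvatureOf (chartPotential cov G x)) (fun i => (contDiffAt_curvatureOf
      (contDiffAt_chartPotential hsmooth G hu (hq.symm ▸ hG)) i).continuousAt) h0
        (EuclideanSpace.basisFun (Fin 4) ℝ).toBasis)
  filter_upwards [hev, (isOpen_extChartAt_source (I := 𝓘(ℝ, R4)) x).mem_nhds
    (mem_extChartAt_source x), G.isOpen.mem_nhds hG] with y hy hy' hyG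
  have hq' : (extChartAt 𝓘(ℝ, R4) x).symm (extChartAt 𝓘(ℝ, R4) x y) = y :=
    (extChartAt 𝓘(ℝ, R4) x).left_inv hy'
  have h1 := h.inChart hsmooth ((extChartAt 𝓘(ℝ, R4) x).map_source hy') (hq'.symm ▸ hyG)
  rw [hq'] at h1
  exact hy _ h1

end LocalGauge

/-! ### The calibrating form is torsion-free near every point of its domain -/

section LocalGauge

set_option linter.unusedSectionVars false

variable {M : Type*} [TopologicalSpace M] [ChartedSpace R4 M] [IsManifold 𝓘(ℝ, R4) ∞ M]
  {E : M → Type*} [TopologicalSpace (TotalSpace R3 E)]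
  [∀ x, NormedAddCommGroup (E x)] [∀ x, InnerProductSpace ℝ (E x)]
  [FiberBundle R3 E] [VectorBundle ℝ R3 E] [ContMDiffVectorBundle ∞ R3 E 𝓘(ℝ, R4)]
  [IsContMDiffRiemannianBundle 𝓘(ℝ, R4) ∞ R3 E]
  {o : ∀ x, Orientation ℝ (E x) (Fin 3)} {cov : CovariantDerivative 𝓘(ℝ, R4) R3 E}

variable {v : ∀ x : M, TangentSpace 𝓘(ℝ, R4) x [⋀^Fin 4]→L[ℝ] ℝ} {G : LocalGauge o}
  {X : M → Matrix (Fin 3) (Fin 3) ℝ} {σ : M → ℝ}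
  {Ω : ∀ p : TotalSpace R3 E, TangentSpace totalModel p [⋀^Fin 3]→L[ℝ] ℝ} {p : TotalSpace R3 E}

theorem chartCoord_self (G : LocalGauge o) (p : TotalSpace R3 E) (i : Fin 3) :
    chartCoord G p i (extChartAt totalModel p p) = fiberCoord G i p := by
  rw [chartCoord, (extChartAt totalModel p).left_inv (mem_extChartAt_source p)]

theorem fst_extChartAt_self (p : TotalSpace R3 E) :
    (extChartAt 𝓘(ℝ, R4) p.proj).symm (extChartAt totalModel p p).1 = p.proj := by
  rw [← (extChartAt_symm_proj p (mem_extChartAt_target p)).1,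
    (extChartAt totalModel p).left_inv (mem_extChartAt_source p)]

theorem continuousAt_symm_proj {z : R4 × R3} (hz : z ∈ (extChartAt totalModel p).target) :
    ContinuousAt (fun z => ((extChartAt totalModel p).symm z).proj) z :=
  (FiberBundle.continuous_proj R3 E).continuousAt.comp
    (contMDiffAt_extChartAt_symm' totalModel hz).continuousAt

theorem eventually_apply_symm_proj (hσ : IsLocallyConstant σ) (p : TotalSpace R3 E) :
    ∀ᶠ z in 𝓝 (extChartAt totalModel p p), σ ((extChartAt totalModel p).symm z).proj = σ p.proj := by
  have h1 := (continuousAt_symm_proj (mem_extChartAt_target p)).eventually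
    ((IsLocallyConstant.iff_eventually_eq σ).1 hσ _)
  beta_reduce at h1
  rwa [(extChartAt totalModel p).left_inv (mem_extChartAt_source p)] at h1

theorem eventually_formInChart_eq (hσ : IsLocallyConstant σ)
    (hΩ : ∀ p : TotalSpace R3 E, p.proj ∈ G.U → Ω p = calibratingForm cov G (σ p.proj) p)
    (hp : p.proj ∈ G.U) :
    formInChart totalModel Ω p =ᶠ[𝓝 (extChartAt totalModel p p)]
      formInChart totalModel (calibratingForm cov G (σ p.proj)) p := by
  have hz := mem_gaugeTarget hp
  filter_upwards [gaugeTarget_mem_nhds hz, eventually_apply_symm_proj hσ p] with z hz' hσz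
  have h2 := hΩ _ hz'.2
  rw [hσz] at h2
  exact congrArg (fun f : (R4 × R3) [⋀^Fin 3]→L[ℝ] ℝ => f.compContinuousLinearMap
    (chartInvDeriv totalModel p z)) h2

theorem IsSign.eventually_hasSign (h : IsSign cov o σ) (hσ : IsLocallyConstant σ)
    (hsmooth : ∀ U : Set M, IsOpen U → ContMDiffCovariantDerivativeOn R3 ∞ cov U)
    (hp : p.proj ∈ G.U) :
    ∀ᶠ z in 𝓝 (extChartAt totalModel p p),
      HasSign (σ p.proj) fun i => curvatureOf (chartPotential cov G p.proj) i z.1 := by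
  have hz := mem_gaugeTarget hp
  filter_upwards [gaugeTarget_mem_nhds hz, eventually_apply_symm_proj hσ p] with z hz' hσz
  have h2 := h.inChart hsmooth (extChartAt_symm_proj p hz'.1).2 (fst_mem_of_mem_gaugeTarget hz')
  rw [(extChartAt_symm_proj p hz'.1).1] at hσz
  rwa [hσz] at h2

/-- The calibrating three-form is adapted, smooth, closed and co-closed in charts. -/
theorem torsionFree_inChart (h : IsSign cov o σ) (hσ : IsLocallyConstant σ)
    (hsmooth : ∀ U : Set M, IsOpen U → ContMDiffCovariantDerivativeOn R3 ∞ cov U)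
    (hv : ∀ x, v x ≠ 0)
    (hX : ∀ x ∈ G.U, IsWedgeMatrix (v x) (fun i => gaugeCurvature cov G i x) (X x))
    (hdef : ∀ x ∈ G.U, IsDefiniteMatrix (X x))
    (hpde : ∀ x ∈ G.U, ∀ i, gaugeExtDer cov G (fieldTriple cov G X) i x = 0)
    (hΩ : ∀ p : TotalSpace R3 E, p.proj ∈ G.U → Ω p = calibratingForm cov G (σ p.proj) p)
    (hp : p.proj ∈ G.U) (hD : 0 < 1 + σ p.proj * ‖p.snd‖ ^ 2) :
    ContDiffAt ℝ ∞ (formInChart totalModel Ω p) (extChartAt totalModel p p) ∧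
      (∀ᶠ u in 𝓝 (extChartAt totalModel p p), ∃ Θ, IsAdapted (formInChart totalModel Ω p u) Θ) ∧
      extDeriv (formInChart totalModel Ω p) (extChartAt totalModel p p) = 0 ∧
      extDeriv (fun u => starOf (formInChart totalModel Ω p u)) (extChartAt totalModel p p) = 0 := by
  have hz := mem_gaugeTarget hp
  have heq := eventually_formInChart_eq hσ hΩ hp
  have hs := h.eventually_hasSign hσ hsmooth hp
  have hσσ : σ p.proj * σ p.proj = 1 := by
    rcases hs.self_of_nhds.1 with hs | hs <;> rw [hs] <;> norm_num
  have hpos : 0 < 1 + σ p.proj * ∑ i, chartCoord G p i (extChartAt totalModel p p) ^ 2 := by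
    simpa only [chartCoord_self, sum_fiberCoord_sq] using hD
  refine ⟨(contDiffAt_calibratingForm hsmooth G hz hpos).congr_of_eventuallyEq heq, ?_,
    heq.extDeriv_eq.trans (extDeriv_calibratingForm hsmooth G hz hσσ hpos), ?_⟩
  · have hpos' : ∀ᶠ u in 𝓝 (extChartAt totalModel p p),
        0 < 1 + σ p.proj * ∑ i, chartCoord G p i u ^ 2 := by
      have hN : ContinuousAt (fun u => 1 + σ p.proj * ∑ i, chartCoord G p i u ^ 2)
          (extChartAt totalModel p p) :=
        (contDiffAt_const.add (contDiffAt_const.mul (ContDiffAt.sum fun i _ =>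
          (contDiffAt_chartCoord G hz.1 hz.2 i).pow 2))).continuousAt
      exact hN.eventually (lt_mem_nhds hpos)
    filter_upwards [gaugeTarget_mem_nhds hz, hs, hpos', heq] with u hu hsu hpu hequ
    obtain ⟨hs1, C, e, hC, hF⟩ := hsu
    obtain ⟨Θ, hΘ, -⟩ := exists_isAdapted_chart hsmooth hv hX hu hs1 hC hF hpu
    rw [hequ]
    exact ⟨Θ, hΘ⟩
  · refine Eq.trans (Filter.EventuallyEq.extDeriv_eq ?_)
      (extDeriv_starOf_calibratingForm hsmooth hv hX hdef hpde hz hs hpos)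
    filter_upwards [heq] with u hu
    rw [hu]

end LocalGauge

/-! ### Completeness of a conformally flat length functional -/

section Completeness

set_option linter.unusedSectionVars false

variable {F Y : Type*} [NormedAddCommGroup F] [InnerProductSpace ℝ F] [NormedAddCommGroup Y]
  [NormedSpace ℝ Y]

theorem one_add_norm_sq_pos (y : F) : 0 < 1 + ‖y‖ ^ 2 := by positivity

theorem norm_le_rpow_one_add_norm_sq (y : F) : ‖y‖ ≤ (1 + ‖y‖ ^ 2) ^ (1 / 2 : ℝ) := by
  rw [← Real.sqrt_eq_rpow]
  exact Real.le_sqrt_of_sq_le (by linarith)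

theorem hasFDerivAt_rpow_one_add_norm_sq (p : ℝ) (y : F) :
    HasFDerivAt (fun y : F => (1 + ‖y‖ ^ 2) ^ p)
      ((p * (1 + ‖y‖ ^ 2) ^ (p - 1)) • (2 • innerSL ℝ y)) y :=
  (((hasStrictFDerivAt_norm_sq y).hasFDerivAt.const_add 1).rpow_const
    (Or.inl (one_add_norm_sq_pos y).ne'))

theorem contDiff_rpow_one_add_norm_sq (p : ℝ) : ContDiff ℝ 1 (fun y : F => (1 + ‖y‖ ^ 2) ^ p) :=
  (contDiff_const.add (contDiff_id.norm_sq ℝ)).rpow_const_of_ne fun y => (one_add_norm_sq_pos y).ne'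

theorem norm_fderiv_rpow_le (p : ℝ) (y w : F) :
    ‖fderiv ℝ (fun y : F => (1 + ‖y‖ ^ 2) ^ p) y w‖ ≤
      2 * |p| * (1 + ‖y‖ ^ 2) ^ (p - 1 / 2) * ‖w‖ := by
  have hN := one_add_norm_sq_pos y
  rw [(hasFDerivAt_rpow_one_add_norm_sq p y).fderiv]
  have h1 : ((p * (1 + ‖y‖ ^ 2) ^ (p - 1)) • (2 • innerSL ℝ y)) w =
      (p * (1 + ‖y‖ ^ 2) ^ (p - 1)) * (2 * inner ℝ y w) := by
    simp [two_mul, two_smul, mul_add]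
  have h2 : (1 + ‖y‖ ^ 2) ^ (p - 1 / 2) =
      (1 + ‖y‖ ^ 2) ^ (p - 1) * (1 + ‖y‖ ^ 2) ^ (1 / 2 : ℝ) := by
    rw [← Real.rpow_add hN]
    ring_nf
  have h3 : |inner ℝ y w| ≤ (1 + ‖y‖ ^ 2) ^ (1 / 2 : ℝ) * ‖w‖ :=
    (abs_real_inner_le_norm y w).trans
      (mul_le_mul_of_nonneg_right (norm_le_rpow_one_add_norm_sq y) (norm_nonneg w))
  rw [h1, Real.norm_eq_abs, abs_mul, abs_mul, abs_mul, h2, abs_of_pos (Real.rpow_pos_of_pos hN _),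
    abs_two]
  have h4 : 0 ≤ |p| * (1 + ‖y‖ ^ 2) ^ (p - 1) := by positivity
  nlinarith [mul_le_mul_of_nonneg_left h3 h4]

theorem norm_fderiv_rpow_smul_le (y w : F) :
    ‖fderiv ℝ (fun y : F => (1 + ‖y‖ ^ 2) ^ (-(1 / 4) : ℝ) • y) y w‖ ≤
      3 / 2 * (1 + ‖y‖ ^ 2) ^ (-(1 / 4) : ℝ) * ‖w‖ := by
  have hN := one_add_norm_sq_pos y
  have hd := (contDiff_rpow_one_add_norm_sq (F := F) (-(1 / 4))).differentiable (by simp) y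
  have h1 := norm_fderiv_rpow_le (-(1 / 4)) y w
  have h2 : (1 + ‖y‖ ^ 2) ^ (-(1 / 4) : ℝ) =
      (1 + ‖y‖ ^ 2) ^ (-(1 / 4) - 1 / 2 : ℝ) * (1 + ‖y‖ ^ 2) ^ (1 / 2 : ℝ) := by
    rw [← Real.rpow_add hN]
    norm_num
  have h3 : ‖fderiv ℝ (fun y : F => (1 + ‖y‖ ^ 2) ^ (-(1 / 4) : ℝ)) y w‖ * ‖y‖ ≤
      1 / 2 * (1 + ‖y‖ ^ 2) ^ (-(1 / 4) : ℝ) * ‖w‖ := by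
    refine (mul_le_mul h1 (norm_le_rpow_one_add_norm_sq y) (norm_nonneg y)
      (by positivity)).trans_eq ?_
    rw [h2, abs_neg, abs_of_pos (by norm_num)]
    ring
  have h4 : fderiv ℝ (fun y : F => (1 + ‖y‖ ^ 2) ^ (-(1 / 4) : ℝ) • y) y w =
      (1 + ‖y‖ ^ 2) ^ (-(1 / 4) : ℝ) • w +
        (fderiv ℝ (fun y : F => (1 + ‖y‖ ^ 2) ^ (-(1 / 4) : ℝ)) y w) • y := by
    rw [fderiv_fun_smul hd differentiableAt_fun_id]
    simp
  refine (congrArg norm h4).trans_le ((norm_add_le _ _).trans ?_)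
  rw [norm_smul, norm_smul, Real.norm_of_nonneg (Real.rpow_nonneg hN.le _)]
  linarith

/-- The distance defined by a length functional. -/
def lengthDist (Q : F → F → ℝ) (a b : F) : ℝ≥0∞ :=
  ⨅ (γ : ℝ → F) (_ : ContDiff ℝ 1 γ ∧ γ 0 = a ∧ γ 1 = b),
    ∫⁻ t in Icc (0 : ℝ) 1, ENNReal.ofReal (Q (γ t) (deriv γ t))

/-- A function whose differential is dominated by the length density varies along a curve by at most
`K` times its length, so it is Lipschitz for the distance. -/
theorem enorm_sub_le_lengthDist {Q : F → F → ℝ} {f : F → Y} (hf : ContDiff ℝ 1 f) {K : ℝ}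
    (hK : 0 < K) (h : ∀ y w, ‖fderiv ℝ f y w‖ ≤ K * Q y w) (a b : F) :
    ‖f b - f a‖ₑ ≤ ENNReal.ofReal K * lengthDist Q a b := by
  have hK0 : ENNReal.ofReal K ≠ 0 := (ENNReal.ofReal_pos.2 hK).ne'
  rw [lengthDist, ENNReal.mul_iInf_of_ne hK0 ENNReal.ofReal_ne_top]
  refine le_iInf fun γ => ?_
  rw [ENNReal.mul_iInf_of_ne hK0 ENNReal.ofReal_ne_top]
  refine le_iInf fun hγ => ?_
  obtain ⟨hγ, rfl, rfl⟩ := hγ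
  have h1 := enorm_sub_le_lintegral_deriv_of_contDiffOn_Icc (f := f ∘ γ)
    (hf.comp hγ).contDiffOn zero_le_one
  refine h1.trans ?_
  rw [← lintegral_const_mul' _ _ ENNReal.ofReal_ne_top]
  refine lintegral_mono fun t => ?_
  have h2 : deriv (f ∘ γ) t = fderiv ℝ f (γ t) (deriv γ t) :=
    fderiv_comp_deriv t (hf.differentiable (by simp) _) (hγ.differentiable (by simp) t)
  rw [h2, ← ENNReal.ofReal_mul hK.le, ← ofReal_norm]
  exact ENNReal.ofReal_le_ofReal (h _ _)

/-- The straight segment is a competitor in the infimum. -/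
theorem lengthDist_le {Q : F → F → ℝ} {K : ℝ} (h : ∀ y w, Q y w ≤ K * ‖w‖) (a b : F) :
    lengthDist Q a b ≤ ENNReal.ofReal (K * ‖b - a‖) := by
  have hγ : ContDiff ℝ 1 fun t : ℝ => a + t • (b - a) := by fun_prop
  refine (iInf₂_le (fun t : ℝ => a + t • (b - a)) ⟨hγ, by simp, by simp⟩).trans ?_
  have hd : ∀ t : ℝ, deriv (fun t : ℝ => a + t • (b - a)) t = b - a := fun t => by
    have h1 := ((hasDerivAt_id t).smul_const (b - a)).const_add a
    rw [one_smul] at h1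
    exact h1.deriv
  refine (lintegral_mono fun t => ENNReal.ofReal_le_ofReal ((h _ _).trans_eq
    (by rw [hd]))).trans ?_
  simp

theorem cauchySeq_of_enorm_sub_le {d : F → F → ℝ≥0∞} {f : F → Y} {K : ℝ} (hK : 0 < K)
    (h : ∀ a b, ‖f b - f a‖ₑ ≤ ENNReal.ofReal K * d a b) {u : ℕ → F}
    (hu : ∀ δ : ℝ≥0∞, 0 < δ → ∃ n₀, ∀ m ≥ n₀, ∀ n ≥ n₀, d (u m) (u n) < δ) :
    CauchySeq fun n => f (u n) := by
  rw [EMetric.cauchySeq_iff]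
  intro ε hε
  have hK0 : ENNReal.ofReal K ≠ 0 := (ENNReal.ofReal_pos.2 hK).ne'
  obtain ⟨n₀, hn⟩ := hu (ε / ENNReal.ofReal K) (ENNReal.div_pos hε.ne' ENNReal.ofReal_ne_top)
  refine ⟨n₀, fun m hm n hn' => ?_⟩
  rw [edist_eq_enorm_sub]
  refine (h _ _).trans_lt ?_
  have h1 := hn n hn' m hm
  rw [ENNReal.lt_div_iff_mul_lt (Or.inl hK0) (Or.inl ENNReal.ofReal_ne_top), mul_comm] at h1
  exact h1

/-- A length functional on a Euclidean space that is bounded below by the conformal factor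
`(1 + ‖y‖²)^{-1/4}` is complete. -/
theorem exists_tendsto_lengthDist [CompleteSpace F] {Q : F → F → ℝ} {m K : ℝ} (hm : 0 < m)
    (h1 : ∀ y w, m * ((1 + ‖y‖ ^ 2) ^ (-(1 / 4) : ℝ) * ‖w‖) ≤ Q y w)
    (h2 : ∀ y w, Q y w ≤ K * ‖w‖) {u : ℕ → F}
    (hu : ∀ δ : ℝ≥0∞, 0 < δ → ∃ n₀, ∀ m ≥ n₀, ∀ n ≥ n₀, lengthDist Q (u m) (u n) < δ) :
    ∃ a, Tendsto (fun n => lengthDist Q (u n) a) atTop (𝓝 0) := by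
  -- The derivatives of `(1 + ‖y‖²)^{1/4}` and of `(1 + ‖y‖²)^{-1/4} y` are bounded by `1/2` and
  -- `3/2` times the density `(1 + ‖y‖²)^{-1/4}`. Both functions are thus Lipschitz, with values in
  -- complete spaces.
  have hc1 : CauchySeq fun n => (1 + ‖u n‖ ^ 2) ^ (1 / 4 : ℝ) := by
    refine cauchySeq_of_enorm_sub_le (f := fun y : F => (1 + ‖y‖ ^ 2) ^ (1 / 4 : ℝ))
      (K := 1 / 2 / m) (by positivity) (enorm_sub_le_lengthDist
        (contDiff_rpow_one_add_norm_sq (1 / 4)) (by positivity) fun y w => ?_) hu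
    refine (norm_fderiv_rpow_le (1 / 4) y w).trans ?_
    rw [abs_of_pos (by norm_num), div_mul_eq_mul_div, le_div_iff₀ hm]
    have h3 := h1 y w
    norm_num at h3 ⊢
    nlinarith
  have hc2 : CauchySeq fun n => (1 + ‖u n‖ ^ 2) ^ (-(1 / 4) : ℝ) • u n := by
    refine cauchySeq_of_enorm_sub_le (f := fun y : F => (1 + ‖y‖ ^ 2) ^ (-(1 / 4) : ℝ) • y)
      (K := 3 / 2 / m) (by positivity) (enorm_sub_le_lengthDist
        ((contDiff_rpow_one_add_norm_sq (-(1 / 4))).smul contDiff_id) (by positivity)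
          fun y w => ?_) hu
    refine (norm_fderiv_rpow_smul_le y w).trans ?_
    rw [div_mul_eq_mul_div (3 / 2 : ℝ) m, le_div_iff₀ hm]
    have h3 := h1 y w
    nlinarith
  obtain ⟨c, hc⟩ := cauchySeq_tendsto_of_complete hc1
  obtain ⟨f, hf⟩ := cauchySeq_tendsto_of_complete hc2
  -- The product of the two functions is `y`, so the sequence itself converges in norm.
  have hlim : Tendsto u atTop (𝓝 (c • f)) := by
    refine (hc.smul hf).congr fun n => ?_
    rw [smul_smul, ← Real.rpow_add (one_add_norm_sq_pos _)]
    simp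
  refine ⟨c • f, ?_⟩
  have h3 : Tendsto (fun n => ENNReal.ofReal (K * ‖c • f - u n‖)) atTop (𝓝 0) := by
    have h4 : Tendsto (fun n => K * ‖c • f - u n‖) atTop (𝓝 (K * ‖c • f - c • f‖)) :=
      (tendsto_const_nhds.sub hlim).norm.const_mul K
    rw [sub_self, norm_zero, mul_zero] at h4
    simpa using ENNReal.tendsto_ofReal h4
  exact tendsto_of_tendsto_of_tendsto_of_le_of_le tendsto_const_nhds h3 (fun _ => zero_le)
    fun n => lengthDist_le h2 _ _

end Completeness

/-! ### The metric on vertical vectors -/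

section LocalGauge

set_option linter.unusedSectionVars false

variable {M : Type*} [TopologicalSpace M] [ChartedSpace R4 M] [IsManifold 𝓘(ℝ, R4) ∞ M]
  {E : M → Type*} [TopologicalSpace (TotalSpace R3 E)]
  [∀ x, NormedAddCommGroup (E x)] [∀ x, InnerProductSpace ℝ (E x)]
  [FiberBundle R3 E] [VectorBundle ℝ R3 E] [ContMDiffVectorBundle ∞ R3 E 𝓘(ℝ, R4)]
  [IsContMDiffRiemannianBundle 𝓘(ℝ, R4) ∞ R3 E]
  {o : ∀ x, Orientation ℝ (E x) (Fin 3)} {cov : CovariantDerivative 𝓘(ℝ, R4) R3 E}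

variable {v : ∀ x : M, TangentSpace 𝓘(ℝ, R4) x [⋀^Fin 4]→L[ℝ] ℝ} {G : LocalGauge o}
  {X : M → Matrix (Fin 3) (Fin 3) ℝ} {σ : M → ℝ}
  {Ω : ∀ p : TotalSpace R3 E, TangentSpace totalModel p [⋀^Fin 3]→L[ℝ] ℝ} {p : TotalSpace R3 E}
  {s : ℝ}

theorem extChartAt_self_fst (p : TotalSpace R3 E) :
    (extChartAt totalModel p p).1 = extChartAt 𝓘(ℝ, R4) p.proj p.proj := by
  have h := (extChartAt 𝓘(ℝ, R4) p.proj).right_inv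
    (extChartAt_symm_proj p (mem_extChartAt_target p)).2
  rw [fst_extChartAt_self] at h
  exact h.symm

theorem fst_eq_zero_of_projDeriv {z : R4 × R3} (hz : z ∈ (extChartAt totalModel p).target)
    {w : R4 × R3} (hw : projDeriv ((extChartAt totalModel p).symm z)
      (chartInvDeriv totalModel p z w) = 0) : w.1 = 0 := by
  obtain ⟨L, hL⟩ := chartInvDeriv_equiv 𝓘(ℝ, R4) (extChartAt_symm_proj p hz).2
  have h1 := congrArg (fun f : R4 × R3 →L[ℝ] R4 => f w) (projDeriv_comp_chartInvDeriv hz)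
  have h2 : L w.1 = 0 := by
    refine Eq.trans ?_ (h1.symm.trans hw)
    exact congrArg (fun f : R4 →L[ℝ] R4 => f w.1) hL
  exact L.map_eq_zero_iff.1 h2

theorem metricOf_vertical
    (hsmooth : ∀ U : Set M, IsOpen U → ContMDiffCovariantDerivativeOn R3 ∞ cov U)
    (hv : ∀ x, v x ≠ 0)
    (hX : ∀ x ∈ G.U, IsWedgeMatrix (v x) (fun i => gaugeCurvature cov G i x) (X x))
    (hp : p.proj ∈ G.U) (hs : s = 1 ∨ s = -1)
    (hΩ : formInChart totalModel Ω p (extChartAt totalModel p p) =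
      formInChart totalModel (calibratingForm cov G s) p (extChartAt totalModel p p))
    {C : Matrix (Fin 3) (Fin 3) ℝ} {h : R4 ≃L[ℝ] (Fin 4 → ℝ)} (hC : 0 < C.det)
    (hF : ∀ i, curvatureOf (chartPotential cov G p.proj) i (extChartAt 𝓘(ℝ, R4) p.proj p.proj) =
      ∑ j, (s * C i j) • sdTwo (coframe h) j)
    (hpos : 0 < 1 + s * ‖p.snd‖ ^ 2) (w : TangentSpace totalModel p) (hw : projDeriv p w = 0) :
    metricOf (V := R4 × R3) (Ω p) w w =
      (((1 + s * ‖p.snd‖ ^ 2) ^ (1 / 4 : ℝ) * C.det ^ (1 / 3 : ℝ)) ^ 2)⁻¹ *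
        ∑ j, (∑ i, C i j * covDerFiberCoord cov G i p w) ^ 2 := by
  have hz := mem_gaugeTarget hp
  have hq := (extChartAt totalModel p).left_inv (mem_extChartAt_source (I := totalModel) p)
  rw [← extChartAt_self_fst] at hF
  have hN : ∑ i, chartCoord G p i (extChartAt totalModel p p) ^ 2 = ‖p.snd‖ ^ 2 := by
    simp only [chartCoord_self, sum_fiberCoord_sq]
  obtain ⟨Θ, h1, -, h3⟩ := exists_isAdapted_chart hsmooth hv hX hz hs hC hF (hN.symm ▸ hpos)
  rw [← hΩ] at h1
  obtain ⟨L, hL, h4⟩ := exists_isAdapted_of_inChart totalModel hz.1 h1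
  have key : ∀ w : R4 × R3, projDeriv ((extChartAt totalModel p).symm (extChartAt totalModel p p))
      w = 0 → metricOf (V := R4 × R3)
        (Ω ((extChartAt totalModel p).symm (extChartAt totalModel p p))) w w =
      (((1 + s * ‖p.snd‖ ^ 2) ^ (1 / 4 : ℝ) * C.det ^ (1 / 3 : ℝ)) ^ 2)⁻¹ *
        ∑ j, (∑ i, C i j * covDerFiberCoord cov G i
          ((extChartAt totalModel p).symm (extChartAt totalModel p p)) w) ^ 2 := by
    intro w hw
    have h5 : chartInvDeriv totalModel p (extChartAt totalModel p p) (L.symm w) = w :=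
      (congrArg (fun f : R4 × R3 →L[ℝ] R4 × R3 => f (L.symm w)) hL).symm.trans
        (L.apply_symm_apply w)
    have h6 := h3 (L.symm w) (fst_eq_zero_of_projDeriv hz.1 (by rw [h5]; exact hw))
    have h7 : ∀ i, chartCovDer cov G p i (extChartAt totalModel p p) (L.symm w) =
        covDerFiberCoord cov G i
          ((extChartAt totalModel p).symm (extChartAt totalModel p p)) w := fun i =>
      congrArg (covDerFiberCoord cov G i
        ((extChartAt totalModel p).symm (extChartAt totalModel p p))) h5
    simp only [h7, hN] at h6
    rw [h4.metricOf_eq]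
    exact h6
  revert w
  rw [hq] at key
  exact key

end LocalGauge

/-! ### Norm bounds for an invertible matrix in an orthonormal basis -/

section Linear

theorem exists_norm_bounds {F : Type*} [NormedAddCommGroup F] [InnerProductSpace ℝ F]
    (b : OrthonormalBasis (Fin 3) ℝ F) {C : Matrix (Fin 3) (Fin 3) ℝ} (hC : C.det ≠ 0) :
    ∃ (T : F →ₗ[ℝ] R3) (m K : ℝ), 0 < m ∧ (∀ w, m * ‖w‖ ≤ ‖T w‖) ∧ (∀ w, ‖T w‖ ≤ K * ‖w‖) ∧
      ∀ w, ∑ j, (∑ i, C i j * inner ℝ (b i) w) ^ 2 = ‖T w‖ ^ 2 := by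
  have : FiniteDimensional ℝ F := b.toBasis.finiteDimensional_of_finite
  let T : F →ₗ[ℝ] R3 := (Matrix.toEuclideanLin C.transpose).comp b.repr.toLinearEquiv.toLinearMap
  have hT : ∀ w j, T w j = ∑ i, C i j * inner ℝ (b i) w := fun w j => by
    simp [T, Matrix.toLpLin_apply, Matrix.mulVec, dotProduct, b.repr_apply_apply]
  have hker : LinearMap.ker T = ⊥ := by
    rw [LinearMap.ker_eq_bot]
    refine Function.Injective.comp (g := Matrix.toEuclideanLin C.transpose) ?_ b.repr.injective
    intro x y hxy
    have h1 : Function.Injective C.transpose.mulVec := by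
      rw [Matrix.mulVec_injective_iff_isUnit, Matrix.isUnit_iff_isUnit_det, Matrix.det_transpose]
      exact hC.isUnit
    exact (WithLp.equiv 2 _).injective (h1 (congrArg (WithLp.equiv 2 _) hxy))
  obtain ⟨K, hK, hT'⟩ := T.exists_antilipschitzWith hker
  refine ⟨T, (K : ℝ)⁻¹, ‖LinearMap.toContinuousLinearMap T‖, by positivity, fun w => ?_, fun w =>
    (LinearMap.toContinuousLinearMap T).le_opNorm w, fun w => ?_⟩
  · have h1 := hT'.le_mul_norm (by simp) w
    rw [inv_mul_le_iff₀ (by positivity)]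
    exact h1
  · rw [EuclideanSpace.real_norm_sq_eq]
    simp only [hT]

end Linear

/-! ### Curves in a fibre and completeness -/

section LocalGauge

set_option linter.unusedSectionVars false

variable {M : Type*} [TopologicalSpace M] [ChartedSpace R4 M] [IsManifold 𝓘(ℝ, R4) ∞ M]
  {E : M → Type*} [TopologicalSpace (TotalSpace R3 E)]
  [∀ x, NormedAddCommGroup (E x)] [∀ x, InnerProductSpace ℝ (E x)]
  [FiberBundle R3 E] [VectorBundle ℝ R3 E] [ContMDiffVectorBundle ∞ R3 E 𝓘(ℝ, R4)]
  [IsContMDiffRiemannianBundle 𝓘(ℝ, R4) ∞ R3 E]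
  {o : ∀ x, Orientation ℝ (E x) (Fin 3)} {cov : CovariantDerivative 𝓘(ℝ, R4) R3 E}

variable {G : LocalGauge o} {x : M}

theorem mdifferentiableAt_fiber_curve {γ : ℝ → E x} {t : ℝ} (hγ : DifferentiableAt ℝ γ t) :
    MDifferentiableAt 𝓘(ℝ, ℝ) totalModel (fun t => TotalSpace.mk' R3 x (γ t)) t := by
  rw [mdifferentiableAt_totalSpace]
  refine ⟨mdifferentiableAt_const, ?_⟩
  refine DifferentiableAt.mdifferentiableAt ?_
  have h1 := ((trivializationAt R3 E x).continuousLinearEquivAt ℝ x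
    (FiberBundle.mem_baseSet_trivializationAt' x)).differentiableAt.comp t hγ
  exact h1

theorem projDeriv_fiber_curve {γ : ℝ → E x} {t : ℝ} (hγ : DifferentiableAt ℝ γ t) :
    projDeriv (TotalSpace.mk' R3 x (γ t))
      (mfderiv 𝓘(ℝ, ℝ) totalModel (fun t => TotalSpace.mk' R3 x (γ t)) t (1 : ℝ)) = 0 := by
  have h1 := mfderiv_comp t (I := 𝓘(ℝ, ℝ)) (I' := totalModel) (I'' := 𝓘(ℝ, R4))
    (mdifferentiable_proj E (TotalSpace.mk' R3 x (γ t))) (mdifferentiableAt_fiber_curve hγ)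
  have h2 : mfderiv 𝓘(ℝ, ℝ) 𝓘(ℝ, R4) (fun _ : ℝ => x) t = 0 := mfderiv_const
  exact (congrArg (fun f : ℝ →L[ℝ] R4 => f 1) (h1.symm.trans h2))

theorem covDerFiberCoord_fiber_curve (hG : x ∈ G.U) {γ : ℝ → E x} {t : ℝ}
    (hγ : DifferentiableAt ℝ γ t) (i : Fin 3) :
    covDerFiberCoord cov G i (TotalSpace.mk' R3 x (γ t))
      (mfderiv 𝓘(ℝ, ℝ) totalModel (fun t => TotalSpace.mk' R3 x (γ t)) t (1 : ℝ)) =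
        inner ℝ (G.frame x i) (deriv γ t) := by
  have hY : MDifferentiableAt totalModel 𝓘(ℝ, ℝ) (fiberCoord G i) (TotalSpace.mk' R3 x (γ t)) := by
    have h1 := ((G.smooth i).contMDiffAt (G.isOpen.mem_nhds hG)).comp (TotalSpace.mk' R3 x (γ t))
      (contMDiff_proj E).contMDiffAt
    exact (ContMDiffAt.inner_bundle (b := fun q : TotalSpace R3 E => q.proj)
      (w := fun q => q.snd) h1 contMDiffAt_id).mdifferentiableAt (by simp)
  have h1 := mfderiv_comp t hY (mdifferentiableAt_fiber_curve hγ)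
  have h2 : mfderiv 𝓘(ℝ, ℝ) 𝓘(ℝ, ℝ) (fun t => inner ℝ (G.frame x i) (γ t)) t (1 : ℝ) =
      inner ℝ (G.frame x i) (deriv γ t) := by
    rw [mfderiv_eq_fderiv]
    have h3 := ((innerSL ℝ (G.frame x i)).hasFDerivAt.comp_hasDerivAt t hγ.hasDerivAt)
    exact h3.deriv
  have h3 : mvfderiv totalModel (fiberCoord G i) (TotalSpace.mk' R3 x (γ t))
      (mfderiv 𝓘(ℝ, ℝ) totalModel (fun t => TotalSpace.mk' R3 x (γ t)) t (1 : ℝ)) =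
        inner ℝ (G.frame x i) (deriv γ t) :=
    (congrArg (fun f : ℝ →L[ℝ] ℝ => f 1) h1).symm.trans h2
  rw [covDerFiberCoord, add_apply, h3]
  have h4 : ∀ j k, ((eps i j k * fiberCoord G k (TotalSpace.mk' R3 x (γ t))) •
      (gaugePotential cov G j (TotalSpace.mk' R3 x (γ t)).proj).comp
        (projDeriv (TotalSpace.mk' R3 x (γ t))))
      (mfderiv 𝓘(ℝ, ℝ) totalModel (fun t => TotalSpace.mk' R3 x (γ t)) t (1 : ℝ)) = 0 := by
    intro j k
    rw [smul_apply, ContinuousLinearMap.comp_apply, projDeriv_fiber_curve hγ, map_zero, smul_zero]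
  simp only [sum_apply, h4, Finset.sum_const_zero, add_zero]

/-- `C` comes from the curvature on the base and is constant along the fibre, so the length density
is `(1 + ‖y‖²)^{-1/4}` times a fixed norm of the velocity. Invertibility of `C` makes that norm
comparable with the Euclidean one. -/
theorem isFiberComplete_of_vertical
    {g : ∀ p : TotalSpace R3 E, TangentSpace totalModel p →L[ℝ] TangentSpace totalModel p →L[ℝ] ℝ}
    (hG : x ∈ G.U) {C : Matrix (Fin 3) (Fin 3) ℝ} (hC : 0 < C.det)
    (hg : ∀ (a : E x) (w : TangentSpace totalModel (TotalSpace.mk' R3 x a)), projDeriv _ w = 0 →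
      g (TotalSpace.mk' R3 x a) w w =
        (((1 + ‖a‖ ^ 2) ^ (1 / 4 : ℝ) * C.det ^ (1 / 3 : ℝ)) ^ 2)⁻¹ *
          ∑ j, (∑ i, C i j * covDerFiberCoord cov G i _ w) ^ 2) :
    IsFiberComplete g x := by
  have : FiniteDimensional ℝ (E x) := (G.frame x).toBasis.finiteDimensional_of_finite
  have : CompleteSpace (E x) := FiniteDimensional.complete ℝ (E x)
  obtain ⟨T, m, K, hm, h1, h2, h3⟩ := exists_norm_bounds (G.frame x) hC.ne'
  set k : ℝ := C.det ^ (1 / 3 : ℝ) with hk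
  have hk0 : 0 < k := Real.rpow_pos_of_pos hC _
  let Q : E x → E x → ℝ := fun y w => (1 + ‖y‖ ^ 2) ^ (-(1 / 4) : ℝ) * (k⁻¹ * ‖T w‖)
  have hd : ∀ a b : E x, fiberDist g x a b = lengthDist Q a b := by
    intro a b
    refine iInf_congr fun γ => iInf_congr fun hγ => lintegral_congr fun t => ?_
    have hγt : DifferentiableAt ℝ γ t := hγ.1.differentiable (by simp) t
    have h4 := hg (γ t) _ (projDeriv_fiber_curve hγt)
    simp only [covDerFiberCoord_fiber_curve hG hγt, h3] at h4
    congr 1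
    refine (congrArg Real.sqrt h4).trans ?_
    rw [← inv_pow, ← mul_pow, Real.sqrt_sq (by positivity), mul_inv,
      ← Real.rpow_neg (one_add_norm_sq_pos _).le, mul_assoc]
  intro u hu
  simp only [hd] at hu ⊢
  refine exists_tendsto_lengthDist (m := k⁻¹ * m) (K := k⁻¹ * K) (by positivity)
    (fun y w => ?_) (fun y w => ?_) hu
  · have h5 : k⁻¹ * (m * ‖w‖) ≤ k⁻¹ * ‖T w‖ := mul_le_mul_of_nonneg_left (h1 w) (by positivity)
    calc k⁻¹ * m * ((1 + ‖y‖ ^ 2) ^ (-(1 / 4) : ℝ) * ‖w‖)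
        = (1 + ‖y‖ ^ 2) ^ (-(1 / 4) : ℝ) * (k⁻¹ * (m * ‖w‖)) := by ring
      _ ≤ Q y w := mul_le_mul_of_nonneg_left h5 (by positivity)
  · have h5 : (1 + ‖y‖ ^ 2) ^ (-(1 / 4) : ℝ) ≤ 1 :=
      Real.rpow_le_one_of_one_le_of_nonpos (by nlinarith [norm_nonneg y]) (by norm_num)
    refine (mul_le_of_le_one_left (by positivity) h5).trans ?_
    rw [mul_assoc]
    exact mul_le_mul_of_nonneg_left (h2 w) (by positivity)

end LocalGauge

end

/-! ### The theorem -/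

theorem theorem1
    {M : Type*} [TopologicalSpace M] [ChartedSpace R4 M] [IsManifold 𝓘(ℝ, R4) ∞ M]
    {E : M → Type*} [TopologicalSpace (TotalSpace R3 E)]
    [∀ x, NormedAddCommGroup (E x)] [∀ x, InnerProductSpace ℝ (E x)]
    [FiberBundle R3 E] [VectorBundle ℝ R3 E] [ContMDiffVectorBundle ∞ R3 E 𝓘(ℝ, R4)]
    [IsContMDiffRiemannianBundle 𝓘(ℝ, R4) ∞ R3 E]
    (o : ∀ x, Orientation ℝ (E x) (Fin 3)) (ho : IsContinuousOrientation o)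
    (cov : CovariantDerivative 𝓘(ℝ, R4) R3 E)
    (hsmooth : ∀ U : Set M, IsOpen U → ContMDiffCovariantDerivativeOn R3 ∞ cov U)
    (hmetric : cov.IsMetricCompatible)
    (v : ∀ x : M, TangentSpace 𝓘(ℝ, R4) x [⋀^Fin 4]→L[ℝ] ℝ) (hv : ∀ x, v x ≠ 0)
    (X : LocalGauge o → M → Matrix (Fin 3) (Fin 3) ℝ)
    (hX : ∀ (G : LocalGauge o), ∀ x ∈ G.U,
      IsWedgeMatrix (v x) (fun i => gaugeCurvature cov G i x) (X G x))
    (hdef : ∀ (G : LocalGauge o), ∀ x ∈ G.U, IsDefiniteMatrix (X G x))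
    (hpde : ∀ (G : LocalGauge o), ∀ x ∈ G.U, ∀ i,
      gaugeExtDer cov G (fieldTriple cov G (X G)) i x = 0) :
    ∃ σ : M → ℝ,
      -- `σ` is the sign of the connection
      IsLocallyConstant σ ∧
      (∀ (G : LocalGauge o), ∀ x ∈ G.U,
        IsSignOfTriple (σ x) (fun i => gaugeCurvature cov G i x)) ∧
      ∃ (Ω : ∀ p : TotalSpace R3 E, TangentSpace totalModel p [⋀^Fin 3]→L[ℝ] ℝ)
        (g : ∀ p : TotalSpace R3 E,
          TangentSpace totalModel p →L[ℝ] TangentSpace totalModel p →L[ℝ] ℝ)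
        (μ : ∀ p : TotalSpace R3 E, TangentSpace totalModel p [⋀^Fin 7]→L[ℝ] ℝ)
        (Ψ : ∀ p : TotalSpace R3 E, TangentSpace totalModel p [⋀^Fin 4]→L[ℝ] ℝ),
        let D : Set (TotalSpace R3 E) := {p | 0 < 1 + σ p.proj * ‖p.snd‖ ^ 2}
        -- `Ω` is given by the explicit formula in every local gauge
        (∀ (G : LocalGauge o), ∀ p ∈ D, p.proj ∈ G.U →
          Ω p = calibratingForm cov G (σ p.proj) p) ∧
        -- `Ω` is stable and defines the smooth Riemannian metric `g`, with volume form `μ`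
        (∀ p ∈ D, IsStableForm (Ω p)) ∧
        (∀ p ∈ D, IsMetricOfForm (Ω p) (g p) (μ p)) ∧
        IsSmoothMetricOn totalModel g D ∧
        -- `Ω` is closed and co-closed
        IsClosedFormOn totalModel Ω D ∧
        (∀ p ∈ D, IsHodgeDual (g p) (μ p) (Ω p) (Ψ p)) ∧
        IsClosedFormOn totalModel Ψ D ∧
        -- `Ω` is parallel: the holonomy of `g` is contained in `G₂`
        (∀ p ∈ D, IsParallelAt totalModel g Ω p) ∧
        -- the metric is complete in the fiber direction where `σ = +1`
        (∀ x : M, σ x = 1 → IsFiberComplete g x) := by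
  obtain ⟨σ, hσ⟩ := exists_isSign ho hsmooth hmetric hv hX hdef
  have hσc := hσ.isLocallyConstant ho hsmooth
  -- An arbitrary gauge is chosen at each base point. By gauge independence the resulting form
  -- agrees with the formula of any single gauge over its whole domain, so the arbitrary choices do
  -- no harm to smoothness.
  choose G hG using ho
  let Ω : ∀ p : TotalSpace R3 E, TangentSpace totalModel p [⋀^Fin 3]→L[ℝ] ℝ :=
    fun p => calibratingForm cov (G p.proj) (σ p.proj) p
  have hΩ : ∀ (G' : LocalGauge o) (p : TotalSpace R3 E), p.proj ∈ G'.U →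
      Ω p = calibratingForm cov G' (σ p.proj) p := fun G' p hp =>
    calibratingForm_change hsmooth hmetric hp (hG p.proj) (σ p.proj)
  obtain ⟨h1, h2, h3, h4, h5, h6, h7⟩ := torsionFree_of_inChart totalModel (Ω := Ω)
    (D := {p : TotalSpace R3 E | 0 < 1 + σ p.proj * ‖p.snd‖ ^ 2}) fun p hp =>
      torsionFree_inChart hσ hσc hsmooth hv (hX (G p.proj)) (hdef (G p.proj)) (hpde (G p.proj))
        (hΩ (G p.proj)) (hG p.proj) hp
  refine ⟨σ, hσc, fun G' x hx => HasSign.isSignOfTriple (W := R4) (hσ G' x hx), Ω,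
    fun p => metricOf (V := R4 × R3) (Ω p), fun p => volOf (V := R4 × R3) (Ω p),
    fun p => starOf (V := R4 × R3) (Ω p), fun G' p _ hp => hΩ G' p hp, h1, h2, h3, h4, h5, h6, h7,
    fun x hx => ?_⟩
  have hs := hσ.inChart hsmooth (mem_extChartAt_target (I := 𝓘(ℝ, R4)) x) (G := G x)
    (by rw [extChartAt_to_inv]; exact hG x)
  rw [extChartAt_to_inv] at hs
  obtain ⟨hs1, C, e, hC, hF⟩ := hs
  -- For `σ x = 1` the whole fibre lies in the domain, and the matrix `C` found at `x` serves at
  -- every point of it.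
  refine isFiberComplete_of_vertical (cov := cov) (hG x) hC fun a w hw => ?_
  have h8 := metricOf_vertical (p := TotalSpace.mk' R3 x a) hsmooth hv (hX (G x)) (hG x) hs1
    (eventually_formInChart_eq hσc (hΩ (G x)) (hG x)).self_of_nhds hC hF
      (by rw [hx]; positivity) w hw
  rw [hx, one_mul] at h8
  exact h8
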